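/- All graphs are finite, undirected, non-empty, without loops or multiple edges. For a graph $G=(V,E)$ and a function $\delta\colon V\to\{0,1\}$, a *solution* for $(G,\delta)$ is a pair $(A,D)$ with $A\subseteq E(\overline G)$ and $D\subseteq E(G)$ such that $H=G+A-D$ is connected and $d_H(v)\equiv\delta(v)\pmod 2$ for every vertex $v$. Its size is $|A|+|D|$, and $\mathrm{opt}(G,\delta)$ is the minimum size of a solution ($+\infty$ if there is none). The problem $\mathrm{CDPE}(\{\mathsf{ea},\mathsf{ed}\})$ (Connected Degree Parity Editing by edge additions and edge deletions) asks, given $G$, $\delta$ and an integer $k\ge 0$, whether $G$ can be turned by at most $k$ edge additions and edge deletions into a connected graph $H$ with $d_H(v)\equiv\delta(v)\pmod 2$ for every vertex $v$. Eulerian Editing asks whether at most $k$ such operations can turn $G$ into a connected graph with all degrees even. Let $n=|V|$ and $m=|E|$. Running times are numbers of steps of a uniform-cost random access machine with addition, subtraction and comparison, and graphs are given by adjacency lists. **Theorem.** 1. $\mathrm{CDPE}(\{\mathsf{ea},\mathsf{ed}\})$ can be decided, and $\mathrm{opt}(G,\delta)$ can be computed, in $O(n+m)$ time. In particular (the case $\delta\equiv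 0$) Eulerian Editing can be decided in $O(n+m)$ time. 2. An optimal solution for $(G,\delta)$, if a solution exists, can be found (and the non-existence of a solution reported otherwise) in $O(n^3)$ time. 3. $(G,\delta,k)$ is a yes-instance of $\mathrm{CDPE}(\{\mathsf{ea},\mathsf{ed}\})$ if and only if $\mathrm{opt}(G,\delta)\le k$. Let $T=\{v\in V: d_G(v)\not\equiv\delta(v)\pmod 2\}$, let $p$ be the number of connected components of $G$ that contain no vertex of $T$, and $q$ the number of those that contain at least one. Then $\mathrm{opt}(G,\delta)=+\infty$ if and only if $|T|$ is odd, or $G=K_2$ and $T=V$, or $G=K_1+K_1$ (two isolated vertices) and $T=\emptyset$. In all other cases $$\mathrm{opt}(G,\delta)=\begin{cases}0 & \text{if } p=1,\ q=0,\\ \max\{3,p\} & \text{if } p\ge 2,\ q=0,\\ \tfrac12|T|+1 & \text{if } p=0,\ q=1,\ G[T]\cong K_{1,r} \text{ for some } r\ge 1, \text{ and each edge of } G[T] \text{ is a bridge of } G,\\ \max\{p+q-1,\ p+\tfrac12|T|\} & \text{otherwise.}\end{cases}$$ -/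

import Mathlib

/-! ### Connected degree parity editing by edge additions and deletions

All graphs are finite, undirected, without loops and multiple edges. -/

namespace ParityEditing

/-- The degree `d_G(v) = |N_G(v)|`. -/
noncomputable def deg {V : Type*} (G : SimpleGraph V) (v : V) : ℕ :=
  (G.neighborSet v).ncard

/-- `EditStep G H`: the graph `H` is obtained from `G` by one edge addition or one edge deletion. -/
def EditStep {V : Type*} (G H : SimpleGraph V) : Prop :=
  (∃ e ∈ Gᶜ.edgeSet, H.edgeSet = G.edgeSet ∪ {e}) ∨
  (∃ e ∈ G.edgeSet, H.edgeSet = G.edgeSet \ {e})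

/-- `Modifiable k G H`: the graph `H` can be obtained from `G` by at most `k` edge additions and
edge deletions. -/
inductive Modifiable {V : Type*} : ℕ → SimpleGraph V → SimpleGraph V → Prop
  | refl (k : ℕ) (G : SimpleGraph V) : Modifiable k G G
  | step {k : ℕ} {G G' H : SimpleGraph V} :
      EditStep G G' → Modifiable k G' H → Modifiable (k + 1) G H

/-- The target graphs: connected, and every vertex `v` has degree congruent to `δ v` modulo 2. -/
def IsTarget {V : Type*} (δ : V → Fin 2) (H : SimpleGraph V) : Prop :=
  H.Connected ∧ ∀ v, deg H v ≡ (δ v : ℕ) [MOD 2]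

/-- `(G, δ, k)` is a yes-instance of Connected Degree Parity Editing with edge additions and
edge deletions. -/
def CDPE {V : Type*} (G : SimpleGraph V) (δ : V → Fin 2) (k : ℕ) : Prop :=
  ∃ H : SimpleGraph V, Modifiable k G H ∧ IsTarget δ H

/-- A graph is Eulerian if it is connected and all its degrees are even. -/
def IsEulerianGraph {V : Type*} (H : SimpleGraph V) : Prop :=
  H.Connected ∧ ∀ v, Even (deg H v)

/-- `(G, k)` is a yes-instance of Eulerian Editing. -/
def EulerianEditing {V : Type*} (G : SimpleGraph V) (k : ℕ) : Prop :=
  ∃ H : SimpleGraph V, Modifiable k G H ∧ IsEulerianGraph H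

/-- The graph `G + A - D`. -/
def edit {V : Type*} (G : SimpleGraph V) (A D : Finset (Sym2 V)) : SimpleGraph V :=
  (G ⊔ SimpleGraph.fromEdgeSet (A : Set (Sym2 V))).deleteEdges (D : Set (Sym2 V))

/-- `(A, D)` is a solution for `(G, δ)`: `A` is a set of non-edges, `D` is a set of edges of `G`,
and `G + A - D` is connected with the prescribed degree parities. -/
def IsSolution {V : Type*} (G : SimpleGraph V) (δ : V → Fin 2) (A D : Finset (Sym2 V)) : Prop :=
  (A : Set (Sym2 V)) ⊆ Gᶜ.edgeSet ∧ (D : Set (Sym2 V)) ⊆ G.edgeSet ∧ IsTarget δ (edit G A D)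

/-- A solution of minimum size `|A| + |D|`. -/
def IsOptimalSolution {V : Type*} (G : SimpleGraph V) (δ : V → Fin 2)
    (A D : Finset (Sym2 V)) : Prop :=
  IsSolution G δ A D ∧
    ∀ A' D' : Finset (Sym2 V), IsSolution G δ A' D' → A.card + D.card ≤ A'.card + D'.card

/-- The minimum size of a solution for `(G, δ)`; it is `⊤` if there is no solution. -/
noncomputable def opt {V : Type*} (G : SimpleGraph V) (δ : V → Fin 2) : ℕ∞ :=
  ⨅ (A : Finset (Sym2 V)) (D : Finset (Sym2 V)) (_ : IsSolution G δ A D),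
    ((A.card + D.card : ℕ) : ℕ∞)

/-- The set `T` of vertices whose degree in `G` has the wrong parity. -/
def wrong {V : Type*} (G : SimpleGraph V) (δ : V → Fin 2) : Set V :=
  {v | ¬ deg G v ≡ (δ v : ℕ) [MOD 2]}

/-- The number `p` of components of `G` that contain no vertex of `T`. -/
noncomputable def numFree {V : Type*} (G : SimpleGraph V) (T : Set V) : ℕ :=
  {c : G.ConnectedComponent | ∀ v ∈ c.supp, v ∉ T}.ncard

/-- The number `q` of components of `G` that contain at least one vertex of `T`. -/
noncomputable def numHit {V : Type*} (G : SimpleGraph V) (T : Set V) : ℕ :=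
  {c : G.ConnectedComponent | ∃ v ∈ c.supp, v ∈ T}.ncard

/-- `G[T]` is a star `K_{1,r}` with `r ≥ 1`, and each edge of `G[T]` is a bridge of `G`. -/
def IsBridgeStar {V : Type*} (G : SimpleGraph V) (T : Set V) : Prop :=
  (∃ r : ℕ, 1 ≤ r ∧ Nonempty (G.induce T ≃g completeBipartiteGraph (Fin 1) (Fin r))) ∧
    ∀ u ∈ T, ∀ v ∈ T, G.Adj u v → G.IsBridge s(u, v)

/-- The trivial instances: `|T|` is odd, or `G = K_2` and `T = V`, or `G = K_1 + K_1` and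
`T = ∅`. -/
def IsTrivialNo {V : Type*} (G : SimpleGraph V) (T : Set V) : Prop :=
  Odd T.ncard ∨
    (Nat.card V = 2 ∧ ((G = ⊤ ∧ T = Set.univ) ∨ (G = ⊥ ∧ T = ∅)))

/-! ### Random access machine

A uniform-cost random access machine over the natural numbers, with addition, truncated subtraction
and comparisons as arithmetic, programmed by structured commands. A program is a finite term, so
it names finitely many registers and finitely many arrays; the arrays are accessed by computed
indices. -/

/-- The memory: registers, and arrays `arr 0, arr 1, …`. -/
structure Store where
  reg : ℕ → ℕ
  arr : ℕ → ℕ → ℕ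

/-- The arithmetic operations. Comparisons return `1` for true and `0` for false. -/
inductive Op
  | add | sub | lt | eq

/-- The value of an operation. -/
def Op.eval : Op → ℕ → ℕ → ℕ
  | .add, x, y => x + y
  | .sub, x, y => x - y
  | .lt, x, y => if x < y then 1 else 0
  | .eq, x, y => if x = y then 1 else 0

/-- Expressions: constants, registers, array cells (`cell a e` is the cell of array `a` whose index
is the value of `e`), and arithmetic operations. -/
inductive Expr
  | const (k : ℕ)
  | reg (i : ℕ)
  | cell (a : ℕ) (e : Expr)
  | op (o : Op) (e₁ e₂ : Expr)

/-- The value of an expression. -/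
def Expr.eval (s : Store) : Expr → ℕ
  | .const k => k
  | .reg i => s.reg i
  | .cell a e => s.arr a (e.eval s)
  | .op o e₁ e₂ => o.eval (e₁.eval s) (e₂.eval s)

/-- The number of steps for evaluating an expression: one for each of its nodes. -/
def Expr.cost : Expr → ℕ
  | .const _ => 1
  | .reg _ => 1
  | .cell _ e => e.cost + 1
  | .op _ e₁ e₂ => e₁.cost + e₂.cost + 1

/-- Programs. A value different from `0` counts as true in `cond` and `loop`. -/
inductive Prog
  | skip
  | set (i : ℕ) (e : Expr)
  | store (a : ℕ) (e₁ e₂ : Expr)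
  | seq (P Q : Prog)
  | cond (e : Expr) (P Q : Prog)
  | loop (e : Expr) (P : Prog)

/-- `Runs P s s' t`: the program `P`, started in memory `s`, halts in memory `s'` after exactly
`t` steps. -/
inductive Runs : Prog → Store → Store → ℕ → Prop
  | skip (s : Store) : Runs .skip s s 1
  | set (i : ℕ) (e : Expr) (s : Store) :
      Runs (.set i e) s ⟨Function.update s.reg i (e.eval s), s.arr⟩ (e.cost + 1)
  | store (a : ℕ) (e₁ e₂ : Expr) (s : Store) :
      Runs (.store a e₁ e₂) s
        ⟨s.reg, Function.update s.arr a (Function.update (s.arr a) (e₁.eval s) (e₂.eval s))⟩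
        (e₁.cost + e₂.cost + 1)
  | seq {P Q : Prog} {s s' s'' : Store} {t t' : ℕ} :
      Runs P s s' t → Runs Q s' s'' t' → Runs (.seq P Q) s s'' (t + t')
  | cond_true {e : Expr} {P Q : Prog} {s s' : Store} {t : ℕ} :
      e.eval s ≠ 0 → Runs P s s' t → Runs (.cond e P Q) s s' (e.cost + 1 + t)
  | cond_false {e : Expr} {P Q : Prog} {s s' : Store} {t : ℕ} :
      e.eval s = 0 → Runs Q s s' t → Runs (.cond e P Q) s s' (e.cost + 1 + t)
  | loop_done {e : Expr} {P : Prog} {s : Store} :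
      e.eval s = 0 → Runs (.loop e P) s s (e.cost + 1)
  | loop_step {e : Expr} {P : Prog} {s s' s'' : Store} {t t' : ℕ} :
      e.eval s ≠ 0 → Runs P s s' t → Runs (.loop e P) s' s'' t' →
        Runs (.loop e P) s s'' (e.cost + 1 + t + t')

/-- `P`, started in memory `s`, halts after at most `b` steps in a memory that satisfies `post`. -/
def HaltsWithin (P : Prog) (s : Store) (b : ℕ) (post : Store → Prop) : Prop :=
  ∃ (s' : Store) (t : ℕ), Runs P s s' t ∧ t ≤ b ∧ post s'

/-- The memory `s` holds the input `(G, δ, k)`, the graph `G` on the vertices `0, …, n - 1` being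
given by adjacency lists in arbitrary order. Register 0 holds `n`, register 1 holds `k`, array 0
holds `δ`, and the list of the neighbours of the vertex `v` stands in array 2, from the index given
by cell `v` of array 1 (inclusive) to the index given by its cell `v + 1` (exclusive). All other
cells are `0`. -/
structure IsInput {n : ℕ} (G : SimpleGraph (Fin n)) (δ : Fin n → Fin 2) (k : ℕ) (s : Store) :
    Prop where
  size : s.reg 0 = n
  budget : s.reg 1 = k
  parity : ∀ v : Fin n, s.arr 0 v = δ v
  start : s.arr 1 0 = 0
  mono : ∀ v : Fin n, s.arr 1 v ≤ s.arr 1 (v + 1)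
  list : ∀ v : Fin n, Set.BijOn (s.arr 2) (Set.Ico (s.arr 1 v) (s.arr 1 (v + 1)))
    (Fin.val '' G.neighborSet v)
  reg_zero : ∀ i, 2 ≤ i → s.reg i = 0
  parity_zero : ∀ i, n ≤ i → s.arr 0 i = 0
  start_zero : ∀ i, n < i → s.arr 1 i = 0
  list_zero : ∀ i, s.arr 1 n ≤ i → s.arr 2 i = 0
  arr_zero : ∀ a, 3 ≤ a → ∀ i, s.arr a i = 0

/-- The pairs `{f i, g i}` with `i < l` list the edges in `F`, each exactly once. -/
def ListsEdges {n : ℕ} (f g : ℕ → ℕ) (l : ℕ) (F : Finset (Sym2 (Fin n))) : Prop :=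
  Set.BijOn (fun i => s(f i, g i)) (Set.Iio l) (Sym2.map Fin.val '' (F : Set (Sym2 (Fin n))))

/-- The answer to a decision problem is in register 0: `1` for yes and `0` for no. -/
def Answers (yes : Prop) (s : Store) : Prop :=
  (yes → s.reg 0 = 1) ∧ (¬ yes → s.reg 0 = 0)

/-- The memory holds the value `x`: register 0 is `0` if `x = ⊤`; otherwise register 0 is `1` and
register 1 is `x`. -/
def ReturnsValue (x : ℕ∞) (s : Store) : Prop :=
  (x = ⊤ → s.reg 0 = 0) ∧ (x ≠ ⊤ → s.reg 0 = 1 ∧ (s.reg 1 : ℕ∞) = x)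

/-- If `(G, δ)` has no solution, then register 0 is `0`. Otherwise register 0 is `1` and the memory
holds an optimal solution `(A, D)`: registers 1 and 2 hold `|A|` and `|D|`, arrays 0 and 1 hold
the end-vertices of the edges in `A`, and arrays 2 and 3 those of the edges in `D`. -/
def ReturnsSolution {n : ℕ} (G : SimpleGraph (Fin n)) (δ : Fin n → Fin 2) (s : Store) : Prop :=
  ((¬ ∃ A D, IsSolution G δ A D) → s.reg 0 = 0) ∧
  ((∃ A D, IsSolution G δ A D) → s.reg 0 = 1 ∧
    ∃ A D, IsOptimalSolution G δ A D ∧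
      ListsEdges (s.arr 0) (s.arr 1) (s.reg 1) A ∧ ListsEdges (s.arr 2) (s.arr 3) (s.reg 2) D)

end ParityEditing

/-!
# Connected degree parity editing by edge additions and deletions

Editing `G` means passing to the symmetric difference of `G` with a graph `F`, at the cost of one
edit per edge of `F`. The result has the required parities iff the odd vertices of `F` are exactly
the vertices of the set `T` of vertices of the wrong parity (`isTarget_symmDiff_iff`). So the
optimum is the least number of edges of a graph `F` whose odd vertices form `T` and for which `G ∆
F` is connected.

**Lower bounds.** Let `p` and `q` be the numbers of components of `G` without and with a vertex of
`T`. The edges of `F` connect the components, so there are at least `p + q - 1` of them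
(`numFree_add_numHit_le`). Each vertex of `T` contributes `1` to the degree sum of `F`, and each
component without a vertex of `T` contributes `2`, so there are at least `p + |T| / 2` edges
(`two_mul_numFree_add_le`). The maximum of both is `Nform`. It is not attained in two cases: if
there are two components and `T` is empty, since an even graph with an edge has three of them
(`Nform_lt_of_two`), and if `G` is connected and `T` induces a star of bridges, since then `F` would
be a perfect matching of `T` and cut off a leaf of the star (`IsBridgeStar.lt_ncard`).

**Construction.** First the components are joined one after the other. The ends of a joining edge
are chosen in such a way that the bound drops by exactly one (`JoinRule.Nform_add_one`). This gives
a connected graph `G'` and a set `T'` of vertices of the wrong parity. Next, the vertices of `T'`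
are paired, non-adjacent ones as long as there are any, so that the remaining ones form a clique
(`PairInv`). Switching all these pairs takes as many edits as the bound requires
(`JoinInv.eq_Nform`). Pairs of non-adjacent vertices only add edges, and two or more deleted edges
of a clique are replaced by paths through the clique (`PairInv.connected_base`). So the result can
be disconnected only if a single pair `u v` of adjacent vertices is left over. In this case `u v` is
a bridge of `G'`, and one tries to exchange an entry of one pair with an entry of another pair. If
none of linearly many exchanges helps, then all pairs of non-adjacent vertices are attached by
bridges to the same end of `u v` (`isBridgeStar_of_no_exchange`), and every joining edge is `u v`
itself (`join_eq_of_no_exchange`). This leaves exactly the two cases in which the bound is not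
attained (`cases_of_no_exchange`). There one more edit suffices if there is a third vertex `x`: the
pair `u v` is replaced by the pairs `u x` and `x v` (`exists_bypass`). With only two vertices there
is no solution.

**Algorithms.** Programs are verified by means of the weakest precondition `Wp`, which keeps track
of the exact running time. In linear time, breadth-first search counts the components, and the
formula is evaluated. A star of bridges is recognized by the degrees in `G[T]` and by a second
search in the graph without the edges inside `T` (`isBridgeStar_iff_sum`). In cubic time, the
construction above is carried out on an adjacency matrix: each of at most `n` joining edges, `O(n)`
exchanges and `n` bypasses takes `O(n ^ 2)` steps, mostly for one breadth-first search.

The programs use the following arrays besides those of the input (0: required parities, 1 and 2: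
adjacency lists). Array 3 holds the parities and array 11 the halves of small numbers, array 4 the
indicator function of `T`, array 5 the labels of the components, array 6 the queue, and array 7
marks vertices such that edges between two of them are ignored. The arrays 8 and 9 hold counters,
marks and scores. For the solver, array 12 holds the multiples of `n`, array 13 the matrix of the
current graph, array 14 that of `G`, array 15 the list of pairs, and array 16 zeros.
-/

set_option linter.unusedSimpArgs false
namespace ParityEditing

/-! ### Running programs -/

/-- The weakest precondition with exact running time: `P`, started in `s`, halts in a memory `s'`
after `t` steps such that `R s' t`. -/
def Wp (P : Prog) (s : Store) (R : Store → ℕ → Prop) : Prop :=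
  ∃ s' t, Runs P s s' t ∧ R s' t

/-- The bridge from `Wp` to the specifications of running times. -/
theorem Wp.haltsWithin {P : Prog} {s : Store} {b : ℕ} {post : Store → Prop}
    (h : Wp P s fun s' t => t ≤ b ∧ post s') : HaltsWithin P s b post := by
  obtain ⟨s', t, h1, h2, h3⟩ := h
  exact ⟨s', t, h1, h2, h3⟩

theorem Wp.mono {P : Prog} {s : Store} {R R' : Store → ℕ → Prop} (h : Wp P s R)
    (hR : ∀ s' t, R s' t → R' s' t) : Wp P s R' := by
  obtain ⟨s', t, h1, h2⟩ := h
  exact ⟨s', t, h1, hR _ _ h2⟩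

@[simp] theorem wp_skip {s : Store} {R : Store → ℕ → Prop} : Wp .skip s R ↔ R s 1 := by
  constructor
  · rintro ⟨s', t, h, hR⟩
    cases h
    exact hR
  · exact fun h => ⟨_, _, .skip s, h⟩

@[simp] theorem wp_set {i : ℕ} {e : Expr} {s : Store} {R : Store → ℕ → Prop} :
    Wp (.set i e) s R ↔ R ⟨Function.update s.reg i (e.eval s), s.arr⟩ (e.cost + 1) := by
  constructor
  · rintro ⟨s', t, h, hR⟩
    cases h
    exact hR
  · exact fun h => ⟨_, _, .set i e s, h⟩

@[simp] theorem wp_store {a : ℕ} {e₁ e₂ : Expr} {s : Store} {R : Store → ℕ → Prop} :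
    Wp (.store a e₁ e₂) s R ↔
      R ⟨s.reg, Function.update s.arr a (Function.update (s.arr a) (e₁.eval s) (e₂.eval s))⟩
        (e₁.cost + e₂.cost + 1) := by
  constructor
  · rintro ⟨s', t, h, hR⟩
    cases h
    exact hR
  · exact fun h => ⟨_, _, .store a e₁ e₂ s, h⟩

@[simp] theorem wp_seq {P Q : Prog} {s : Store} {R : Store → ℕ → Prop} :
    Wp (.seq P Q) s R ↔ Wp P s fun s₁ t₁ => Wp Q s₁ fun s₂ t₂ => R s₂ (t₁ + t₂) := by
  constructor
  · rintro ⟨s', t, h, hR⟩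
    cases h with
    | seq h1 h2 => exact ⟨_, _, h1, _, _, h2, hR⟩
  · rintro ⟨s', t, h, s₂, t₂, h2, hR⟩
    exact ⟨_, _, .seq h h2, hR⟩

@[simp] theorem wp_cond {e : Expr} {P Q : Prog} {s : Store} {R : Store → ℕ → Prop} :
    Wp (.cond e P Q) s R ↔
      if e.eval s = 0 then Wp Q s fun s' t => R s' (e.cost + 1 + t)
      else Wp P s fun s' t => R s' (e.cost + 1 + t) := by
  constructor
  · rintro ⟨s', t, h, hR⟩
    cases h with
    | cond_true h1 h2 => rw [if_neg h1]; exact ⟨_, _, h2, hR⟩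
    | cond_false h1 h2 => rw [if_pos h1]; exact ⟨_, _, h2, hR⟩
  · intro h
    split_ifs at h with h1
    · obtain ⟨s', t, h, hR⟩ := h
      exact ⟨_, _, .cond_false h1 h, hR⟩
    · obtain ⟨s', t, h, hR⟩ := h
      exact ⟨_, _, .cond_true h1 h, hR⟩

/-- The registers that a program may write to. -/
def Prog.setsReg : Prog → ℕ → Bool
  | .skip, _ => false
  | .set i _, j => i == j
  | .store _ _ _, _ => false
  | .seq P Q, j => P.setsReg j || Q.setsReg j
  | .cond _ P Q, j => P.setsReg j || Q.setsReg j
  | .loop _ P, j => P.setsReg j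

/-- The arrays that a program may write to. -/
def Prog.setsArr : Prog → ℕ → Bool
  | .skip, _ => false
  | .set _ _, _ => false
  | .store a _ _, j => a == j
  | .seq P Q, j => P.setsArr j || Q.setsArr j
  | .cond _ P Q, j => P.setsArr j || Q.setsArr j
  | .loop _ P, j => P.setsArr j

/-- `s'` agrees with `s` on all registers and arrays that `P` does not write to. -/
def Frame (P : Prog) (s s' : Store) : Prop :=
  (∀ i, P.setsReg i = false → s'.reg i = s.reg i) ∧
  (∀ a, P.setsArr a = false → s'.arr a = s.arr a)

theorem Frame.refl (P : Prog) (s : Store) : Frame P s s := ⟨fun _ _ => rfl, fun _ _ => rfl⟩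

theorem Frame.trans {P : Prog} {s s' s'' : Store} (h : Frame P s s') (h' : Frame P s' s'') :
    Frame P s s'' :=
  ⟨fun i hi => (h'.1 i hi).trans (h.1 i hi), fun a ha => (h'.2 a ha).trans (h.2 a ha)⟩

theorem Frame.weaken {P Q : Prog} {s s' : Store} (h : Frame P s s')
    (hr : ∀ i, Q.setsReg i = false → P.setsReg i = false)
    (ha : ∀ i, Q.setsArr i = false → P.setsArr i = false) : Frame Q s s' :=
  ⟨fun i hi => h.1 i (hr i hi), fun i hi => h.2 i (ha i hi)⟩

theorem Runs.frame {P : Prog} {s s' : Store} {t : ℕ} (h : Runs P s s' t) : Frame P s s' := by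
  induction h with
  | skip s => exact Frame.refl _ _
  | set i e s =>
    refine ⟨fun j hj => ?_, fun _ _ => rfl⟩
    simp only [Prog.setsReg, beq_eq_false_iff_ne] at hj
    simp [Function.update_of_ne (Ne.symm hj)]
  | store a e₁ e₂ s =>
    refine ⟨fun _ _ => rfl, fun j hj => ?_⟩
    simp only [Prog.setsArr, beq_eq_false_iff_ne] at hj
    simp [Function.update_of_ne (Ne.symm hj)]
  | seq _ _ ih1 ih2 =>
    refine (ih1.weaken ?_ ?_).trans (ih2.weaken ?_ ?_) <;> intro i hi <;>
      simp_all [Prog.setsReg, Prog.setsArr]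
  | cond_true _ _ ih =>
    refine ih.weaken ?_ ?_ <;> intro i hi <;> simp_all [Prog.setsReg, Prog.setsArr]
  | cond_false _ _ ih =>
    refine ih.weaken ?_ ?_ <;> intro i hi <;> simp_all [Prog.setsReg, Prog.setsArr]
  | loop_done _ => exact Frame.refl _ _
  | loop_step _ _ _ ih1 ih2 => exact (ih1.weaken (fun _ h => h) fun _ h => h).trans ih2

theorem Wp.frame {P : Prog} {s : Store} {R : Store → ℕ → Prop} (h : Wp P s R) :
    Wp P s fun s' t => R s' t ∧ Frame P s s' := by
  obtain ⟨s', t, h1, h2⟩ := h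
  exact ⟨s', t, h1, h2, h1.frame⟩

/-- The consequence rule together with the frame condition. -/
theorem Wp.mono' {P : Prog} {s : Store} {R R' : Store → ℕ → Prop} (h : Wp P s R)
    (hR : ∀ s' t, Frame P s s' → R s' t → R' s' t) : Wp P s R' :=
  h.frame.mono fun s' t h' => hR s' t h'.2 h'.1

/-- The rule for loops: `I s b` says that the invariant holds in memory `s` and that the budget for
the remaining steps is `b`. What is left of the budget at the end is passed to `Q`. -/
theorem wp_loop {e : Expr} {P : Prog} {s₀ : Store} {b₀ : ℕ} {Q : Store → ℕ → Prop}
    (I : Store → ℕ → Prop) (h0 : I s₀ b₀)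
    (hdone : ∀ s b, Frame P s₀ s → I s b → e.eval s = 0 → ∃ b', Q s b' ∧ e.cost + 1 + b' ≤ b)
    (hstep : ∀ s b, Frame P s₀ s → I s b → e.eval s ≠ 0 →
      Wp P s fun s' t => ∃ b', I s' b' ∧ e.cost + 1 + t + b' ≤ b) :
    Wp (.loop e P) s₀ fun s t => ∃ b', Q s b' ∧ t + b' ≤ b₀ := by
  suffices H : ∀ b s, Frame P s₀ s → I s b →
      Wp (.loop e P) s fun s' t => ∃ b', Q s' b' ∧ t + b' ≤ b from
    H _ _ (Frame.refl _ _) h0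
  intro b
  induction b using Nat.strong_induction_on with
  | _ b ih =>
    intro s hF hI
    by_cases he : e.eval s = 0
    · obtain ⟨b', h1, h2⟩ := hdone s b hF hI he
      exact ⟨s, _, .loop_done he, b', h1, h2⟩
    · obtain ⟨s', t, h1, b', h2, h3⟩ := hstep s b hF hI he
      have hF' : Frame P s₀ s' := hF.trans h1.frame
      -- every round takes a step, so the budget strictly decreases
      obtain ⟨s'', t', h4, b'', h5, h6⟩ := ih b' (by omega) s' hF' h2
      exact ⟨s'', _, .loop_step he h1 h4, b'', h5, by omega⟩

/-- `for i = a, …, bound - 1 do P`. -/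
def forLoop (i : ℕ) (a bound : Expr) (P : Prog) : Prog :=
  .seq (.set i a) (.loop (.op .lt (.reg i) bound)
    (.seq P (.set i (.op .add (.reg i) (.const 1)))))

/-- The rule for counting loops with amortized cost: `I j s t` says that the invariant holds before
round `j`, in memory `s`, after the bodies of the earlier rounds took `t` steps. -/
theorem wp_for {i : ℕ} {a bound : Expr} {P : Prog} {s₀ : Store} (m N : ℕ)
    (I : ℕ → Store → ℕ → Prop) (ha : a.eval s₀ = m) (hm : m ≤ N) (hP : P.setsReg i = false)
    (h0 : I m ⟨Function.update s₀.reg i m, s₀.arr⟩ 0)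
    (hb : ∀ j s t, Frame (forLoop i a bound P) s₀ s → I j s t → s.reg i = j → bound.eval s = N)
    (hstep : ∀ j s t, m ≤ j → j < N → Frame (forLoop i a bound P) s₀ s → s.reg i = j → I j s t →
      Wp P s fun s' t' => I (j + 1) ⟨Function.update s'.reg i (j + 1), s'.arr⟩ (t + t')) :
    Wp (forLoop i a bound P) s₀ fun s t =>
      s.reg i = N ∧ ∃ t', I N s t' ∧
        t ≤ t' + (N - m) * (bound.cost + 7) + a.cost + bound.cost + 4 := by
  have key : Wp (.loop (.op .lt (.reg i) bound)
      (.seq P (.set i (.op .add (.reg i) (.const 1))))) ⟨Function.update s₀.reg i m, s₀.arr⟩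
      fun s t => s.reg i = N ∧ ∃ t', I N s t' ∧
        t ≤ t' + (N - m) * (bound.cost + 7) + bound.cost + 3 := by
    -- `d` rounds remain; `t` is the time spent in the bodies of the earlier ones
    suffices H : ∀ d j s t, j + d = N → m ≤ j → Frame (forLoop i a bound P) s₀ s → s.reg i = j →
        I j s t → Wp (.loop (.op .lt (.reg i) bound)
        (.seq P (.set i (.op .add (.reg i) (.const 1))))) s
        fun s' t'' => s'.reg i = N ∧ ∃ t', I N s' t' ∧
          t'' + t ≤ t' + d * (bound.cost + 7) + bound.cost + 3 by
      have hF : Frame (forLoop i a bound P) s₀ ⟨Function.update s₀.reg i m, s₀.arr⟩ := by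
        refine ⟨fun k hk => ?_, fun _ _ => rfl⟩
        have : k ≠ i := by
          rintro rfl
          simp [forLoop, Prog.setsReg] at hk
        simp [Function.update_of_ne this]
      exact (H (N - m) m _ 0 (by omega) le_rfl hF (by simp) h0).mono fun s t h => by simpa using h
    intro d
    induction d with
    | zero =>
      intro j s t hj _ hF hi hI
      have hjN : j = N := by omega
      have hbd := hb j s t hF hI hi
      refine ⟨s, _, .loop_done (by simp [Expr.eval, Op.eval, hi, hbd, hjN]), by omega, t,
        hjN ▸ hI, ?_⟩
      simp only [Expr.cost]
      omega
    | succ d ih =>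
      intro j s t hj hmj hF hi hI
      have hbd := hb j s t hF hI hi
      obtain ⟨s', t', hr, hI'⟩ := hstep j s t hmj (by omega) hF hi hI
      have hi' : s'.reg i = j := by rw [hr.frame.1 i hP, hi]
      have hF1 : Frame (forLoop i a bound P) s s' := by
        refine hr.frame.weaken ?_ ?_ <;> intro k hk <;>
          simp_all [forLoop, Prog.setsReg, Prog.setsArr]
      have hF2 : Frame (forLoop i a bound P) s' ⟨Function.update s'.reg i (j + 1), s'.arr⟩ := by
        refine ⟨fun k hk => ?_, fun _ _ => rfl⟩
        have : k ≠ i := by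
          rintro rfl
          simp [forLoop, Prog.setsReg] at hk
        simp [Function.update_of_ne this]
      have hrun : Runs (.seq P (.set i (.op .add (.reg i) (.const 1)))) s
          ⟨Function.update s'.reg i (j + 1), s'.arr⟩ (t' + 4) := by
        have := Runs.seq hr (Runs.set i (.op .add (.reg i) (.const 1)) s')
        simpa [Expr.eval, Op.eval, Expr.cost, hi'] using this
      obtain ⟨s'', t'', hr2, h2, t3, h3, h4⟩ := ih (j + 1) _ (t + t') (by omega) (by omega)
        ((hF.trans hF1).trans hF2) (by simp) hI'
      refine ⟨s'', _, .loop_step ?_ hrun hr2, h2, t3, h3, ?_⟩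
      · simp only [Expr.eval, Op.eval, hi, hbd]
        rw [if_pos (by omega)]
        simp
      · simp only [Expr.cost]
        have : (d + 1) * (bound.cost + 7) = d * (bound.cost + 7) + (bound.cost + 7) := by ring
        omega
  rw [forLoop, wp_seq, wp_set, ha]
  refine key.mono fun s t h => ⟨h.1, ?_⟩
  obtain ⟨t', h1, h2⟩ := h.2
  exact ⟨t', h1, by omega⟩

/-- The rule for counting loops whose body has bounded cost. -/
theorem wp_for_const {i : ℕ} {a bound : Expr} {P : Prog} {s₀ : Store} (m N c : ℕ)
    (I : ℕ → Store → Prop) (ha : a.eval s₀ = m) (hm : m ≤ N) (hP : P.setsReg i = false)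
    (h0 : I m ⟨Function.update s₀.reg i m, s₀.arr⟩)
    (hb : ∀ j s, Frame (forLoop i a bound P) s₀ s → I j s → s.reg i = j → bound.eval s = N)
    (hstep : ∀ j s, m ≤ j → j < N → Frame (forLoop i a bound P) s₀ s → s.reg i = j → I j s →
      Wp P s fun s' t => I (j + 1) ⟨Function.update s'.reg i (j + 1), s'.arr⟩ ∧ t ≤ c) :
    Wp (forLoop i a bound P) s₀ fun s t => (s.reg i = N ∧ I N s) ∧
      t ≤ (N - m) * (c + bound.cost + 7) + a.cost + bound.cost + 4 := by
  refine (wp_for m N (fun j s t => I j s ∧ t ≤ (j - m) * c) ha hm hP ⟨h0, by simp⟩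
    (fun j s t hF hI hi => hb j s hF hI.1 hi) ?_).mono ?_
  · intro j s t hmj hj hF hi hI
    refine (hstep j s hmj hj hF hi hI.1).mono fun s' t' h => ⟨h.1, ?_⟩
    have h1 := hI.2
    have h2 := h.2
    have : (j + 1 - m) * c = (j - m) * c + c := by
      rw [Nat.succ_sub hmj, Nat.succ_mul]
    omega
  · rintro s t ⟨h1, t', ⟨h2, h3⟩, h4⟩
    refine ⟨⟨h1, h2⟩, ?_⟩
    have : (N - m) * (c + bound.cost + 7) = (N - m) * c + (N - m) * (bound.cost + 7) := by ring
    omega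

/-! ### Breadth-first search -/

/-- The arrays `S`, `A` hold adjacency lists, the list of `u` being the entries of `A` with index in
`[S u, S (u + 1))`. An entry `v` in the list of `u` stands for an edge of `K` unless both `u` and
`v` are marked by `f`. -/
structure AdjLists {n : ℕ} (K : SimpleGraph (Fin n)) (S A f : ℕ → ℕ) : Prop where
  start : S 0 = 0
  mono : ∀ v : Fin n, S v ≤ S (v + 1)
  lt : ∀ v : Fin n, ∀ e, S v ≤ e → e < S (v + 1) → A e < n
  adj : ∀ u v : Fin n, K.Adj u v ↔ (∃ e, S u ≤ e ∧ e < S (u + 1) ∧ A e = v) ∧ f u + f v < 2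

/-- The labels `lab v` number the connected components of `K` by `1, …, c`. -/
structure Labels {n : ℕ} (K : SimpleGraph (Fin n)) (lab : ℕ → ℕ) (c : ℕ) : Prop where
  pos : ∀ v : Fin n, 1 ≤ lab v
  le : ∀ v : Fin n, lab v ≤ c
  attained : ∀ k, 1 ≤ k → k ≤ c → ∃ v : Fin n, lab v = k
  eq_iff : ∀ u v : Fin n, lab u = lab v ↔ K.Reachable u v

/-- The invariant of breadth-first search. The queue `Q` has been filled up to `tail` with the
labelled vertices; the vertices before `head`, forming `done`, have been processed. -/
structure BfsInv {n : ℕ} (K : SimpleGraph (Fin n)) (lab Q : ℕ → ℕ) (done : Finset (Fin n))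
    (head tail c : ℕ) : Prop where
  head_le : head ≤ tail
  queue : ∀ i < tail, ∃ v : Fin n, Q i = v ∧ lab v ≠ 0
  inj : ∀ i < tail, ∀ j < tail, Q i = Q j → i = j
  surj : ∀ v : Fin n, lab v ≠ 0 → ∃ i < tail, Q i = v
  mem_done : ∀ v : Fin n, v ∈ done ↔ ∃ i < head, Q i = v
  le : ∀ v : Fin n, lab v ≤ c
  attained : ∀ k, 1 ≤ k → k ≤ c → ∃ v : Fin n, lab v = k
  reach : ∀ u v : Fin n, lab u = lab v → lab u ≠ 0 → K.Reachable u v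
  closed : ∀ u ∈ done, ∀ v : Fin n, K.Adj u v → lab v = lab u
  active : ∀ v : Fin n, lab v ≠ 0 → v ∉ done → lab v = c

namespace BfsInv

variable {n : ℕ} {K : SimpleGraph (Fin n)} {lab Q : ℕ → ℕ} {done : Finset (Fin n)}
  {head tail c : ℕ}

theorem init (K : SimpleGraph (Fin n)) (h : ∀ v : Fin n, lab v = 0) :
    BfsInv K lab Q ∅ 0 0 0 where
  head_le := le_rfl
  queue := by simp
  inj := by simp
  surj := by simp [h]
  mem_done := by simp
  le := by simp [h]
  attained := by omega
  reach := by simp [h]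
  closed := by simp
  active := by simp [h]

theorem lt_iff_notMem (h : BfsInv K lab Q done head tail c) {i : ℕ} (hi : i < tail) {v : Fin n}
    (hv : Q i = v) : v ∉ done ↔ head ≤ i := by
  rw [h.mem_done]
  constructor
  · intro h1
    by_contra h2
    exact h1 ⟨i, by omega, hv⟩
  · rintro h1 ⟨j, hj, hj'⟩
    have := h.inj i hi j (by have := h.head_le; omega) (hv.trans hj'.symm)
    omega

theorem mem_done_of_ne (h : BfsInv K lab Q done tail tail c) {v : Fin n} (hv : lab v ≠ 0) :
    v ∈ done :=
  (h.mem_done v).2 (h.surj v hv)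

/-- Labelling a new vertex with the label `c'` of the current component and appending it to the
queue, either as the root of a new component or as a neighbour of the processed vertex. -/
theorem push (h : BfsInv K lab Q done head tail c) {w : Fin n} (hw : lab w = 0) {c' : ℕ}
    (hc : (c' = c + 1 ∧ head = tail) ∨
      (c' = c ∧ ∃ u : Fin n, lab u = c ∧ c ≠ 0 ∧ K.Adj u w)) :
    BfsInv K (Function.update lab w c') (Function.update Q tail w) done head (tail + 1) c' := by
  have hc0 : c' ≠ 0 := by
    rcases hc with h1 | ⟨h1, u, h2, h3, h4⟩ <;> omega
  have hcc : c ≤ c' := by rcases hc with h1 | h1 <;> omega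
  have hQ : ∀ i < tail, Function.update Q tail (w : ℕ) i = Q i := fun i hi =>
    Function.update_of_ne (by omega) _ _
  have hl : ∀ v : Fin n, v ≠ w → Function.update lab w c' v = lab v := fun v hv =>
    Function.update_of_ne (fun h => hv (Fin.ext h)) _ _
  have hlw : Function.update lab w c' w = c' := Function.update_self _ _ _
  have hne : ∀ v : Fin n, lab v ≠ 0 → v ≠ w := fun v hv h => hv (h ▸ hw)
  have hQw : ∀ i < tail, Q i ≠ w := by
    intro i hi h1
    obtain ⟨v, hv, hv'⟩ := h.queue i hi
    exact hne v hv' (Fin.ext (hv.symm.trans h1))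
  have hwd : w ∉ done := by
    rw [h.mem_done]
    rintro ⟨i, hi, h1⟩
    exact hQw i (by have := h.head_le; omega) h1
  have hreach : ∀ v : Fin n, v ≠ w → lab v = c' → K.Reachable v w := by
    intro v hv hvc
    rcases hc with h1 | ⟨h1, u, h2, h3, h4⟩
    · have := h.le v
      omega
    · exact (h.reach v u (by omega) (by omega)).trans h4.reachable
  refine ⟨by have := h.head_le; omega, ?_, ?_, ?_, ?_, ?_, ?_, ?_, ?_, ?_⟩
  · intro i hi
    rcases Nat.lt_succ_iff_lt_or_eq.1 hi with hi | rfl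
    · obtain ⟨v, hv, hv'⟩ := h.queue i hi
      exact ⟨v, by rw [hQ i hi, hv], by rwa [hl v (hne v hv')]⟩
    · exact ⟨w, by simp, by simpa⟩
  · intro i hi j hj hij
    rcases Nat.lt_succ_iff_lt_or_eq.1 hi with hi | rfl <;>
      rcases Nat.lt_succ_iff_lt_or_eq.1 hj with hj | rfl
    · rw [hQ i hi, hQ j hj] at hij
      exact h.inj i hi j hj hij
    · rw [hQ i hi, Function.update_self] at hij
      exact absurd hij (hQw i hi)
    · rw [hQ j hj, Function.update_self] at hij
      exact absurd hij.symm (hQw j hj)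
    · rfl
  · intro v hv
    by_cases hvw : v = w
    · exact ⟨tail, by omega, by simp [hvw]⟩
    · rw [hl v hvw] at hv
      obtain ⟨i, hi, h1⟩ := h.surj v hv
      exact ⟨i, by omega, by rw [hQ i hi, h1]⟩
  · intro v
    rw [h.mem_done]
    refine exists_congr fun i => and_congr_right fun hi => ?_
    rw [hQ i (by have := h.head_le; omega)]
  · intro v
    by_cases hvw : v = w
    · rw [hvw, hlw]
    · rw [hl v hvw]
      exact (h.le v).trans hcc
  · intro k hk hk'
    by_cases hkc : k = c'
    · exact ⟨w, by rw [hlw, hkc]⟩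
    · obtain ⟨v, hv⟩ := h.attained k hk (by rcases hc with h1 | h1 <;> omega)
      exact ⟨v, by rw [hl v (hne v (by omega)), hv]⟩
  · intro u v huv hu
    by_cases h1 : u = w <;> by_cases h2 : v = w
    · rw [h1, h2]
    · rw [h1, hlw, hl v h2] at huv
      exact h1 ▸ (hreach v h2 huv.symm).symm
    · rw [h2, hlw, hl u h1] at huv
      exact h2 ▸ hreach u h1 huv
    · rw [hl u h1, hl v h2] at huv
      rw [hl u h1] at hu
      exact h.reach u v huv hu
  · intro u hu v huv
    have h1 : u ≠ w := fun h => hwd (h ▸ hu)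
    have hlu : lab u ≠ 0 := by
      obtain ⟨i, hi, h2⟩ := (h.mem_done u).1 hu
      obtain ⟨v, hv, hv'⟩ := h.queue i (by have := h.head_le; omega)
      rwa [show u = v from Fin.ext (h2.symm.trans hv)]
    have h3 := h.closed u hu v huv
    rw [hl u h1, hl v (hne v (by omega)), h3]
  · intro v hv hvd
    by_cases hvw : v = w
    · rw [hvw, hlw]
    · rw [hl v hvw] at hv ⊢
      rcases hc with ⟨h1, h2⟩ | ⟨h1, -⟩
      · subst h2
        exact absurd (h.mem_done_of_ne hv) hvd
      · rw [h1]
        exact h.active v hv hvd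

/-- A vertex all of whose neighbours are labelled counts as processed. -/
theorem finish (h : BfsInv K lab Q done head tail c) (ht : head < tail) {u : Fin n}
    (hu : Q head = u) (hn : ∀ v : Fin n, K.Adj u v → lab v ≠ 0) :
    BfsInv K lab Q (insert u done) (head + 1) tail c := by
  have hud : u ∉ done := (h.lt_iff_notMem ht hu).2 le_rfl
  have hlu : lab u ≠ 0 := by
    obtain ⟨v, hv, hv'⟩ := h.queue head ht
    rwa [show u = v from Fin.ext (hu.symm.trans hv)]
  refine ⟨ht, h.queue, h.inj, h.surj, ?_, h.le, h.attained, h.reach, ?_, ?_⟩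
  · intro v
    rw [Finset.mem_insert, h.mem_done]
    constructor
    · rintro (rfl | ⟨i, hi, h1⟩)
      · exact ⟨head, by omega, hu⟩
      · exact ⟨i, by omega, h1⟩
    · rintro ⟨i, hi, h1⟩
      rcases Nat.lt_succ_iff_lt_or_eq.1 hi with hi | rfl
      · exact Or.inr ⟨i, hi, h1⟩
      · exact Or.inl (Fin.ext (h1.symm.trans hu))
  · intro x hx v hxv
    rcases Finset.mem_insert.1 hx with rfl | hx
    · by_cases hvd : v ∈ done
      · exact (h.closed v hvd x hxv.symm).symm
      · rw [h.active v (hn v hxv) hvd, h.active x hlu hud]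
    · exact h.closed x hx v hxv
  · intro v hv hvd
    exact h.active v hv fun h1 => hvd (Finset.mem_insert_of_mem h1)

/-- When every vertex is labelled and processed, the labels number the components: equal labels were
spread along edges, and no edge leaves the set of vertices with a given label. -/
theorem labels (h : BfsInv K lab Q done tail tail c) (hv : ∀ v : Fin n, lab v ≠ 0) :
    Labels K lab c where
  pos v := Nat.one_le_iff_ne_zero.2 (hv v)
  le := h.le
  attained := h.attained
  eq_iff u v := by
    refine ⟨fun huv => h.reach u v huv (hv u), ?_⟩
    rintro ⟨p⟩
    induction p with
    | nil => rfl
    | cons hadj _ ih =>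
      exact (h.closed _ (h.mem_done_of_ne (hv _)) _ hadj).symm.trans ih

end BfsInv

/-- Looks through the list of the vertex in register 34, labels the unlabelled neighbours with the
label in register 30, and appends them to the queue. -/
def bfsScan : Prog :=
  forLoop 35 (.cell 1 (.reg 34)) (.cell 1 (.op .add (.reg 34) (.const 1)))
    (.seq (.set 36 (.cell 2 (.reg 35)))
      (.cond (.cell 5 (.reg 36)) .skip
        (.cond (.op .lt (.op .add (.cell 7 (.reg 34)) (.cell 7 (.reg 36))) (.const 2))
          (.seq (.store 5 (.reg 36) (.reg 30))
            (.seq (.store 6 (.reg 32) (.reg 36))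
              (.set 32 (.op .add (.reg 32) (.const 1)))))
          .skip)))

/-- Processes the queue in array 6 between `head` (register 31) and `tail` (register 32). -/
def bfsQueue : Prog :=
  .loop (.op .lt (.reg 31) (.reg 32))
    (.seq (.set 34 (.cell 6 (.reg 31)))
      (.seq bfsScan (.set 31 (.op .add (.reg 31) (.const 1)))))

/-- Breadth-first search: array 5 receives labels `1, …, c` of the components, and register 30 the
number `c` of components. -/
def bfs : Prog :=
  .seq (forLoop 33 (.const 0) (.reg 0) (.store 5 (.reg 33) (.const 0)))
    (.seq (.set 30 (.const 0)) (.seq (.set 31 (.const 0)) (.seq (.set 32 (.const 0))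
      (forLoop 33 (.const 0) (.reg 0)
        (.cond (.cell 5 (.reg 33)) .skip
          (.seq (.set 30 (.op .add (.reg 30) (.const 1)))
            (.seq (.store 5 (.reg 33) (.reg 30))
              (.seq (.store 6 (.reg 32) (.reg 33))
                (.seq (.set 32 (.op .add (.reg 32) (.const 1)))
                  bfsQueue)))))))))

section
variable {n : ℕ} {K : SimpleGraph (Fin n)}

theorem wp_bfsScan {s : Store} {done : Finset (Fin n)} {u : Fin n}
    (hA : AdjLists K (s.arr 1) (s.arr 2) (s.arr 7))
    (hI : BfsInv K (s.arr 5) (s.arr 6) done (s.reg 31) (s.reg 32) (s.reg 30))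
    (ht : s.reg 31 < s.reg 32) (hu : s.arr 6 (s.reg 31) = u) (hu' : s.reg 34 = u) :
    Wp bfsScan s fun s' t =>
      (BfsInv K (s'.arr 5) (s'.arr 6) done (s'.reg 31) (s'.reg 32) (s'.reg 30) ∧
        s'.reg 31 < s'.reg 32 ∧ s'.arr 6 (s'.reg 31) = u ∧
        (∀ v : Fin n, K.Adj u v → s'.arr 5 v ≠ 0) ∧
        ∀ v : Fin n, s.arr 5 v ≠ 0 → s'.arr 5 v ≠ 0) ∧
      t ≤ (s.arr 1 (u + 1) - s.arr 1 u) * 50 + 20 := by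
  refine (wp_for_const (s.arr 1 u) (s.arr 1 (u + 1)) 35 (fun j s' =>
    (BfsInv K (s'.arr 5) (s'.arr 6) done (s'.reg 31) (s'.reg 32) (s'.reg 30) ∧
      s'.reg 31 < s'.reg 32 ∧ s'.arr 6 (s'.reg 31) = u) ∧
      (∀ e, s.arr 1 u ≤ e → e < j → ∀ v : Fin n, s.arr 2 e = v → K.Adj u v → s'.arr 5 v ≠ 0) ∧
      ∀ v : Fin n, s.arr 5 v ≠ 0 → s'.arr 5 v ≠ 0)
    (by simp [Expr.eval, hu']) (hA.mono u) rfl ⟨⟨by simpa using hI, by simpa using ht,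
      by simpa using hu⟩, fun e h1 h2 => absurd h1 (by omega), fun _ => id⟩ ?_ ?_).mono ?_
  · intro j s' hF _ _
    simp [Expr.eval, Op.eval, hF.1 34 rfl, hF.2 1 rfl, hu']
  · rintro j s' hj hj' hF hr ⟨⟨h1, h2, h3⟩, h4, h5⟩
    have e1 := hF.2 1 rfl
    have e2 := hF.2 2 rfl
    have e7 := hF.2 7 rfl
    have e34 := (hF.1 34 rfl).trans hu'
    obtain ⟨v, hv⟩ : ∃ v : Fin n, s.arr 2 j = v := ⟨⟨_, hA.lt u j hj hj'⟩, rfl⟩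
    have hadj := hA.adj u v
    have step : ∀ l : ℕ → ℕ, (∀ w : Fin n, s'.arr 5 w ≠ 0 → l w ≠ 0) → (K.Adj u v → l v ≠ 0) →
        (∀ e, s.arr 1 u ≤ e → e < j + 1 → ∀ w : Fin n, s.arr 2 e = w → K.Adj u w → l w ≠ 0) ∧
        ∀ w : Fin n, s.arr 5 w ≠ 0 → l w ≠ 0 := by
      refine fun l hx hxv => ⟨fun e he he' w hw huw => ?_, fun w hw => hx w (h5 w hw)⟩
      by_cases hej : e = j
      · subst hej
        have : w = v := Fin.ext (hw.symm.trans hv)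
        subst this
        exact hxv huw
      · exact hx w (h4 e he (by omega) w hw huw)
    by_cases c1 : s'.arr 5 v = 0
    · by_cases c2 : s.arr 7 u + s.arr 7 v < 2
      · have huv : K.Adj u v := hadj.2 ⟨⟨j, hj, hj', hv⟩, c2⟩
        -- the processed vertex is not in `done`, so it carries the current label
        have hud : u ∉ done := (h1.lt_iff_notMem h2 h3).2 le_rfl
        have hlu : s'.arr 5 u ≠ 0 := by
          obtain ⟨w, hw, hw'⟩ := h1.queue _ h2
          rwa [show u = w from Fin.ext (h3.symm.trans hw)]
        have hc := h1.active u hlu hud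
        have hp := h1.push c1 (Or.inr ⟨rfl, u, hc, by omega, huv⟩)
        simp only [wp_seq, wp_set, wp_cond, wp_skip, wp_store, Expr.eval, Op.eval,
          Expr.cost, Function.update_self, Function.update_of_ne, ne_eq, Nat.reduceEqDiff,
          not_false_eq_true, not_true_eq_false, ↓reduceIte, one_ne_zero, hr, e2, hv, e7, e34, c1,
          c2]
        refine ⟨⟨⟨hp, by omega, ?_⟩, step _ ?_ ?_⟩, by omega⟩
        · rw [Function.update_of_ne (by omega), h3]
        · intro w hw
          by_cases hwv : w = v
          · subst hwv; exact absurd c1 hw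
          · rwa [Function.update_of_ne (fun h => hwv (Fin.ext h))]
        · intro _
          simp only [Function.update_self]
          omega
      · simp only [wp_seq, wp_set, wp_cond, wp_skip, wp_store, Expr.eval, Op.eval,
          Expr.cost, Function.update_self, Function.update_of_ne, ne_eq, Nat.reduceEqDiff,
          not_false_eq_true, not_true_eq_false, ↓reduceIte, one_ne_zero, hr, e2, hv, e7, e34, c1,
          c2]
        exact ⟨⟨⟨h1, h2, h3⟩, step _ (fun _ => id) fun h => absurd (hadj.1 h).2 c2⟩, by omega⟩
    · simp only [wp_seq, wp_set, wp_cond, wp_skip, wp_store, Expr.eval, Op.eval,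
          Expr.cost, Function.update_self, Function.update_of_ne, ne_eq, Nat.reduceEqDiff,
          not_false_eq_true, not_true_eq_false, ↓reduceIte, one_ne_zero, hr, e2, hv, c1]
      exact ⟨⟨⟨h1, h2, h3⟩, step _ (fun _ => id) fun _ => c1⟩, by omega⟩
  · rintro s' t ⟨⟨-, ⟨h1, h2, h3⟩, h4, h5⟩, h6⟩
    refine ⟨⟨h1, h2, h3, fun v hv => ?_, h5⟩, ?_⟩
    · obtain ⟨⟨e, he, he', hev⟩, -⟩ := (hA.adj u v).1 hv
      exact h4 e he he' v hev hv
    · simp only [Expr.cost] at h6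
      omega

/-- An upper bound for the time that breadth-first search spends on the vertices not in `done`. -/
def bfsWork (S : ℕ → ℕ) (done : Finset (Fin n)) : ℕ :=
  ∑ v ∈ doneᶜ, ((S (v + 1) - S v) * 50 + 40)

theorem bfsWork_insert (S : ℕ → ℕ) {done : Finset (Fin n)} {u : Fin n} (hu : u ∉ done) :
    bfsWork S done = bfsWork S (insert u done) + ((S (u + 1) - S u) * 50 + 40) := by
  rw [bfsWork, bfsWork, Finset.compl_insert, Finset.sum_erase_add]
  simpa using hu

theorem AdjLists.sum_length {S A f : ℕ → ℕ} (hA : AdjLists K S A f) :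
    ∑ v : Fin n, (S (v + 1) - S v) = S n := by
  rw [Fin.sum_univ_eq_sum_range (fun v => S (v + 1) - S v) n]
  suffices H : ∀ m ≤ n, ∑ v ∈ Finset.range m, (S (v + 1) - S v) = S m from H n le_rfl
  intro m hm
  induction m with
  | zero => simp [hA.start]
  | succ m ih =>
    rw [Finset.sum_range_succ, ih (by omega)]
    have := hA.mono ⟨m, hm⟩
    simp only at this
    omega

/-- The time is amortized: every round puts the vertex at the head of the queue into `done`, and is
paid for by its term of `bfsWork`. -/
theorem wp_bfsQueue {s : Store} {done : Finset (Fin n)}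
    (hA : AdjLists K (s.arr 1) (s.arr 2) (s.arr 7))
    (hI : BfsInv K (s.arr 5) (s.arr 6) done (s.reg 31) (s.reg 32) (s.reg 30)) :
    Wp bfsQueue s fun s' t => ∃ done',
      BfsInv K (s'.arr 5) (s'.arr 6) done' (s'.reg 31) (s'.reg 32) (s'.reg 30) ∧
      s'.reg 31 = s'.reg 32 ∧ (∀ v : Fin n, s.arr 5 v ≠ 0 → s'.arr 5 v ≠ 0) ∧
      t + bfsWork (s.arr 1) done' ≤ bfsWork (s.arr 1) done + 4 := by
  refine (wp_loop (b₀ := bfsWork (s.arr 1) done + 4) (Q := fun s' b => ∃ done',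
      BfsInv K (s'.arr 5) (s'.arr 6) done' (s'.reg 31) (s'.reg 32) (s'.reg 30) ∧
      s'.reg 31 = s'.reg 32 ∧ (∀ v : Fin n, s.arr 5 v ≠ 0 → s'.arr 5 v ≠ 0) ∧
      b = bfsWork (s.arr 1) done')
    (fun s' b => ∃ done',
      BfsInv K (s'.arr 5) (s'.arr 6) done' (s'.reg 31) (s'.reg 32) (s'.reg 30) ∧
      (∀ v : Fin n, s.arr 5 v ≠ 0 → s'.arr 5 v ≠ 0) ∧ b = bfsWork (s.arr 1) done' + 4)
    ⟨done, hI, fun _ => id, rfl⟩ ?_ ?_).mono ?_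
  · rintro s' b hF ⟨done', h1, h2, rfl⟩ he
    have hge : s'.reg 32 ≤ s'.reg 31 := by
      by_contra h
      simp [Expr.eval, Op.eval, not_le.1 h] at he
    exact ⟨_, ⟨done', h1, le_antisymm h1.head_le hge, h2, rfl⟩, by simp [Expr.cost]; omega⟩
  · rintro s' b hF ⟨done', h1, h2, rfl⟩ he
    have e1 := hF.2 1 rfl
    have e2 := hF.2 2 rfl
    have e7 := hF.2 7 rfl
    have hlt : s'.reg 31 < s'.reg 32 := by
      by_contra h
      simp [Expr.eval, Op.eval, h] at he
    obtain ⟨u, hu, -⟩ := h1.queue _ hlt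
    have hud : u ∉ done' := (h1.lt_iff_notMem hlt hu).2 le_rfl
    rw [wp_seq, wp_set, wp_seq]
    refine (wp_bfsScan (K := K) (done := done') (u := u) (by simpa [e1, e2, e7] using hA)
      (by simpa using h1) (by simpa using hlt) (by simpa using hu)
      (by simpa [Expr.eval] using hu)).mono ?_
    rintro s'' t ⟨⟨g1, g2, g3, g4, g5⟩, g6⟩
    rw [wp_set]
    refine ⟨_, ⟨insert u done', ?_, ?_, rfl⟩, ?_⟩
    · simpa [Expr.eval, Op.eval] using g1.finish g2 g3 g4
    · exact fun v hv => g5 v (h2 v hv)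
    · rw [bfsWork_insert _ hud]
      simp only [e1] at g6
      simp only [Expr.cost]
      omega
  · rintro s' t ⟨b', ⟨done', h1, h2, h3, rfl⟩, h4⟩
    exact ⟨done', h1, h2, h3, h4⟩

theorem wp_bfs {s : Store} (hn : s.reg 0 = n)
    (hA : AdjLists K (s.arr 1) (s.arr 2) (s.arr 7)) :
    Wp bfs s fun s' t => Labels K (s'.arr 5) (s'.reg 30) ∧ t ≤ 100 * (n + s.arr 1 n) + 50 := by
  rw [bfs, wp_seq]
  refine (wp_for_const 0 n 4 (fun j s' => ∀ v : Fin n, v < j → s'.arr 5 v = 0) rfl (Nat.zero_le _)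
    rfl (by simp) (fun j s' hF _ _ => by simpa [Expr.eval] using (hF.1 0 rfl).trans hn) ?_).mono' ?_
  · intro j s' _ _ _ hr hI
    simp [Expr.eval, Expr.cost, hr]
    intro v hv
    by_cases hvj : (v : ℕ) = j
    · simp [hvj]
    · rw [Function.update_of_ne hvj]
      exact hI v (by omega)
  rintro s1 t1 hF1 ⟨⟨-, h1⟩, ht1⟩
  simp only [wp_seq, wp_set, Expr.eval, Expr.cost]
  refine (wp_for 0 n (fun j s' t => ∃ done,
    BfsInv K (s'.arr 5) (s'.arr 6) done (s'.reg 31) (s'.reg 32) (s'.reg 30) ∧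
      s'.reg 31 = s'.reg 32 ∧ (∀ v : Fin n, v < j → s'.arr 5 v ≠ 0) ∧
      -- a root costs a constant, all else is paid for by the work on the vertices in `done`
      t + bfsWork (s.arr 1) done ≤ bfsWork (n := n) (s.arr 1) ∅ + 30 * j) rfl (Nat.zero_le _)
    rfl ⟨∅, ?_, by simp, by simp, by simp⟩
    (fun j s' t hF _ _ => by simpa [Expr.eval, hF1.1 0 rfl, hn] using hF.1 0 rfl) ?_).mono ?_
  · simpa using BfsInv.init K fun v => h1 v v.2
  · rintro j s' t - hj hF hr ⟨done, g1, g2, g3, g4⟩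
    have e1 : s'.arr 1 = s.arr 1 := (hF.2 1 rfl).trans (hF1.2 1 rfl)
    have e2 : s'.arr 2 = s.arr 2 := (hF.2 2 rfl).trans (hF1.2 2 rfl)
    have e7 : s'.arr 7 = s.arr 7 := (hF.2 7 rfl).trans (hF1.2 7 rfl)
    have hlast : ∀ l : ℕ → ℕ, (∀ w : Fin n, s'.arr 5 w ≠ 0 → l w ≠ 0) → l j ≠ 0 →
        ∀ v : Fin n, v < j + 1 → l v ≠ 0 := by
      intro l hl hlj v hv
      by_cases hvj : (v : ℕ) = j
      · rwa [hvj]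
      · exact hl v (g3 v (by omega))
    by_cases c1 : s'.arr 5 j = 0
    · have hp := g1.push (w := ⟨j, hj⟩) c1 (Or.inl ⟨rfl, g2⟩)
      simp only [wp_cond, Expr.eval, hr, c1, if_true, wp_seq, wp_set, wp_store, Expr.cost, Op.eval,
        ne_eq, not_true_eq_false, if_false]
      refine (wp_bfsQueue (K := K) (done := done) (by simpa [e1, e2, e7] using hA)
        (by simpa [hr] using hp)).mono ?_
      rintro s'' t' ⟨done', f1, f2, f3, f4⟩
      refine ⟨done', by simpa using f1, by simpa using f2, ?_, ?_⟩
      · refine hlast _ (fun w hw => f3 w ?_) (f3 ⟨j, hj⟩ (by simp [hr]))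
        by_cases hwj : (w : ℕ) = j
        · rw [hwj] at hw
          exact absurd c1 hw
        · simpa [hr, hwj] using hw
      · change _ + bfsWork (s'.arr 1) done' ≤ bfsWork (s'.arr 1) done + 4 at f4
        rw [e1] at f4
        omega
    · simp only [wp_cond, Expr.eval, hr, c1, if_false, wp_skip, Expr.cost]
      refine ⟨done, by simpa using g1, by simpa using g2, hlast _ (fun _ => id) c1, by omega⟩
  · rintro s' t ⟨-, t', ⟨done, g1, g2, g3, g4⟩, ht⟩
    refine ⟨(show BfsInv K _ _ done (s'.reg 32) (s'.reg 32) _ from g2 ▸ g1).labels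
      fun v => g3 v v.2, ?_⟩
    have hW : bfsWork (n := n) (s.arr 1) ∅ = s.arr 1 n * 50 + n * 40 := by
      simp [bfsWork, Finset.sum_add_distrib, ← Finset.sum_mul, hA.sum_length]
    simp only [Expr.cost] at ht ht1
    omega

end

open SimpleGraph
open scoped symmDiff

/-! ### Edited graphs as symmetric differences -/


section
variable {V : Type*}

theorem symmDiff_adj {G H : SimpleGraph V} {x y : V} :
    (G ∆ H).Adj x y ↔ (G.Adj x y ∧ ¬ H.Adj x y) ∨ (H.Adj x y ∧ ¬ G.Adj x y) := by
  simp [symmDiff_def]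

theorem edgeSet_symmDiff (G H : SimpleGraph V) : (G ∆ H).edgeSet = G.edgeSet ∆ H.edgeSet := by
  ext e
  induction e with
  | _ x y => simp [Set.mem_symmDiff, symmDiff_adj]

theorem fromEdgeSet_of_subset {G : SimpleGraph V} {S : Set (Sym2 V)} (h : S ⊆ G.edgeSet) :
    (fromEdgeSet S).edgeSet = S := by
  rw [edgeSet_fromEdgeSet, sdiff_eq_left]
  refine Set.disjoint_left.2 fun e he hd => ?_
  exact G.not_isDiag_of_mem_edgeSet (h he) hd

/-- The number of edges in which a graph differs from the symmetric difference of two graphs is at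
most the total number of edges. -/
theorem ncard_symmDiff_le [Finite V] (F F' : SimpleGraph V) :
    (F ∆ F').edgeSet.ncard ≤ F.edgeSet.ncard + F'.edgeSet.ncard := by
  rw [edgeSet_symmDiff]
  exact (Set.ncard_le_ncard Set.symmDiff_subset_union).trans (Set.ncard_union_le _ _)

theorem deg_symmDiff [Finite V] (G H : SimpleGraph V) (v : V) :
    (deg (G ∆ H) v : ZMod 2) = deg G v + deg H v := by
  have h0 : (G ∆ H).neighborSet v = G.neighborSet v ∆ H.neighborSet v := by
    ext w
    simp [Set.mem_symmDiff, symmDiff_adj]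
  have h1 : (G.neighborSet v ∆ H.neighborSet v).ncard +
      2 * (G.neighborSet v ∩ H.neighborSet v).ncard =
      (G.neighborSet v).ncard + (H.neighborSet v).ncard := by
    have h2 := Set.ncard_inter_add_ncard_sdiff_eq_ncard (G.neighborSet v) (H.neighborSet v)
    have h3 := Set.ncard_inter_add_ncard_sdiff_eq_ncard (H.neighborSet v) (G.neighborSet v)
    rw [Set.inter_comm] at h3
    rw [Set.symmDiff_def, Set.ncard_union_eq
      (Set.disjoint_left.2 fun x hx hx' => hx.2 hx'.1)]
    omega
  have h4 := congrArg (Nat.cast (R := ZMod 2)) h1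
  push_cast at h4
  rw [show (2 : ZMod 2) = 0 from rfl, zero_mul, add_zero] at h4
  rw [deg, h0, h4]
  rfl

theorem mem_wrong_iff {G : SimpleGraph V} {δ : V → Fin 2} {v : V} :
    v ∈ wrong G δ ↔ (deg G v : ZMod 2) ≠ ((δ v : ℕ) : ZMod 2) := by
  rw [wrong, Set.mem_ofPred_eq, ← ZMod.natCast_eq_natCast_iff]

theorem odd_iff_cast {m : ℕ} : Odd m ↔ (m : ZMod 2) = 1 := by
  rw [← Nat.not_even_iff_odd, ← ZMod.natCast_eq_zero_iff_even]
  generalize (m : ZMod 2) = a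
  revert a
  decide

/-- Editing `G` by `F` yields a target graph if and only if the result is connected and the vertices
of odd degree in `F` are those of the wrong parity in `G`. -/
theorem isTarget_symmDiff_iff [Finite V] {G F : SimpleGraph V} {δ : V → Fin 2} :
    IsTarget δ (G ∆ F) ↔ (G ∆ F).Connected ∧ ∀ v, Odd (deg F v) ↔ v ∈ wrong G δ := by
  refine and_congr_right fun _ => forall_congr' fun v => ?_
  rw [mem_wrong_iff, odd_iff_cast, ← ZMod.natCast_eq_natCast_iff, deg_symmDiff]
  generalize (deg G v : ZMod 2) = a
  generalize (deg F v : ZMod 2) = b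
  generalize ((δ v : ℕ) : ZMod 2) = c
  revert a b c
  decide

theorem edgeSet_singleton_of_editStep {G G' : SimpleGraph V} (h : EditStep G G') :
    ∃ e, (G ∆ G').edgeSet = {e} := by
  rcases h with ⟨e, he, h⟩ | ⟨e, he, h⟩
  · refine ⟨e, ?_⟩
    have : e ∉ G.edgeSet := by
      induction e with
      | _ x y => simp only [mem_edgeSet, compl_adj] at he ⊢; exact he.2
    rw [edgeSet_symmDiff, h]
    ext f
    simp only [Set.mem_symmDiff, Set.mem_union, Set.mem_singleton_iff]
    by_cases hf : f = e
    · subst hf; simp [this]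
    · simp [hf]
  · refine ⟨e, ?_⟩
    rw [edgeSet_symmDiff, h]
    ext f
    simp only [Set.mem_symmDiff, Set.mem_sdiff, Set.mem_singleton_iff]
    by_cases hf : f = e
    · subst hf; simp [he]
    · simp [hf]

theorem editStep_symmDiff_edge {G : SimpleGraph V} {e : Sym2 V} (he : ¬ e.IsDiag) :
    EditStep G (G ∆ fromEdgeSet {e}) := by
  have h1 : (fromEdgeSet {e} : SimpleGraph V).edgeSet = {e} := by simpa using he
  by_cases heG : e ∈ G.edgeSet
  · refine Or.inr ⟨e, heG, ?_⟩
    rw [edgeSet_symmDiff, h1]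
    ext f
    simp only [Set.mem_symmDiff, Set.mem_sdiff, Set.mem_singleton_iff]
    by_cases hf : f = e
    · subst hf; simp [heG]
    · simp [hf]
  · refine Or.inl ⟨e, ?_, ?_⟩
    · induction e with
      | _ x y => simpa using ⟨by simpa using he, by simpa using heG⟩
    · rw [edgeSet_symmDiff, h1]
      ext f
      simp only [Set.mem_symmDiff, Set.mem_union, Set.mem_singleton_iff]
      by_cases hf : f = e
      · subst hf; simp [heG]
      · simp [hf]

/-- The graphs within reach of at most `k` edits are those whose symmetric difference with `G` has
at most `k` edges: each edit changes one edge of the symmetric difference. -/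
theorem modifiable_iff [Finite V] {k : ℕ} {G H : SimpleGraph V} :
    Modifiable k G H ↔ (G ∆ H).edgeSet.ncard ≤ k := by
  constructor
  · intro h
    induction h with
    | refl k G => simp
    | @step k G G' H h _ ih =>
      obtain ⟨e, he⟩ := edgeSet_singleton_of_editStep h
      have h1 : G ∆ H = (G ∆ G') ∆ (G' ∆ H) := by
        rw [symmDiff_assoc, symmDiff_symmDiff_cancel_left]
      have h2 := ncard_symmDiff_le (G ∆ G') (G' ∆ H)
      rw [← h1, he, Set.ncard_singleton] at h2
      omega
  · induction k generalizing G with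
    | zero =>
      intro h
      have h1 : (G ∆ H).edgeSet = ∅ := by
        rw [← Set.ncard_eq_zero]; omega
      rw [edgeSet_eq_empty] at h1
      rw [symmDiff_eq_bot.1 h1]
      exact .refl _ _
    | succ k ih =>
      intro h
      by_cases h1 : G ∆ H = ⊥
      · rw [symmDiff_eq_bot.1 h1]
        exact .refl _ _
      · obtain ⟨e, he⟩ : (G ∆ H).edgeSet.Nonempty := by
          rwa [Set.nonempty_iff_ne_empty, ne_eq, edgeSet_eq_empty]
        have hd := (G ∆ H).not_isDiag_of_mem_edgeSet he
        refine .step (editStep_symmDiff_edge hd) (ih ?_)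
        have h2 : (G ∆ fromEdgeSet {e}) ∆ H = (G ∆ H) ∆ fromEdgeSet {e} := by
          rw [symmDiff_assoc, symmDiff_comm (fromEdgeSet {e}), symmDiff_assoc]
        have h3 : (fromEdgeSet {e} : SimpleGraph V).edgeSet = {e} := by simpa using hd
        have h4 : (G ∆ H).edgeSet ∆ {e} = (G ∆ H).edgeSet \ {e} := by
          ext f
          simp only [Set.mem_symmDiff, Set.mem_sdiff, Set.mem_singleton_iff]
          by_cases hf : f = e
          · subst hf; simp [he]
          · simp [hf]
        rw [h2, edgeSet_symmDiff, h3, h4]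
        have := Set.ncard_sdiff_singleton_add_one he
        omega

theorem edgeSet_edit {G : SimpleGraph V} {A D : Finset (Sym2 V)}
    (hA : (A : Set (Sym2 V)) ⊆ Gᶜ.edgeSet) :
    (edit G A D).edgeSet = (G.edgeSet ∪ A) \ D := by
  rw [edit, edgeSet_deleteEdges, edgeSet_sup, fromEdgeSet_of_subset hA]

theorem notMem_edgeSet_of_mem_compl {G : SimpleGraph V} {e : Sym2 V} (h : e ∈ Gᶜ.edgeSet) :
    e ∉ G.edgeSet := by
  induction e with
  | _ x y => simp only [mem_edgeSet, compl_adj] at h ⊢; exact h.2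

/-- The sets of added and of deleted edges partition the difference to the edited graph. -/
theorem edgeSet_symmDiff_edit {G : SimpleGraph V} {A D : Finset (Sym2 V)}
    (hA : (A : Set (Sym2 V)) ⊆ Gᶜ.edgeSet) (hD : (D : Set (Sym2 V)) ⊆ G.edgeSet) :
    (G ∆ edit G A D).edgeSet = (A : Set (Sym2 V)) ∪ D := by
  rw [edgeSet_symmDiff, edgeSet_edit hA]
  ext e
  have h1 : e ∈ (A : Set (Sym2 V)) → e ∉ G.edgeSet := fun h => notMem_edgeSet_of_mem_compl (hA h)
  have h2 := @hD e
  simp only [Set.mem_symmDiff, Set.mem_sdiff, Set.mem_union]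
  tauto

theorem card_add_card_eq {G : SimpleGraph V} {A D : Finset (Sym2 V)}
    (hA : (A : Set (Sym2 V)) ⊆ Gᶜ.edgeSet) (hD : (D : Set (Sym2 V)) ⊆ G.edgeSet) :
    A.card + D.card = (G ∆ edit G A D).edgeSet.ncard := by
  classical
  rw [edgeSet_symmDiff_edit hA hD, ← Finset.coe_union, Set.ncard_coe_finset,
    Finset.card_union_of_disjoint]
  rw [Finset.disjoint_left]
  exact fun e he he' => notMem_edgeSet_of_mem_compl (hA he) (hD he')

/-- Every target graph comes from a solution: the added edges are those of `H \ G`, the deleted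
ones those of `G \ H`. -/
theorem edit_eq_of_coe {G H : SimpleGraph V} {A D : Finset (Sym2 V)}
    (hA : (A : Set (Sym2 V)) = H.edgeSet \ G.edgeSet)
    (hD : (D : Set (Sym2 V)) = G.edgeSet \ H.edgeSet) :
    (A : Set (Sym2 V)) ⊆ Gᶜ.edgeSet ∧ (D : Set (Sym2 V)) ⊆ G.edgeSet ∧ edit G A D = H := by
  have hA' : (A : Set (Sym2 V)) ⊆ Gᶜ.edgeSet := by
    intro e he
    rw [hA] at he
    induction e with
    | _ x y =>
      simp only [Set.mem_sdiff, mem_edgeSet] at he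
      simpa using ⟨he.1.ne, he.2⟩
  refine ⟨hA', by rw [hD]; exact Set.sdiff_subset, ?_⟩
  rw [← edgeSet_inj, edgeSet_edit hA', hA, hD]
  ext e
  simp only [Set.mem_sdiff, Set.mem_union]
  tauto

/-- Solutions correspond to graphs `F` such that `G ∆ F` is a target; the size of a solution is the
number of edges of `F`. -/
theorem exists_isSolution_iff [Finite V] {G : SimpleGraph V} {δ : V → Fin 2} {m : ℕ} :
    (∃ A D, IsSolution G δ A D ∧ A.card + D.card = m) ↔
      ∃ F, IsTarget δ (G ∆ F) ∧ F.edgeSet.ncard = m := by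
  constructor
  · rintro ⟨A, D, ⟨hA, hD, hT⟩, rfl⟩
    exact ⟨G ∆ edit G A D, by rwa [symmDiff_symmDiff_cancel_left], (card_add_card_eq hA hD).symm⟩
  · rintro ⟨F, hF, rfl⟩
    obtain ⟨h1, h2, h3⟩ := edit_eq_of_coe (G := G) (H := G ∆ F)
      (A := (Set.toFinite ((G ∆ F).edgeSet \ G.edgeSet)).toFinset)
      (D := (Set.toFinite (G.edgeSet \ (G ∆ F).edgeSet)).toFinset) (by simp) (by simp)
    refine ⟨_, _, ⟨h1, h2, by rwa [h3]⟩, ?_⟩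
    rw [card_add_card_eq h1 h2, h3, symmDiff_symmDiff_cancel_left]

theorem opt_le_iff [Finite V] {G : SimpleGraph V} {δ : V → Fin 2} {k : ℕ} :
    opt G δ ≤ k ↔ ∃ F, IsTarget δ (G ∆ F) ∧ F.edgeSet.ncard ≤ k := by
  have h1 : opt G δ ≤ k ↔ ∃ A D, IsSolution G δ A D ∧ A.card + D.card ≤ k := by
    have h2 : opt G δ ≤ k ↔ opt G δ < (k + 1 : ℕ) := by
      rw [Nat.cast_add, Nat.cast_one, ENat.lt_add_one_iff (ENat.natCast_ne_top k)]
    rw [h2, opt]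
    simp only [iInf_lt_iff, Nat.cast_lt, exists_prop, Nat.lt_succ_iff]
  rw [h1]
  constructor
  · rintro ⟨A, D, h, hk⟩
    obtain ⟨F, hF, hF'⟩ := exists_isSolution_iff.1 ⟨A, D, h, rfl⟩
    exact ⟨F, hF, hF' ▸ hk⟩
  · rintro ⟨F, h, hk⟩
    obtain ⟨A, D, hF, hF'⟩ := exists_isSolution_iff.2 ⟨F, h, rfl⟩
    exact ⟨A, D, hF, hF' ▸ hk⟩

theorem cdpe_iff [Finite V] {G : SimpleGraph V} {δ : V → Fin 2} {k : ℕ} :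
    CDPE G δ k ↔ opt G δ ≤ k := by
  rw [opt_le_iff, CDPE]
  constructor
  · rintro ⟨H, h1, h2⟩
    exact ⟨G ∆ H, by rwa [symmDiff_symmDiff_cancel_left], modifiable_iff.1 h1⟩
  · rintro ⟨F, h1, h2⟩
    exact ⟨G ∆ F, modifiable_iff.2 (by rwa [symmDiff_symmDiff_cancel_left]), h1⟩

theorem opt_eq_top_iff [Finite V] {G : SimpleGraph V} {δ : V → Fin 2} :
    opt G δ = ⊤ ↔ ∀ F, ¬ IsTarget δ (G ∆ F) := by
  constructor
  · intro h F hF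
    have := (opt_le_iff (k := F.edgeSet.ncard)).2 ⟨F, hF, le_rfl⟩
    rw [h] at this
    exact absurd (top_le_iff.1 this) (ENat.natCast_ne_top _)
  · intro h
    by_contra h1
    obtain ⟨k, hk⟩ := ENat.ne_top_iff_exists.1 h1
    obtain ⟨F, hF, -⟩ := opt_le_iff.1 hk.symm.le
    exact h F hF

theorem opt_eq_coe [Finite V] {G F : SimpleGraph V} {δ : V → Fin 2} {m : ℕ}
    (hF : IsTarget δ (G ∆ F)) (hm : F.edgeSet.ncard ≤ m)
    (hmin : ∀ F', IsTarget δ (G ∆ F') → m ≤ F'.edgeSet.ncard) : opt G δ = m := by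
  refine le_antisymm (opt_le_iff.2 ⟨F, hF, hm⟩) ?_
  by_contra h
  obtain ⟨k, hk⟩ := ENat.ne_top_iff_exists.1 (ne_top_of_lt (not_le.1 h))
  obtain ⟨F', hF', hk'⟩ := opt_le_iff.1 hk.symm.le
  rw [← hk, Nat.cast_le, not_le] at h
  have := hmin F' hF'
  omega

end

/-! ### Graphs given by lists of pairs -/

section
variable {V : Type*}

/-- The graph whose edges are the pairs of distinct vertices with value `1` under `f`. -/
def gr (f : Sym2 V → ZMod 2) : SimpleGraph V where
  Adj x y := x ≠ y ∧ f s(x, y) = 1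
  symm := ⟨fun x y h => ⟨h.1.symm, by rw [Sym2.eq_swap]; exact h.2⟩⟩
  loopless := ⟨fun x h => h.1 rfl⟩

theorem gr_adj {f : Sym2 V → ZMod 2} {x y : V} : (gr f).Adj x y ↔ x ≠ y ∧ f s(x, y) = 1 := Iff.rfl

theorem gr_add (f g : Sym2 V → ZMod 2) : gr (f + g) = gr f ∆ gr g := by
  ext x y
  simp only [symmDiff_adj, gr_adj, Pi.add_apply]
  generalize f s(x, y) = a
  generalize g s(x, y) = b
  have : ∀ a b : ZMod 2, a + b = 1 ↔ (a = 1 ∧ ¬ b = 1) ∨ (b = 1 ∧ ¬ a = 1) := by decide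
  rw [this]
  tauto

@[simp] theorem gr_zero : gr (0 : Sym2 V → ZMod 2) = ⊥ := by
  ext x y
  simp [gr_adj]

open Classical in
/-- The indicator function of the pair `a b`. -/
noncomputable def pairVec (a b : V) : Sym2 V → ZMod 2 := fun e => if e = s(a, b) then 1 else 0

theorem pairVec_comm (a b : V) : pairVec a b = pairVec b a := by
  funext e
  have h : s(a, b) = s(b, a) := Sym2.eq_swap
  unfold pairVec
  rw [h]

@[simp] theorem gr_pairVec (a b : V) : gr (pairVec a b) = edge a b := by
  ext x y
  rw [gr_adj, edge_adj, pairVec, ← Sym2.eq_iff]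
  by_cases h : s(x, y) = s(a, b) <;> simp [h]

/-- The sum of the indicator functions of the pairs `z (2 j), z (2 j + 1)` with `j < N`. -/
noncomputable def vec (z : ℕ → V) (N : ℕ) : Sym2 V → ZMod 2 :=
  ∑ j ∈ Finset.range N, pairVec (z (2 * j)) (z (2 * j + 1))

theorem vec_succ (z : ℕ → V) (N : ℕ) :
    vec z (N + 1) = vec z N + pairVec (z (2 * N)) (z (2 * N + 1)) :=
  Finset.sum_range_succ _ _

theorem vec_congr {z z' : ℕ → V} {N : ℕ} (h : ∀ i < 2 * N, z i = z' i) : vec z N = vec z' N :=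
  Finset.sum_congr rfl fun j hj => by
    rw [Finset.mem_range] at hj
    rw [h (2 * j) (by omega), h (2 * j + 1) (by omega)]

open Classical in
/-- The parity of the number of positions `i < m` with `z i = v`. -/
noncomputable def occ (z : ℕ → V) (m : ℕ) (v : V) : ZMod 2 :=
  ∑ i ∈ Finset.range m, if z i = v then 1 else 0

theorem occ_congr {z z' : ℕ → V} {m : ℕ} (h : ∀ i < m, z i = z' i) (v : V) :
    occ z m v = occ z' m v :=
  Finset.sum_congr rfl fun j hj => by rw [h j (Finset.mem_range.1 hj)]

/-- A list of `N` pairs describes at most `N` edits: pairs that occur twice cancel, and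
pairs of equal vertices are ignored. -/
theorem ncard_edgeSet_gr_vec_le [Finite V] (z : ℕ → V) (N : ℕ) :
    (gr (vec z N)).edgeSet.ncard ≤ N := by
  induction N with
  | zero => simp [vec]
  | succ N ih =>
    rw [vec_succ, gr_add, gr_pairVec]
    refine (ncard_symmDiff_le _ _).trans (Nat.add_le_add ih ?_)
    refine (Set.ncard_le_ncard edgeSet_edge_subset).trans ?_
    simp

open Classical in
theorem deg_edge [Finite V] (a b v : V) :
    (deg (edge a b) v : ZMod 2) = (if a = v then 1 else 0) + if b = v then 1 else 0 := by
  by_cases hab : a = b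
  · subst hab
    simp only [edge_self_eq_bot, deg]
    rw [show (⊥ : SimpleGraph V).neighborSet v = ∅ from by ext; simp]
    split_ifs <;> simp
    decide
  have h : (edge a b).neighborSet v = if a = v then {b} else if b = v then {a} else ∅ := by
    ext w
    simp only [mem_neighborSet, edge_adj]
    split_ifs with h1 h2
    · subst h1; simp; grind
    · subst h2; simp; grind
    · simp; grind
  rw [deg, h]
  split_ifs with h1 h2 h2
  · exact absurd (h1.trans h2.symm) hab
  · simp
  · simp
  · simp

/-- The degree of `v` in the graph of a list of pairs has the parity of the number of positions at
which `v` stands. Pairs of equal vertices are harmless: they contribute two positions and no edge.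
-/
theorem deg_gr_vec [Finite V] (z : ℕ → V) (N : ℕ) (v : V) :
    (deg (gr (vec z N)) v : ZMod 2) = occ z (2 * N) v := by
  classical
  induction N with
  | zero =>
    simp only [vec, Finset.range_zero, Finset.sum_empty, gr_zero, occ, mul_zero, deg]
    rw [show (⊥ : SimpleGraph V).neighborSet v = ∅ from by ext; simp]
    simp
  | succ N ih =>
    rw [vec_succ, gr_add, deg_symmDiff, ih, gr_pairVec, deg_edge, occ, occ,
      show 2 * (N + 1) = 2 * N + 1 + 1 by ring, Finset.sum_range_succ, Finset.sum_range_succ]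
    ring

/-- A list of pairs whose end-vertices are, up to even multiplicities, the vertices of the wrong
parity yields a solution as soon as the edited graph is connected. -/
theorem isTarget_of_occ [Finite V] {G : SimpleGraph V} {δ : V → Fin 2} {z : ℕ → V} {N : ℕ}
    (hz : ∀ v, occ z (2 * N) v = 1 ↔ v ∈ wrong G δ) (hc : (G ∆ gr (vec z N)).Connected) :
    IsTarget δ (G ∆ gr (vec z N)) := by
  rw [isTarget_symmDiff_iff]
  refine ⟨hc, fun v => ?_⟩
  rw [← hz, odd_iff_cast, deg_gr_vec]

end

/-! ### Lower bounds -/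

section
variable {V : Type*}

/-- A connected graph has an edge that leaves a given set of vertices. -/
theorem exists_crossing {H : SimpleGraph V} (hH : H.Connected) {S : Set V} {x y : V} (hx : x ∈ S)
    (hy : y ∉ S) : ∃ a b, H.Adj a b ∧ a ∈ S ∧ b ∉ S := by
  obtain ⟨w⟩ := hH.preconnected x y
  obtain ⟨d, -, h1, h2⟩ := w.exists_boundary_dart S hx hy
  exact ⟨d.fst, d.snd, d.adj, h1, h2⟩

/-- A map that sends edges to pairs of connected vertices sends walks to such pairs. -/
theorem reachable_of_adj {W : Type*} {H : SimpleGraph V} {K : SimpleGraph W} {φ : V → W}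
    (h : ∀ x y, H.Adj x y → K.Reachable (φ x) (φ y)) {x y : V} (hxy : H.Reachable x y) :
    K.Reachable (φ x) (φ y) := by
  obtain ⟨w⟩ := hxy
  induction w with
  | nil => rfl
  | cons hadj _ ih => exact (h _ _ hadj).trans ih

/-- A graph in which the ends of the edges of a connected graph are reachable from each other is
connected. -/
theorem connected_of_adj {G H : SimpleGraph V} (hG : G.Connected)
    (h : ∀ x y, G.Adj x y → H.Reachable x y) : H.Connected := by
  have := hG.nonempty
  exact ⟨fun x y => reachable_of_adj (φ := id) h (hG.preconnected x y)⟩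

theorem deg_eq_degree (F : SimpleGraph V) (v : V) [Fintype (F.neighborSet v)] :
    deg F v = F.degree v := by
  rw [deg, Set.ncard_eq_toFinset_card', ← card_neighborFinset_eq_degree, neighborFinset]

theorem sum_deg [Fintype V] (F : SimpleGraph V) : ∑ v, deg F v = 2 * F.edgeSet.ncard := by
  classical
  rw [Set.ncard_eq_toFinset_card', ← edgeFinset, ← F.sum_degrees_eq_twice_card_edges]
  exact Finset.sum_congr rfl fun v _ => deg_eq_degree F v

theorem deg_pos_iff [Finite V] {F : SimpleGraph V} {v : V} : 0 < deg F v ↔ ∃ w, F.Adj v w := by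
  rw [deg, Set.ncard_pos]
  rfl

theorem numFree_add_numHit [Finite V] (G : SimpleGraph V) (T : Set V) :
    numFree G T + numHit G T = Nat.card G.ConnectedComponent := by
  have h : {c : G.ConnectedComponent | ∃ v ∈ c.supp, v ∈ T} =
      {c : G.ConnectedComponent | ∀ v ∈ c.supp, v ∉ T}ᶜ := by
    ext c
    simp
  rw [numFree, numHit, h, Set.ncard_add_ncard_compl]

theorem numHit_eq_zero_iff [Finite V] {G : SimpleGraph V} {T : Set V} :
    numHit G T = 0 ↔ T = ∅ := by
  rw [numHit, Set.ncard_eq_zero, Set.eq_empty_iff_forall_notMem, Set.eq_empty_iff_forall_notMem]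
  constructor
  · exact fun h v hv => h (G.connectedComponentMk v) ⟨v, rfl, hv⟩
  · rintro h c ⟨v, -, hv⟩
    exact h v hv

theorem connected_iff_numFree_add_numHit [Finite V] [Nonempty V] {G : SimpleGraph V} {T : Set V} :
    G.Connected ↔ numFree G T + numHit G T = 1 := by
  rw [numFree_add_numHit, Nat.card_eq_one_iff_unique]
  constructor
  · intro h
    exact ⟨h.preconnected.subsingleton_connectedComponent, inferInstance⟩
  · rintro ⟨h, -⟩
    exact ⟨fun u v => ConnectedComponent.exact (h.elim _ _)⟩

open Classical in
theorem sum_indicator [Fintype V] (T : Set V) :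
    ∑ v : V, (if v ∈ T then 1 else 0) = T.ncard := by
  rw [Finset.sum_boole, Set.ncard_eq_toFinset_card']
  simp [Set.toFinset]

/-- The degree sum is at least `1` for each vertex of odd degree and `2` for each vertex in `B`. -/
theorem sum_deg_ge [Fintype V] {F : SimpleGraph V} {T : Set V}
    (hodd : ∀ v, Odd (deg F v) ↔ v ∈ T) (B : Set V) (hB : ∀ v ∈ B, v ∉ T ∧ 2 ≤ deg F v) :
    T.ncard + 2 * B.ncard ≤ ∑ v, deg F v := by
  classical
  have h1 : ∑ v : V, ((if v ∈ T then 1 else 0) + 2 * if v ∈ B then 1 else 0) =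
      T.ncard + 2 * B.ncard := by
    rw [Finset.sum_add_distrib, ← Finset.mul_sum, sum_indicator, sum_indicator]
  rw [← h1]
  refine Finset.sum_le_sum fun v _ => ?_
  by_cases hv : v ∈ B
  · have := hB v hv
    rw [if_neg this.1, if_pos hv]
    exact this.2
  · rw [if_neg hv]
    split_ifs with h
    · exact ((hodd v).2 h).pos
    · simp

section
variable [Finite V] {G F : SimpleGraph V} {T : Set V}

theorem even_ncard_of_odd_deg (hodd : ∀ v, Odd (deg F v) ↔ v ∈ T) : Even T.ncard := by
  classical
  have := Fintype.ofFinite V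
  have h1 : ∑ v : V, (deg F v : ZMod 2) = ((2 * F.edgeSet.ncard : ℕ) : ZMod 2) := by
    rw [← sum_deg, Nat.cast_sum]
  have h2 : ∑ v : V, (deg F v : ZMod 2) = (T.ncard : ZMod 2) := by
    rw [← sum_indicator, Nat.cast_sum]
    refine Finset.sum_congr rfl fun v _ => ?_
    split_ifs with h
    · rw [Nat.cast_one, ← odd_iff_cast, hodd]
      exact h
    · rw [Nat.cast_zero, ZMod.natCast_eq_zero_iff_even, ← Nat.not_odd_iff_even, hodd]
      exact h
  rw [← ZMod.natCast_eq_zero_iff_even, ← h2, h1]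
  push_cast
  rw [show (2 : ZMod 2) = 0 from rfl, zero_mul]

/-- The edges of `F` must connect the components of `G`, so a spanning tree of the quotient graph
shows that there are at least `p + q - 1` of them. -/
theorem numFree_add_numHit_le (hc : (G ∆ F).Connected) :
    numFree G T + numHit G T ≤ F.edgeSet.ncard + 1 := by
  rw [numFree_add_numHit]
  -- the graph that `F` induces on the components of `G`
  let Q : SimpleGraph G.ConnectedComponent :=
    { Adj := fun c d => c ≠ d ∧
        ∃ u v, F.Adj u v ∧ G.connectedComponentMk u = c ∧ G.connectedComponentMk v = d
      symm := ⟨fun c d ⟨h, u, v, h1, h2, h3⟩ => ⟨h.symm, v, u, h1.symm, h3, h2⟩⟩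
      loopless := ⟨fun c h => h.1 rfl⟩ }
  have hQ : Q.Connected := by
    have := hc.nonempty
    refine ⟨fun c d => ?_⟩
    induction c using ConnectedComponent.ind with | _ u => ?_
    induction d using ConnectedComponent.ind with | _ v => ?_
    refine reachable_of_adj (φ := G.connectedComponentMk) (fun x y hxy => ?_)
      (hc.preconnected u v)
    rcases symmDiff_adj.1 hxy with h | h
    · rw [ConnectedComponent.sound h.1.reachable]
    · by_cases hxy : G.connectedComponentMk x = G.connectedComponentMk y
      · rw [hxy]
      · exact Adj.reachable (show Q.Adj _ _ from ⟨hxy, x, y, h.1, rfl, rfl⟩)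
  refine hQ.card_vert_le_card_edgeSet_add_one.trans (Nat.add_le_add_right ?_ 1)
  have hsub : Q.edgeSet ⊆ Sym2.map G.connectedComponentMk '' F.edgeSet := by
    intro e
    induction e with
    | _ c d =>
      rintro ⟨-, u, v, h1, h2, h3⟩
      exact ⟨s(u, v), h1, by simp [h2, h3]⟩
  exact (Set.ncard_le_ncard hsub).trans (Set.ncard_image_le (Set.toFinite _))

/-- Each component `C` of `G` without a vertex of `T` is left by an edge of `F`, unless it is the
only component. The end of this edge in `C` has positive even degree in `F`, so it contributes `2`
to the degree sum, and each vertex of `T` contributes `1`. -/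
theorem two_mul_numFree_add_le (hodd : ∀ v, Odd (deg F v) ↔ v ∈ T) (hc : (G ∆ F).Connected)
    (hpq : 2 ≤ numFree G T + numHit G T ∨ numFree G T = 0) :
    2 * numFree G T + T.ncard ≤ 2 * F.edgeSet.ncard := by
  have := Fintype.ofFinite V
  let B : Set V := {v | v ∉ T ∧ 2 ≤ deg F v}
  have h1 := sum_deg_ge hodd B fun v hv => hv
  rw [sum_deg] at h1
  suffices h : numFree G T ≤ B.ncard by omega
  rcases hpq with hpq | hpq
  swap
  · omega
  rw [numFree_add_numHit] at hpq
  have : Nontrivial G.ConnectedComponent := Finite.one_lt_card_iff_nontrivial.1 hpq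
  refine (Set.ncard_le_ncard (t := G.connectedComponentMk '' B) ?_).trans
    (Set.ncard_image_le (Set.toFinite _))
  intro C hC
  obtain ⟨D, hD⟩ := exists_ne C
  obtain ⟨x, rfl⟩ := C.exists_rep
  obtain ⟨y, rfl⟩ := D.exists_rep
  obtain ⟨a, b, hab, ha, hb⟩ := exists_crossing hc (S := {v | G.connectedComponentMk v =
    G.connectedComponentMk x}) (x := x) (y := y) rfl hD
  have haT : a ∉ T := hC a ha
  have hF : F.Adj a b := by
    rcases symmDiff_adj.1 hab with h | h
    · exact absurd ((ConnectedComponent.sound h.1.reachable).symm.trans ha) hb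
    · exact h.1
  refine ⟨a, ⟨haT, ?_⟩, ha⟩
  have h2 : 0 < deg F a := deg_pos_iff.2 ⟨b, hF⟩
  rw [← hodd, Nat.not_odd_iff_even] at haT
  obtain ⟨m, hm⟩ := haT
  omega

/-- A vertex of positive even degree has two neighbours, and the three degrees add up to at least
`6`. -/
theorem three_le_of_even (hodd : ∀ v, ¬ Odd (deg F v)) (hF : F ≠ ⊥) : 3 ≤ F.edgeSet.ncard := by
  classical
  have := Fintype.ofFinite V
  obtain ⟨a, b, hab⟩ := ne_bot_iff_exists_adj.1 hF
  have h2 : ∀ v w, F.Adj v w → 2 ≤ deg F v := by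
    intro v w h
    have h1 : 0 < deg F v := deg_pos_iff.2 ⟨w, h⟩
    obtain ⟨m, hm⟩ := Nat.not_odd_iff_even.1 (hodd v)
    omega
  obtain ⟨c, hc, hcb⟩ := Set.exists_ne_of_one_lt_ncard (h2 a b hab) b
  have hac : F.Adj a c := hc
  have h3 : ∑ v ∈ ({a, b, c} : Finset V), deg F v ≤ ∑ v, deg F v :=
    Finset.sum_le_sum_of_subset (Finset.subset_univ _)
  rw [Finset.sum_insert (by simp [hab.ne, hac.ne]), Finset.sum_insert (by simp [hcb.symm]),
    Finset.sum_singleton, sum_deg] at h3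
  have := h2 a b hab
  have := h2 b a hab.symm
  have := h2 c a hac.symm
  omega

end

/-- A star with at least one edge, described by its centre `c`. -/
theorem isBridgeStar_iff [Finite V] {G : SimpleGraph V} {T : Set V} :
    IsBridgeStar G T ↔ 2 ≤ T.ncard ∧ ∃ c ∈ T,
      (∀ u ∈ T, u ≠ c → G.Adj c u ∧ G.IsBridge s(c, u)) ∧
      ∀ u ∈ T, ∀ v ∈ T, u ≠ c → v ≠ c → ¬ G.Adj u v := by
  constructor
  · rintro ⟨⟨r, hr, ⟨φ⟩⟩, hb⟩
    have hadj : ∀ x y : T, G.Adj x y ↔ (completeBipartiteGraph (Fin 1) (Fin r)).Adj (φ x) (φ y) :=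
      fun x y => by rw [φ.map_adj_iff]; rfl
    have hl : ∀ x : T, x = φ.symm (Sum.inl 0) ∨ ∃ i, φ x = Sum.inr i := by
      intro x
      rcases h : φ x with i | i
      · left
        rw [← φ.symm_apply_apply x, h, Subsingleton.elim i 0]
      · exact Or.inr ⟨i, rfl⟩
    refine ⟨?_, φ.symm (Sum.inl 0), (φ.symm (Sum.inl 0)).2, ?_, ?_⟩
    · have h1 : Nat.card T = Nat.card (Fin 1 ⊕ Fin r) := Nat.card_congr φ.toEquiv
      rw [← Nat.card_coe_set_eq, h1]
      simp
      omega
    · intro u hu huc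
      have : G.Adj (φ.symm (Sum.inl 0)) u := by
        rw [hadj _ ⟨u, hu⟩]
        rcases hl ⟨u, hu⟩ with h | ⟨i, hi⟩
        · exact absurd (congrArg Subtype.val h) huc
        · simp [hi]
      exact ⟨this, hb _ (Subtype.coe_prop _) u hu this⟩
    · intro u hu v hv huc hvc
      rw [hadj ⟨u, hu⟩ ⟨v, hv⟩]
      rcases hl ⟨u, hu⟩ with h | ⟨i, hi⟩
      · exact absurd (congrArg Subtype.val h) huc
      rcases hl ⟨v, hv⟩ with h | ⟨j, hj⟩
      · exact absurd (congrArg Subtype.val h) hvc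
      simp [hi, hj]
  · rintro ⟨h2, c, hc, h3, h4⟩
    have hcard : (T \ {c}).ncard + 1 = T.ncard := Set.ncard_sdiff_singleton_add_one hc
    let e : (T \ {c} : Set V) ≃ Fin (T \ {c}).ncard :=
      Finite.equivFinOfCardEq (Nat.card_coe_set_eq _)
    let g : Fin 1 ⊕ Fin (T \ {c}).ncard → T :=
      Sum.elim (fun _ => ⟨c, hc⟩) fun i => ⟨e.symm i, (e.symm i).2.1⟩
    have hg : Function.Bijective g := by
      constructor
      · rintro (i | i) (j | j) h
        · rw [Subsingleton.elim i j]
        · exact absurd (congrArg Subtype.val h).symm (e.symm j).2.2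
        · exact absurd (congrArg Subtype.val h) (e.symm i).2.2
        · have h6 : (g (Sum.inr i)).1 = (g (Sum.inr j)).1 := congrArg Subtype.val h
          have h5 : e.symm i = e.symm j := Subtype.ext h6
          rw [e.symm.injective h5]
      · rintro ⟨u, hu⟩
        by_cases huc : u = c
        · exact ⟨Sum.inl 0, Subtype.ext huc.symm⟩
        · exact ⟨Sum.inr (e ⟨u, hu, huc⟩), by simp [g]⟩
    have hadj : ∀ x y, (G.induce T).Adj (g x) (g y) ↔
        (completeBipartiteGraph (Fin 1) (Fin (T \ {c}).ncard)).Adj x y := by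
      have hi : ∀ i, G.Adj c (e.symm i) := fun i => (h3 _ (e.symm i).2.1 (e.symm i).2.2).1
      rintro (i | i) (j | j)
      · simp [g]
      · simpa [g] using hi j
      · simpa [g] using (hi i).symm
      · simpa [g] using h4 _ (e.symm i).2.1 _ (e.symm j).2.1 (e.symm i).2.2 (e.symm j).2.2
    refine ⟨⟨_, by omega, ⟨(⟨Equiv.ofBijective g hg, fun {x y} => hadj x y⟩ :
      completeBipartiteGraph (Fin 1) (Fin (T \ {c}).ncard) ≃g G.induce T).symm⟩⟩, ?_⟩
    intro u hu v hv huv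
    by_cases huc : u = c
    · subst huc
      exact (h3 v hv huv.ne').2
    · by_cases hvc : v = c
      · subst hvc
        rw [Sym2.eq_swap]
        exact (h3 u hu huc).2
      · exact absurd huv (h4 u hu v hv huc hvc)

/-- If `T` induces a star of bridges, then a perfect matching of `T` must delete an edge at the
centre, and nothing reconnects the leaf that is cut off. -/
theorem IsBridgeStar.lt_ncard [Finite V] {G F : SimpleGraph V} {T : Set V} (hs : IsBridgeStar G T)
    (hodd : ∀ v, Odd (deg F v) ↔ v ∈ T) (hc : (G ∆ F).Connected) :
    T.ncard < 2 * F.edgeSet.ncard := by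
  classical
  have := Fintype.ofFinite V
  by_contra hle
  obtain ⟨-, c, hcT, h3, h4⟩ := isBridgeStar_iff.1 hs
  -- equality in the degree count means that `F` is a perfect matching of `T`
  have hsum : ∀ v, deg F v = if v ∈ T then 1 else 0 := by
    have h1 := sum_indicator T
    have h2 : ∀ v ∈ Finset.univ, (if v ∈ T then 1 else 0) ≤ deg F v := by
      intro v _
      split_ifs with h
      · exact ((hodd v).2 h).pos
      · simp
    have h5 := (Finset.sum_eq_sum_iff_of_le h2).1
      (le_antisymm (Finset.sum_le_sum h2) (by rw [h1, sum_deg]; omega))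
    exact fun v => (h5 v (Finset.mem_univ v)).symm
  have hT : ∀ v w, F.Adj v w → v ∈ T := by
    intro v w h
    by_contra hv
    have h1 : 0 < deg F v := deg_pos_iff.2 ⟨w, h⟩
    rw [hsum, if_neg hv] at h1
    omega
  obtain ⟨l, hl⟩ : ∃ l, F.Adj c l := deg_pos_iff.1 (by rw [hsum, if_pos hcT]; omega)
  have hlT := hT l c hl.symm
  obtain ⟨hcl, hbr⟩ := h3 l hlT hl.ne'
  have huniq : ∀ b, F.Adj l b → b = c := by
    intro b hb
    have h1 := hsum l
    rw [if_pos hlT, deg, Set.ncard_eq_one] at h1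
    obtain ⟨x, hx⟩ := h1
    have h5 : b ∈ F.neighborSet l := hb
    have h6 : c ∈ F.neighborSet l := hl.symm
    rw [hx] at h5 h6
    exact h5.trans h6.symm
  -- an edge of `G ∆ F` that leaves the side of the leaf `l` after the deletion of `c l`
  rw [isBridge_iff] at hbr
  obtain ⟨a, b, hab, ha, hb⟩ := exists_crossing hc
    (S := {x | (G.deleteEdges {s(c, l)}).Reachable l x}) (x := l) (y := c)
    (Reachable.refl _) (fun h => hbr (Reachable.symm h))
  rcases symmDiff_adj.1 hab with ⟨h1, h2⟩ | ⟨h1, h2⟩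
  · by_cases he : s(a, b) = s(c, l)
    · refine h2 ?_
      rw [← mem_edgeSet, he]
      exact hl
    · exact hb (Reachable.trans ha (Adj.reachable (by
        simp only [deleteEdges_adj, Set.mem_singleton_iff]; exact ⟨h1, he⟩)))
  · by_cases hal : a = l
    · subst hal
      rw [huniq b h1] at h2
      exact h2 hcl.symm
    · -- an end in `T` other than `l` is adjacent to `c`, hence is on the side of `c`
      have hac : a ≠ c := fun h => hbr (Reachable.symm (h ▸ ha))
      refine hbr (Reachable.symm (Reachable.trans ha (Adj.reachable ?_)))
      have := (h3 a (hT a b h1) hac).1.symm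
      simp only [deleteEdges_adj, Set.mem_singleton_iff]
      refine ⟨this, fun h => ?_⟩
      rw [Sym2.eq_swap, Sym2.congr_right] at h
      exact hal h

/-- The minimum size of a solution outside the exceptional cases, in terms of the number `p` of
components without a vertex of `T`, the number `q` of other components, and `t = |T|`. -/
def Nform (p q t : ℕ) : ℕ :=
  if q = 0 then if p ≤ 1 then 0 else p else max (p + q - 1) (p + t / 2)

/-- The lower bound for the number of edits that holds in all cases. -/
theorem Nform_le [Finite V] {G F : SimpleGraph V} {T : Set V}
    (hodd : ∀ v, Odd (deg F v) ↔ v ∈ T) (hc : (G ∆ F).Connected) :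
    Nform (numFree G T) (numHit G T) T.ncard ≤ F.edgeSet.ncard := by
  have h1 := numFree_add_numHit_le (T := T) hc
  have h2 := two_mul_numFree_add_le hodd hc
  rw [Nform]
  split_ifs with h3 h4
  · omega
  · omega
  · omega

/-- Two components and no vertex of the wrong parity: the lower bound `2` is not attained, since an
even graph with an edge has at least three edges. -/
theorem Nform_lt_of_two [Finite V] {G F : SimpleGraph V} {T : Set V}
    (hodd : ∀ v, Odd (deg F v) ↔ v ∈ T) (hc : (G ∆ F).Connected)
    (hp : numFree G T = 2) (hq : numHit G T = 0) : 3 ≤ F.edgeSet.ncard := by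
  have hT := numHit_eq_zero_iff.1 hq
  refine three_le_of_even (fun v hv => by simpa [hT] using (hodd v).1 hv) fun hF => ?_
  have := hc.nonempty
  rw [hF, symmDiff_bot, connected_iff_numFree_add_numHit (T := T)] at hc
  omega

end

/-! ### Joining components -/

section
variable {V : Type*}

/-- Reachability after the addition of one edge. -/
theorem reachable_sup_edge_iff {G : SimpleGraph V} {a b x y : V} :
    (G ⊔ edge a b).Reachable x y ↔ G.Reachable x y ∨ (G.Reachable x a ∧ G.Reachable b y) ∨
      (G.Reachable x b ∧ G.Reachable a y) := by
  constructor
  · rintro ⟨w⟩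
    induction w with
    | nil => exact Or.inl (Reachable.refl _)
    | @cons u v w h _ ih =>
      rw [sup_adj, edge_adj] at h
      rcases h with h | ⟨⟨rfl, rfl⟩ | ⟨rfl, rfl⟩, -⟩
      · have := h.reachable
        rcases ih with h1 | ⟨h1, h2⟩ | ⟨h1, h2⟩
        · exact Or.inl (this.trans h1)
        · exact Or.inr (Or.inl ⟨this.trans h1, h2⟩)
        · exact Or.inr (Or.inr ⟨this.trans h1, h2⟩)
      · rcases ih with h1 | ⟨h1, h2⟩ | ⟨h1, h2⟩
        · exact Or.inr (Or.inl ⟨Reachable.refl _, h1⟩)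
        · exact Or.inr (Or.inl ⟨Reachable.refl _, h2⟩)
        · exact Or.inl h2
      · rcases ih with h1 | ⟨h1, h2⟩ | ⟨h1, h2⟩
        · exact Or.inr (Or.inr ⟨Reachable.refl _, h1⟩)
        · exact Or.inl h2
        · exact Or.inr (Or.inr ⟨Reachable.refl _, h2⟩)
  · have hab : (G ⊔ edge a b).Reachable a b := by
      by_cases h : a = b
      · rw [h]
      · exact Adj.reachable (by simp [edge_adj, h])
    rintro (h | ⟨h1, h2⟩ | ⟨h1, h2⟩)
    · exact h.mono le_sup_left
    · exact (h1.mono le_sup_left).trans (hab.trans (h2.mono le_sup_left))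
    · exact (h1.mono le_sup_left).trans (hab.symm.trans (h2.mono le_sup_left))

theorem symmDiff_edge_of_not_reachable {G : SimpleGraph V} {a b : V} (h : ¬ G.Reachable a b) :
    G ∆ edge a b = G ⊔ edge a b :=
  ((disjoint_edge G).2 fun h' => h h'.reachable).symmDiff_eq_sup

theorem ncard_symmDiff_add [Finite V] (A B : Set V) :
    (A ∆ B).ncard + 2 * (A ∩ B).ncard = A.ncard + B.ncard := by
  have h2 := Set.ncard_inter_add_ncard_sdiff_eq_ncard A B
  have h3 := Set.ncard_inter_add_ncard_sdiff_eq_ncard B A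
  rw [Set.inter_comm] at h3
  rw [Set.symmDiff_def, Set.ncard_union_eq (Set.disjoint_left.2 fun x hx hx' => hx.2 hx'.1)]
  omega

section
variable {G : SimpleGraph V} {T : Set V} {a b : V}

theorem mk_sup_edge_eq_iff {x y : V} :
    (G ⊔ edge a b).connectedComponentMk x = (G ⊔ edge a b).connectedComponentMk y ↔
      G.connectedComponentMk x = G.connectedComponentMk y ∨
      (G.connectedComponentMk x = G.connectedComponentMk a ∧
        G.connectedComponentMk b = G.connectedComponentMk y) ∨
      (G.connectedComponentMk x = G.connectedComponentMk b ∧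
        G.connectedComponentMk a = G.connectedComponentMk y) := by
  simp only [ConnectedComponent.eq]
  exact reachable_sup_edge_iff

theorem card_connectedComponent_sup_edge [Finite V] (h : ¬ G.Reachable a b) :
    Nat.card (G ⊔ edge a b).ConnectedComponent + 1 = Nat.card G.ConnectedComponent := by
  have hAB : G.connectedComponentMk a ≠ G.connectedComponentMk b :=
    fun h' => h (ConnectedComponent.exact h')
  let φ : ({G.connectedComponentMk b}ᶜ : Set G.ConnectedComponent) →
      (G ⊔ edge a b).ConnectedComponent :=
    fun c => c.1.map (Hom.ofLE le_sup_left)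
  have hφ : Function.Bijective φ := by
    constructor
    · rintro ⟨c, hc⟩ ⟨d, hd⟩ hcd
      induction c using ConnectedComponent.ind with | _ x => ?_
      induction d using ConnectedComponent.ind with | _ y => ?_
      have h1 := mk_sup_edge_eq_iff.1 hcd
      rw [Set.mem_compl_iff, Set.mem_singleton_iff] at hc hd
      rcases h1 with h1 | h1 | h1
      · exact Subtype.ext h1
      · exact absurd h1.2.symm hd
      · exact absurd h1.1 hc
    · intro c
      induction c using ConnectedComponent.ind with | _ x => ?_
      by_cases hx : G.connectedComponentMk x = G.connectedComponentMk b
      · exact ⟨⟨G.connectedComponentMk a, hAB⟩,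
          mk_sup_edge_eq_iff.2 (Or.inr (Or.inl ⟨rfl, hx.symm⟩))⟩
      · exact ⟨⟨G.connectedComponentMk x, hx⟩, rfl⟩
  rw [← Nat.card_congr (Equiv.ofBijective φ hφ), Nat.card_coe_set_eq,
    ← Set.ncard_add_ncard_compl {G.connectedComponentMk b}, Set.ncard_singleton, add_comm]

open Classical in
/-- How the number of components without a vertex of `T` changes when the components of `a` and `b`
are joined by an edge and the membership of `a` and `b` in `T` is switched. -/
theorem numFree_sup_edge [Finite V] (h : ¬ G.Reachable a b) :
    ∃ x, numFree G T = x + (if ∀ v, G.Reachable a v → v ∉ T then 1 else 0) +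
        (if ∀ v, G.Reachable b v → v ∉ T then 1 else 0) ∧
      numFree (G ⊔ edge a b) (T ∆ {a, b}) =
        x + if ∀ v, G.Reachable a v ∨ G.Reachable b v → v ∉ T ∆ {a, b} then 1 else 0 := by
  have hAB : G.connectedComponentMk a ≠ G.connectedComponentMk b :=
    fun h' => h (ConnectedComponent.exact h')
  -- the components without a vertex of `T` that are not involved
  let X : Set G.ConnectedComponent := {c | (∀ v ∈ c.supp, v ∉ T) ∧
    c ≠ G.connectedComponentMk a ∧ c ≠ G.connectedComponentMk b}
  let φ : G.ConnectedComponent → (G ⊔ edge a b).ConnectedComponent :=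
    fun c => c.map (Hom.ofLE le_sup_left)
  have hX : Set.InjOn φ X := by
    rintro c ⟨-, hca, hcb⟩ d - hcd
    induction c using ConnectedComponent.ind with | _ x => ?_
    induction d using ConnectedComponent.ind with | _ y => ?_
    rcases mk_sup_edge_eq_iff.1 hcd with h1 | h1 | h1
    · exact h1
    · exact absurd h1.1 hca
    · exact absurd h1.1 hcb
  have hfree : ∀ x, (∀ v ∈ (G.connectedComponentMk x).supp, v ∉ T) ↔
      ∀ v, G.Reachable x v → v ∉ T := by
    intro x
    refine forall_congr' fun v => ?_
    rw [ConnectedComponent.mem_supp_iff, ConnectedComponent.eq, reachable_comm]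
  refine ⟨X.ncard, ?_, ?_⟩
  · have h1 : {c : G.ConnectedComponent | ∀ v ∈ c.supp, v ∉ T} =
        (X ∪ (if ∀ v, G.Reachable a v → v ∉ T then {G.connectedComponentMk a} else ∅)) ∪
          (if ∀ v, G.Reachable b v → v ∉ T then {G.connectedComponentMk b} else ∅) := by
      ext c
      rw [← hfree, ← hfree]
      by_cases hca : c = G.connectedComponentMk a
      · subst hca
        have : G.connectedComponentMk a ∉ X := fun h => h.2.1 rfl
        split_ifs <;> simp_all
      · by_cases hcb : c = G.connectedComponentMk b
        · subst hcb
          have : G.connectedComponentMk b ∉ X := fun h => h.2.2 rfl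
          split_ifs <;> simp_all
        · have : c ∈ X ↔ ∀ v ∈ c.supp, v ∉ T := ⟨fun h => h.1, fun h => ⟨h, hca, hcb⟩⟩
          split_ifs <;> simp_all
    rw [numFree, h1, Set.ncard_union_eq, Set.ncard_union_eq]
    · split_ifs <;> simp
    · refine Set.disjoint_left.2 fun c hc hc' => ?_
      split_ifs at hc' with h2
      · exact hc.2.1 hc'
      · exact hc'
    · refine Set.disjoint_left.2 fun c hc hc' => ?_
      split_ifs at hc' with h2
      · rcases hc with hc | hc
        · exact hc.2.2 hc'
        · split_ifs at hc with h3
          · exact hAB (hc.symm.trans hc')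
          · exact hc
      · exact hc'
  · have h1 : {c : (G ⊔ edge a b).ConnectedComponent | ∀ v ∈ c.supp, v ∉ T ∆ {a, b}} =
        φ '' X ∪ (if ∀ v, G.Reachable a v ∨ G.Reachable b v → v ∉ T ∆ {a, b} then
          {φ (G.connectedComponentMk a)} else ∅) := by
      ext c
      induction c using ConnectedComponent.ind with | _ x => ?_
      have hmem : ∀ v, v ∈ ((G ⊔ edge a b).connectedComponentMk x).supp ↔
          (G.Reachable v x ∨ (G.Reachable v a ∧ G.Reachable b x) ∨
            (G.Reachable v b ∧ G.Reachable a x)) := by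
        intro v
        rw [ConnectedComponent.mem_supp_iff, ConnectedComponent.eq, reachable_sup_edge_iff]
      by_cases hx : G.Reachable x a ∨ G.Reachable x b
      · have h2 : ∀ v, v ∈ ((G ⊔ edge a b).connectedComponentMk x).supp ↔
            (G.Reachable a v ∨ G.Reachable b v) := by
          intro v
          rw [hmem]
          have e1 := @reachable_comm V G v x
          have e2 := @reachable_comm V G v a
          have e3 := @reachable_comm V G v b
          have e4 := @reachable_comm V G x a
          have e5 := @reachable_comm V G x b
          constructor
          · rintro (h | h | h)
            · rcases hx with hx | hx
              · exact Or.inl (h.trans hx).symm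
              · exact Or.inr (h.trans hx).symm
            · exact Or.inl h.1.symm
            · exact Or.inr h.1.symm
          · rintro (h | h)
            · rcases hx with hx | hx
              · exact Or.inl (hx.trans h).symm
              · exact Or.inr (Or.inl ⟨h.symm, hx.symm⟩)
            · rcases hx with hx | hx
              · exact Or.inr (Or.inr ⟨h.symm, hx.symm⟩)
              · exact Or.inl (hx.trans h).symm
        have h3 : (G ⊔ edge a b).connectedComponentMk x ∉ φ '' X := by
          rintro ⟨c, ⟨-, hca, hcb⟩, hc⟩
          induction c using ConnectedComponent.ind with | _ y => ?_
          have h4 : (G ⊔ edge a b).connectedComponentMk y = (G ⊔ edge a b).connectedComponentMk x :=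
            hc
          rcases mk_sup_edge_eq_iff.1 h4 with h5 | h5 | h5
          · rcases hx with hx | hx
            · exact hca (h5.trans (ConnectedComponent.sound hx))
            · exact hcb (h5.trans (ConnectedComponent.sound hx))
          · exact hca h5.1
          · exact hcb h5.1
        have h4 : (G ⊔ edge a b).connectedComponentMk x = φ (G.connectedComponentMk a) := by
          refine mk_sup_edge_eq_iff.2 ?_
          rcases hx with hx | hx
          · exact Or.inl (ConnectedComponent.sound hx)
          · exact Or.inr (Or.inr ⟨ConnectedComponent.sound hx, rfl⟩)
        rw [Set.mem_union, Set.mem_ofPred_eq]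
        simp only [h2]
        split_ifs with h5
        · simp [h3, h4]
          exact h5
        · simp only [Set.mem_empty_iff_false, or_false, h3, iff_false]
          exact h5
      · push Not at hx
        have h2 : ∀ v, v ∈ ((G ⊔ edge a b).connectedComponentMk x).supp ↔ G.Reachable v x := by
          intro v
          rw [hmem]
          constructor
          · rintro (h | h | h)
            · exact h
            · exact absurd h.2.symm hx.2
            · exact absurd h.2.symm hx.1
          · exact Or.inl
        have h3 : (G ⊔ edge a b).connectedComponentMk x ≠ φ (G.connectedComponentMk a) := by
          intro h
          rcases mk_sup_edge_eq_iff.1 h with h5 | h5 | h5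
          · exact hx.1 (ConnectedComponent.exact h5)
          · exact hx.1 (ConnectedComponent.exact h5.1)
          · exact hx.2 (ConnectedComponent.exact h5.1)
        have h4 : (G ⊔ edge a b).connectedComponentMk x ∈ φ '' X ↔
            G.connectedComponentMk x ∈ X := by
          constructor
          · rintro ⟨c, hc, hc'⟩
            induction c using ConnectedComponent.ind with | _ y => ?_
            have h4 : (G ⊔ edge a b).connectedComponentMk y =
              (G ⊔ edge a b).connectedComponentMk x := hc'
            rcases mk_sup_edge_eq_iff.1 h4 with h5 | h5 | h5
            · rwa [← h5]
            · exact absurd h5.1 hc.2.1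
            · exact absurd h5.1 hc.2.2
          · exact fun h => ⟨_, h, rfl⟩
        have h5 : G.connectedComponentMk x ∈ X ↔ ∀ v, G.Reachable v x → v ∉ T ∆ {a, b} := by
          have : ∀ v, G.Reachable v x → (v ∉ T ↔ v ∉ T ∆ {a, b}) := by
            intro v hv
            have h6 : v ∉ ({a, b} : Set V) := by
              rintro (rfl | rfl)
              · exact hx.1 hv.symm
              · exact hx.2 hv.symm
            simp [Set.mem_symmDiff, h6]
          constructor
          · rintro ⟨h6, -⟩ v hv
            exact (this v hv).1 (h6 v (ConnectedComponent.sound hv))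
          · refine fun h6 => ⟨fun v hv => (this v (ConnectedComponent.exact hv)).2
              (h6 v (ConnectedComponent.exact hv)), fun h7 => hx.1 (ConnectedComponent.exact h7),
              fun h7 => hx.2 (ConnectedComponent.exact h7)⟩
        rw [Set.mem_union, h4, h5, Set.mem_ofPred_eq]
        simp only [h2]
        split_ifs <;> simp [h3]
    rw [numFree, h1, Set.ncard_union_eq, hX.ncard_image]
    · split_ifs <;> simp
    · refine Set.disjoint_left.2 fun c hc hc' => ?_
      split_ifs at hc' with h2
      · obtain ⟨d, hd, rfl⟩ := hc
        induction d using ConnectedComponent.ind with | _ y => ?_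
        rcases mk_sup_edge_eq_iff.1 hc' with h5 | h5 | h5
        · exact hd.2.1 h5
        · exact hd.2.1 h5.1
        · exact hd.2.2 h5.1
      · exact hc'

/-- The admissible choices of an edge `a b` between two components: if there are vertices of the
wrong parity, then `a` is one, and the component of `b` is free if possible; otherwise also `b` has
the wrong parity, and some other vertex of the wrong parity is in the component of `a` if some
component contains two of them. -/
inductive JoinRule (G : SimpleGraph V) (T : Set V) (a b : V) : Prop
  | empty : T = ∅ → JoinRule G T a b
  | free : a ∈ T → (∀ v, G.Reachable b v → v ∉ T) → JoinRule G T a b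
  | big : a ∈ T → b ∈ T → (∃ c ∈ T, c ≠ a ∧ G.Reachable a c) → JoinRule G T a b
  | small : a ∈ T → b ∈ T → (∀ u ∈ T, ∀ v ∈ T, G.Reachable u v → u = v) → numFree G T = 0 →
      JoinRule G T a b

/-- If no component contains two vertices of `T`, then the components that meet `T` correspond to
the vertices of `T`. -/
theorem ncard_eq_numHit [Finite V] (h : ∀ u ∈ T, ∀ v ∈ T, G.Reachable u v → u = v) :
    T.ncard = numHit G T := by
  have h1 : {c : G.ConnectedComponent | ∃ v ∈ c.supp, v ∈ T} = G.connectedComponentMk '' T := by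
    ext c
    constructor
    · rintro ⟨v, hv, hvT⟩
      exact ⟨v, hvT, hv⟩
    · rintro ⟨v, hvT, hv⟩
      exact ⟨v, hv, hvT⟩
  rw [numHit, h1, Set.InjOn.ncard_image]
  exact fun u hu v hv huv => h u hu v hv (ConnectedComponent.exact huv)

/-- Joining two components by an admissible edge lowers the bound by exactly one. -/
theorem JoinRule.Nform_add_one [Finite V] (hr : JoinRule G T a b) (h : ¬ G.Reachable a b)
    (hT : Even T.ncard) :
    Nform (numFree (G ⊔ edge a b) (T ∆ {a, b})) (numHit (G ⊔ edge a b) (T ∆ {a, b}))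
        (T ∆ {a, b}).ncard + 1 = Nform (numFree G T) (numHit G T) T.ncard ∧
      Even (T ∆ {a, b}).ncard := by
  classical
  have hab : a ≠ b := fun h' => h (h' ▸ Reachable.refl _)
  obtain ⟨x, hx, hx'⟩ := numFree_sup_edge (T := T) h
  have hcard := card_connectedComponent_sup_edge h
  rw [← numFree_add_numHit _ (T ∆ {a, b}), ← numFree_add_numHit _ T] at hcard
  have ht := ncard_symmDiff_add T {a, b}
  rw [Set.ncard_pair hab] at ht
  have hpos : ∀ v ∈ T ∆ {a, b}, 0 < numHit (G ⊔ edge a b) (T ∆ {a, b}) := fun v hv =>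
    Nat.pos_of_ne_zero fun h0 => by
      rw [numHit_eq_zero_iff.1 h0] at hv
      exact hv
  obtain ⟨m, hm⟩ := hT
  rcases hr with hr | ⟨ha, hb⟩ | ⟨ha, hb, c, hc, hca, hac⟩ | ⟨ha, hb, hu, hp⟩
  · subst hr
    have h1 : ¬ ∀ v, G.Reachable a v ∨ G.Reachable b v → v ∉ (∅ : Set V) ∆ {a, b} := fun h1 =>
      h1 a (Or.inl (Reachable.refl _)) (by simp [Set.mem_symmDiff])
    have h2 := numHit_eq_zero_iff (G := G) (T := ∅)|>.2 rfl
    have h3 := hpos a (by simp [Set.mem_symmDiff])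
    rw [if_neg h1] at hx'
    simp only [Set.mem_empty_iff_false, not_false_eq_true, implies_true, if_true] at hx
    simp only [Set.empty_inter, Set.ncard_empty] at ht
    rw [Nform, Nform, if_neg h3.ne', if_pos h2, if_neg (by omega)]
    rw [Nat.even_iff]
    omega
  · have hbT : b ∉ T := hb b (Reachable.refl _)
    have h1 : ¬ ∀ v, G.Reachable a v ∨ G.Reachable b v → v ∉ T ∆ {a, b} := fun h1 =>
      h1 b (Or.inr (Reachable.refl _)) (by simp [Set.mem_symmDiff, hbT])
    have h2 : ¬ ∀ v, G.Reachable a v → v ∉ T := fun h2 => h2 a (Reachable.refl _) ha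
    have h3 := hpos b (by simp [Set.mem_symmDiff, hbT])
    have h4 : T ∩ {a, b} = {a} := by
      ext v
      simp only [Set.mem_inter_iff, Set.mem_insert_iff, Set.mem_singleton_iff]
      constructor
      · rintro ⟨hv, rfl | rfl⟩
        · rfl
        · exact absurd hv hbT
      · rintro rfl
        exact ⟨ha, Or.inl rfl⟩
    rw [if_neg h1] at hx'
    rw [if_neg h2, if_pos hb] at hx
    rw [h4, Set.ncard_singleton] at ht
    rw [Nform, Nform, if_neg h3.ne', if_neg (by omega), Nat.even_iff]
    omega
  all_goals
    have h2 : ¬ ∀ v, G.Reachable a v → v ∉ T := fun h2 => h2 a (Reachable.refl _) ha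
    have h3 : ¬ ∀ v, G.Reachable b v → v ∉ T := fun h2 => h2 b (Reachable.refl _) hb
    have h4 : T ∩ {a, b} = {a, b} := by
      refine Set.inter_eq_right.2 ?_
      rintro v (rfl | rfl)
      · exact ha
      · exact hb
    rw [if_neg h2, if_neg h3] at hx
    rw [h4, Set.ncard_pair hab] at ht
  · have hcb : c ≠ b := fun h' => h (h' ▸ hac)
    have hcT : c ∈ T ∆ {a, b} := by simp [Set.mem_symmDiff, hc, hca, hcb]
    have h1 : ¬ ∀ v, G.Reachable a v ∨ G.Reachable b v → v ∉ T ∆ {a, b} := fun h1 =>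
      h1 c (Or.inl hac) hcT
    have h5 := hpos c hcT
    rw [if_neg h1] at hx'
    rw [Nform, Nform, if_neg h5.ne', if_neg (by omega), Nat.even_iff]
    omega
  · have h1 : ∀ v, G.Reachable a v ∨ G.Reachable b v → v ∉ T ∆ {a, b} := by
      intro v hv hvT
      rcases hvT with ⟨h5, h6⟩ | ⟨h5, h6⟩
      · refine h6 ?_
        rcases hv with hv | hv
        · exact Or.inl (hu a ha v h5 hv).symm
        · exact Or.inr (hu b hb v h5 hv).symm
      · rcases h5 with rfl | rfl
        · exact h6 ha
        · exact h6 hb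
    have h5 := ncard_eq_numHit hu
    rw [if_pos h1] at hx'
    rw [Nform, Nform, if_neg (by omega : numHit G T ≠ 0), Nat.even_iff]
    split_ifs <;> omega

/-- As long as the graph is disconnected, there is an admissible joining edge: start from a
component with two vertices of `T` if there is one, and go to a component without a vertex of `T` if
possible. -/
theorem exists_joinRule [Nonempty V] [Finite V] (hG : ¬ G.Connected) :
    ∃ a b, ¬ G.Reachable a b ∧ JoinRule G T a b := by
  have hex : ∀ a, ∃ b, ¬ G.Reachable a b := by
    intro a
    by_contra! h
    exact hG ((connected_iff_exists_forall_reachable G).2 ⟨a, h⟩)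
  by_cases hT : T = ∅
  · obtain ⟨a⟩ := ‹Nonempty V›
    obtain ⟨b, hb⟩ := hex a
    exact ⟨a, b, hb, .empty hT⟩
  by_cases hbig : ∃ a ∈ T, ∃ c ∈ T, c ≠ a ∧ G.Reachable a c
  · obtain ⟨a, ha, hc⟩ := hbig
    obtain ⟨b, hb⟩ := hex a
    by_cases hf : ∀ v, G.Reachable b v → v ∉ T
    · exact ⟨a, b, hb, .free ha hf⟩
    · push Not at hf
      obtain ⟨v, hv, hvT⟩ := hf
      exact ⟨a, v, fun h => hb (h.trans hv.symm), .big ha hvT hc⟩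
  · push Not at hbig
    obtain ⟨a, ha⟩ := Set.nonempty_iff_ne_empty.2 hT
    by_cases hp : numFree G T = 0
    · obtain ⟨b, hb⟩ := hex a
      have hf : ∃ v, G.Reachable b v ∧ v ∈ T := by
        by_contra! hf
        rw [numFree, Set.ncard_eq_zero, Set.eq_empty_iff_forall_notMem] at hp
        exact hp (G.connectedComponentMk b) fun v hv => hf v (ConnectedComponent.exact hv).symm
      obtain ⟨v, hv, hvT⟩ := hf
      refine ⟨a, v, fun h => hb (h.trans hv.symm), .small ha hvT (fun u hu w hw huw => ?_) hp⟩
      by_contra hne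
      exact hbig u hu w hw (Ne.symm hne) huw
    · obtain ⟨C, hC⟩ := Set.nonempty_of_ncard_ne_zero hp
      induction C using ConnectedComponent.ind with | _ b => ?_
      have hf : ∀ v, G.Reachable b v → v ∉ T := fun v hv => hC v (ConnectedComponent.sound hv.symm)
      exact ⟨a, b, fun h => hf a h.symm ha, .free ha hf⟩

end

/-- The pairs `z (2 j), z (2 j + 1)` with `j < l` have been chosen one after the other by the rule
`JoinRule`; they turn `G` into `G'` and the set `T` of vertices of the wrong parity into `T'`. -/
structure JoinInv (G : SimpleGraph V) (T : Set V) (z : ℕ → V) (l : ℕ) (G' : SimpleGraph V)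
    (T' : Set V) : Prop where
  graph : G' = G ∆ gr (vec z l)
  mem : ∀ v, v ∈ T' ↔ ¬ (v ∈ T ↔ occ z (2 * l) v = 1)
  adj : ∀ j < l, G'.Adj (z (2 * j)) (z (2 * j + 1))
  bridge : ∀ j < l, G'.IsBridge s(z (2 * j), z (2 * j + 1))
  inj : ∀ i < l, ∀ j < l, s(z (2 * i), z (2 * i + 1)) = s(z (2 * j), z (2 * j + 1)) → i = j
  count : Nform (numFree G' T') (numHit G' T') T'.ncard + l =
    Nform (numFree G T) (numHit G T) T.ncard
  even : Even T'.ncard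

theorem JoinInv.init {G : SimpleGraph V} {T : Set V} (hT : Even T.ncard) (z : ℕ → V) :
    JoinInv G T z 0 G T where
  graph := by simp [vec]
  mem v := by simp [occ]
  adj := by simp
  bridge := by simp
  inj := by simp
  count := by simp
  even := hT

theorem JoinInv.congr {G G' : SimpleGraph V} {T T' : Set V} {z z' : ℕ → V} {l : ℕ}
    (h : JoinInv G T z l G' T') (hz : ∀ i < 2 * l, z i = z' i) : JoinInv G T z' l G' T' where
  graph := by rw [h.graph, vec_congr hz]
  mem v := by rw [h.mem, occ_congr hz]
  adj j hj := by
    rw [← hz _ (by omega), ← hz _ (by omega)]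
    exact h.adj j hj
  bridge j hj := by
    rw [← hz _ (by omega), ← hz _ (by omega)]
    exact h.bridge j hj
  inj i hi j hj := by
    rw [← hz _ (by omega), ← hz _ (by omega), ← hz _ (by omega), ← hz _ (by omega)]
    exact h.inj i hi j hj
  count := h.count
  even := h.even

/-- One more joining edge. The earlier joining edges remain bridges, because the new one joins two
components. -/
theorem JoinInv.step [Finite V] {G G' : SimpleGraph V} {T T' : Set V} {z : ℕ → V} {l : ℕ}
    (h : JoinInv G T z l G' T') (hn : ¬ G'.Reachable (z (2 * l)) (z (2 * l + 1)))
    (hr : JoinRule G' T' (z (2 * l)) (z (2 * l + 1))) :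
    JoinInv G T z (l + 1) (G' ∆ edge (z (2 * l)) (z (2 * l + 1)))
      (T' ∆ {z (2 * l), z (2 * l + 1)}) := by
  classical
  have hne : z (2 * l) ≠ z (2 * l + 1) := fun h' => hn (h' ▸ Reachable.refl _)
  have hsup := symmDiff_edge_of_not_reachable hn
  have hnew : ∀ j < l, s(z (2 * j), z (2 * j + 1)) ≠ s(z (2 * l), z (2 * l + 1)) := by
    intro j hj he
    have := h.adj j hj
    rw [← mem_edgeSet, he, mem_edgeSet] at this
    exact hn this.reachable
  refine ⟨?_, ?_, ?_, ?_, ?_, ?_, ?_⟩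
  · rw [vec_succ, gr_add, gr_pairVec, ← symmDiff_assoc, ← h.graph]
  · intro v
    rw [Set.mem_symmDiff, h.mem, show 2 * (l + 1) = 2 * l + 1 + 1 by ring]
    have : occ z (2 * l + 1 + 1) v = occ z (2 * l) v + (if v ∈ ({z (2 * l), z (2 * l + 1)} : Set V)
        then 1 else 0) := by
      rw [occ, Finset.sum_range_succ, Finset.sum_range_succ, ← occ, add_assoc]
      congr 1
      simp only [Set.mem_insert_iff, Set.mem_singleton_iff]
      by_cases h1 : v = z (2 * l)
      · subst h1
        simp [hne.symm]
      · by_cases h2 : v = z (2 * l + 1)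
        · subst h2
          simp [hne]
        · simp [h1, h2, Ne.symm h1, Ne.symm h2]
    rw [this]
    generalize occ z (2 * l) v = o
    have hd : ∀ o : ZMod 2, (o + 1 = 1 ↔ ¬ o = 1) := by decide
    split_ifs with h1
    · rw [hd]
      tauto
    · rw [add_zero]
      tauto
  · intro j hj
    rw [hsup, sup_adj, edge_adj]
    rcases Nat.lt_succ_iff_lt_or_eq.1 hj with hj | rfl
    · exact Or.inl (h.adj j hj)
    · exact Or.inr ⟨Or.inl ⟨rfl, rfl⟩, hne⟩
  · intro j hj
    rw [hsup]
    rcases Nat.lt_succ_iff_lt_or_eq.1 hj with hj | rfl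
    · exact (h.bridge j hj).sup_edge_of_not_reachable_of_isBridge hn (h.adj j hj)
    · exact isBridge_sup_edge.2 (.of_not_reachable hn)
  · intro i hi j hj hij
    rcases Nat.lt_succ_iff_lt_or_eq.1 hi with hi | rfl <;>
      rcases Nat.lt_succ_iff_lt_or_eq.1 hj with hj | rfl
    · exact h.inj i hi j hj hij
    · exact absurd hij (hnew i hi)
    · exact absurd hij.symm (hnew j hj)
    · rfl
  · rw [hsup, ← h.count, ← (hr.Nform_add_one hn h.even).1]
    ring
  · exact (hr.Nform_add_one hn h.even).2

/-- Joining ends with a connected graph, because each joining edge lowers the bound by one. -/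
theorem exists_joinInv [Finite V] [Nonempty V] (G : SimpleGraph V) {T : Set V}
    (hT : Even T.ncard) : ∃ z l G' T', JoinInv G T z l G' T' ∧ G'.Connected := by
  suffices H : ∀ d z l G' T', JoinInv G T z l G' T' →
      Nform (numFree G T) (numHit G T) T.ncard ≤ d + l →
      ∃ z l G' T', JoinInv G T z l G' T' ∧ G'.Connected by
    obtain ⟨v⟩ := ‹Nonempty V›
    exact H _ (fun _ => v) 0 G T (.init hT _) le_rfl
  intro d
  induction d with
  | zero =>
    intro z l G' T' h hd
    refine ⟨z, l, G', T', h, ?_⟩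
    by_contra hG
    obtain ⟨a, b, hab, hr⟩ := exists_joinRule (T := T') hG
    have := (hr.Nform_add_one hab h.even).1
    have := h.count
    omega
  | succ d ih =>
    intro z l G' T' h hd
    by_cases hG : G'.Connected
    · exact ⟨z, l, G', T', h, hG⟩
    obtain ⟨a, b, hab, hr⟩ := exists_joinRule (T := T') hG
    let z' : ℕ → V := fun i => if i < 2 * l then z i else if i = 2 * l then a else b
    have h1 : z' (2 * l) = a := by simp [z']
    have h2 : z' (2 * l + 1) = b := by simp [z']
    have h3 : JoinInv G T z' l G' T' := h.congr fun i hi => by simp [z', hi]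
    exact ih z' (l + 1) _ _ (h3.step (by rwa [h1, h2]) (by rwa [h1, h2])) (by omega)

end

/-! ### Exchanging edges around a bridge -/

section
variable {V : Type*} {G : SimpleGraph V}

/-- A bridge lies in no triangle. -/
theorem not_adj_of_bridge {u v x : V} (h : G.IsBridge s(u, v)) (hux : G.Adj u x) (hxv : x ≠ v) :
    ¬ G.Adj x v := by
  intro hadj
  have hxu := hux.ne'
  refine isBridge_iff.1 h (Reachable.trans (v := x) (Adj.reachable ?_) (Adj.reachable ?_)) <;>
    simp only [deleteEdges_adj, Set.mem_singleton_iff, Sym2.eq_iff]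
  · exact ⟨hux, by grind⟩
  · exact ⟨hadj, by grind⟩

/-- After the deletion of an edge, every vertex is still connected to one of its ends. -/
theorem reachable_deleteEdges_or (hG : G.Connected) (a b u : V) :
    (G.deleteEdges {s(a, b)}).Reachable a u ∨ (G.deleteEdges {s(a, b)}).Reachable b u := by
  have h : (G.deleteEdges {s(a, b)} ⊔ edge a b).Reachable a u := by
    refine (hG.preconnected a u).mono fun x y hxy => ?_
    simp only [sup_adj, deleteEdges_adj, Set.mem_singleton_iff, edge_adj, Sym2.eq_iff]
    have := hxy.ne
    tauto
  rcases reachable_sup_edge_iff.1 h with h | h | h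
  · exact Or.inl h
  · exact Or.inr h.2
  · exact Or.inl h.2

theorem connected_delete_add {a b c d : V} (hG : G.Connected)
    (hab : ¬ G.IsBridge s(a, b)) (hcd : ¬ G.Adj c d) : (G ∆ edge a b ∆ edge c d).Connected := by
  refine (hG.connected_delete_edge_of_not_isBridge hab).mono fun x y hxy => ?_
  simp only [deleteEdges_adj, Set.mem_singleton_iff, Sym2.eq_iff] at hxy
  simp only [symmDiff_adj, edge_adj]
  grind [adj_symm]

theorem connected_add_add {a b c d : V} (hG : G.Connected) (hab : ¬ G.Adj a b) (hcd : ¬ G.Adj c d) :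
    (G ∆ edge a b ∆ edge c d).Connected := by
  refine hG.mono fun x y hxy => ?_
  simp only [symmDiff_adj, edge_adj]
  grind [adj_symm]

/-- Deleting a bridge `u v` and joining a neighbour of `u` with a neighbour of `v`. -/
theorem connected_delete_bridge {u v x x' y y' : V} (hG : G.Connected)
    (huv : G.IsBridge s(u, v)) (hadj : G.Adj u v) (hx : G.Adj u x) (hx' : G.Adj v x')
    (hy : G.Adj u y) (hy' : G.Adj v y') (hxv : x ≠ v) (hxu : x' ≠ u) (hyv : y ≠ v) (hyu : y' ≠ u)
    (hxy : x ≠ y) (hxy' : x' ≠ y') : (G ∆ edge u v ∆ edge x x' ∆ edge y y').Connected := by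
  -- otherwise `u w w' v` would be a detour around the bridge
  have cross : ∀ w w', G.Adj u w → G.Adj v w' → w ≠ v → w' ≠ u → ¬ G.Adj w w' ∧ w ≠ w' := by
    intro w w' hw hw' h1 h2
    have hne : w ≠ w' := by
      rintro rfl
      exact not_adj_of_bridge huv hw h1 hw'.symm
    refine ⟨fun h => ?_, hne⟩
    refine isBridge_iff.1 huv (Reachable.trans (v := w) (Adj.reachable ?_)
      (Reachable.trans (v := w') (Adj.reachable ?_) (Adj.reachable ?_))) <;>
      simp only [deleteEdges_adj, Set.mem_singleton_iff, Sym2.eq_iff]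
    · exact ⟨hw, by grind [Adj.ne]⟩
    · exact ⟨h, by grind [Adj.ne]⟩
    · exact ⟨hw'.symm, by grind [Adj.ne]⟩
  obtain ⟨n1, n2⟩ := cross x x' hx hx' hxv hxu
  obtain ⟨n3, n4⟩ := cross y y' hy hy' hyv hyu
  have hstay : ∀ p q, G.Adj p q → s(p, q) ≠ s(u, v) →
      (G ∆ edge u v ∆ edge x x' ∆ edge y y').Adj p q := by
    intro p q hpq hne
    rw [ne_eq, Sym2.eq_iff] at hne
    simp only [symmDiff_adj, edge_adj]
    grind [adj_symm]
  have hnew : (G ∆ edge u v ∆ edge x x' ∆ edge y y').Adj x x' := by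
    have := hx.ne
    have := hx'.ne
    have h1 : ¬ (x = u ∧ x' = v ∨ x = v ∧ x' = u) := by grind
    have h2 : ¬ (x = y ∧ x' = y' ∨ x = y' ∧ x' = y) := by
      have := cross x y' hx hy' hxv hyu
      grind
    simp only [symmDiff_adj, edge_adj]
    grind
  refine connected_of_adj hG fun p q hpq => ?_
  by_cases h : s(p, q) = s(u, v)
  · have key : (G ∆ edge u v ∆ edge x x' ∆ edge y y').Reachable u v :=
      (hstay u x hx (by rw [ne_eq, Sym2.eq_iff]; grind [Adj.ne])).reachable.trans
        (hnew.reachable.trans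
          (hstay v x' hx' (by rw [ne_eq, Sym2.eq_iff]; grind [Adj.ne])).reachable.symm)
    rcases Sym2.eq_iff.1 h with ⟨rfl, rfl⟩ | ⟨rfl, rfl⟩
    · exact key
    · exact key.symm
  · exact (hstay p q hpq h).reachable

/-- Two different bridges `a b` and `u v` can be exchanged for two edges between their ends, with
`u v` kept in the graph. -/
theorem connected_exchange_bridges {a b u v : V} (hG : G.Connected) (hab : G.Adj a b)
    (hbab : G.IsBridge s(a, b)) (huv : G.Adj u v) (hbuv : G.IsBridge s(u, v))
    (hne : s(a, b) ≠ s(u, v)) :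
    (G ∆ edge a b ∆ edge v b ∆ edge u a).Connected ∨
      (G ∆ edge a b ∆ edge a v ∆ edge u b).Connected := by
  -- by the symmetry between `a` and `b`, the bridge `u v` lies on the side of `a`
  wlog hau : (G.deleteEdges {s(a, b)}).Reachable a u generalizing a b with H
  · have h1 := (reachable_deleteEdges_or hG a b u).resolve_left hau
    rw [Sym2.eq_swap] at h1
    have := H hab.symm (by rwa [Sym2.eq_swap]) (by rwa [Sym2.eq_swap]) h1
    rw [edge_comm b a, edge_comm v a, edge_comm b v] at this
    exact this.symm
  have hDuv : (G.deleteEdges {s(a, b)}).Adj u v := by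
    simp only [deleteEdges_adj, Set.mem_singleton_iff]
    exact ⟨huv, hne.symm⟩
  -- the side of `a` is joined to `b` by the edge `a b` only
  have hnb : ∀ w, (G.deleteEdges {s(a, b)}).Reachable a w → w ≠ b ∧ (w ≠ a → ¬ G.Adj w b) := by
    intro w hw
    refine ⟨fun h => isBridge_iff.1 hbab (h ▸ hw), fun hwa hadj =>
      isBridge_iff.1 hbab (hw.trans (Adj.reachable ?_))⟩
    simp only [deleteEdges_adj, Set.mem_singleton_iff, Sym2.eq_iff]
    exact ⟨hadj, by grind [Adj.ne]⟩
  have hav := hau.trans hDuv.reachable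
  obtain ⟨hub, hub'⟩ := hnb u hau
  obtain ⟨hvb, hvb'⟩ := hnb v hav
  -- it suffices to reconnect `b` with `u` while keeping the two sides of the bridge
  have key : ∀ K : SimpleGraph V, G.deleteEdges {s(a, b)} ≤ K → K.Reachable u b → K.Connected := by
    intro K hDK hK
    have h1 : K.Reachable a b := (hau.mono hDK).trans hK
    refine connected_of_adj hG fun p q hpq => ?_
    by_cases h : s(p, q) = s(a, b)
    · rcases Sym2.eq_iff.1 h with ⟨rfl, rfl⟩ | ⟨rfl, rfl⟩
      · exact h1
      · exact h1.symm
    · refine (hDK ?_ : K.Adj p q).reachable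
      simp only [deleteEdges_adj, Set.mem_singleton_iff]
      exact ⟨hpq, h⟩
  by_cases hc : v ≠ a ∧ ¬ G.Adj u a
  · left
    have hsub : G.deleteEdges {s(a, b)} ≤ G ∆ edge a b ∆ edge v b ∆ edge u a := by
      intro p q hpq
      simp only [deleteEdges_adj, Set.mem_singleton_iff, Sym2.eq_iff] at hpq
      have h1 := hvb' hc.1
      simp only [symmDiff_adj, edge_adj]
      grind [adj_symm]
    refine key _ hsub ((hsub hDuv).reachable.trans (Adj.reachable ?_))
    have h1 := hvb' hc.1
    have := hab.ne
    have := huv.ne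
    simp only [symmDiff_adj, edge_adj]
    grind
  · -- now `v = a` or `u` is adjacent to `a`, so `a` and `v` are not adjacent
    right
    have hua : u ≠ a := by
      rintro rfl
      exact hc ⟨huv.ne', G.irrefl⟩
    have hva : ¬ G.Adj a v := by
      by_cases hva : v = a
      · rw [hva]
        exact G.irrefl
      · have h1 : G.Adj u a := by
          by_contra h1
          exact hc ⟨hva, h1⟩
        exact not_adj_of_bridge hbuv h1 (Ne.symm hva)
    have h1 := hub' hua
    have hsub : G.deleteEdges {s(a, b)} ≤ G ∆ edge a b ∆ edge a v ∆ edge u b := by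
      intro p q hpq
      simp only [deleteEdges_adj, Set.mem_singleton_iff, Sym2.eq_iff] at hpq
      simp only [symmDiff_adj, edge_adj]
      grind [adj_symm]
    refine key _ hsub (Adj.reachable ?_)
    have := hab.ne
    have := huv.ne
    simp only [symmDiff_adj, edge_adj]
    grind

/-- A bridge `u v` can be bypassed: for a suitable vertex `x`, switching `u x` and `x v` keeps the
graph connected. -/
theorem exists_bypass [Finite V] {u v : V} (hG : G.Connected) (huv : G.Adj u v)
    (hb : G.IsBridge s(u, v)) (hV : 3 ≤ Nat.card V) :
    ∃ x, x ≠ u ∧ x ≠ v ∧ (G ∆ edge u x ∆ edge x v).Connected := by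
  have hw : ∃ w, w ∉ ({u, v} : Set V) := by
    by_contra! h
    have h1 : (Set.univ : Set V) ⊆ {u, v} := fun w _ => h w
    have h2 := Set.ncard_le_ncard h1
    rw [Set.ncard_univ, Set.ncard_pair huv.ne] at h2
    omega
  obtain ⟨w, hw⟩ := hw
  -- a neighbour `x` of one end is not adjacent to the other end, and switching the two pairs replaces
  -- one edge at `x` by the other
  obtain ⟨y, x, hyx, hy, hx⟩ := exists_crossing hG (S := {u, v}) (x := u) (y := w) (Or.inl rfl) hw
  simp only [Set.mem_insert_iff, Set.mem_singleton_iff, not_or] at hy hx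
  refine ⟨x, hx.1, hx.2, ?_⟩
  have hstay : (G ∆ edge u x ∆ edge x v).Adj u v := by
    simp only [symmDiff_adj, edge_adj]
    grind
  have hne := huv.ne
  rcases hy with rfl | rfl
  · have h1 := not_adj_of_bridge hb hyx hx.2
    have hnew : (G ∆ edge y x ∆ edge x v).Adj x v := by
      simp only [symmDiff_adj, edge_adj]
      grind
    refine connected_of_adj hG fun p q hpq => ?_
    by_cases h : s(p, q) = s(y, x)
    · have h2 := hstay.reachable.trans hnew.reachable.symm
      rcases Sym2.eq_iff.1 h with ⟨rfl, rfl⟩ | ⟨rfl, rfl⟩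
      · exact h2
      · exact h2.symm
    · refine Adj.reachable ?_
      rw [Sym2.eq_iff] at h
      simp only [symmDiff_adj, edge_adj]
      grind [adj_symm]
  · have h1 : ¬ G.Adj x u := not_adj_of_bridge (by rwa [Sym2.eq_swap]) hyx hx.1
    have h1' : ¬ G.Adj u x := fun h => h1 h.symm
    have hnew : (G ∆ edge u x ∆ edge x y).Adj u x := by
      simp only [symmDiff_adj, edge_adj]
      grind
    refine connected_of_adj hG fun p q hpq => ?_
    by_cases h : s(p, q) = s(x, y)
    · have h2 := hnew.reachable.symm.trans hstay.reachable
      rcases Sym2.eq_iff.1 h with ⟨rfl, rfl⟩ | ⟨rfl, rfl⟩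
      · exact h2
      · exact h2.symm
    · refine Adj.reachable ?_
      rw [Sym2.eq_iff] at h
      simp only [symmDiff_adj, edge_adj]
      grind [adj_symm]

/-- If a vertex of `T` is joined to all others by bridges, then `T` induces a star, since a bridge
lies in no triangle. -/
theorem isBridgeStar_of_center [Finite V] {T : Set V} {c : V} (hT : 2 ≤ T.ncard) (hc : c ∈ T)
    (h : ∀ u ∈ T, u ≠ c → G.Adj c u ∧ G.IsBridge s(c, u)) : IsBridgeStar G T := by
  refine isBridgeStar_iff.2 ⟨hT, c, hc, h, fun u hu v hv huc hvc huv => ?_⟩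
  exact not_adj_of_bridge (h v hv hvc).2 (h u hu huc).1 huv.ne huv

end

/-! ### Pairing the vertices of the wrong parity -/

section
variable {V : Type*}

/-- The vertices of `T` stand in `z`, each exactly once, at the positions from `2 l` to `2 N`. The
pairs with index less than `m` are not adjacent, and the remaining vertices form a clique. -/
structure PairInv (G : SimpleGraph V) (T : Set V) (z : ℕ → V) (l m N : ℕ) : Prop where
  le : l ≤ m
  le' : m ≤ N
  nonadj : ∀ j, l ≤ j → j < m → ¬ G.Adj (z (2 * j)) (z (2 * j + 1))
  clique : ∀ i i', 2 * m ≤ i → i < 2 * N → 2 * m ≤ i' → i' < 2 * N → i ≠ i' → G.Adj (z i) (z i')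
  inj : ∀ i i', 2 * l ≤ i → i < 2 * N → 2 * l ≤ i' → i' < 2 * N → z i = z i' → i = i'
  mem : ∀ v, v ∈ T ↔ ∃ i, 2 * l ≤ i ∧ i < 2 * N ∧ z i = v

namespace PairInv

variable {G : SimpleGraph V} {T : Set V} {z : ℕ → V} {l m N : ℕ}

theorem ncard_eq (h : PairInv G T z l m N) : T.ncard = 2 * (N - l) := by
  have h1 : T = z '' (Finset.Ico (2 * l) (2 * N) : Set ℕ) := by
    ext v
    rw [h.mem]
    simp [and_assoc]
  rw [h1, Set.InjOn.ncard_image, Set.ncard_coe_finset, Nat.card_Ico]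
  · omega
  · intro i hi j hj hij
    simp only [Finset.coe_Ico, Set.mem_Ico] at hi hj
    exact h.inj i j hi.1 hi.2 hj.1 hj.2 hij

theorem sum_boole_eq_one [DecidableEq V] (h : PairInv G T z l m N) (v : V) :
    ((∑ i ∈ Finset.Ico (2 * l) (2 * N), if z i = v then 1 else 0 : ZMod 2) = 1) ↔ v ∈ T := by
  by_cases hv : v ∈ T
  · obtain ⟨i, hi, hi', rfl⟩ := (h.mem v).1 hv
    rw [Finset.sum_eq_single_of_mem i (Finset.mem_Ico.2 ⟨hi, hi'⟩)]
    · simp [hv]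
    · intro j hj hji
      rw [Finset.mem_Ico] at hj
      exact if_neg fun h1 => hji (h.inj j i hj.1 hj.2 hi hi' h1)
  · rw [Finset.sum_eq_zero]
    · simp [hv]
    · intro j hj
      rw [Finset.mem_Ico] at hj
      exact if_neg fun h1 => hv ((h.mem v).2 ⟨j, hj.1, hj.2, h1⟩)

end PairInv

/-- All pairs together have the vertices of `T` as their odd vertices. -/
theorem JoinInv.occ_eq_one_iff {G G' : SimpleGraph V} {T T' : Set V} {z : ℕ → V} {l m N : ℕ}
    (h : JoinInv G T z l G' T') (hp : PairInv G' T' z l m N) (v : V) :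
    occ z (2 * N) v = 1 ↔ v ∈ T := by
  classical
  have h1 := hp.sum_boole_eq_one v
  rw [h.mem] at h1
  have h2 : occ z (2 * N) v = occ z (2 * l) v +
      ∑ i ∈ Finset.Ico (2 * l) (2 * N), if z i = v then 1 else 0 := by
    rw [occ, occ, ← Finset.sum_range_add_sum_Ico _ (show 2 * l ≤ 2 * N by
      have := hp.le; have := hp.le'; omega)]
  rw [h2]
  revert h1
  generalize occ z (2 * l) v = a
  generalize (∑ i ∈ Finset.Ico (2 * l) (2 * N), if z i = v then 1 else 0 : ZMod 2) = b
  have : ∀ a b : ZMod 2, a + b = 1 ↔ ((a = 1 ∧ ¬ b = 1) ∨ (¬ a = 1 ∧ b = 1)) := by decide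
  rw [this]
  tauto

/-- Permuting the first `m` positions does not change the parities. -/
theorem occ_comp_perm (z : ℕ → V) (σ : Equiv.Perm ℕ) {m : ℕ} (hσ : ∀ i, i < m ↔ σ i < m) (v : V) :
    occ (z ∘ σ) m v = occ z m v := by
  rw [occ, occ]
  refine Finset.sum_equiv σ (fun i => ?_) fun i _ => rfl
  rw [Finset.mem_range, Finset.mem_range, hσ]

theorem swap_lt_iff {a b m i : ℕ} (ha : a < m) (hb : b < m) : i < m ↔ Equiv.swap a b i < m := by
  rcases eq_or_ne i a with rfl | h1
  · simp [ha, hb]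
  rcases eq_or_ne i b with rfl | h2
  · simp [ha, hb]
  rw [Equiv.swap_apply_of_ne_of_ne h1 h2]

/-- The number of pairs is the lower bound for the size of a solution. -/
theorem JoinInv.eq_Nform [Finite V] [Nonempty V] {G G' : SimpleGraph V} {T T' : Set V} {z : ℕ → V}
    {l m N : ℕ} (h : JoinInv G T z l G' T') (hG' : G'.Connected) (hp : PairInv G' T' z l m N) :
    N = Nform (numFree G T) (numHit G T) T.ncard := by
  rw [← h.count]
  have h1 := hp.ncard_eq
  have h2 := connected_iff_numFree_add_numHit (T := T').1 hG'
  have h3 := hp.le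
  have h4 := hp.le'
  rw [Nform]
  split_ifs with h5 h6
  · rw [numHit_eq_zero_iff] at h5
    simp only [h5, Set.ncard_empty] at h1
    omega
  · omega
  · omega

/-- Pairs of non-adjacent vertices of `T` are chosen as long as there are any; the vertices that
remain form a clique and are paired arbitrarily. -/
theorem exists_pairInv [Finite V] (G : SimpleGraph V) {T : Set V} (hT : Even T.ncard) (z : ℕ → V)
    (l : ℕ) : ∃ z' m N, (∀ i < 2 * l, z i = z' i) ∧ PairInv G T z' l m N := by
  obtain ⟨k, hk⟩ := hT
  induction k generalizing T z l with
  | zero =>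
    have hT : T = ∅ := by
      rw [← Set.ncard_eq_zero]; exact hk
    refine ⟨z, l, l, fun _ _ => rfl, le_rfl, le_rfl, ?_, ?_, ?_, ?_⟩
    · intros; omega
    · intros; omega
    · intros; omega
    · intro v
      simp only [hT, Set.mem_empty_iff_false, false_iff, not_exists]
      intro i
      omega
  | succ k ih =>
    by_cases hex : ∃ u ∈ T, ∃ v ∈ T, u ≠ v ∧ ¬ G.Adj u v
    · obtain ⟨u, hu, v, hv, huv, hadj⟩ := hex
      have hcard : (T \ {u, v}).ncard = k + k := by
        rw [Set.ncard_sdiff (by rintro x (rfl | rfl) <;> assumption), Set.ncard_pair huv]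
        omega
      obtain ⟨z', m, N, h1, h2⟩ := ih
        (fun i => if i < 2 * l then z i else if i = 2 * l then u else v) (l + 1) hcard
      have hu' : z' (2 * l) = u := by rw [← h1 _ (by omega)]; simp
      have hv' : z' (2 * l + 1) = v := by rw [← h1 _ (by omega)]; simp
      have hold : ∀ i, 2 * (l + 1) ≤ i → i < 2 * N → z' i ≠ u ∧ z' i ≠ v := by
        intro i hi hi'
        have := ((h2.mem (z' i)).2 ⟨i, hi, hi', rfl⟩).2
        simpa using this
      have hle := h2.le
      have hle' := h2.le'
      have hpos : ∀ i, 2 * l ≤ i → i = 2 * l ∨ i = 2 * l + 1 ∨ 2 * (l + 1) ≤ i := by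
        intros; omega
      refine ⟨z', m, N, fun i hi => ?_, by omega, hle', ?_, h2.clique, ?_, ?_⟩
      · rw [← h1 i (by omega)]; simp [hi]
      · intro j hj hj'
        by_cases hjl : j = l
        · rwa [hjl, hu', hv']
        · exact h2.nonadj j (by omega) hj'
      · intro i i' hi hiN hi' hiN' heq
        rcases hpos i hi with rfl | rfl | h3 <;> rcases hpos i' hi' with rfl | rfl | h4
        · rfl
        · exact absurd (hu'.symm.trans (heq.trans hv')) huv
        · exact absurd (heq.symm.trans hu') (hold i' h4 hiN').1
        · exact absurd (hu'.symm.trans (heq.symm.trans hv')) huv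
        · rfl
        · exact absurd (heq.symm.trans hv') (hold i' h4 hiN').2
        · exact absurd (heq.trans hu') (hold i h3 hiN).1
        · exact absurd (heq.trans hv') (hold i h3 hiN).2
        · exact h2.inj i i' h3 hiN h4 hiN' heq
      · intro w
        constructor
        · intro hw
          by_cases hwu : w = u
          · exact ⟨2 * l, le_rfl, by omega, by rw [hu', hwu]⟩
          · by_cases hwv : w = v
            · exact ⟨2 * l + 1, by omega, by omega, by rw [hv', hwv]⟩
            · obtain ⟨i, hi, hi', hiw⟩ := (h2.mem w).1 ⟨hw, by simp [hwu, hwv]⟩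
              exact ⟨i, by omega, hi', hiw⟩
        · rintro ⟨i, hi, hi', rfl⟩
          rcases hpos i hi with rfl | rfl | h3
          · rwa [hu']
          · rwa [hv']
          · exact ((h2.mem _).2 ⟨i, h3, hi', rfl⟩).1
    · push Not at hex
      have hne : T.Nonempty := Set.nonempty_of_ncard_ne_zero (by omega)
      obtain ⟨w₀, -⟩ := hne
      let e : T ≃ Fin T.ncard := Finite.equivFinOfCardEq (Nat.card_coe_set_eq _)
      let z' : ℕ → V := fun i => if i < 2 * l then z i else
        if h : i - 2 * l < T.ncard then e.symm ⟨_, h⟩ else w₀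
      have hz' : ∀ i, 2 * l ≤ i → ∀ h : i - 2 * l < T.ncard, z' i = e.symm ⟨_, h⟩ := by
        intro i hi h
        simp only [z']
        rw [if_neg (by omega), dif_pos h]
      have hinj : ∀ i i', 2 * l ≤ i → i < 2 * (l + (k + 1)) → 2 * l ≤ i' →
          i' < 2 * (l + (k + 1)) → z' i = z' i' → i = i' := by
        intro i i' hi hiN hi' hiN' heq
        rw [hz' i hi (by omega), hz' i' hi' (by omega)] at heq
        have := congrArg Fin.val (e.symm.injective (Subtype.ext heq))
        simp only at this
        omega
      have hmem : ∀ i, 2 * l ≤ i → i < 2 * (l + (k + 1)) → z' i ∈ T := by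
        intro i hi hiN
        rw [hz' i hi (by omega)]
        exact Subtype.coe_prop _
      refine ⟨z', l, l + (k + 1), fun i hi => by simp [z', hi], le_rfl, by omega, ?_, ?_, hinj, ?_⟩
      · intros; omega
      · intro i i' hi hiN hi' hiN' hne
        exact hex _ (hmem i hi hiN) _ (hmem i' hi' hiN') fun h =>
          hne (hinj i i' hi hiN hi' hiN' h)
      · intro v
        constructor
        · intro hv
          refine ⟨2 * l + e ⟨v, hv⟩, by omega, ?_, ?_⟩
          · have := (e ⟨v, hv⟩).2
            omega
          · rw [hz' _ (by omega) (by simp)]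
            simp
        · rintro ⟨i, hi, hi', rfl⟩
          exact hmem i hi hi'

/-! ### Finding a connected candidate -/

/-- The sum of the indicator functions of the pairs with index in `J`. -/
noncomputable def pairSum (z : ℕ → V) (J : Finset ℕ) : Sym2 V → ZMod 2 :=
  ∑ j ∈ J, pairVec (z (2 * j)) (z (2 * j + 1))

theorem pairSum_apply_eq_zero {z : ℕ → V} {J : Finset ℕ} {e : Sym2 V}
    (h : ∀ j ∈ J, e ≠ s(z (2 * j), z (2 * j + 1))) : pairSum z J e = 0 := by
  rw [pairSum, Finset.sum_apply]
  exact Finset.sum_eq_zero fun j hj => if_neg (h j hj)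

/-- Switching pairs that are not adjacent only adds edges. -/
theorem le_symmDiff_pairSum {K : SimpleGraph V} {z : ℕ → V} {J : Finset ℕ}
    (h : ∀ j ∈ J, ¬ K.Adj (z (2 * j)) (z (2 * j + 1))) : K ≤ K ∆ gr (pairSum z J) := by
  intro x y hxy
  refine symmDiff_adj.2 (Or.inl ⟨hxy, fun h' => ?_⟩)
  rw [gr_adj, pairSum_apply_eq_zero] at h'
  · exact zero_ne_one h'.2
  · intro j hj he
    refine h j hj ?_
    rwa [← mem_edgeSet, ← he, mem_edgeSet]

theorem zmod2_add_self (f : Sym2 V → ZMod 2) : f + f = 0 := by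
  funext e
  simp only [Pi.add_apply, Pi.zero_apply]
  generalize f e = a
  revert a
  decide

/-- The sum of all pairs after the exchange of two positions `i ∈ {2 j, 2 j + 1}` and `2 k + 1`. -/
theorem vec_swap {z : ℕ → V} {j k N i : ℕ} (hj : j < N) (hk : k < N) (hjk : j ≠ k)
    (hi : i = 2 * j ∨ i = 2 * j + 1) :
    vec (z ∘ Equiv.swap i (2 * k + 1)) N = pairSum z ((Finset.range N).erase j |>.erase k) +
      (pairVec (z (2 * k)) (z i) +
        pairVec (z (2 * k + 1)) (z (if i = 2 * j then 2 * j + 1 else 2 * j))) := by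
  have hk' : k ∈ (Finset.range N).erase j := by simp [hk, hjk.symm]
  rw [vec, ← Finset.sum_erase_add _ _ (Finset.mem_range.2 hj), ← Finset.sum_erase_add _ _ hk',
    add_assoc]
  congr 1
  · refine Finset.sum_congr rfl fun a ha => ?_
    simp only [Finset.mem_erase, Finset.mem_range] at ha
    simp only [Function.comp]
    rw [Equiv.swap_apply_of_ne_of_ne (by omega) (by omega),
      Equiv.swap_apply_of_ne_of_ne (by omega) (by omega)]
  · simp only [Function.comp, Equiv.swap_apply_right]
    rw [Equiv.swap_apply_of_ne_of_ne (a := i) (x := 2 * k) (by omega) (by omega)]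
    congr 1
    rcases hi with rfl | rfl
    · rw [Equiv.swap_apply_left, Equiv.swap_apply_of_ne_of_ne (by omega) (by omega), if_pos rfl]
    · rw [Equiv.swap_apply_left, Equiv.swap_apply_of_ne_of_ne (by omega) (by omega),
        if_neg (by omega), pairVec_comm]

section
variable {G G' : SimpleGraph V} {T T' : Set V} {z : ℕ → V} {l m N : ℕ}

/-- The pairs of vertices of `T` that are left over by a maximal matching of non-adjacent vertices
are deleted from the graph; if there are at least two of them, then connectivity is preserved. -/
theorem PairInv.connected_base (hp : PairInv G' T' z l m N) (hG' : G'.Connected)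
    (hN : N ≠ m + 1) : (G' ∆ gr (pairSum z (Finset.Ico l N))).Connected := by
  have hle := hp.le
  have hle' := hp.le'
  have hstay : ∀ x y, G'.Adj x y →
      (∀ j, m ≤ j → j < N → s(x, y) ≠ s(z (2 * j), z (2 * j + 1))) →
      (G' ∆ gr (pairSum z (Finset.Ico l N))).Adj x y := by
    intro x y hxy h
    refine symmDiff_adj.2 (Or.inl ⟨hxy, fun h' => ?_⟩)
    rw [gr_adj, pairSum_apply_eq_zero] at h'
    · exact zero_ne_one h'.2
    · intro j hj
      rw [Finset.mem_Ico] at hj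
      by_cases hjm : j < m
      · intro he
        refine hp.nonadj j hj.1 hjm ?_
        rwa [← mem_edgeSet, ← he, mem_edgeSet]
      · exact h j (by omega) hj.2
  refine connected_of_adj hG' fun x y hxy => ?_
  by_cases h : ∃ j, m ≤ j ∧ j < N ∧ s(x, y) = s(z (2 * j), z (2 * j + 1))
  · -- the ends of a deleted pair are joined through a vertex of another remaining pair
    obtain ⟨j, hj, hj', he⟩ := h
    obtain ⟨k, hk, hk', hkj⟩ : ∃ k, m ≤ k ∧ k < N ∧ k ≠ j := by
      by_cases hjm : j = m
      · exact ⟨m + 1, by omega, by omega, by omega⟩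
      · exact ⟨m, by omega, by omega, by omega⟩
    have hside : ∀ i, i = 2 * j ∨ i = 2 * j + 1 →
        (G' ∆ gr (pairSum z (Finset.Ico l N))).Adj (z i) (z (2 * k)) := by
      intro i hi
      refine hstay _ _ (hp.clique i (2 * k) (by omega) (by omega) (by omega) (by omega) (by omega))
        fun a ha ha' h1 => ?_
      rcases Sym2.eq_iff.1 h1 with h1 | h1
      · have h2 := hp.inj _ _ (by omega) (by omega) (by omega) (by omega) h1.1
        have h3 := hp.inj _ _ (by omega) (by omega) (by omega) (by omega) h1.2
        omega
      · have h2 := hp.inj _ _ (by omega) (by omega) (by omega) (by omega) h1.1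
        have h3 := hp.inj _ _ (by omega) (by omega) (by omega) (by omega) h1.2
        omega
    have key := (hside _ (Or.inl rfl)).reachable.trans (hside _ (Or.inr rfl)).reachable.symm
    rcases Sym2.eq_iff.1 he with ⟨rfl, rfl⟩ | ⟨rfl, rfl⟩
    · exact key
    · exact key.symm
  · push Not at h
    exact (hstay x y hxy h).reachable

/-- A pair of vertices of `T` differs from every pair of vertices at other positions. -/
theorem PairInv.pair_ne (hp : PairInv G' T' z l m N) {j i : ℕ} (hj : l ≤ j) (hj' : j < N)
    (hi : 2 * l ≤ i) (hi' : i < 2 * N) (h1 : i ≠ 2 * j) (h2 : i ≠ 2 * j + 1) (w : V) :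
    s(z (2 * j), z (2 * j + 1)) ≠ s(z i, w) := by
  intro h
  rcases Sym2.eq_iff.1 h with h | h
  · exact h1 (hp.inj _ _ hi hi' (by omega) (by omega) h.1.symm)
  · exact h2 (hp.inj _ _ hi hi' (by omega) (by omega) h.2.symm)

/-- The graph obtained by the exchange of a position of the pair `j` with the position `2 k + 1`,
for two pairs of vertices of `T'`. -/
theorem JoinInv.symmDiff_swap (h : JoinInv G T z l G' T') {j k i : ℕ} (hj : l ≤ j) (hj' : j < N)
    (hk : l ≤ k) (hk' : k < N) (hjk : j ≠ k) (hi : i = 2 * j ∨ i = 2 * j + 1) :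
    G ∆ gr (vec (z ∘ Equiv.swap i (2 * k + 1)) N) =
      (G' ∆ edge (z (2 * k)) (z i) ∆
        edge (z (2 * k + 1)) (z (if i = 2 * j then 2 * j + 1 else 2 * j))) ∆
        gr (pairSum z (((Finset.Ico l N).erase j).erase k)) := by
  have h1 : pairSum z (((Finset.range N).erase j).erase k) = pairSum z (Finset.range l) +
      pairSum z (((Finset.Ico l N).erase j).erase k) := by
    rw [pairSum, pairSum, pairSum, ← Finset.sum_union]
    · congr 1
      ext a
      simp only [Finset.mem_union, Finset.mem_erase, Finset.mem_Ico, Finset.mem_range]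
      omega
    · rw [Finset.disjoint_left]
      intro a
      simp only [Finset.mem_erase, Finset.mem_Ico, Finset.mem_range]
      omega
  rw [vec_swap hj' hk' hjk hi, h1, add_assoc, gr_add, ← symmDiff_assoc,
    show pairSum z (Finset.range l) = vec z l from rfl, ← h.graph, add_comm, gr_add, gr_add,
    gr_pairVec, gr_pairVec, ← symmDiff_assoc, ← symmDiff_assoc]

/-- The graph obtained by the exchange of a position of a joining pair `j` with the last
position. -/
theorem JoinInv.symmDiff_swap_join (h : JoinInv G T z l G' T') {j k i : ℕ} (hj : j < l)
    (hk : l ≤ k) (hi : i = 2 * j ∨ i = 2 * j + 1) :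
    G ∆ gr (vec (z ∘ Equiv.swap i (2 * k + 1)) (k + 1)) =
      (G' ∆ edge (z (2 * j)) (z (2 * j + 1)) ∆ edge (z (2 * k)) (z i) ∆
        edge (z (2 * k + 1)) (z (if i = 2 * j then 2 * j + 1 else 2 * j))) ∆
        gr (pairSum z (Finset.Ico l k)) := by
  have h1 : pairSum z (((Finset.range (k + 1)).erase j).erase k) = pairSum z (Finset.range l) +
      pairVec (z (2 * j)) (z (2 * j + 1)) + pairSum z (Finset.Ico l k) := by
    have h2 : pairSum z (Finset.range l) = pairSum z ((Finset.range l).erase j) +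
        pairVec (z (2 * j)) (z (2 * j + 1)) :=
      (Finset.sum_erase_add _ _ (Finset.mem_range.2 hj)).symm
    rw [h2, add_assoc (pairSum z ((Finset.range l).erase j)), zmod2_add_self, add_zero, pairSum,
      pairSum, pairSum, ← Finset.sum_union]
    · congr 1
      ext a
      simp only [Finset.mem_union, Finset.mem_erase, Finset.mem_Ico, Finset.mem_range]
      omega
    · rw [Finset.disjoint_left]
      intro a
      simp only [Finset.mem_erase, Finset.mem_Ico, Finset.mem_range]
      omega
  rw [vec_swap (by omega) (by omega) (by omega) hi, h1, h.graph]
  simp only [gr_add, gr_pairVec, show pairSum z (Finset.range l) = vec z l from rfl]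
  ac_rfl

/-- The graph obtained by switching all pairs, seen from the joined graph `G'`. -/
theorem JoinInv.symmDiff_base (h : JoinInv G T z l G' T') (hl : l ≤ N) :
    G ∆ gr (vec z N) = G' ∆ gr (pairSum z (Finset.Ico l N)) := by
  have h1 : vec z N = vec z l + pairSum z (Finset.Ico l N) := by
    rw [vec, vec, pairSum, Finset.sum_range_add_sum_Ico _ hl]
  rw [h1, gr_add, ← symmDiff_assoc, ← h.graph]

/-- The pairs in `J` do not occur in the graph obtained from `G'` by switching some pairs each of
which has an end at a position that does not belong to `J`. -/
theorem PairInv.connected_of_connected (hp : PairInv G' T' z l m N) {K : SimpleGraph V}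
    {J : Finset ℕ} (hJ : ∀ j ∈ J, l ≤ j ∧ j < m) (hK : K.Connected)
    (hKG : ∀ x y, K.Adj x y → G'.Adj x y ∨ ∃ i w, 2 * l ≤ i ∧ i < 2 * N ∧
      (∀ j ∈ J, i ≠ 2 * j ∧ i ≠ 2 * j + 1) ∧ s(x, y) = s(z i, w)) :
    (K ∆ gr (pairSum z J)).Connected := by
  refine hK.mono (le_symmDiff_pairSum fun j hj hadj => ?_)
  rcases hKG _ _ hadj with h1 | ⟨i, w, hi, hi', h1, h2⟩
  · exact hp.nonadj j (hJ j hj).1 (hJ j hj).2 h1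
  · have := hp.le'
    have := hJ j hj
    exact hp.pair_ne this.1 (by omega) hi hi' (h1 j hj).1 (h1 j hj).2 w h2

theorem adj_symmDiff_edge {K : SimpleGraph V} {a b x y : V} (h : (K ∆ edge a b).Adj x y) :
    K.Adj x y ∨ s(x, y) = s(a, b) := by
  simp only [symmDiff_adj, edge_adj] at h
  rw [Sym2.eq_iff]
  tauto

/-- If the exchange of the bridge `u v` and a pair `x y` for `u x` and `v y`, or for `u y` and
`v x`, never yields a connected graph, then `x` and `y` are joined by bridges to the same end
of `u v`. -/
theorem adj_bridge_of_not_connected {u v x y : V} (hG : G.Connected) (hb : G.IsBridge s(u, v))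
    (hxv : x ≠ v) (hyv : y ≠ v) (h1 : ¬ (G ∆ edge u x ∆ edge v y).Connected)
    (h2 : ¬ (G ∆ edge u y ∆ edge v x).Connected) :
    ((G.Adj u x ∧ G.IsBridge s(u, x)) ∧ (G.Adj u y ∧ G.IsBridge s(u, y))) ∨
      ((G.Adj v x ∧ G.IsBridge s(v, x)) ∧ (G.Adj v y ∧ G.IsBridge s(v, y))) := by
  have d1 : G.Adj u x ∨ G.Adj v y := by
    by_contra! hn
    exact h1 (connected_add_add hG hn.1 hn.2)
  have d2 : G.Adj u y ∨ G.Adj v x := by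
    by_contra! hn
    exact h2 (connected_add_add hG hn.1 hn.2)
  have tx : G.Adj u x → ¬ G.Adj v x := fun h1 h2 => not_adj_of_bridge hb h1 hxv h2.symm
  have ty : G.Adj u y → ¬ G.Adj v y := fun h1 h2 => not_adj_of_bridge hb h1 hyv h2.symm
  -- as the bridge lies in no triangle, `x` and `y` are adjacent to at most one of its ends
  by_cases hux : G.Adj u x
  · have huy := d2.resolve_right (tx hux)
    refine Or.inl ⟨⟨hux, ?_⟩, huy, ?_⟩
    · by_contra hn
      exact h1 (connected_delete_add hG hn (ty huy))
    · by_contra hn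
      exact h2 (connected_delete_add hG hn (tx hux))
  · have hvy := d1.resolve_left hux
    have hvx := d2.resolve_left fun h1 => ty h1 hvy
    refine Or.inr ⟨⟨hvx, ?_⟩, hvy, ?_⟩
    · by_contra hn
      refine h2 ?_
      rw [symmDiff_right_comm]
      exact connected_delete_add hG hn fun h1 => ty h1 hvy
    · by_contra hn
      refine h1 ?_
      rw [symmDiff_right_comm]
      exact connected_delete_add hG hn hux

/-- The candidate lists: `z` itself, and the lists obtained from it by the exchange of any position
with the last one, or with the second position of the first pair after the joining pairs. For
`N = 0` the truncated difference `2 * N - 1` does not matter, as there is no `i < 0`. -/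
def IsExchange (z w : ℕ → V) (l N : ℕ) : Prop :=
  w = z ∨ (∃ i < 2 * N, w = z ∘ Equiv.swap i (2 * N - 1)) ∨
    (l < N ∧ ∃ i < 2 * N, w = z ∘ Equiv.swap i (2 * l + 1))


section
variable (h : JoinInv G T z l G' T') (hp : PairInv G' T' z l m (m + 1)) (hG' : G'.Connected)
  (hno : ∀ w, IsExchange z w l (m + 1) → ¬ (G ∆ gr (vec w (m + 1))).Connected)
include h hp hG' hno

/-- Otherwise `z` itself would do: the pairs with smaller index only add edges, and the last pair is
an edge whose deletion does not disconnect `G'`. -/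
theorem isBridge_of_no_exchange : G'.IsBridge s(z (2 * m), z (2 * m + 1)) := by
  by_contra hbr
  have hle := hp.le
  refine hno z (Or.inl rfl) ?_
  have h1 : pairSum z (Finset.Ico l (m + 1)) =
      pairVec (z (2 * m)) (z (2 * m + 1)) + pairSum z (Finset.Ico l m) := by
    rw [pairSum, Finset.sum_Ico_succ_top hle, add_comm]
    rfl
  rw [h.symmDiff_base (by omega), h1, gr_add, gr_pairVec, ← symmDiff_assoc]
  refine hp.connected_of_connected (fun j hj => Finset.mem_Ico.1 hj)
    ((hG'.connected_delete_edge_of_not_isBridge hbr).mono fun x y hxy => ?_) fun x y hxy => ?_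
  · simp only [deleteEdges_adj, Set.mem_singleton_iff, Sym2.eq_iff] at hxy
    simp only [symmDiff_adj, edge_adj]
    tauto
  · refine (adj_symmDiff_edge hxy).imp id fun h1 => ⟨2 * m, _, by omega, by omega, ?_, h1⟩
    intro j hj
    rw [Finset.mem_Ico] at hj
    omega

/-- Exchanging an end of a pair of non-adjacent vertices with an end of the last pair must fail in
both ways, so the two vertices are attached by bridges to the same end of the last pair. -/
theorem matched_of_no_exchange {j : ℕ} (hj : l ≤ j) (hj' : j < m) :
    ∃ c, (c = 2 * m ∨ c = 2 * m + 1) ∧ ∀ i, i = 2 * j ∨ i = 2 * j + 1 →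
      G'.Adj (z c) (z i) ∧ G'.IsBridge s(z c, z i) := by
  have hbr := isBridge_of_no_exchange h hp hG' hno
  have key : ∀ i, i = 2 * j ∨ i = 2 * j + 1 → ¬ (G' ∆ edge (z (2 * m)) (z i) ∆
      edge (z (2 * m + 1)) (z (if i = 2 * j then 2 * j + 1 else 2 * j))).Connected := by
    intro i hi hc
    refine hno (z ∘ Equiv.swap i (2 * m + 1)) (Or.inr (Or.inl ⟨i, by omega, rfl⟩)) ?_
    rw [h.symmDiff_swap hj (by omega) (by omega) (by omega) (by omega) hi]
    have hJ : ∀ a ∈ ((Finset.Ico l (m + 1)).erase j).erase m, l ≤ a ∧ a < m := by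
      intro a
      simp only [Finset.mem_erase, Finset.mem_Ico]
      omega
    have hJ' : ∀ b, b = 2 * m ∨ b = 2 * m + 1 →
        ∀ a ∈ ((Finset.Ico l (m + 1)).erase j).erase m, b ≠ 2 * a ∧ b ≠ 2 * a + 1 := by
      intro b hb a ha
      have := hJ a ha
      omega
    refine hp.connected_of_connected hJ hc fun x y hxy => ?_
    rcases adj_symmDiff_edge hxy with h1 | h1
    · refine (adj_symmDiff_edge h1).imp id fun h1 => ⟨2 * m, _, by omega, by omega,
        hJ' _ (Or.inl rfl), h1⟩
    · exact Or.inr ⟨2 * m + 1, _, by omega, by omega, hJ' _ (Or.inr rfl), h1⟩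
  have c1 := key _ (Or.inl rfl)
  have c2 := key _ (Or.inr rfl)
  rw [if_pos rfl] at c1
  rw [if_neg (by omega)] at c2
  have hz : ∀ i, i = 2 * j ∨ i = 2 * j + 1 → z i ≠ z (2 * m + 1) := fun i hi he => by
    have := hp.inj i (2 * m + 1) (by omega) (by omega) (by omega) (by omega) he
    omega
  rcases adj_bridge_of_not_connected hG' hbr (hz _ (Or.inl rfl)) (hz _ (Or.inr rfl)) c1 c2 with
    h1 | h1
  · refine ⟨2 * m, Or.inl rfl, ?_⟩
    rintro i (rfl | rfl)
    exacts [h1.1, h1.2]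
  · refine ⟨2 * m + 1, Or.inr rfl, ?_⟩
    rintro i (rfl | rfl)
    exacts [h1.1, h1.2]

/-- If the pairs `l` and `j` were attached to different ends of the bridge, then exchanging an end
of one with an end of the other would yield two edges that replace the bridge. -/
theorem not_cross_of_no_exchange {j c c' : ℕ} (hj : l < j) (hj' : j < m)
    (hc : (c = 2 * m ∧ c' = 2 * m + 1) ∨ (c = 2 * m + 1 ∧ c' = 2 * m))
    (h1 : ∀ i, i = 2 * l ∨ i = 2 * l + 1 → G'.Adj (z c) (z i))
    (h2 : ∀ i, i = 2 * j ∨ i = 2 * j + 1 → G'.Adj (z c') (z i)) : False := by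
  have hbr := isBridge_of_no_exchange h hp hG' hno
  have hadj : G'.Adj (z (2 * m)) (z (2 * m + 1)) :=
    hp.clique _ _ (by omega) (by omega) (by omega) (by omega) (by omega)
  have hbr' : G'.IsBridge s(z c, z c') ∧ G'.Adj (z c) (z c') ∧
      edge (z c) (z c') = edge (z (2 * m)) (z (2 * m + 1)) := by
    rcases hc with ⟨rfl, rfl⟩ | ⟨rfl, rfl⟩
    · exact ⟨hbr, hadj, rfl⟩
    · exact ⟨by rwa [Sym2.eq_swap], hadj.symm, edge_comm _ _⟩
  refine hno (z ∘ Equiv.swap (2 * j) (2 * l + 1))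
    (Or.inr (Or.inr ⟨by omega, 2 * j, by omega, rfl⟩)) ?_
  rw [h.symmDiff_swap (j := j) (k := l) (by omega) (by omega) le_rfl (by omega) (by omega)
    (Or.inl rfl), if_pos rfl]
  have h3 : pairSum z (((Finset.Ico l (m + 1)).erase j).erase l) =
      pairVec (z (2 * m)) (z (2 * m + 1)) + pairSum z (((Finset.Ico l m).erase j).erase l) := by
    have h4 : m ∈ ((Finset.Ico l (m + 1)).erase j).erase l := by
      simp only [Finset.mem_erase, Finset.mem_Ico]
      omega
    rw [pairSum, ← Finset.sum_erase_add _ _ h4, add_comm]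
    congr 2
    ext a
    simp only [Finset.mem_erase, Finset.mem_Ico]
    omega
  rw [h3, gr_add, gr_pairVec, ← symmDiff_assoc]
  have hz : ∀ i i', 2 * l ≤ i → i < 2 * (m + 1) → 2 * l ≤ i' → i' < 2 * (m + 1) → i ≠ i' →
      z i ≠ z i' := fun i i' e1 e2 e3 e4 e5 e6 => e5 (hp.inj i i' e1 e2 e3 e4 e6)
  have hJ : ∀ a ∈ ((Finset.Ico l m).erase j).erase l, l ≤ a ∧ a < m ∧ a ≠ j ∧ a ≠ l := by
    intro a
    simp only [Finset.mem_erase, Finset.mem_Ico]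
    omega
  have hJ' : ∀ b, (b = 2 * l ∨ b = 2 * l + 1 ∨ b = 2 * m) →
      ∀ a ∈ ((Finset.Ico l m).erase j).erase l, b ≠ 2 * a ∧ b ≠ 2 * a + 1 := by
    intro b hb a ha
    have := hJ a ha
    omega
  refine hp.connected_of_connected (fun a ha => ⟨(hJ a ha).1, (hJ a ha).2.1⟩) ?_ fun x y hxy => ?_
  · rw [symmDiff_right_comm, symmDiff_right_comm G', ← hbr'.2.2]
    exact connected_delete_bridge hG' hbr'.1 hbr'.2.1 (h1 _ (Or.inl rfl)) (h2 _ (Or.inl rfl))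
      (h1 _ (Or.inr rfl)) (h2 _ (Or.inr rfl))
      (hz _ _ (by omega) (by omega) (by omega) (by omega) (by omega))
      (hz _ _ (by omega) (by omega) (by omega) (by omega) (by omega))
      (hz _ _ (by omega) (by omega) (by omega) (by omega) (by omega))
      (hz _ _ (by omega) (by omega) (by omega) (by omega) (by omega))
      (hz _ _ (by omega) (by omega) (by omega) (by omega) (by omega))
      (hz _ _ (by omega) (by omega) (by omega) (by omega) (by omega))
  · rcases adj_symmDiff_edge hxy with e | e
    · rcases adj_symmDiff_edge e with e | e
      · exact (adj_symmDiff_edge e).imp id fun e => ⟨2 * l, _, by omega, by omega,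
          hJ' _ (by omega), e⟩
      · exact Or.inr ⟨2 * l + 1, _, by omega, by omega, hJ' _ (by omega), e⟩
    · exact Or.inr ⟨2 * m, _, by omega, by omega, hJ' _ (by omega), e⟩

/-- All pairs of non-adjacent vertices are attached to the same end `c` of the last pair, so `T'`
induces a star of bridges with centre `c`. -/
theorem isBridgeStar_of_no_exchange [Finite V] : IsBridgeStar G' T' := by
  have hbr := isBridge_of_no_exchange h hp hG' hno
  have hle := hp.le
  have hadj : G'.Adj (z (2 * m)) (z (2 * m + 1)) :=
    hp.clique _ _ (by omega) (by omega) (by omega) (by omega) (by omega)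
  obtain ⟨c, hc, hcm⟩ : ∃ c, (c = 2 * m ∨ c = 2 * m + 1) ∧ ∀ j, l ≤ j → j < m →
      ∀ i, i = 2 * j ∨ i = 2 * j + 1 → G'.Adj (z c) (z i) ∧ G'.IsBridge s(z c, z i) := by
    by_cases hlm : l = m
    · exact ⟨2 * m, Or.inl rfl, by intros; omega⟩
    obtain ⟨c, hc, h1⟩ := matched_of_no_exchange h hp hG' hno (j := l) le_rfl (by omega)
    refine ⟨c, hc, fun j hj hj' => ?_⟩
    obtain ⟨c', hc', h2⟩ := matched_of_no_exchange h hp hG' hno hj hj'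
    by_cases hcc : c' = c
    · rwa [hcc] at h2
    · by_cases hjl : j = l
      · rwa [hjl]
      · exact (not_cross_of_no_exchange h hp hG' hno (j := j) (c := c) (c' := c') (by omega) hj'
          (by omega) (fun i hi => (h1 i hi).1) fun i hi => (h2 i hi).1).elim
  refine isBridgeStar_of_center (c := z c) ?_ ((hp.mem _).2 ⟨c, by omega, by omega, rfl⟩) ?_
  · rw [hp.ncard_eq]
    omega
  · intro x hx hxc
    obtain ⟨i, hi, hi', rfl⟩ := (hp.mem x).1 hx
    by_cases him : i < 2 * m
    · exact hcm (i / 2) (by omega) (by omega) i (by omega)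
    · have hic : i ≠ c := fun he => hxc (by rw [he])
      rcases hc with rfl | rfl
      · obtain rfl : i = 2 * m + 1 := by omega
        exact ⟨hadj, hbr⟩
      · obtain rfl : i = 2 * m := by omega
        exact ⟨hadj.symm, by rwa [Sym2.eq_swap]⟩

/-- By `connected_exchange_bridges`, a joining pair other than the last pair could be exchanged with
it. -/
theorem join_eq_of_no_exchange {j : ℕ} (hj : j < l) :
    s(z (2 * j), z (2 * j + 1)) = s(z (2 * m), z (2 * m + 1)) := by
  by_contra hne
  have hbr := isBridge_of_no_exchange h hp hG' hno
  have hle := hp.le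
  have hadj : G'.Adj (z (2 * m)) (z (2 * m + 1)) :=
    hp.clique _ _ (by omega) (by omega) (by omega) (by omega) (by omega)
  have key : ∀ i, i = 2 * j ∨ i = 2 * j + 1 → ¬ (G' ∆ edge (z (2 * j)) (z (2 * j + 1)) ∆
      edge (z (2 * m)) (z i) ∆
      edge (z (2 * m + 1)) (z (if i = 2 * j then 2 * j + 1 else 2 * j))).Connected := by
    intro i hi hc
    refine hno (z ∘ Equiv.swap i (2 * m + 1)) (Or.inr (Or.inl ⟨i, by omega, rfl⟩)) ?_
    rw [h.symmDiff_swap_join hj hle hi]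
    have hJ : ∀ b, b = 2 * m ∨ b = 2 * m + 1 →
        ∀ a ∈ Finset.Ico l m, b ≠ 2 * a ∧ b ≠ 2 * a + 1 := by
      intro b hb a ha
      rw [Finset.mem_Ico] at ha
      omega
    refine hp.connected_of_connected (fun a ha => Finset.mem_Ico.1 ha) hc fun x y hxy => ?_
    rcases adj_symmDiff_edge hxy with e | e
    · rcases adj_symmDiff_edge e with e | e
      · rcases adj_symmDiff_edge e with e | e
        · exact Or.inl e
        · left
          rw [← mem_edgeSet, e, mem_edgeSet]
          exact h.adj j hj
      · exact Or.inr ⟨2 * m, _, by omega, by omega, hJ _ (by omega), e⟩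
    · exact Or.inr ⟨2 * m + 1, _, by omega, by omega, hJ _ (by omega), e⟩
  have c1 := key _ (Or.inl rfl)
  have c2 := key _ (Or.inr rfl)
  rw [if_pos rfl, symmDiff_right_comm] at c1
  rw [if_neg (by omega), symmDiff_right_comm] at c2
  rcases connected_exchange_bridges hG' (h.adj j hj) (h.bridge j hj) hadj hbr hne with h1 | h1
  · exact c1 h1
  · rw [edge_comm (z (2 * j)) (z (2 * m + 1))] at h1
    exact c2 h1

end
end
end

/-! ### The exceptional instances and the value of the optimum -/

section
variable {V : Type*}

/-- The list `z` of `N` pairs with its last pair `(u, v)` replaced by the two pairs `(u, x)` and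
`(x, v)`. -/
def bypass (z : ℕ → V) (N : ℕ) (x : V) : ℕ → V :=
  fun i => if i < 2 * N - 1 then z i else if i < 2 * N + 1 then x else z (2 * N - 1)

/-- A bypass does not change the parities: the vertex `x` is counted twice. -/
theorem occ_bypass (z : ℕ → V) (m : ℕ) (x v : V) :
    occ (bypass z (m + 1) x) (2 * (m + 1 + 1)) v = occ z (2 * (m + 1)) v := by
  classical
  have h1 : occ (bypass z (m + 1) x) (2 * m + 1) v = occ z (2 * m + 1) v := by
    refine occ_congr (fun i hi => ?_) v
    rw [bypass, if_pos (by omega)]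
  rw [show 2 * (m + 1 + 1) = 2 * m + 1 + 1 + 1 + 1 by ring, occ,
    Finset.sum_range_succ _ (2 * m + 1 + 1 + 1), Finset.sum_range_succ _ (2 * m + 1 + 1),
    Finset.sum_range_succ _ (2 * m + 1), show 2 * (m + 1) = 2 * m + 1 + 1 by ring, occ,
    Finset.sum_range_succ _ (2 * m + 1)]
  rw [occ, occ] at h1
  rw [h1]
  have e1 : bypass z (m + 1) x (2 * m + 1) = x := by
    rw [bypass, if_neg (by omega), if_pos (by omega)]
  have e2 : bypass z (m + 1) x (2 * m + 1 + 1) = x := by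
    rw [bypass, if_neg (by omega), if_pos (by omega)]
  have e3 : bypass z (m + 1) x (2 * m + 1 + 1 + 1) = z (2 * m + 1) := by
    rw [bypass, if_neg (by omega), if_neg (by omega)]
    rfl
  rw [e1, e2, e3, add_assoc (∑ i ∈ Finset.range (2 * m + 1), _)]
  have h2 : ∀ a : ZMod 2, a + a = 0 := by decide
  rw [h2, add_zero]

section
variable {G G' : SimpleGraph V} {T T' : Set V} {z : ℕ → V} {l m N : ℕ}

/-- The graph obtained by switching the pairs of `bypass z (m + 1) x`, seen from the joined graph.
-/
theorem JoinInv.symmDiff_bypass (h : JoinInv G T z l G' T') (hl : l ≤ m) (x : V) :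
    G ∆ gr (vec (bypass z (m + 1) x) (m + 1 + 1)) =
      G' ∆ edge (z (2 * m)) x ∆ edge x (z (2 * m + 1)) ∆ gr (pairSum z (Finset.Ico l m)) := by
  have h1 : vec (bypass z (m + 1) x) m = vec z m := vec_congr fun i hi => by
    rw [bypass, if_pos (by omega)]
  have h2 : vec z m = vec z l + pairSum z (Finset.Ico l m) := by
    rw [vec, vec, pairSum, Finset.sum_range_add_sum_Ico _ hl]
  have e0 : bypass z (m + 1) x (2 * m) = z (2 * m) := by
    rw [bypass, if_pos (by omega)]
  have e1 : bypass z (m + 1) x (2 * m + 1) = x := by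
    rw [bypass, if_neg (by omega), if_pos (by omega)]
  have e2 : bypass z (m + 1) x (2 * (m + 1)) = x := by
    rw [bypass, if_neg (by omega), if_pos (by omega)]
  have e3 : bypass z (m + 1) x (2 * (m + 1) + 1) = z (2 * m + 1) := by
    rw [bypass, if_neg (by omega), if_neg (by omega)]
    rfl
  rw [vec_succ, vec_succ, h1, h2, e0, e1, e2, e3, h.graph]
  simp only [gr_add, gr_pairVec]
  ac_rfl

section
variable (h : JoinInv G T z l G' T') (hp : PairInv G' T' z l m (m + 1)) (hG' : G'.Connected)
  (hno : ∀ w, IsExchange z w l (m + 1) → ¬ (G ∆ gr (vec w (m + 1))).Connected)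
include h hp hG' hno

/-- The instances in which no exchange helps: a star of bridges, or two components and no vertex of
the wrong parity. -/
theorem cases_of_no_exchange [Finite V] [Nonempty V] :
    (G' = G ∧ T' = T ∧ IsBridgeStar G T ∧ numFree G T = 0 ∧ numHit G T = 1) ∨
      (G = G' ∆ edge (z (2 * m)) (z (2 * m + 1)) ∧ T = ∅ ∧ numFree G T = 2 ∧ numHit G T = 0) := by
  have hs := isBridgeStar_of_no_exchange h hp hG' hno
  have hj := fun j (hj : j < l) => join_eq_of_no_exchange h hp hG' hno hj
  have hT' : 2 ≤ T'.ncard := (isBridgeStar_iff.1 hs).1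
  have hq : numHit G' T' ≠ 0 := by
    rw [Ne, numHit_eq_zero_iff]
    rintro rfl
    simp at hT'
  have hpq := connected_iff_numFree_add_numHit (T := T').1 hG'
  -- every joining pair is the last pair, and the joining pairs are distinct
  have hl : l ≤ 1 := by
    by_contra! hl
    have := h.inj 0 (by omega) 1 (by omega) (by rw [hj 0 (by omega), hj 1 (by omega)])
    omega
  obtain rfl | rfl : l = 0 ∨ l = 1 := by omega
  · left
    have hG : G' = G := by
      rw [h.graph]
      simp [vec]
    have hT : T' = T := by
      ext v
      rw [h.mem]
      simp [occ]
    subst hG hT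
    exact ⟨rfl, rfl, hs, by omega, by omega⟩
  · right
    have hadj := h.adj 0 (by omega)
    have he := hj 0 (by omega)
    -- the last pair undoes the joining edge: its ends are in `T'`, and hence not in `T`
    have hT : T = T' \ {z (2 * m), z (2 * m + 1)} := by
      have h1 : ∀ v, occ z (2 * 1) v = 1 ↔ v = z (2 * m) ∨ v = z (2 * m + 1) := by
        intro v
        have h2 : (v = z (2 * m) ∨ v = z (2 * m + 1)) ↔ (v = z 0 ∨ v = z 1) := by
          have : v ∈ s(z 0, z 1) ↔ v ∈ s(z (2 * m), z (2 * m + 1)) := by rw [← he]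
          simpa using this.symm
        rw [h2, occ, Finset.sum_range_succ, Finset.sum_range_one]
        have h3 : z 0 ≠ z 1 := hadj.ne
        by_cases a : z 0 = v
        · subst a
          simp [h3.symm]
        · by_cases b : z 1 = v
          · subst b
            simp [a]
          · simp [a, b, Ne.symm a, Ne.symm b]
      have h4 : ∀ i, i = 2 * m ∨ i = 2 * m + 1 → z i ∈ T' := fun i hi =>
        (hp.mem _).2 ⟨i, by have := hp.le; omega, by omega, rfl⟩
      ext v
      have h5 := h.mem v
      rw [h1] at h5
      have h6 : v = z (2 * m) ∨ v = z (2 * m + 1) → v ∈ T' := by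
        rintro (rfl | rfl)
        exacts [h4 _ (Or.inl rfl), h4 _ (Or.inr rfl)]
      simp only [Set.mem_sdiff, Set.mem_insert_iff, Set.mem_singleton_iff]
      tauto
    have hG : G = G' ∆ edge (z (2 * m)) (z (2 * m + 1)) := by
      have h1 : edge (z (2 * 0)) (z (2 * 0 + 1)) = edge (z (2 * m)) (z (2 * m + 1)) := by
        rw [edge, edge, he]
      rw [h.graph, ← h1, ← gr_pairVec]
      simp [vec]
    have hc : T.ncard + 2 = T'.ncard := by
      have hle := hp.le
      have hne : z (2 * m) ≠ z (2 * m + 1) := fun e => by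
        have := hp.inj _ _ (by omega) (by omega) (by omega) (by omega) e
        omega
      rw [hT, Set.ncard_sdiff, Set.ncard_pair hne]
      · omega
      · rintro x (rfl | rfl)
        · exact (hp.mem _).2 ⟨2 * m, by omega, by omega, rfl⟩
        · exact (hp.mem _).2 ⟨2 * m + 1, by omega, by omega, rfl⟩
    have hcc : numFree G T + numHit G T ≤ 1 + 1 := by
      have h1 : (G ∆ gr (vec z 1)).Connected := by rwa [← h.graph]
      exact (numFree_add_numHit_le h1).trans (Nat.add_le_add_right (ncard_edgeSet_gr_vec_le z 1) 1)
    have hcount := h.count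
    have hn := hp.ncard_eq
    rw [Nform, if_neg hq, Nform] at hcount
    by_cases hq0 : numHit G T = 0
    · exact ⟨hG, numHit_eq_zero_iff.1 hq0, by grind, hq0⟩
    · rw [if_neg hq0] at hcount
      omega

/-- If no exchange helps, then one more edit does, provided that there is a third vertex. -/
theorem exists_bypass_connected [Finite V] (hV : 3 ≤ Nat.card V) :
    ∃ x, (G ∆ gr (vec (bypass z (m + 1) x) (m + 1 + 1))).Connected := by
  have hle := hp.le
  have hadj : G'.Adj (z (2 * m)) (z (2 * m + 1)) :=
    hp.clique _ _ (by omega) (by omega) (by omega) (by omega) (by omega)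
  obtain ⟨x, -, -, hx⟩ := exists_bypass hG' hadj (isBridge_of_no_exchange h hp hG' hno) hV
  refine ⟨x, ?_⟩
  rw [h.symmDiff_bypass hle]
  refine hp.connected_of_connected (fun j hj => Finset.mem_Ico.1 hj) hx fun a b hab => ?_
  have hJ : ∀ i, i = 2 * m ∨ i = 2 * m + 1 →
      ∀ j ∈ Finset.Ico l m, i ≠ 2 * j ∧ i ≠ 2 * j + 1 := by
    intro i hi j hj
    rw [Finset.mem_Ico] at hj
    omega
  rcases adj_symmDiff_edge hab with e | e
  · exact (adj_symmDiff_edge e).imp id fun e =>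
      ⟨2 * m, x, by omega, by omega, hJ _ (Or.inl rfl), e⟩
  · exact Or.inr ⟨2 * m + 1, x, by omega, by omega, hJ _ (Or.inr rfl), e.trans Sym2.eq_swap⟩

/-- In the exceptional instances the lower bound `m + 1` is not attained. -/
theorem lt_ncard_of_no_exchange [Finite V] [Nonempty V] {F : SimpleGraph V}
    (hodd : ∀ v, Odd (deg F v) ↔ v ∈ T) (hc : (G ∆ F).Connected) :
    m + 1 < F.edgeSet.ncard := by
  have hN := h.eq_Nform hG' hp
  rcases cases_of_no_exchange h hp hG' hno with ⟨-, -, h1, h2, h3⟩ | ⟨-, -, h2, h3⟩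
  · have := h1.lt_ncard hodd hc
    rw [Nform, if_neg (by omega)] at hN
    omega
  · have := Nform_lt_of_two hodd hc h2 h3
    rw [Nform, if_pos h3] at hN
    split_ifs at hN
    all_goals omega

end

theorem eq_bot_or_eq_top_of_card_eq_two [Finite V] (hV : Nat.card V = 2) (F : SimpleGraph V) :
    F = ⊥ ∨ F = ⊤ := by
  obtain ⟨a, b, hab, hu⟩ := Nat.card_eq_two_iff.1 hV
  have hall : ∀ x, x = a ∨ x = b := fun x => by
    have : x ∈ ({a, b} : Set V) := hu ▸ Set.mem_univ x
    simpa using this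
  by_cases h : F.Adj a b
  · right
    ext x y
    simp only [top_adj]
    refine ⟨fun h => h.ne, fun hxy => ?_⟩
    rcases hall x with rfl | rfl <;> rcases hall y with rfl | rfl
    exacts [absurd rfl hxy, h, h.symm, absurd rfl hxy]
  · left
    ext x y
    simp only [bot_adj, iff_false]
    intro hxy
    rcases hall x with rfl | rfl <;> rcases hall y with rfl | rfl
    exacts [hxy.ne rfl, h hxy, h hxy.symm, hxy.ne rfl]

/-- The trivial instances have no solution: on two vertices `F` is empty or complete, and neither
makes the graph connected with the right parities. -/
theorem not_connected_of_isTrivialNo [Finite V] [Nonempty V] (hG : IsTrivialNo G T)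
    {F : SimpleGraph V} (hodd : ∀ v, Odd (deg F v) ↔ v ∈ T) : ¬ (G ∆ F).Connected := by
  intro hc
  rcases hG with h1 | ⟨hV, h1⟩
  · exact Nat.not_even_iff_odd.2 h1 (even_ncard_of_odd_deg hodd)
  have hnt : Nontrivial V := Finite.one_lt_card_iff_nontrivial.1 (by omega)
  have hbot : ¬ (⊥ : SimpleGraph V).Connected := fun h => by
    obtain ⟨x, y, hxy⟩ := exists_pair_ne V
    exact hxy (reachable_bot.1 (h.preconnected x y))
  have hdbot : ∀ v, ¬ Odd (deg (⊥ : SimpleGraph V) v) := fun v => by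
    have : deg (⊥ : SimpleGraph V) v = 0 := by
      rw [deg, Set.ncard_eq_zero]
      ext w
      simp
    simp [this]
  have hdtop : ∀ v, Odd (deg (⊤ : SimpleGraph V) v) := fun v => by
    have h2 : (⊤ : SimpleGraph V).neighborSet v = Set.univ \ {v} := by
      ext w
      simp [eq_comm]
    have : deg (⊤ : SimpleGraph V) v = 1 := by
      rw [deg, h2, Set.ncard_sdiff (by simp), Set.ncard_univ, hV, Set.ncard_singleton]
    simp [this]
  obtain ⟨v⟩ := ‹Nonempty V›
  rcases h1 with ⟨rfl, rfl⟩ | ⟨rfl, rfl⟩ <;>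
    rcases eq_bot_or_eq_top_of_card_eq_two hV F with rfl | rfl
  · exact hdbot v ((hodd v).2 trivial)
  · rw [symmDiff_self] at hc
    exact hbot hc
  · rw [symmDiff_self] at hc
    exact hbot hc
  · exact (hodd v).1 (hdtop v)

/-- If no exchange helps and there is no third vertex for a bypass, then the instance is trivial. -/
theorem isTrivialNo_of_no_exchange [Finite V] [Nonempty V] (h : JoinInv G T z l G' T')
    (hp : PairInv G' T' z l m (m + 1)) (hG' : G'.Connected)
    (hno : ∀ w, IsExchange z w l (m + 1) → ¬ (G ∆ gr (vec w (m + 1))).Connected)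
    (hV : Nat.card V < 3) : IsTrivialNo G T := by
  have hadj : G'.Adj (z (2 * m)) (z (2 * m + 1)) := by
    have := hp.le
    exact hp.clique _ _ (by omega) (by omega) (by omega) (by omega) (by omega)
  have hnt : Nontrivial V := ⟨_, _, hadj.ne⟩
  have hV2 : Nat.card V = 2 := by
    have := Finite.one_lt_card_iff_nontrivial.2 hnt
    omega
  have hG2 : G' = ⊤ := (eq_bot_or_eq_top_of_card_eq_two hV2 G').resolve_left (by
    rintro rfl
    exact hadj)
  refine Or.inr ⟨hV2, ?_⟩
  rcases cases_of_no_exchange h hp hG' hno with ⟨h1, -, h2, -⟩ | ⟨h1, h2, -⟩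
  · left
    have h3 := (isBridgeStar_iff.1 h2).1
    refine ⟨h1.symm.trans hG2, Set.eq_of_subset_of_ncard_le (Set.subset_univ _) ?_⟩
    rw [Set.ncard_univ]
    omega
  · right
    refine ⟨(eq_bot_or_eq_top_of_card_eq_two hV2 G).resolve_right fun h3 => ?_, h2⟩
    have h4 : G.Adj (z (2 * m)) (z (2 * m + 1)) := by
      rw [h3]
      exact hadj.ne
    rw [h1, symmDiff_adj, edge_adj] at h4
    have := hadj.ne
    tauto

theorem IsExchange.occ_eq {w : ℕ → V} (h : IsExchange z w l N) (v : V) :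
    occ w (2 * N) v = occ z (2 * N) v := by
  rcases h with rfl | ⟨i, hi, rfl⟩ | ⟨hl, i, hi, rfl⟩
  · rfl
  · exact occ_comp_perm _ _ (fun _ => swap_lt_iff hi (by omega)) v
  · exact occ_comp_perm _ _ (fun _ => swap_lt_iff hi (by omega)) v

/-- If the last pair is not the only pair of adjacent vertices of `T'`, then `z` itself needs no
exchange. -/
theorem exists_exchange_or [Finite V] (h : JoinInv G T z l G' T') (hp : PairInv G' T' z l m N)
    (hG' : G'.Connected) :
    (∃ w, IsExchange z w l N ∧ (G ∆ gr (vec w N)).Connected) ∨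
      (N = m + 1 ∧ ∀ w, IsExchange z w l N → ¬ (G ∆ gr (vec w N)).Connected) := by
  by_cases hN : N = m + 1
  · by_cases hex : ∃ w, IsExchange z w l N ∧ (G ∆ gr (vec w N)).Connected
    · exact Or.inl hex
    · push Not at hex
      exact Or.inr ⟨hN, hex⟩
  · refine Or.inl ⟨z, Or.inl rfl, ?_⟩
    rw [h.symmDiff_base (hp.le.trans hp.le')]
    exact hp.connected_base hG' hN

end

section
variable [Finite V] [Nonempty V] {G : SimpleGraph V} {δ : V → Fin 2}

/-- The list of pairs on which the candidates are based: joining pairs, pairs of non-adjacent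
vertices of the wrong parity, and pairs of the remaining vertices of the wrong parity. -/
theorem exists_lists (hT : Even (wrong G δ).ncard) : ∃ z l m N G' T',
    JoinInv G (wrong G δ) z l G' T' ∧ PairInv G' T' z l m N ∧ G'.Connected := by
  obtain ⟨z, l, G', T', h, hG'⟩ := exists_joinInv G hT
  obtain ⟨z', m, N, hz, hp⟩ := exists_pairInv G' h.even z l
  exact ⟨z', l, m, N, G', T', h.congr hz, hp, hG'⟩

theorem opt_eq_top_iff_isTrivialNo : opt G δ = ⊤ ↔ IsTrivialNo G (wrong G δ) := by
  rw [opt_eq_top_iff]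
  constructor
  · intro hno
    by_cases hT : Even (wrong G δ).ncard
    · obtain ⟨z, l, m, N, G', T', h, hp, hG'⟩ := exists_lists hT
      have hocc := h.occ_eq_one_iff hp
      rcases exists_exchange_or h hp hG' with ⟨w, hw, hc⟩ | ⟨rfl, hex⟩
      · refine absurd (isTarget_of_occ (fun v => ?_) hc) (hno _)
        rw [hw.occ_eq, hocc]
      · refine isTrivialNo_of_no_exchange h hp hG' hex (not_le.1 fun hV => ?_)
        obtain ⟨x, hx⟩ := exists_bypass_connected h hp hG' hex hV
        refine absurd (isTarget_of_occ (fun v => ?_) hx) (hno _)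
        rw [occ_bypass, hocc]
    · exact Or.inl (Nat.not_even_iff_odd.1 hT)
  · intro h F hF
    rw [isTarget_symmDiff_iff] at hF
    exact not_connected_of_isTrivialNo h hF.2 hF.1

open Classical in
/-- The optimum is the lower bound, or one more in the two exceptional cases. -/
theorem opt_eq (hG : ¬ IsTrivialNo G (wrong G δ)) : opt G δ =
    ((Nform (numFree G (wrong G δ)) (numHit G (wrong G δ)) (wrong G δ).ncard +
      if (numFree G (wrong G δ) = 0 ∧ numHit G (wrong G δ) = 1 ∧ IsBridgeStar G (wrong G δ)) ∨
        (numFree G (wrong G δ) = 2 ∧ numHit G (wrong G δ) = 0) then 1 else 0 : ℕ) : ℕ∞) := by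
  have hT : Even (wrong G δ).ncard := Nat.not_odd_iff_even.1 fun h => hG (Or.inl h)
  obtain ⟨z, l, m, N, G', T', h, hp, hG'⟩ := exists_lists hT
  have hocc := h.occ_eq_one_iff hp
  have hN := h.eq_Nform hG' hp
  rcases exists_exchange_or h hp hG' with ⟨w, hw, hc⟩ | ⟨rfl, hex⟩
  · have hF := isTarget_of_occ (δ := δ)
      (fun v => by rw [hw.occ_eq, hocc]) hc
    have hle := ncard_edgeSet_gr_vec_le w N
    have hF' := isTarget_symmDiff_iff.1 hF
    rw [if_neg, add_zero, ← hN]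
    · refine opt_eq_coe hF hle fun F' hF'' => ?_
      rw [isTarget_symmDiff_iff] at hF''
      rw [hN]
      exact Nform_le hF''.2 hF''.1
    · rintro (⟨h1, h2, h3⟩ | ⟨h1, h2⟩)
      · have := h3.lt_ncard hF'.2 hF'.1
        rw [h1, h2] at hN
        simp only [Nform] at hN
        grind
      · have := Nform_lt_of_two hF'.2 hF'.1 h1 h2
        rw [h1, h2] at hN
        simp only [Nform] at hN
        grind
  · have hcases : (numFree G (wrong G δ) = 0 ∧ numHit G (wrong G δ) = 1 ∧
        IsBridgeStar G (wrong G δ)) ∨ (numFree G (wrong G δ) = 2 ∧ numHit G (wrong G δ) = 0) := by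
      rcases cases_of_no_exchange h hp hG' hex with ⟨-, -, h1, h2, h3⟩ | ⟨-, -, h2, h3⟩
      · exact Or.inl ⟨h2, h3, h1⟩
      · exact Or.inr ⟨h2, h3⟩
    have hV : 3 ≤ Nat.card V := not_lt.1 fun hV =>
      hG (isTrivialNo_of_no_exchange h hp hG' hex hV)
    obtain ⟨x, hx⟩ := exists_bypass_connected h hp hG' hex hV
    rw [if_pos hcases, ← hN]
    refine opt_eq_coe (isTarget_of_occ (fun v => ?_) hx) (ncard_edgeSet_gr_vec_le _ _)
      fun F' hF' => ?_
    · rw [occ_bypass, hocc]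
    · rw [isTarget_symmDiff_iff] at hF'
      exact lt_ncard_of_no_exchange h hp hG' hex hF'.2 hF'.1

/-- The value of the optimum in the four cases. -/
theorem opt_formula (hG : ¬ IsTrivialNo G (wrong G δ)) :
    let T := wrong G δ
    let p := numFree G T
    let q := numHit G T
    (p = 1 ∧ q = 0 → opt G δ = 0) ∧
    (2 ≤ p ∧ q = 0 → opt G δ = (max 3 p : ℕ)) ∧
    (p = 0 ∧ q = 1 ∧ IsBridgeStar G T → opt G δ = (T.ncard / 2 + 1 : ℕ)) ∧
    (1 ≤ q ∧ ¬ (p = 0 ∧ q = 1 ∧ IsBridgeStar G T) →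
      opt G δ = (max (p + q - 1) (p + T.ncard / 2) : ℕ)) := by
  intro T p q
  rw [opt_eq hG]
  refine ⟨?_, ?_, ?_, ?_⟩
  · rintro ⟨h1, h2⟩
    simp only [p, q, T] at h1 h2
    simp [Nform, h1, h2]
  · rintro ⟨h1, h2⟩
    simp only [p, q, T] at h1 h2 ⊢
    simp only [Nform, h2]
    rw [Nat.cast_inj]
    grind
  · rintro ⟨h1, h2, h3⟩
    simp only [p, q, T] at h1 h2 h3 ⊢
    simp [Nform, h1, h2, h3]
  · rintro ⟨h1, h2⟩
    simp only [p, q, T] at h1 h2 ⊢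
    rw [if_neg, Nform, if_neg (by omega), add_zero]
    rintro (h3 | h3)
    · exact h2 h3
    · omega

end

theorem eulerianEditing_iff {V : Type*} {G : SimpleGraph V} {k : ℕ} :
    EulerianEditing G k ↔ CDPE G (fun _ => 0) k := by
  simp only [EulerianEditing, CDPE, IsEulerianGraph, IsTarget, Fin.val_zero,
    Nat.even_iff, Nat.ModEq, Nat.zero_mod]

end

/-! ### Adjacency lists, component labels, and a test for stars of bridges -/

section
variable {n : ℕ} {G : SimpleGraph (Fin n)} {δ : Fin n → Fin 2} {k : ℕ} {s : Store}

/-- The values of `x` on the vertices are the indicator function of `T`. -/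
def Indicates (T : Set (Fin n)) (x : ℕ → ℕ) : Prop :=
  ∀ v : Fin n, (v ∈ T → x v = 1) ∧ (v ∉ T → x v = 0)

/-- The graph obtained from `G` by deleting all edges between vertices of `T`. -/
def dropInside {V : Type*} (G : SimpleGraph V) (T : Set V) : SimpleGraph V where
  Adj u v := G.Adj u v ∧ ¬ (u ∈ T ∧ v ∈ T)
  symm := ⟨fun _ _ h => ⟨h.1.symm, fun h' => h.2 h'.symm⟩⟩
  loopless := ⟨fun _ h => h.1.ne rfl⟩

theorem IsInput.adj_iff (h : IsInput G δ k s) (u v : Fin n) :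
    G.Adj u v ↔ ∃ e, s.arr 1 u ≤ e ∧ e < s.arr 1 (u + 1) ∧ s.arr 2 e = v := by
  have h1 : (v : ℕ) ∈ Fin.val '' G.neighborSet u ↔ G.Adj u v := by
    rw [Function.Injective.mem_set_image Fin.val_injective, mem_neighborSet]
  rw [← h1, ← (h.list u).image_eq]
  simp [and_assoc]

theorem IsInput.list_lt (h : IsInput G δ k s) (u : Fin n) {e : ℕ} (he : s.arr 1 u ≤ e)
    (he' : e < s.arr 1 (u + 1)) : s.arr 2 e < n := by
  obtain ⟨w, -, hw⟩ := (h.list u).mapsTo ⟨he, he'⟩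
  rw [← hw]
  exact w.2

theorem IsInput.adjLists (h : IsInput G δ k s) {f : ℕ → ℕ} (hf : ∀ v : Fin n, f v = 0) :
    AdjLists G (s.arr 1) (s.arr 2) f where
  start := h.start
  mono := h.mono
  lt u _ := h.list_lt u
  adj u v := by
    rw [← h.adj_iff, hf, hf]
    simp

theorem IsInput.adjLists_dropInside (h : IsInput G δ k s) {f : ℕ → ℕ} {T : Set (Fin n)}
    (hf : Indicates T f) : AdjLists (dropInside G T) (s.arr 1) (s.arr 2) f where
  start := h.start
  mono := h.mono
  lt u _ := h.list_lt u
  adj u v := by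
    rw [← h.adj_iff]
    refine and_congr_right fun _ => ?_
    by_cases hu : u ∈ T <;> by_cases hv : v ∈ T <;>
      simp [hu, hv, (hf u).1, (hf u).2, (hf v).1, (hf v).2]

theorem IsInput.sum_list (h : IsInput G δ k s) {T : Set (Fin n)} {x : ℕ → ℕ}
    (hx : Indicates T x) (u : Fin n) :
    ∑ e ∈ Finset.Ico (s.arr 1 u) (s.arr 1 (u + 1)), x (s.arr 2 e) =
      (G.neighborSet u ∩ T).ncard := by
  classical
  have hb := h.list u
  have h1 : ∑ e ∈ Finset.Ico (s.arr 1 u) (s.arr 1 (u + 1)), x (s.arr 2 e) =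
      ∑ v ∈ (G.neighborSet u).toFinset, x v := by
    refine (Finset.sum_nbij (fun v : Fin n => (v : ℕ)) (s := (G.neighborSet u).toFinset)
      (t := (Finset.Ico (s.arr 1 u) (s.arr 1 (u + 1))).image (s.arr 2)) (f := fun v => x v)
      (g := x) ?_ ?_ ?_ fun _ _ => rfl).symm ▸ ?_
    · intro v hv
      rw [Set.mem_toFinset] at hv
      obtain ⟨e, he, he'⟩ := hb.surjOn ⟨v, hv, rfl⟩
      exact Finset.mem_image.2 ⟨e, by simpa using he, he'⟩
    · exact Fin.val_injective.injOn
    · intro w hw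
      rw [Finset.mem_coe, Finset.mem_image] at hw
      obtain ⟨e, he, rfl⟩ := hw
      obtain ⟨v, hv, hv'⟩ := hb.mapsTo (by simpa using he)
      exact ⟨v, by simpa using hv, hv'⟩
    · rw [Finset.sum_image]
      intro e he e' he' hee
      exact hb.injOn (by simpa using he) (by simpa using he') hee
  rw [h1, Set.ncard_eq_toFinset_card', Set.toFinset_inter, ← Finset.filter_mem_eq_inter,
    Finset.card_filter]
  refine Finset.sum_congr rfl fun v _ => ?_
  by_cases hv : v ∈ T
  · simp [hv, (hx v).1]
  · simp [hv, (hx v).2]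

theorem IsInput.deg_eq (h : IsInput G δ k s) (u : Fin n) :
    s.arr 1 (u + 1) - s.arr 1 u = deg G u := by
  have h1 := h.sum_list (T := Set.univ) (x := fun _ => 1) (fun v => by simp) u
  simpa [deg] using h1

theorem IsInput.arr_one_eq (h : IsInput G δ k s) : s.arr 1 n = 2 * G.edgeSet.ncard := by
  rw [← sum_deg, ← (h.adjLists (f := fun _ => 0) fun _ => rfl).sum_length]
  exact Finset.sum_congr rfl fun v _ => h.deg_eq v

section
variable {K : SimpleGraph (Fin n)} {lab : ℕ → ℕ} {c : ℕ}

/-- The label of a component. -/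
def Labels.ofComponent (h : Labels K lab c) : K.ConnectedComponent → ℕ :=
  ConnectedComponent.lift (fun v => lab v) fun u v p _ => (h.eq_iff u v).2 p.reachable

theorem Labels.ofComponent_injective (h : Labels K lab c) :
    Function.Injective h.ofComponent := by
  intro a b
  induction a using ConnectedComponent.ind with | _ u
  induction b using ConnectedComponent.ind with | _ v
  intro hab
  exact ConnectedComponent.eq.2 ((h.eq_iff u v).1 hab)

theorem Labels.card_eq (h : Labels K lab c) : Nat.card K.ConnectedComponent = c := by
  have h1 : Set.range h.ofComponent = Set.Icc 1 c := by
    ext x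
    constructor
    · rintro ⟨a, rfl⟩
      induction a using ConnectedComponent.ind with | _ u
      exact ⟨h.pos u, h.le u⟩
    · rintro ⟨h1, h2⟩
      obtain ⟨v, hv⟩ := h.attained x h1 h2
      exact ⟨K.connectedComponentMk v, hv⟩
  rw [← Nat.card_range_of_injective h.ofComponent_injective, h1]
  simp

theorem Labels.ncard_image (h : Labels K lab c) (T : Set (Fin n)) :
    ((fun v : Fin n => lab v) '' T).ncard = numHit K T := by
  rw [numHit, ← Set.ncard_image_of_injective _ h.ofComponent_injective]
  congr 1
  ext x
  constructor
  · rintro ⟨v, hv, rfl⟩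
    exact ⟨K.connectedComponentMk v, ⟨v, rfl, hv⟩, rfl⟩
  · rintro ⟨a, ⟨v, hv, hvT⟩, rfl⟩
    refine ⟨v, hvT, ?_⟩
    rw [← (ConnectedComponent.mem_supp_iff _ _).1 hv]
    rfl

/-- Every component contains at most one vertex of `T` iff there are as many components that meet
`T` as vertices of `T`. -/
theorem Labels.numHit_eq_ncard_iff (h : Labels K lab c) {T : Set (Fin n)} :
    numHit K T = T.ncard ↔ ∀ u ∈ T, ∀ v ∈ T, K.Reachable u v → u = v := by
  rw [← h.ncard_image, Set.ncard_image_iff]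
  constructor
  · intro hi u hu v hv huv
    exact hi hu hv ((h.eq_iff u v).2 huv)
  · intro hi u hu v hv huv
    exact hi u hu v hv ((h.eq_iff u v).1 huv)

end

section
variable {V : Type*} {G : SimpleGraph V} {T : Set V}

/-- A star with vertex set `T` consists of bridges iff the vertices of `T` lie in different
components after the deletion of the edges of the star. -/
theorem isBridge_iff_separated {c : V} (hc : c ∈ T) (hadj : ∀ u ∈ T, u ≠ c → G.Adj c u)
    (hind : ∀ u ∈ T, ∀ v ∈ T, u ≠ c → v ≠ c → ¬ G.Adj u v) :
    (∀ u ∈ T, u ≠ c → G.IsBridge s(c, u)) ↔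
      ∀ u ∈ T, ∀ v ∈ T, (dropInside G T).Reachable u v → u = v := by
  constructor
  · intro hb
    have hcu : ∀ u ∈ T, u ≠ c → ¬ (dropInside G T).Reachable c u := by
      intro u hu huc hr
      refine (isBridge_iff.1 (hb u hu huc)) (hr.mono ?_)
      intro x y hxy
      simp only [deleteEdges_adj, Set.mem_singleton_iff]
      refine ⟨hxy.1, fun he => hxy.2 ?_⟩
      rcases Sym2.eq_iff.1 he with ⟨rfl, rfl⟩ | ⟨rfl, rfl⟩
      exacts [⟨hc, hu⟩, ⟨hu, hc⟩]
    intro u hu v hv hr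
    by_contra huv
    by_cases huc : u = c
    · subst huc
      exact hcu v hv (Ne.symm huv) hr
    by_cases hvc : v = c
    · subst hvc
      exact hcu u hu huc hr.symm
    refine (isBridge_iff.1 (hb u hu huc)) (Reachable.trans (v := v) (Adj.reachable ?_)
      (hr.symm.mono ?_))
    · simp only [deleteEdges_adj, Set.mem_singleton_iff]
      refine ⟨hadj v hv hvc, fun he => ?_⟩
      rcases Sym2.eq_iff.1 he with h | h
      exacts [huv h.2.symm, huc h.1.symm]
    · intro x y hxy
      simp only [deleteEdges_adj, Set.mem_singleton_iff]
      refine ⟨hxy.1, fun he => hxy.2 ?_⟩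
      rcases Sym2.eq_iff.1 he with ⟨rfl, rfl⟩ | ⟨rfl, rfl⟩
      exacts [⟨hc, hu⟩, ⟨hu, hc⟩]
  · intro hs u hu huc
    rw [isBridge_iff]
    intro hr
    have key : ∀ w, (G.deleteEdges {s(c, u)}).Reachable u w → (dropInside G T).Reachable u w := by
      rintro w ⟨p⟩
      have : ∀ {x y} (_ : (G.deleteEdges {s(c, u)}).Walk x y), (dropInside G T).Reachable u x →
          (dropInside G T).Reachable u y := by
        intro x y p
        induction p with
        | nil => exact id
        | @cons a b d hab p ih =>
          intro hx
          refine ih (hx.trans (Adj.reachable ?_))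
          simp only [deleteEdges_adj, Set.mem_singleton_iff] at hab
          refine ⟨hab.1, fun ⟨ha, hb⟩ => ?_⟩
          -- the only edge from `u` to `T` is the deleted one
          have hau := hs u hu a ha hx
          subst hau
          by_cases hbc : b = c
          · subst hbc
            exact hab.2 Sym2.eq_swap
          · exact hind u hu b hb huc hbc hab.1
      exact this p (Reachable.refl _)
    exact huc (hs u hu c hc (key c hr.symm))

open Classical in
/-- A set `T` of at least two vertices induces a star of bridges iff some vertex of `T` is adjacent
to all others, the sum of the degrees in `G[T]` is that of a tree, and distinct vertices of `T` are
not connected any more once the edges inside `T` are dropped. -/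
theorem isBridgeStar_iff_sum [Fintype V] : IsBridgeStar G T ↔ 2 ≤ T.ncard ∧
    ∑ u ∈ T.toFinset, (G.neighborSet u ∩ T).ncard + 2 = 2 * T.ncard ∧
    (∃ c ∈ T, (G.neighborSet c ∩ T).ncard + 1 = T.ncard) ∧
    ∀ u ∈ T, ∀ v ∈ T, (dropInside G T).Reachable u v → u = v := by
  rw [isBridgeStar_iff]
  refine and_congr_right fun h2 => ?_
  have hdeg : ∀ c ∈ T, (G.neighborSet c ∩ T).ncard + 1 = T.ncard ↔ ∀ u ∈ T, u ≠ c → G.Adj c u := by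
    intro c hc
    have hsub : G.neighborSet c ∩ T ⊆ T \ {c} := fun u hu =>
      ⟨hu.2, fun h => (show G.Adj c u from hu.1).ne (by simpa using h.symm)⟩
    have hcard := Set.ncard_sdiff_singleton_add_one hc
    constructor
    · intro h u hu huc
      have h3 := Set.eq_of_subset_of_ncard_le hsub (by omega)
      have : u ∈ G.neighborSet c ∩ T := h3 ▸ ⟨hu, huc⟩
      exact this.1
    · intro h
      have : G.neighborSet c ∩ T = T \ {c} :=
        hsub.antisymm fun u hu => ⟨h u hu.1 hu.2, hu.1⟩
      rw [this, hcard]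
  have hsum : ∀ c ∈ T, (∀ u ∈ T, u ≠ c → G.Adj c u) →
      ((∑ u ∈ T.toFinset, (G.neighborSet u ∩ T).ncard + 2 = 2 * T.ncard) ↔
        ∀ u ∈ T, ∀ v ∈ T, u ≠ c → v ≠ c → ¬ G.Adj u v) := by
    intro c hc hadj
    have hdc := (hdeg c hc).2 hadj
    have hct : c ∈ T.toFinset := Set.mem_toFinset.2 hc
    have hcard : (T.toFinset.erase c).card + 1 = T.ncard := by
      rw [Finset.card_erase_add_one hct, ← Set.ncard_eq_toFinset_card']
    have hge : ∀ u ∈ T.toFinset.erase c, 1 ≤ (G.neighborSet u ∩ T).ncard := by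
      intro u hu
      simp only [Finset.mem_erase, Set.mem_toFinset] at hu
      exact (Set.ncard_pos).2 ⟨c, (hadj u hu.2 hu.1).symm, hc⟩
    have heq : (∑ u ∈ T.toFinset, (G.neighborSet u ∩ T).ncard + 2 = 2 * T.ncard) ↔
        ∑ u ∈ T.toFinset.erase c, 1 = ∑ u ∈ T.toFinset.erase c, (G.neighborSet u ∩ T).ncard := by
      rw [← Finset.sum_erase_add _ _ hct, Finset.sum_const, smul_eq_mul]
      omega
    rw [heq, Finset.sum_eq_sum_iff_of_le hge]
    constructor
    · intro h u hu v hv huc hvc huv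
      have h1 := h u (by simp [hu, huc])
      obtain ⟨a, ha⟩ := Set.ncard_eq_one.1 h1.symm
      have e1 : c ∈ G.neighborSet u ∩ T := ⟨(hadj u hu huc).symm, hc⟩
      have e2 : v ∈ G.neighborSet u ∩ T := ⟨huv, hv⟩
      rw [ha] at e1 e2
      exact hvc (e2.trans e1.symm)
    · intro h u hu
      simp only [Finset.mem_erase, Set.mem_toFinset] at hu
      refine (Set.ncard_eq_one.2 ⟨c, ?_⟩).symm
      ext v
      constructor
      · rintro ⟨h3, h4⟩
        by_contra hvc
        exact h u hu.2 v h4 hu.1 hvc h3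
      · rintro rfl
        exact ⟨(hadj u hu.2 hu.1).symm, hc⟩
  constructor
  · rintro ⟨c, hc, hadj, hind⟩
    have hadj' := fun u hu huc => (hadj u hu huc).1
    exact ⟨(hsum c hc hadj').2 hind, ⟨c, hc, (hdeg c hc).2 hadj'⟩,
      (isBridge_iff_separated hc hadj' hind).1 fun u hu huc => (hadj u hu huc).2⟩
  · rintro ⟨hs, ⟨c, hc, hd⟩, hsep⟩
    have hadj := (hdeg c hc).1 hd
    have hind := (hsum c hc hadj).1 hs
    exact ⟨c, hc, fun u hu huc => ⟨hadj u hu huc,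
      (isBridge_iff_separated hc hadj hind).2 hsep u hu huc⟩, hind⟩

end

/-- A recognition of the trivial instances by the numbers of components and of vertices of the wrong
parity. -/
theorem isTrivialNo_iff {V : Type*} [Finite V] [Nonempty V] {G : SimpleGraph V} {T : Set V} :
    IsTrivialNo G T ↔ Odd T.ncard ∨ Nat.card V = 2 ∧
      (Nat.card G.ConnectedComponent = 1 ∧ T.ncard = 2 ∨
        Nat.card G.ConnectedComponent = 2 ∧ T.ncard = 0) := by
  refine or_congr_right (and_congr_right fun hV => ?_)
  have h1 : Nat.card G.ConnectedComponent = 1 ↔ G = ⊤ := by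
    rw [← numFree_add_numHit G ∅, ← connected_iff_numFree_add_numHit]
    constructor
    · intro h
      refine (eq_bot_or_eq_top_of_card_eq_two hV G).resolve_left ?_
      rintro rfl
      have hnt : Nontrivial V := Finite.one_lt_card_iff_nontrivial.1 (by omega)
      obtain ⟨x, y, hxy⟩ := exists_pair_ne V
      exact hxy (reachable_bot.1 (h.preconnected x y))
    · rintro rfl
      exact connected_top
  have h2 : T.ncard = 2 ↔ T = Set.univ := by
    rw [← hV, ← Set.ncard_univ]
    exact ⟨fun h => Set.eq_of_subset_of_ncard_le (Set.subset_univ _) h.ge, fun h => h ▸ rfl⟩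
  have h3 : Nat.card G.ConnectedComponent = 2 ↔ G = ⊥ := by
    constructor
    · intro h
      refine (eq_bot_or_eq_top_of_card_eq_two hV G).resolve_right fun h' => ?_
      have := h1.2 h'
      omega
    · rintro rfl
      have hinj : Function.Bijective (⊥ : SimpleGraph V).connectedComponentMk :=
        ⟨fun x y h => reachable_bot.1 (ConnectedComponent.eq.1 h), fun c => by
          induction c using ConnectedComponent.ind with | _ v
          exact ⟨v, rfl⟩⟩
      rw [← Nat.card_congr (Equiv.ofBijective _ hinj), hV]
  rw [h1, h2, h3, Set.ncard_eq_zero]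

end

/-! ### The linear-time program -/

/-- Array 3 receives the parities and array 11 the halves of the numbers up to `n`. -/
def tables : Prog :=
  forLoop 37 (.const 0) (.reg 0)
    (.seq (.store 3 (.op .add (.reg 37) (.const 1)) (.op .sub (.const 1) (.cell 3 (.reg 37))))
      (.store 11 (.op .add (.reg 37) (.const 1))
        (.op .add (.cell 11 (.reg 37)) (.cell 3 (.reg 37)))))

theorem wp_tables {n : ℕ} {s : Store} (hn : s.reg 0 = n) (h3 : s.arr 3 0 = 0)
    (h11 : s.arr 11 0 = 0) :
    Wp tables s fun s' t => (∀ i ≤ n, s'.arr 3 i = i % 2 ∧ s'.arr 11 i = i / 2) ∧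
      t ≤ 30 * n + 10 := by
  refine (wp_for_const 0 n 20 (fun j s' => ∀ i ≤ j, s'.arr 3 i = i % 2 ∧ s'.arr 11 i = i / 2)
    rfl (Nat.zero_le _) rfl ?_ (fun j s' hF _ _ => by simpa [Expr.eval] using (hF.1 0 rfl).trans hn)
    ?_).mono ?_
  · intro i hi
    obtain rfl : i = 0 := by omega
    simp [h3, h11]
  · intro j s' _ _ _ hr hI
    have h1 := hI j le_rfl
    simp only [wp_seq, wp_store, Expr.eval, Op.eval, Expr.cost, hr, Function.update_self,
      Function.update_of_ne, ne_eq, Nat.reduceEqDiff, not_false_eq_true, h1.1, h1.2]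
    refine ⟨fun i hi => ?_, by omega⟩
    by_cases hij : i = j + 1
    · subst hij
      rw [Function.update_of_ne (by omega : j ≠ j + 1), h1.1]
      simp only [Function.update_self]
      omega
    · rw [Function.update_of_ne hij, Function.update_of_ne hij]
      exact hI i (by omega)
  · rintro s' t ⟨⟨-, h⟩, ht⟩
    refine ⟨h, ?_⟩
    simp only [Expr.cost] at ht
    omega

section
variable {n : ℕ}

open Classical in
/-- The sum of `g` over the vertices in `T` that are less than `j`. -/
noncomputable def sumBelow (T : Set (Fin n)) (g : Fin n → ℕ) (j : ℕ) : ℕ :=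
  ∑ v ∈ Finset.range j, if h : v < n then if ⟨v, h⟩ ∈ T then g ⟨v, h⟩ else 0 else 0

open Classical in
theorem sumBelow_succ (T : Set (Fin n)) (g : Fin n → ℕ) (v : Fin n) :
    sumBelow T g (v + 1) = sumBelow T g v + if v ∈ T then g v else 0 := by
  rw [sumBelow, Finset.sum_range_succ, dif_pos v.2]
  rfl

open Classical in
theorem sumBelow_eq (T : Set (Fin n)) (g : Fin n → ℕ) :
    sumBelow T g n = ∑ v ∈ T.toFinset, g v := by
  rw [sumBelow, ← Fin.sum_univ_eq_sum_range
    (fun v => if h : v < n then if ⟨v, h⟩ ∈ T then g ⟨v, h⟩ else 0 else 0)]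
  simp only [Fin.is_lt, dif_pos, Fin.eta]
  rw [← Finset.sum_filter]
  congr 1
  ext v
  simp

theorem sumBelow_one (T : Set (Fin n)) : sumBelow T (fun _ => 1) n = T.ncard := by
  classical
  rw [sumBelow_eq, Finset.sum_const, smul_eq_mul, mul_one, Set.ncard_eq_toFinset_card']

/-- Array 4 receives the indicator function of the set `T` of vertices of the wrong parity, and
register 10 the size of `T`. -/
def markWrong : Prog :=
  .seq (.set 10 (.const 0)) (forLoop 37 (.const 0) (.reg 0)
    (.seq (.store 4 (.reg 37) (.op .sub (.const 1) (.op .eq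
      (.cell 3 (.op .sub (.cell 1 (.op .add (.reg 37) (.const 1))) (.cell 1 (.reg 37))))
      (.cell 0 (.reg 37)))))
      (.set 10 (.op .add (.reg 10) (.cell 4 (.reg 37))))))

section
variable {G : SimpleGraph (Fin n)} {δ : Fin n → Fin 2} {k : ℕ} {s₀ s : Store}

/-- The memory still holds the graph of the input. -/
structure Holds (n : ℕ) (s₀ s : Store) : Prop where
  size : s.reg 0 = n
  start : s.arr 1 = s₀.arr 1
  list : s.arr 2 = s₀.arr 2

theorem deg_le (G : SimpleGraph (Fin n)) (v : Fin n) : deg G v ≤ n := by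
  have := Set.ncard_le_ncard (Set.subset_univ (G.neighborSet v)) (Set.toFinite _)
  rwa [Set.ncard_univ, Nat.card_fin] at this

/-- The degree of a vertex is the length of its adjacency list. -/
theorem wp_markWrong (h : IsInput G δ k s₀) (hs : Holds n s₀ s) (h0 : s.arr 0 = s₀.arr 0)
    (h3 : ∀ i ≤ n, s.arr 3 i = i % 2) :
    Wp markWrong s fun s' t => (Indicates (wrong G δ) (s'.arr 4) ∧
      s'.reg 10 = (wrong G δ).ncard) ∧ t ≤ 40 * n + 20 := by
  rw [markWrong, wp_seq, wp_set]
  refine (wp_for_const 0 n 26 (fun j s' => (∀ v : Fin n, v < j →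
      (v ∈ wrong G δ → s'.arr 4 v = 1) ∧ (v ∉ wrong G δ → s'.arr 4 v = 0)) ∧
      s'.reg 10 = sumBelow (wrong G δ) (fun _ => 1) j)
    rfl (Nat.zero_le _) rfl ?_ (fun j s' hF _ _ => by
      simpa [Expr.eval, hs.size] using hF.1 0 rfl) ?_).mono ?_
  · simp [sumBelow, Expr.eval]
  · intro j s' _ hj hF hr hI
    have e0 : s'.arr 0 = s₀.arr 0 := (hF.2 0 rfl).trans h0
    have e1 : s'.arr 1 = s₀.arr 1 := (hF.2 1 rfl).trans hs.start
    have e3 : s'.arr 3 = s.arr 3 := hF.2 3 rfl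
    lift j to Fin n using hj
    have hd := h.deg_eq j
    have hmod : s.arr 3 (deg G j) = deg G j % 2 := h3 _ (deg_le G j)
    have hw : j ∈ wrong G δ ↔ ¬ (deg G j % 2 = s₀.arr 0 j) := by
      rw [wrong, Set.mem_ofPred_eq, Nat.ModEq, Nat.mod_eq_of_lt (δ j).2, h.parity]
    have hlast : ∀ x : ℕ → ℕ, (j ∈ wrong G δ → x j = 1) → (j ∉ wrong G δ → x j = 0) →
        (∀ v : Fin n, v ≠ j → x v = s'.arr 4 v) → ∀ v : Fin n, (v : ℕ) < j + 1 →
        (v ∈ wrong G δ → x v = 1) ∧ (v ∉ wrong G δ → x v = 0) := by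
      intro x h1 h2 h3 v hv
      by_cases hvj : v = j
      · subst hvj
        exact ⟨h1, h2⟩
      · rw [h3 v hvj]
        exact hI.1 v (by have := Fin.val_ne_of_ne hvj; omega)
    simp only [wp_seq, wp_store, wp_set, Expr.eval, Op.eval, Expr.cost, hr, Function.update_self,
      Function.update_of_ne, ne_eq, Nat.reduceEqDiff, not_false_eq_true, e0, e1, e3, hd, hmod, hI.2,
      sumBelow_succ]
    refine ⟨⟨hlast _ ?_ ?_ ?_, ?_⟩, by omega⟩
    · intro hj
      simp [hw.1 hj]
    · intro hj
      rw [hw, not_not] at hj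
      simp [hj]
    · intro v hv
      rw [Function.update_of_ne (Fin.val_ne_of_ne hv)]
    · by_cases hj : j ∈ wrong G δ
      · simp [hj, hw.1 hj]
      · have hj' := hj
        rw [hw, not_not] at hj'
        simp [hj, hj']
  · rintro s' t ⟨⟨-, h1, h2⟩, ht⟩
    refine ⟨⟨fun v => h1 v v.2, h2.trans (sumBelow_one _)⟩, ?_⟩
    simp only [Expr.cost] at ht ⊢
    omega

end

/-- Register `r` receives the number of labels (array 5) of the vertices that are marked in
array 4. The array `a`, initially zero, is used to mark the labels that have been counted. -/
def countHit (a r : ℕ) : Prog :=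
  .seq (.set r (.const 0)) (forLoop 37 (.const 0) (.reg 0)
    (.cond (.cell 4 (.reg 37))
      (.cond (.cell a (.cell 5 (.reg 37))) .skip
        (.seq (.store a (.cell 5 (.reg 37)) (.const 1)) (.set r (.op .add (.reg r) (.const 1)))))
      .skip))

theorem wp_countHit {a r : ℕ} {s : Store} {T : Set (Fin n)} (hn : s.reg 0 = n)
    (ha : ∀ i, s.arr a i = 0) (hT : Indicates T (s.arr 4)) (ha4 : a ≠ 4) (ha5 : a ≠ 5)
    (hr0 : r ≠ 0) (hr : r ≠ 37) :
    Wp (countHit a r) s fun s' t => s'.reg r = ((fun v : Fin n => s.arr 5 v) '' T).ncard ∧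
      t ≤ 40 * n + 20 := by
  have har : ∀ i, (countHit a r).setsArr i = (a == i) := by
    intro i
    simp [countHit, forLoop, Prog.setsArr]
  have hrr : ∀ i, (forLoop 37 (.const 0) (.reg 0)
    (.cond (.cell 4 (.reg 37))
      (.cond (.cell a (.cell 5 (.reg 37))) .skip
        (.seq (.store a (.cell 5 (.reg 37)) (.const 1)) (.set r (.op .add (.reg r) (.const 1)))))
      .skip)).setsReg i = ((37 == i) || (r == i)) := by
    intro i
    simp [forLoop, Prog.setsReg]
    grind
  have haa : ∀ i, (forLoop 37 (.const 0) (.reg 0)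
    (.cond (.cell 4 (.reg 37))
      (.cond (.cell a (.cell 5 (.reg 37))) .skip
        (.seq (.store a (.cell 5 (.reg 37)) (.const 1)) (.set r (.op .add (.reg r) (.const 1)))))
      .skip)).setsArr i = (a == i) := by
    intro i
    simp [forLoop, Prog.setsArr]
  rw [countHit, wp_seq, wp_set]
  -- `L` is the set of the labels that have been counted
  refine (wp_for_const 0 n 24 (fun j s' => ∃ L : Finset ℕ,
      (∀ x, x ∈ L ↔ ∃ v : Fin n, (v : ℕ) < j ∧ v ∈ T ∧ s.arr 5 v = x) ∧
      (∀ x, s'.arr a x ≠ 0 ↔ x ∈ L) ∧ s'.reg r = L.card)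
    rfl (Nat.zero_le _) ?_ ⟨∅, ?_⟩ (fun j s' hF _ _ => by
      simpa [Expr.eval, hn, hr0.symm] using hF.1 0 (by simp [hrr, hr0])) ?_).mono ?_
  · simp [Prog.setsReg, hr]
  · simp [Expr.eval, ha, hr]
  · rintro j s' - hj hF hr' ⟨L, h1, h2, h3⟩
    have e4 : s'.arr 4 = s.arr 4 := hF.2 4 (by simp [haa, ha4])
    have e5 : s'.arr 5 = s.arr 5 := hF.2 5 (by simp [haa, ha5])
    lift j to Fin n using hj
    have hstep : ∀ x, (∃ v : Fin n, (v : ℕ) < j + 1 ∧ v ∈ T ∧ s.arr 5 v = x) ↔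
        x ∈ L ∨ (j ∈ T ∧ s.arr 5 j = x) := by
      intro x
      rw [h1]
      constructor
      · rintro ⟨v, hv, hv', hv''⟩
        by_cases hvj : v = j
        · subst hvj
          exact Or.inr ⟨hv', hv''⟩
        · exact Or.inl ⟨v, by have := Fin.val_ne_of_ne hvj; omega, hv', hv''⟩
      · rintro (⟨v, hv, hv'⟩ | h)
        · exact ⟨v, by omega, hv'⟩
        · exact ⟨j, by omega, h⟩
    by_cases hjT : j ∈ T
    · by_cases hjL : s.arr 5 j ∈ L
      · have h4 : s'.arr a (s.arr 5 j) ≠ 0 := (h2 _).2 hjL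
        simp only [wp_seq, wp_store, wp_set, wp_cond, wp_skip, Expr.eval, Op.eval, Expr.cost, hr',
          e4, e5, (hT j).1 hjT, h4, one_ne_zero, ↓reduceIte]
        refine ⟨⟨L, fun x => ?_, h2, ?_⟩, by omega⟩
        · rw [hstep]
          grind
        · rw [Function.update_of_ne hr, h3]
      · have h4 : s'.arr a (s.arr 5 j) = 0 := by
          by_contra h
          exact hjL ((h2 _).1 h)
        simp only [wp_seq, wp_store, wp_set, wp_cond, wp_skip, Expr.eval, Op.eval, Expr.cost, hr',
          e4, e5, (hT j).1 hjT, h4, one_ne_zero, ↓reduceIte]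
        refine ⟨⟨insert (s.arr 5 j) L, fun x => ?_, fun x => ?_, ?_⟩, by omega⟩
        · rw [hstep, Finset.mem_insert]
          grind
        · rw [Function.update_self, Finset.mem_insert, ← h2]
          by_cases hx : x = s.arr 5 j
          · simp [hx]
          · simp [hx]
        · rw [Function.update_of_ne hr, Function.update_self, Finset.card_insert_of_notMem hjL, h3]
    · simp only [wp_seq, wp_store, wp_set, wp_cond, wp_skip, Expr.eval, Op.eval, Expr.cost, hr',
          e4, e5, (hT j).2 hjT, ↓reduceIte]
      refine ⟨⟨L, fun x => ?_, h2, ?_⟩, by omega⟩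
      · rw [hstep]
        grind
      · rw [Function.update_of_ne hr, h3]
  · rintro s' t ⟨⟨-, L, h1, -, h3⟩, ht⟩
    constructor
    · rw [h3, ← Set.ncard_coe_finset]
      congr 1
      ext x
      simp [h1]
    · simp only [Expr.cost] at ht ⊢
      omega

/-- Register 41 receives the sum of the degrees in `G[T]`, and register 42 becomes non-zero if some
vertex of `T` is adjacent to all others. -/
def sumDegrees : Prog :=
  .seq (.set 41 (.const 0)) (.seq (.set 42 (.const 0)) (forLoop 38 (.const 0) (.reg 0)
    (.cond (.cell 4 (.reg 38))
      (.seq (.set 40 (.const 0))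
        (.seq (forLoop 39 (.cell 1 (.reg 38)) (.cell 1 (.op .add (.reg 38) (.const 1)))
          (.set 40 (.op .add (.reg 40) (.cell 4 (.cell 2 (.reg 39))))))
        (.seq (.set 41 (.op .add (.reg 41) (.reg 40)))
          (.cond (.op .eq (.op .add (.reg 40) (.const 1)) (.reg 10)) (.set 42 (.const 1)) .skip))))
      .skip)))

section
variable {G : SimpleGraph (Fin n)} {δ : Fin n → Fin 2} {k : ℕ} {s₀ s : Store} {T : Set (Fin n)}

theorem wp_sumDegrees (h : IsInput G δ k s₀) (hs : Holds n s₀ s) (hT : Indicates T (s.arr 4))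
    (ht : s.reg 10 = T.ncard) :
    Wp sumDegrees s fun s' t => (s'.reg 41 = sumBelow T (fun v => (G.neighborSet v ∩ T).ncard) n ∧
      (s'.reg 42 ≠ 0 ↔ ∃ c ∈ T, (G.neighborSet c ∩ T).ncard + 1 = T.ncard)) ∧
      t ≤ 70 * (n + s₀.arr 1 n) + 20 := by
  rw [sumDegrees]
  simp only [wp_seq, wp_set, Expr.eval, Expr.cost]
  refine (wp_for 0 n (fun j s' t =>
      s'.reg 41 = sumBelow T (fun v => (G.neighborSet v ∩ T).ncard) j ∧
      (s'.reg 42 ≠ 0 ↔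
        ∃ c : Fin n, (c : ℕ) < j ∧ c ∈ T ∧ (G.neighborSet c ∩ T).ncard + 1 = T.ncard) ∧
      t ≤ 40 * j + 30 * s₀.arr 1 j)
    rfl (Nat.zero_le _) rfl ?_ (fun j s' t hF _ _ => by
      simpa [Expr.eval, hs.size] using hF.1 0 rfl) ?_).mono ?_
  · simp [sumBelow]
  · rintro j s' t - hj hF hr ⟨h1, h2, h3⟩
    have e4 : s'.arr 4 = s.arr 4 := hF.2 4 rfl
    have e1 : s'.arr 1 = s₀.arr 1 := (hF.2 1 rfl).trans hs.start
    have e2 : s'.arr 2 = s₀.arr 2 := (hF.2 2 rfl).trans hs.list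
    have e10 : s'.reg 10 = T.ncard := (hF.1 10 rfl).trans (by simpa using ht)
    lift j to Fin n using hj
    have hmono := h.mono j
    have hex : (∃ c : Fin n, (c : ℕ) < j + 1 ∧ c ∈ T ∧ (G.neighborSet c ∩ T).ncard + 1 = T.ncard) ↔
        s'.reg 42 ≠ 0 ∨ (j ∈ T ∧ (G.neighborSet j ∩ T).ncard + 1 = T.ncard) := by
      rw [h2]
      constructor
      · rintro ⟨v, hv, hv'⟩
        by_cases hvj : v = j
        · subst hvj
          exact Or.inr hv'
        · exact Or.inl ⟨v, by have := Fin.val_ne_of_ne hvj; omega, hv'⟩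
      · rintro (⟨v, hv, hv'⟩ | h)
        · exact ⟨v, by omega, hv'⟩
        · exact ⟨j, by omega, h⟩
    rw [sumBelow_succ, hex]
    by_cases hjT : j ∈ T
    · simp only [wp_cond, wp_seq, wp_set, Expr.eval, Op.eval, Expr.cost, hr, e4, (hT j).1 hjT,
        one_ne_zero, ↓reduceIte]
      refine (wp_for_const (s₀.arr 1 j) (s₀.arr 1 (j + 1)) 6 (fun i s'' =>
        s''.reg 40 = ∑ e ∈ Finset.Ico (s₀.arr 1 j) i, s.arr 4 (s₀.arr 2 e)) ?_ hmono rfl ?_ ?_ ?_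
        ).mono' ?_
      · simp [Expr.eval, hr, e1]
      · simp
      · intro i s'' hF' _ _
        have a1 : s''.arr 1 = s₀.arr 1 := (hF'.2 1 rfl).trans e1
        have a2 : s''.reg 38 = j := by simpa [hr] using hF'.1 38 rfl
        simp [Expr.eval, Op.eval, a1, a2]
      · intro i s'' hi hi' hF' hr' hI
        have a2 : s''.arr 2 = s₀.arr 2 := (hF'.2 2 rfl).trans e2
        have a4 : s''.arr 4 = s.arr 4 := (hF'.2 4 rfl).trans e4
        simp only [wp_set, Expr.eval, Op.eval, Expr.cost, Function.update_self,
          Function.update_of_ne, ne_eq, Nat.reduceEqDiff, not_false_eq_true, hr', a2, a4, hI,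
          Finset.sum_Ico_succ_top hi]
        exact ⟨trivial, by omega⟩
      · rintro s'' t' hF' ⟨⟨-, h4⟩, ht'⟩
        rw [h.sum_list hT] at h4
        have b41 : s''.reg 41 = s'.reg 41 := by simpa using hF'.1 41 rfl
        have b42 : s''.reg 42 = s'.reg 42 := by simpa using hF'.1 42 rfl
        have b10 : s''.reg 10 = T.ncard := by simpa using (hF'.1 10 rfl).trans (by simpa using e10)
        simp only [Expr.cost] at ht'
        by_cases hc : (G.neighborSet j ∩ T).ncard + 1 = T.ncard
        · simp only [wp_cond, wp_seq, wp_set, Expr.eval, Op.eval, Expr.cost, Function.update_self,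
            Function.update_of_ne, ne_eq, Nat.reduceEqDiff, not_false_eq_true, h4, b41, b42, b10,
            hc, one_ne_zero, ↓reduceIte, hjT, h1]
          refine ⟨trivial, by simp, by omega⟩
        · simp only [wp_cond, wp_seq, wp_set, wp_skip, Expr.eval, Op.eval, Expr.cost,
            Function.update_self,
            Function.update_of_ne, ne_eq, Nat.reduceEqDiff, not_false_eq_true, h4, b41, b42, b10,
            hc, ↓reduceIte, hjT, h1]
          refine ⟨trivial, by simp, by omega⟩
    · simp only [wp_cond, wp_skip, Expr.eval, Op.eval, Expr.cost, hr, e4, (hT j).2 hjT,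
        Function.update_of_ne, ne_eq, Nat.reduceEqDiff, not_false_eq_true, ↓reduceIte, h1, hjT]
      refine ⟨rfl, by simp, by omega⟩
  · rintro s' t ⟨-, t', ⟨h1, h2, h3⟩, h4⟩
    refine ⟨⟨h1, h2.trans ⟨?_, ?_⟩⟩, ?_⟩
    · rintro ⟨c, -, h5⟩
      exact ⟨c, h5⟩
    · rintro ⟨c, h5⟩
      exact ⟨c, c.2, h5⟩
    · simp only [Expr.cost] at h4 ⊢
      omega

end
end

/-- Computes the numbers on which the optimum depends: `n` in register 0, `|T|` in register 10, the
number of components in register 11, the number of components that meet `T` in register 12, and the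
data for the recognition of a star of bridges: the sum of the degrees in `G[T]` in register 41,
whether some vertex of `T` is adjacent to all others in register 42, and in register 13 the number
of components that meet `T` once the edges inside `T` are dropped. -/
def analyse : Prog :=
  .seq tables (.seq markWrong (.seq bfs (.seq (.set 11 (.reg 30)) (.seq (countHit 8 12)
    (.seq sumDegrees (.seq (forLoop 37 (.const 0) (.reg 0) (.store 7 (.reg 37) (.cell 4 (.reg 37))))
      (.seq bfs (countHit 9 13))))))))

/-- Evaluates the formula for the optimum: register 20 becomes `0` if there is no solution, and
otherwise register 20 becomes `1` and register 21 the optimum. A conjunction of comparisons is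
evaluated as an equation between their number and their sum. -/
def evalFormula : Prog :=
  .seq (.set 14 (.op .sub (.reg 11) (.reg 12)))
  (.seq (.set 20 (.op .sub (.const 1) (.op .add (.cell 3 (.reg 10))
    (.op .eq (.const 2) (.op .add (.op .eq (.reg 0) (.const 2)) (.op .add
      (.op .eq (.const 2) (.op .add (.op .eq (.reg 11) (.const 1)) (.op .eq (.reg 10) (.const 2))))
      (.op .eq (.const 2)
        (.op .add (.op .eq (.reg 11) (.const 2)) (.op .eq (.reg 10) (.const 0))))))))))
  (.seq (.set 22 (.op .eq (.const 4) (.op .add (.op .lt (.const 1) (.reg 10)) (.op .add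
    (.op .eq (.op .add (.reg 41) (.const 2)) (.op .add (.reg 10) (.reg 10))) (.op .add
    (.op .lt (.const 0) (.reg 42)) (.op .eq (.reg 13) (.reg 10)))))))
  (.seq (.set 23 (.op .add
    (.op .eq (.const 3) (.op .add (.op .eq (.reg 14) (.const 0)) (.op .add
      (.op .eq (.reg 12) (.const 1)) (.reg 22))))
    (.op .eq (.const 2) (.op .add (.op .eq (.reg 14) (.const 2)) (.op .eq (.reg 12) (.const 0))))))
  (.seq (.cond (.reg 12)
    (.cond (.op .lt (.op .sub (.reg 11) (.const 1)) (.op .add (.reg 14) (.cell 11 (.reg 10))))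
      (.set 21 (.op .add (.reg 14) (.cell 11 (.reg 10))))
      (.set 21 (.op .sub (.reg 11) (.const 1))))
    (.cond (.op .lt (.const 1) (.reg 14)) (.set 21 (.reg 14)) (.set 21 (.const 0))))
    (.set 21 (.op .add (.reg 21) (.reg 23)))))))

section
variable {n : ℕ} {G : SimpleGraph (Fin n)} {δ : Fin n → Fin 2} {k : ℕ} {s : Store}

/-- The memory after the analysis of the input. -/
structure Analysed (G : SimpleGraph (Fin n)) (δ : Fin n → Fin 2) (s : Store) : Prop where
  size : s.reg 0 = n
  count : s.reg 10 = (wrong G δ).ncard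
  components : s.reg 11 = numFree G (wrong G δ) + numHit G (wrong G δ)
  hit : s.reg 12 = numHit G (wrong G δ)
  star : IsBridgeStar G (wrong G δ) ↔ 2 ≤ s.reg 10 ∧ s.reg 41 + 2 = 2 * s.reg 10 ∧ s.reg 42 ≠ 0 ∧
    s.reg 13 = s.reg 10
  parity : s.arr 3 (s.reg 10) = s.reg 10 % 2
  half : s.arr 11 (s.reg 10) = s.reg 10 / 2

theorem ncard_le_card (T : Set (Fin n)) : T.ncard ≤ n := by
  have := Set.ncard_le_ncard (Set.subset_univ T) (Set.toFinite _)
  rwa [Set.ncard_univ, Nat.card_fin] at this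

theorem wp_analyse (h : IsInput G δ k s) :
    Wp analyse s fun s' t => Analysed G δ s' ∧ t ≤ 500 * (n + s.arr 1 n) + 500 := by
  set T := wrong G δ with hTdef
  rw [analyse, wp_seq]
  refine (wp_tables h.size (h.arr_zero 3 (by omega) 0) (h.arr_zero 11 (by omega) 0)).mono' ?_
  rintro s1 t1 hF1 ⟨h1, ht1⟩
  have hs1 : Holds n s s1 := ⟨(hF1.1 0 rfl).trans h.size, hF1.2 1 rfl, hF1.2 2 rfl⟩
  rw [wp_seq]
  refine (wp_markWrong h hs1 (hF1.2 0 rfl) fun i hi => (h1 i hi).1).mono' ?_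
  rintro s2 t2 hF2 ⟨⟨h2, h2'⟩, ht2⟩
  have hs2 : Holds n s s2 := ⟨(hF2.1 0 rfl).trans hs1.size, (hF2.2 1 rfl).trans hs1.start,
    (hF2.2 2 rfl).trans hs1.list⟩
  rw [wp_seq]
  have hz : ∀ a, 3 ≤ a → s2.arr a = s1.arr a → s1.arr a = s.arr a → ∀ i, s2.arr a i = 0 :=
    fun a ha e1 e2 i => by rw [e1, e2, h.arr_zero a ha]
  refine (wp_bfs (K := G) hs2.size ?_).mono' ?_
  · rw [hs2.start, hs2.list]
    exact h.adjLists fun v => hz 7 (by omega) (hF2.2 7 rfl) (hF1.2 7 rfl) v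
  rintro s3 t3 hF3 ⟨h3, ht3⟩
  rw [hs2.start] at ht3
  rw [wp_seq, wp_set, wp_seq]
  have i4 : Indicates T (s3.arr 4) := by
    rw [hF3.2 4 rfl]
    exact h2
  refine (wp_countHit (a := 8) (r := 12) (n := n) (T := T) ?_ ?_ (by simpa using i4)
    (by omega) (by omega) (by omega) (by omega)).mono' ?_
  · simpa using (hF3.1 0 rfl).trans hs2.size
  · intro i
    simpa [hF3.2 8 rfl] using hz 8 (by omega) (hF2.2 8 rfl) (hF1.2 8 rfl) i
  rintro s4 t4 hF4 ⟨h4, ht4⟩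
  simp only at h4
  have hs4 : Holds n s s4 := by
    refine ⟨?_, ?_, ?_⟩
    · simpa [hF3.1 0 rfl, hs2.size] using hF4.1 0 rfl
    · simpa [hF3.2 1 rfl, hs2.start] using hF4.2 1 rfl
    · simpa [hF3.2 2 rfl, hs2.list] using hF4.2 2 rfl
  have j4 : Indicates T (s4.arr 4) := by
    rw [hF4.2 4 rfl]
    exact i4
  have k4 : s4.reg 10 = T.ncard := by
    simpa [hF3.1 10 rfl, h2'] using hF4.1 10 rfl
  have l4 : s4.reg 11 = s3.reg 30 := by simpa [Expr.eval] using hF4.1 11 rfl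
  rw [wp_seq]
  refine (wp_sumDegrees h hs4 j4 k4).mono' ?_
  rintro s5 t5 hF5 ⟨⟨h5, h5'⟩, ht5⟩
  have hs5 : Holds n s s5 := ⟨(hF5.1 0 rfl).trans hs4.size, (hF5.2 1 rfl).trans hs4.start,
    (hF5.2 2 rfl).trans hs4.list⟩
  have j5 : Indicates T (s5.arr 4) := by
    rw [hF5.2 4 rfl]
    exact j4
  rw [wp_seq]
  refine (wp_for_const 0 n 5 (fun j s' => ∀ v : Fin n, (v : ℕ) < j → s'.arr 7 v = s5.arr 4 v)
    rfl (Nat.zero_le _) rfl (by simp) (fun j s' hF _ _ => by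
      simpa [Expr.eval, hs5.size] using hF.1 0 rfl) ?_).mono' ?_
  · intro j s' _ hj hF hr hI
    have e4 : s'.arr 4 = s5.arr 4 := hF.2 4 rfl
    simp only [wp_store, Expr.eval, Expr.cost, hr, e4, Function.update_self]
    refine ⟨fun v hv => ?_, by omega⟩
    by_cases hvj : (v : ℕ) = j
    · simp [hvj]
    · rw [Function.update_of_ne hvj]
      exact hI v (by omega)
  rintro s6 t6 hF6 ⟨⟨-, h6⟩, ht6⟩
  have hs6 : Holds n s s6 := ⟨(hF6.1 0 rfl).trans hs5.size, (hF6.2 1 rfl).trans hs5.start,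
    (hF6.2 2 rfl).trans hs5.list⟩
  have j6 : Indicates T (s6.arr 4) := by
    rw [hF6.2 4 rfl]
    exact j5
  rw [wp_seq]
  refine (wp_bfs (K := dropInside G T) hs6.size ?_).mono' ?_
  · rw [hs6.start, hs6.list]
    refine h.adjLists_dropInside fun v => ?_
    rw [h6 v v.2]
    exact j5 v
  rintro s7 t7 hF7 ⟨h7, ht7⟩
  rw [hs6.start] at ht7
  refine (wp_countHit (a := 9) (r := 13) (n := n) (T := T) ((hF7.1 0 rfl).trans hs6.size) ?_
    (by rw [hF7.2 4 rfl]; exact j6) (by omega) (by omega) (by omega) (by omega)).mono' ?_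
  · intro i
    rw [hF7.2 9 rfl, hF6.2 9 rfl, hF5.2 9 rfl]
    rw [hF4.2 9 rfl]
    simpa [hF3.2 9 rfl] using hz 9 (by omega) (hF2.2 9 rfl) (hF1.2 9 rfl) i
  rintro s8 t8 hF8 ⟨h8, ht8⟩
  have c10 : s8.reg 10 = T.ncard := by
    rw [hF8.1 10 rfl, hF7.1 10 rfl, hF6.1 10 rfl, hF5.1 10 rfl, k4]
  have c11 : s8.reg 11 = s3.reg 30 := by
    rw [hF8.1 11 rfl, hF7.1 11 rfl, hF6.1 11 rfl, hF5.1 11 rfl, l4]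
  have c12 : s8.reg 12 = numHit G T := by
    rw [hF8.1 12 rfl, hF7.1 12 rfl, hF6.1 12 rfl, hF5.1 12 rfl, h4, h3.ncard_image]
  have c41 : s8.reg 41 = sumBelow T (fun v => (G.neighborSet v ∩ T).ncard) n := by
    rw [hF8.1 41 rfl, hF7.1 41 rfl, hF6.1 41 rfl, h5]
  have c42 : s8.reg 42 = s5.reg 42 := by
    rw [hF8.1 42 rfl, hF7.1 42 rfl, hF6.1 42 rfl]
  have hpar : ∀ a, s8.arr a = s7.arr a → s7.arr a = s6.arr a → s6.arr a = s5.arr a →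
      s5.arr a = s4.arr a → s4.arr a = s3.arr a → s3.arr a = s2.arr a → s2.arr a = s1.arr a →
      s8.arr a = s1.arr a := by
    intro a e1 e2 e3 e4 e5 e6 e7
    rw [e1, e2, e3, e4, e5, e6, e7]
  refine ⟨⟨?_, c10, ?_, c12, ?_, ?_, ?_⟩, ?_⟩
  · rw [hF8.1 0 rfl, hF7.1 0 rfl, hs6.size]
  · rw [c11, numFree_add_numHit, h3.card_eq]
  · classical
    rw [isBridgeStar_iff_sum, ← h7.numHit_eq_ncard_iff, c10, c41, sumBelow_eq, c42, h5', h8,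
      h7.ncard_image]
  · rw [hpar 3 (hF8.2 3 rfl) (hF7.2 3 rfl) (hF6.2 3 rfl) (hF5.2 3 rfl) (hF4.2 3 rfl) (hF3.2 3 rfl)
      (hF2.2 3 rfl), c10]
    exact (h1 _ (ncard_le_card T)).1
  · rw [hpar 11 (hF8.2 11 rfl) (hF7.2 11 rfl) (hF6.2 11 rfl) (hF5.2 11 rfl) (hF4.2 11 rfl)
      (hF3.2 11 rfl) (hF2.2 11 rfl), c10]
    exact (h1 _ (ncard_le_card T)).2
  · simp only [Expr.cost] at ht6 ⊢
    omega

theorem two_eq_boole_add (p q : Prop) [Decidable p] [Decidable q] :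
    (if 2 = (if p then 1 else 0) + (if q then 1 else 0) then 1 else 0 : ℕ) =
      if p ∧ q then 1 else 0 := by
  by_cases hp : p <;> by_cases hq : q <;> simp [hp, hq]

theorem three_eq_boole_add (p q r : Prop) [Decidable p] [Decidable q] [Decidable r] :
    (if 3 = (if p then 1 else 0) + ((if q then 1 else 0) + (if r then 1 else 0))
      then 1 else 0 : ℕ) = if p ∧ q ∧ r then 1 else 0 := by
  by_cases hp : p <;> by_cases hq : q <;> by_cases hr : r <;> simp [hp, hq, hr]

theorem four_eq_boole_add (p q r u : Prop) [Decidable p] [Decidable q] [Decidable r] [Decidable u] :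
    (if 4 = (if p then 1 else 0) + ((if q then 1 else 0) + ((if r then 1 else 0) +
      (if u then 1 else 0))) then 1 else 0 : ℕ) = if p ∧ q ∧ r ∧ u then 1 else 0 := by
  by_cases hp : p <;> by_cases hq : q <;> by_cases hr : r <;> by_cases hu : u <;>
    simp [hp, hq, hr, hu]

theorem wp_evalFormula [NeZero n] (h : Analysed G δ s) :
    Wp evalFormula s fun s' t => ((opt G δ = ⊤ → s'.reg 20 = 0) ∧
      (opt G δ ≠ ⊤ → s'.reg 20 = 1 ∧ (s'.reg 21 : ℕ∞) = opt G δ)) ∧ t ≤ 200 := by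
  classical
  have htriv := opt_eq_top_iff_isTrivialNo (G := G) (δ := δ)
  have hopt := opt_eq (G := G) (δ := δ)
  rw [isTrivialNo_iff] at htriv hopt
  rw [h.star] at hopt
  rw [← numFree_add_numHit G (wrong G δ), ← h.components, ← h.count, Nat.card_fin] at htriv hopt
  rw [← h.hit] at hopt
  have hp : numFree G (wrong G δ) = s.reg 11 - s.reg 12 := by
    rw [h.components, h.hit]
    omega
  have hle : s.reg 12 ≤ s.reg 11 := by
    rw [h.components, h.hit]
    omega
  rw [hp] at hopt
  have hpar := h.parity
  have hhalf := h.half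
  have hsize := h.size
  simp only [evalFormula, wp_seq, wp_set, wp_cond, Expr.eval, Op.eval, Expr.cost,
    Function.update_self, Function.update_of_ne, ne_eq, Nat.reduceEqDiff, not_false_eq_true,
    hpar, hhalf, hsize]
  generalize s.reg 10 = a10 at *
  generalize s.reg 11 = a11 at *
  generalize s.reg 12 = a12 at *
  generalize s.reg 13 = a13 at *
  generalize s.reg 41 = a41 at *
  generalize s.reg 42 = a42 at *
  have e20 : 1 - (a10 % 2 + if 2 = (if n = 2 then 1 else 0) +
      ((if a11 = 1 ∧ a10 = 2 then 1 else 0) + if a11 = 2 ∧ a10 = 0 then 1 else 0) then 1 else 0) =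
      if opt G δ = ⊤ then 0 else 1 := by
    rw [Nat.odd_iff] at htriv
    by_cases hT : opt G δ = ⊤
    · have := htriv.1 hT
      rw [if_pos hT]
      split_ifs <;> omega
    · have := mt htriv.2 hT
      rw [if_neg hT]
      split_ifs <;> omega
  have e23 : ((if a11 - a12 = 0 ∧ a12 = 1 ∧ 1 < a10 ∧ a41 + 2 = a10 + a10 ∧ 0 < a42 ∧ a13 = a10
      then 1 else 0) + if a11 - a12 = 2 ∧ a12 = 0 then 1 else 0) =
      if a11 - a12 = 0 ∧ a12 = 1 ∧ 2 ≤ a10 ∧ a41 + 2 = 2 * a10 ∧ a42 ≠ 0 ∧ a13 = a10 ∨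
        a11 - a12 = 2 ∧ a12 = 0 then 1 else 0 := by
    split_ifs <;> omega
  simp only [two_eq_boole_add, three_eq_boole_add, four_eq_boole_add, e20, e23]
  rw [← htriv] at hopt
  have key : ∀ x, x = Nform (a11 - a12) a12 a10 →
      (opt G δ = ⊤ → (if opt G δ = ⊤ then 0 else 1) = 0) ∧
      (¬ opt G δ = ⊤ → (if opt G δ = ⊤ then 0 else 1) = 1 ∧
        ((x + if a11 - a12 = 0 ∧ a12 = 1 ∧ 2 ≤ a10 ∧ a41 + 2 = 2 * a10 ∧ a42 ≠ 0 ∧ a13 = a10 ∨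
          a11 - a12 = 2 ∧ a12 = 0 then 1 else 0 : ℕ) : ℕ∞) = opt G δ) := by
    rintro x rfl
    refine ⟨fun h => if_pos h, fun h => ⟨if_neg h, by convert (hopt h).symm⟩⟩
  rw [Nform] at key
  by_cases c1 : a12 = 0
  · by_cases c2 : 1 < a11 - a12
    · rw [if_pos c1, if_neg (by simp [c2])]
      refine ⟨key _ ?_, by omega⟩
      rw [if_pos c1, if_neg (by omega)]
    · rw [if_pos c1, if_pos (by simp [c2])]
      refine ⟨key _ ?_, by omega⟩
      rw [if_pos c1, if_pos (by omega)]
  · by_cases c2 : a11 - 1 < a11 - a12 + a10 / 2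
    · rw [if_neg c1, if_neg (by simp [c2])]
      refine ⟨key _ ?_, by omega⟩
      rw [if_neg c1]
      omega
    · rw [if_neg c1, if_pos (by simp [c2])]
      refine ⟨key _ ?_, by omega⟩
      rw [if_neg c1]
      omega

/-- Computes the optimum in linear time. -/
def optProg : Prog :=
  .seq analyse (.seq evalFormula (.seq (.set 0 (.reg 20)) (.set 1 (.reg 21))))

/-- Decides in linear time whether the optimum is at most the number in register 1. -/
def decideProg : Prog :=
  .seq analyse (.seq evalFormula (.set 0 (.op .eq (.const 2)
    (.op .add (.reg 20) (.op .sub (.const 1) (.op .lt (.reg 1) (.reg 21)))))))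

theorem wp_optProg [NeZero n] (h : IsInput G δ k s) :
    Wp optProg s fun s' t => t ≤ 2000 * (n + G.edgeSet.ncard) ∧ ReturnsValue (opt G δ) s' := by
  have hn := Nat.pos_of_ne_zero (NeZero.ne n)
  rw [optProg, wp_seq]
  refine (wp_analyse h).mono fun s1 t1 ⟨h1, ht1⟩ => ?_
  rw [wp_seq]
  refine (wp_evalFormula h1).mono fun s2 t2 ⟨⟨h2, h3⟩, ht2⟩ => ?_
  rw [h.arr_one_eq] at ht1
  simp only [wp_seq, wp_set, Expr.eval, Expr.cost]
  refine ⟨by omega, ?_, ?_⟩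
  · simpa using h2
  · simpa using h3

theorem wp_decideProg [NeZero n] (h : IsInput G δ k s) :
    Wp decideProg s fun s' t => t ≤ 2000 * (n + G.edgeSet.ncard) ∧ Answers (CDPE G δ k) s' := by
  have hn := Nat.pos_of_ne_zero (NeZero.ne n)
  rw [decideProg, wp_seq]
  refine (wp_analyse h).mono' fun s1 t1 hF1 ⟨h1, ht1⟩ => ?_
  rw [wp_seq]
  refine (wp_evalFormula h1).mono' fun s2 t2 hF2 ⟨⟨h2, h3⟩, ht2⟩ => ?_
  rw [h.arr_one_eq] at ht1
  have hk : s2.reg 1 = k := by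
    rw [hF2.1 1 rfl, hF1.1 1 rfl, h.budget]
  simp only [wp_set, Expr.eval, Op.eval, Expr.cost, hk]
  refine ⟨by omega, ?_⟩
  simp only [Answers, cdpe_iff, Function.update_self]
  by_cases hT : opt G δ = ⊤
  · simp only [hT, h2 hT, top_le_iff, ENat.natCast_ne_top]
    refine ⟨False.elim, fun _ => if_neg ?_⟩
    omega
  · obtain ⟨h4, h5⟩ := h3 hT
    rw [← h5, h4, Nat.cast_le]
    by_cases hle : s2.reg 21 ≤ k
    · simp [hle, not_lt.2 hle]
    · simp [hle, not_le.1 hle]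

end

/-! ### Adjacency matrices -/

section
variable {n : ℕ}

/-- The array `x` holds the matrix of the relation `R`, row by row. -/
def IsRel (R : Fin n → Fin n → Prop) (x : ℕ → ℕ) : Prop :=
  ∀ u v : Fin n, (R u v → x (u * n + v) = 1) ∧ (¬ R u v → x (u * n + v) = 0)

theorem cell_inj {a b u v : Fin n} (h : (u : ℕ) * n + v = a * n + b) : u = a ∧ v = b := by
  have h1 : (u : ℕ) = a := by
    have := congrArg (· / n) h
    have hn : 0 < n := u.pos
    simpa [Nat.mul_add_div, mul_comm _ n, hn, Nat.div_eq_of_lt] using this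
  have h2 : (v : ℕ) = b := by
    rw [h1] at h
    omega
  exact ⟨Fin.ext h1, Fin.ext h2⟩

theorem cell_lt (u v : Fin n) : (u : ℕ) * n + v < n * n := by
  have h1 : ((u : ℕ) + 1) * n ≤ n * n := Nat.mul_le_mul_right _ u.2
  have := v.2
  have h2 : ((u : ℕ) + 1) * n = u * n + n := by ring
  omega

theorem IsRel.set {R R' : Fin n → Fin n → Prop} {x : ℕ → ℕ} (h : IsRel R x) (a b : Fin n) {y : ℕ}
    (hR : ∀ u v, ¬ (u = a ∧ v = b) → (R' u v ↔ R u v)) (h1 : R' a b → y = 1)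
    (h0 : ¬ R' a b → y = 0) : IsRel R' (Function.update x (a * n + b) y) := by
  intro u v
  by_cases huv : u = a ∧ v = b
  · obtain ⟨rfl, rfl⟩ := huv
    rw [Function.update_self]
    exact ⟨h1, h0⟩
  · rw [Function.update_of_ne fun he => huv (cell_inj he), hR u v huv]
    exact h u v

theorem IsRel.congr {R R' : Fin n → Fin n → Prop} {x : ℕ → ℕ} (h : IsRel R x)
    (hR : ∀ u v, R' u v ↔ R u v) : IsRel R' x := by
  intro u v
  rw [hR]
  exact h u v

/-- The memory holds `n`, the multiples of `n` (array 12), and zeros in the arrays 7 and 16. The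
multiples serve for the access to matrices, since the machine cannot multiply; array 7 marks the
edges to be ignored by breadth-first search, of which there are none, and array 16 is the empty
matrix. -/
structure Ctx (n : ℕ) (s : Store) : Prop where
  size : s.reg 0 = n
  zero : ∀ i, s.arr 7 i = 0
  row : ∀ i ≤ n, s.arr 12 i = i * n
  zero' : ∀ i, s.arr 16 i = 0

theorem Ctx.of_frame {P : Prog} {s s' : Store} (h : Ctx n s) (hF : Frame P s s')
    (h0 : P.setsReg 0 = false := by rfl) (h7 : P.setsArr 7 = false := by rfl)
    (h12 : P.setsArr 12 = false := by rfl) (h16 : P.setsArr 16 = false := by rfl) : Ctx n s' where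
  size := (hF.1 0 h0).trans h.size
  zero i := by rw [hF.2 7 h7, h.zero]
  row i hi := by rw [hF.2 12 h12, h.row i hi]
  zero' i := by rw [hF.2 16 h16, h.zero']

/-- Array 12 receives the multiples of `n`. -/
def rows : Prog :=
  forLoop 37 (.const 0) (.reg 0)
    (.store 12 (.op .add (.reg 37) (.const 1)) (.op .add (.cell 12 (.reg 37)) (.reg 0)))

theorem wp_rows {s : Store} (hn : s.reg 0 = n) (h12 : s.arr 12 0 = 0) :
    Wp rows s fun s' t => (∀ i ≤ n, s'.arr 12 i = i * n) ∧ t ≤ 30 * n + 10 := by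
  refine (wp_for_const 0 n 20 (fun j s' => ∀ i ≤ j, s'.arr 12 i = i * n)
    rfl (Nat.zero_le _) rfl ?_ (fun j s' hF _ _ => by simpa [Expr.eval] using (hF.1 0 rfl).trans hn)
    ?_).mono ?_
  · intro i hi
    obtain rfl : i = 0 := by omega
    simp [h12]
  · intro j s' _ _ hF hr hI
    have h1 := hI j le_rfl
    have h0 : s'.reg 0 = n := (hF.1 0 rfl).trans hn
    simp only [wp_store, Expr.eval, Op.eval, Expr.cost, hr, Function.update_self, h1, h0]
    refine ⟨fun i hi => ?_, by omega⟩
    by_cases hij : i = j + 1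
    · subst hij
      rw [Function.update_self]
      ring
    · rw [Function.update_of_ne hij]
      exact hI i (by omega)
  · rintro s' t ⟨⟨-, h⟩, ht⟩
    refine ⟨h, ?_⟩
    simp only [Expr.cost] at ht
    omega

/-- Copies the matrix in array `a` to array `b`. -/
def copyMatrix (a b : ℕ) : Prog :=
  forLoop 37 (.const 0) (.cell 12 (.reg 0)) (.store b (.reg 37) (.cell a (.reg 37)))

theorem wp_copyMatrix {s : Store} {a b : ℕ} (hab : a ≠ b) (hb : b ≠ 12) (h : Ctx n s)
    {R : Fin n → Fin n → Prop} (hR : IsRel R (s.arr a)) :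
    Wp (copyMatrix a b) s fun s' t => IsRel R (s'.arr b) ∧ t ≤ 20 * n ^ 2 + 10 := by
  have hset : ∀ i, (copyMatrix a b).setsArr i = (b == i) := by
    intro i
    simp [copyMatrix, forLoop, Prog.setsArr]
  refine (wp_for_const 0 (n * n) 5 (fun j s' => ∀ i < j, s'.arr b i = s.arr a i)
    rfl (Nat.zero_le _) rfl (by simp) (fun j s' hF _ _ => ?_) ?_).mono ?_
  · have h1 : s'.arr 12 = s.arr 12 := hF.2 12 ((hset 12).trans (by simpa using hb))
    have h2 : s'.reg 0 = n := (hF.1 0 rfl).trans h.size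
    simp only [Expr.eval, h1, h2, h.row n le_rfl]
  · intro j s' _ hj hF hr hI
    have h1 : s'.arr a = s.arr a := hF.2 a ((hset a).trans (by simpa using hab.symm))
    simp only [wp_store, Expr.eval, Expr.cost, hr, Function.update_self, h1]
    refine ⟨fun i hi => ?_, by omega⟩
    by_cases hij : i = j
    · simp [hij]
    · rw [Function.update_of_ne hij]
      exact hI i (by omega)
  · rintro s' t ⟨⟨-, h1⟩, ht⟩
    constructor
    · intro u v
      rw [h1 _ (cell_lt u v)]
      exact hR u v
    · simp only [Expr.cost, Nat.sub_zero] at ht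
      rw [sq]
      omega

/-- Turns the adjacency lists into a matrix in array 13. -/
def buildMatrix : Prog :=
  forLoop 44 (.const 0) (.reg 0)
    (forLoop 45 (.cell 1 (.reg 44)) (.cell 1 (.op .add (.reg 44) (.const 1)))
      (.store 13 (.op .add (.cell 12 (.reg 44)) (.cell 2 (.reg 45))) (.const 1)))

theorem wp_buildMatrix {G : SimpleGraph (Fin n)} {δ : Fin n → Fin 2} {k : ℕ} {s₀ s : Store}
    (h : IsInput G δ k s₀) (hs : Ctx n s) (h1 : s.arr 1 = s₀.arr 1) (h2 : s.arr 2 = s₀.arr 2)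
    (h13 : ∀ i, s.arr 13 i = 0) :
    Wp buildMatrix s fun s' t => IsRel G.Adj (s'.arr 13) ∧ t ≤ 30 * n ^ 2 + 40 * n + 10 := by
  refine (wp_for_const 0 n (30 * n + 30) (fun j s' =>
    IsRel (fun u v => (u : ℕ) < j ∧ G.Adj u v) (s'.arr 13))
    rfl (Nat.zero_le _) rfl (fun u v => by simp [h13])
    (fun j s' hF _ _ => by simpa [Expr.eval] using (hF.1 0 rfl).trans hs.size) ?_).mono ?_
  · intro j s' _ hj hF hr hI
    have hs' := hs.of_frame hF
    have e1 : s'.arr 1 = s₀.arr 1 := (hF.2 1 rfl).trans h1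
    have e2 : s'.arr 2 = s₀.arr 2 := (hF.2 2 rfl).trans h2
    lift j to Fin n using hj
    refine (wp_for_const (s₀.arr 1 j) (s₀.arr 1 (j + 1)) 10 (fun i s'' =>
      IsRel (fun u v => G.Adj u v ∧ ((u : ℕ) < j ∨ u = j ∧
        ∃ e, s₀.arr 1 j ≤ e ∧ e < i ∧ s₀.arr 2 e = v)) (s''.arr 13))
      (by simp [Expr.eval, hr, e1]) (h.mono j) rfl ?_ ?_ ?_).mono ?_
    · refine hI.congr fun u v => ?_
      constructor
      · rintro ⟨h1, h2 | ⟨-, e, h2, h3, -⟩⟩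
        · exact ⟨h2, h1⟩
        · omega
      · exact fun h => ⟨h.2, Or.inl h.1⟩
    · intro i s'' hF' _ _
      have a1 : s''.arr 1 = s₀.arr 1 := (hF'.2 1 rfl).trans e1
      have a2 : s''.reg 44 = j := by simpa [hr] using hF'.1 44 rfl
      simp [Expr.eval, Op.eval, a1, a2]
    · intro i s'' hi hi' hF' hr' hI'
      have a2 : s''.arr 2 = s₀.arr 2 := (hF'.2 2 rfl).trans e2
      have a3 : s''.reg 44 = j := by simpa [hr] using hF'.1 44 rfl
      have a4 := (hs'.of_frame hF').row j j.2.le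
      obtain ⟨w, hw⟩ : ∃ w : Fin n, s₀.arr 2 i = w := ⟨⟨_, h.list_lt j hi hi'⟩, rfl⟩
      simp only [wp_store, Expr.eval, Op.eval, Expr.cost, hr', a2, a3, a4, hw, Function.update_self]
      have hjw : G.Adj j w := (h.adj_iff j w).2 ⟨i, hi, hi', hw⟩
      refine ⟨hI'.set j w (fun u v huv => ?_) (fun _ => rfl) fun hn => ?_, by omega⟩
      · refine and_congr_right fun _ => or_congr_right (and_congr_right fun hu => ?_)
        constructor
        · rintro ⟨e, b1, b2, b3⟩
          refine ⟨e, b1, ?_, b3⟩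
          rcases Nat.lt_succ_iff_lt_or_eq.1 b2 with b2 | rfl
          · exact b2
          · exact absurd ⟨hu, Fin.ext (b3.symm.trans hw)⟩ huv
        · rintro ⟨e, b1, b2, b3⟩
          exact ⟨e, b1, by omega, b3⟩
      · exact absurd ⟨hjw, Or.inr ⟨rfl, i, hi, by omega, hw⟩⟩ hn
    · rintro s'' t ⟨⟨-, hI'⟩, ht⟩
      refine ⟨?_, ?_⟩
      · refine hI'.congr fun u v => ?_
        constructor
        · rintro ⟨b1, b2⟩
          refine ⟨b2, ?_⟩
          by_cases hu : u = j
          · subst hu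
            exact Or.inr ⟨rfl, (h.adj_iff u v).1 b2⟩
          · have := Fin.val_ne_of_ne hu
            exact Or.inl (by omega)
        · rintro ⟨b1, b2 | ⟨rfl, -⟩⟩
          · exact ⟨by omega, b1⟩
          · exact ⟨by omega, b1⟩
      · have hd := h.deg_eq j
        have := deg_le G j
        simp only [Expr.cost] at ht
        omega
  · rintro s' t ⟨⟨-, hI⟩, ht⟩
    refine ⟨hI.congr fun u v => by simp, ?_⟩
    simp only [Expr.cost, Nat.sub_zero] at ht
    have : n * (30 * n + 30 + 1 + 7) = 30 * n ^ 2 + 38 * n := by ring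
    omega

/-- Turns row `u` (register 44) of the matrix in array 13 into a list in array 2, starting at the
index in register 50. -/
def listRow : Prog :=
  forLoop 45 (.const 0) (.reg 0)
    (.cond (.cell 13 (.op .add (.cell 12 (.reg 44)) (.reg 45)))
      (.seq (.store 2 (.reg 50) (.reg 45)) (.set 50 (.op .add (.reg 50) (.const 1)))) .skip)

/-- Turns the matrix in array 13 into adjacency lists. -/
def lists : Prog :=
  .seq (.set 50 (.const 0)) (.seq (.store 1 (.const 0) (.const 0))
    (forLoop 44 (.const 0) (.reg 0)
      (.seq listRow (.store 1 (.op .add (.reg 44) (.const 1)) (.reg 50)))))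

theorem wp_listRow {K : SimpleGraph (Fin n)} {s : Store} (hs : Ctx n s)
    (hK : IsRel K.Adj (s.arr 13)) {u : Fin n} (hu : s.reg 44 = u) :
    Wp listRow s fun s' t => (s.reg 50 ≤ s'.reg 50 ∧ s'.reg 50 ≤ s.reg 50 + n ∧
      (∀ e, s.reg 50 ≤ e → e < s'.reg 50 → s'.arr 2 e < n) ∧
      (∀ v : Fin n, K.Adj u v ↔ ∃ e, s.reg 50 ≤ e ∧ e < s'.reg 50 ∧ s'.arr 2 e = v) ∧
      ∀ e < s.reg 50, s'.arr 2 e = s.arr 2 e) ∧ t ≤ 40 * n + 10 := by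
  refine (wp_for_const 0 n 20 (fun j s' => s.reg 50 ≤ s'.reg 50 ∧ s'.reg 50 ≤ s.reg 50 + j ∧
      (∀ e, s.reg 50 ≤ e → e < s'.reg 50 → s'.arr 2 e < j) ∧
      (∀ v : Fin n, (v : ℕ) < j ∧ K.Adj u v ↔ ∃ e, s.reg 50 ≤ e ∧ e < s'.reg 50 ∧ s'.arr 2 e = v) ∧
      ∀ e < s.reg 50, s'.arr 2 e = s.arr 2 e) rfl (Nat.zero_le _) rfl ?_
    (fun j s' hF _ _ => by simpa [Expr.eval] using (hF.1 0 rfl).trans hs.size) ?_).mono ?_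
  · refine ⟨le_rfl, le_rfl, fun e h1 h2 => ?_, fun v => ?_, fun _ _ => rfl⟩
    · simp at h2
      omega
    · simp
      intro e h1 h2
      omega
  · rintro j s' - hj hF hr ⟨h1, h2, h3, h4, h5⟩
    have e12 := (hs.of_frame hF).row u u.2.le
    have e13 : s'.arr 13 = s.arr 13 := hF.2 13 rfl
    have e44 : s'.reg 44 = u := (hF.1 44 rfl).trans hu
    lift j to Fin n using hj
    by_cases hadj : K.Adj u j
    · simp only [wp_seq, wp_set, wp_cond, wp_skip, wp_store, Expr.eval, Op.eval,
        Expr.cost, Function.update_self, Function.update_of_ne, ne_eq, Nat.reduceEqDiff,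
        not_false_eq_true, not_true_eq_false, ↓reduceIte, one_ne_zero, hr, e12, e13, e44,
        (hK u j).1 hadj]
      refine ⟨⟨by omega, by omega, fun e he he' => ?_, fun v => ?_, fun e he => ?_⟩, by omega⟩
      · by_cases hee : e = s'.reg 50
        · simp [hee]
        · rw [Function.update_of_ne hee]
          have := h3 e he (by omega)
          omega
      · constructor
        · rintro ⟨hv, hv'⟩
          by_cases hvj : v = j
          · exact ⟨s'.reg 50, h1, by omega, by simp [hvj]⟩
          · have := Fin.val_ne_of_ne hvj
            obtain ⟨e, b1, b2, b3⟩ := (h4 v).1 ⟨by omega, hv'⟩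
            refine ⟨e, b1, by omega, ?_⟩
            rw [Function.update_of_ne (by omega), b3]
        · rintro ⟨e, b1, b2, b3⟩
          by_cases hee : e = s'.reg 50
          · rw [hee, Function.update_self] at b3
            have : v = j := Fin.ext b3.symm
            subst this
            exact ⟨by omega, hadj⟩
          · rw [Function.update_of_ne hee] at b3
            obtain ⟨c1, c2⟩ := (h4 v).2 ⟨e, b1, by omega, b3⟩
            exact ⟨by omega, c2⟩
      · rw [Function.update_of_ne (by omega), h5 e he]
    · simp only [wp_seq, wp_set, wp_cond, wp_skip, wp_store, Expr.eval, Op.eval,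
        Expr.cost, Function.update_self, Function.update_of_ne, ne_eq, Nat.reduceEqDiff,
        not_false_eq_true, not_true_eq_false, ↓reduceIte, one_ne_zero, hr, e12, e13, e44,
        (hK u j).2 hadj]
      refine ⟨⟨h1, by omega, fun e he he' => ?_, fun v => ?_, h5⟩, by omega⟩
      · have := h3 e he he'
        omega
      · rw [← h4]
        refine and_congr_left fun hv => ?_
        have : v ≠ j := fun h => hadj (h ▸ hv)
        have := Fin.val_ne_of_ne this
        omega
  · rintro s' t ⟨⟨-, h1, h2, h3, h4, h5⟩, ht⟩
    refine ⟨⟨h1, h2, h3, fun v => ?_, h5⟩, ?_⟩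
    · rw [← h4]
      simp
    · simp only [Expr.cost] at ht
      omega

theorem wp_lists {K : SimpleGraph (Fin n)} {s : Store} (hs : Ctx n s)
    (hK : IsRel K.Adj (s.arr 13)) :
    Wp lists s fun s' t => (AdjLists K (s'.arr 1) (s'.arr 2) (s'.arr 7) ∧ s'.arr 1 n ≤ n ^ 2) ∧
      t ≤ 40 * n ^ 2 + 50 * n + 20 := by
  simp only [lists, wp_seq, wp_set, wp_store, Expr.eval, Expr.cost]
  refine (wp_for_const 0 n (40 * n + 30) (fun j s' => s'.arr 1 0 = 0 ∧ s'.reg 50 = s'.arr 1 j ∧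
      s'.arr 1 j ≤ j * n ∧ ∀ u : Fin n, (u : ℕ) < j → s'.arr 1 u ≤ s'.arr 1 (u + 1) ∧
        s'.arr 1 (u + 1) ≤ s'.reg 50 ∧
        (∀ e, s'.arr 1 u ≤ e → e < s'.arr 1 (u + 1) → s'.arr 2 e < n) ∧
        ∀ v : Fin n, K.Adj u v ↔ ∃ e, s'.arr 1 u ≤ e ∧ e < s'.arr 1 (u + 1) ∧ s'.arr 2 e = v)
    rfl (Nat.zero_le _) rfl ?_
    (fun j s' hF _ _ => by simpa [Expr.eval, hs.size] using hF.1 0 rfl) ?_).mono' ?_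
  · simp
  · rintro j s' - hj hF hr ⟨h1, h2, h3, h4⟩
    have hs0 : Ctx n ⟨Function.update s.reg 50 0, Function.update s.arr 1
        (Function.update (s.arr 1) 0 0)⟩ :=
      ⟨by simp [hs.size], by simp [hs.zero], by simpa using hs.row, by simp [hs.zero']⟩
    have hs' := hs0.of_frame hF
    have e13 : s'.arr 13 = s.arr 13 := by simpa using hF.2 13 rfl
    lift j to Fin n using hj
    rw [wp_seq]
    refine (wp_listRow hs' (by rwa [e13]) hr).mono' ?_
    rintro s'' t hF' ⟨⟨g1, g2, g3, g4, g5⟩, ht⟩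
    have f1 : s''.arr 1 = s'.arr 1 := hF'.2 1 rfl
    have f44 : s''.reg 44 = j := (hF'.1 44 rfl).trans hr
    simp only [wp_store, Expr.eval, Op.eval, Expr.cost, f44, f1]
    have hup : ∀ i ≤ (j : ℕ), Function.update (s'.arr 1) (j + 1) (s''.reg 50) i = s'.arr 1 i :=
      fun i hi => Function.update_of_ne (by omega) _ _
    simp only [Function.update_self]
    rw [h2] at g1 g2 g3 g4 g5
    refine ⟨⟨?_, ?_, ?_, fun u hu => ?_⟩, by omega⟩
    · rw [hup 0 (by omega), h1]
    · simp
    · have : ((j : ℕ) + 1) * n = j * n + n := by ring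
      omega
    · simp only [ne_eq, Nat.reduceEqDiff, not_false_eq_true, Function.update_of_ne]
      by_cases huj : u = j
      · subst huj
        rw [hup _ le_rfl, Function.update_self]
        exact ⟨g1, by simp, g3, g4⟩
      · have := Fin.val_ne_of_ne huj
        rw [hup _ (by omega), hup _ (by omega)]
        obtain ⟨b1, b2, b3, b4⟩ := h4 u (by omega)
        rw [h2] at b2
        refine ⟨b1, by omega, fun e he he' => ?_, fun v => ?_⟩
        · rw [g5 e (by omega)]
          exact b3 e he he'
        · rw [b4]
          refine exists_congr fun e => and_congr_right fun _ => and_congr_right fun he => ?_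
          rw [g5 e (by omega)]
  · rintro s' t hF ⟨⟨-, h1, h2, h3, h4⟩, ht⟩
    have h7 : ∀ i, s'.arr 7 i = 0 := fun i => by simpa [hs.zero] using congrFun (hF.2 7 rfl) i
    refine ⟨⟨⟨h1, fun u => (h4 u u.2).1, fun u => (h4 u u.2).2.2.1, fun u v => ?_⟩, ?_⟩, ?_⟩
    · rw [(h4 u u.2).2.2.2 v, h7, h7]
      simp
    · rwa [sq]
    · simp only [Expr.cost, Nat.sub_zero] at ht
      have : n * (40 * n + 30 + 1 + 7) = 40 * n ^ 2 + 38 * n := by ring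
      omega

/-- Labels the components of the graph whose matrix is in array 13. -/
def components : Prog := .seq lists bfs

theorem wp_components {K : SimpleGraph (Fin n)} {s : Store} (hs : Ctx n s)
    (hK : IsRel K.Adj (s.arr 13)) :
    Wp components s fun s' t => Labels K (s'.arr 5) (s'.reg 30) ∧
      t ≤ 140 * n ^ 2 + 150 * n + 70 := by
  rw [components, wp_seq]
  refine (wp_lists hs hK).mono' ?_
  rintro s1 t1 hF1 ⟨⟨h1, h2⟩, ht1⟩
  refine (wp_bfs (hs.of_frame hF1).size h1).mono ?_
  rintro s2 t2 ⟨h3, ht2⟩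
  exact ⟨h3, by omega⟩

theorem Labels.eq_one_iff [NeZero n] {K : SimpleGraph (Fin n)} {lab : ℕ → ℕ} {c : ℕ}
    (h : Labels K lab c) : c = 1 ↔ K.Connected := by
  rw [connected_iff_numFree_add_numHit (T := ∅), numFree_add_numHit, h.card_eq]

/-- Switches the adjacency of the vertices in the registers 51 and 52, if they are distinct. -/
def toggle : Prog :=
  .cond (.op .eq (.reg 51) (.reg 52)) .skip
    (.seq (.store 13 (.op .add (.cell 12 (.reg 51)) (.reg 52))
      (.op .sub (.const 1) (.cell 13 (.op .add (.cell 12 (.reg 51)) (.reg 52)))))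
    (.store 13 (.op .add (.cell 12 (.reg 52)) (.reg 51))
      (.op .sub (.const 1) (.cell 13 (.op .add (.cell 12 (.reg 52)) (.reg 51))))))

theorem wp_toggle {K : SimpleGraph (Fin n)} {s : Store} {a b : Fin n} (hs : Ctx n s)
    (hK : IsRel K.Adj (s.arr 13)) (ha : s.reg 51 = a) (hb : s.reg 52 = b) :
    Wp toggle s fun s' t => IsRel (K ∆ edge a b).Adj (s'.arr 13) ∧ t ≤ 40 := by
  by_cases hab : a = b
  · subst hab
    simp only [toggle, wp_cond, Expr.eval, Op.eval, ha, hb, Expr.cost, ↓reduceIte, one_ne_zero,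
      wp_skip]
    refine ⟨?_, by omega⟩
    have : K ∆ edge a a = K := by simp
    rwa [this]
  · have hab' : (a : ℕ) ≠ b := Fin.val_ne_of_ne hab
    simp only [toggle, wp_cond, wp_seq, wp_store, Expr.eval, Op.eval, ha, hb, Expr.cost, ↓reduceIte,
      hab', hs.row a a.2.le, hs.row b b.2.le, Function.update_self, Function.update_of_ne, ne_eq,
      Nat.reduceEqDiff, not_false_eq_true]
    refine ⟨?_, by omega⟩
    have h1 : IsRel (fun u v => if u = a ∧ v = b then ¬ K.Adj a b else K.Adj u v)
        (Function.update (s.arr 13) (a * n + b) (1 - s.arr 13 (a * n + b))) := by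
      refine hK.set a b (fun u v huv => by simp [huv]) (fun h => ?_) fun h => ?_
      · simp only [and_self, if_true] at h
        rw [(hK a b).2 h]
      · simp only [and_self, if_true, not_not] at h
        rw [(hK a b).1 h]
    have h2 := h1 b a
    simp only [show ¬ (b = a ∧ a = b) from fun h => hab h.2, if_false] at h2
    refine h1.set b a (fun u v huv => ?_) (fun h => ?_) fun h => ?_
    · simp only [symmDiff_adj, edge_adj]
      by_cases h3 : u = a ∧ v = b
      · obtain ⟨rfl, rfl⟩ := h3
        simp [hab]
      · simp only [h3, huv, if_false]
        tauto
    · rw [h2.2]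
      simp only [symmDiff_adj, edge_adj] at h
      tauto
    · rw [h2.1]
      simp only [symmDiff_adj, edge_adj] at h
      tauto

/-- Switches the adjacency of all pairs in array 15; register 53 holds their number. -/
def toggleAll : Prog :=
  forLoop 46 (.const 0) (.reg 53)
    (.seq (.set 51 (.cell 15 (.op .add (.reg 46) (.reg 46))))
      (.seq (.set 52 (.cell 15 (.op .add (.op .add (.reg 46) (.reg 46)) (.const 1)))) toggle))

theorem wp_toggleAll {K : SimpleGraph (Fin n)} {s : Store} {z : ℕ → Fin n} {N : ℕ} (hs : Ctx n s)
    (hK : IsRel K.Adj (s.arr 13)) (hN : s.reg 53 = N) (hz : ∀ i < 2 * N, s.arr 15 i = z i) :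
    Wp toggleAll s fun s' t => IsRel (K ∆ gr (vec z N)).Adj (s'.arr 13) ∧ t ≤ 80 * N + 10 := by
  refine (wp_for_const 0 N 60 (fun j s' => IsRel (K ∆ gr (vec z j)).Adj (s'.arr 13)) rfl
    (Nat.zero_le _) rfl (by simpa [vec] using hK)
    (fun j s' hF _ _ => by simpa [Expr.eval, hN] using hF.1 53 rfl) ?_).mono ?_
  · intro j s' _ hj hF hr hI
    have e15 : s'.arr 15 = s.arr 15 := hF.2 15 rfl
    have hs' := hs.of_frame hF
    have b1 := hz (j + j) (by omega)
    have b2 := hz (j + j + 1) (by omega)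
    simp only [wp_seq, wp_set, Expr.eval, Op.eval, Expr.cost, hr, e15, b1, b2,
      Function.update_of_ne, ne_eq, Nat.reduceEqDiff, not_false_eq_true]
    refine (wp_toggle (K := K ∆ gr (vec z j)) (a := z (j + j)) (b := z (j + j + 1))
      (by exact ⟨by simpa using hs'.size, hs'.zero, hs'.row, hs'.zero'⟩) (by exact hI) (by simp)
      (by simp)).mono ?_
    rintro s'' t ⟨h1, ht⟩
    refine ⟨?_, by omega⟩
    rw [vec_succ, gr_add, gr_pairVec, ← symmDiff_assoc, two_mul]
    exact h1
  · rintro s' t ⟨⟨-, h1⟩, ht⟩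
    refine ⟨h1, ?_⟩
    simp only [Expr.cost] at ht
    omega

end

/-! ### Joining the components in cubic time -/

section
variable {n : ℕ} {K : SimpleGraph (Fin n)} {T : Set (Fin n)} {lab : ℕ → ℕ} {c : ℕ}

/-- For each label in array 5, array 8 receives the number of vertices of `T` with this label. -/
def countLabels : Prog :=
  .seq (forLoop 37 (.const 0) (.reg 0) (.store 8 (.cell 5 (.reg 37)) (.const 0)))
    (forLoop 37 (.const 0) (.reg 0) (.store 8 (.cell 5 (.reg 37))
      (.op .add (.cell 8 (.cell 5 (.reg 37))) (.cell 4 (.reg 37)))))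

/-- Register 54 receives a vertex of maximal score; the scores are in array 9. -/
def argmax : Prog :=
  .seq (.set 54 (.const 0)) (forLoop 37 (.const 0) (.reg 0)
    (.cond (.op .lt (.cell 9 (.reg 54)) (.cell 9 (.reg 37))) (.set 54 (.reg 37)) .skip))

/-- The scores for the choice of the first end of a joining edge: vertices of `T` are preferred,
among them those with another vertex of `T` in the same component. -/
def scoreFirst : Prog :=
  forLoop 37 (.const 0) (.reg 0) (.store 9 (.reg 37) (.op .add (.cell 4 (.reg 37))
    (.op .eq (.const 2) (.op .add (.cell 4 (.reg 37))
      (.op .lt (.const 1) (.cell 8 (.cell 5 (.reg 37))))))))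

/-- The scores for the choice of the second end of a joining edge: it must lie in another component
than the first end (register 51); components without a vertex of `T` are preferred, and otherwise
vertices of `T`. -/
def scoreSecond : Prog :=
  forLoop 37 (.const 0) (.reg 0)
    (.cond (.op .eq (.cell 5 (.reg 37)) (.cell 5 (.reg 51))) (.store 9 (.reg 37) (.const 0))
      (.cond (.cell 8 (.cell 5 (.reg 37)))
        (.store 9 (.reg 37) (.op .add (.const 1) (.cell 4 (.reg 37))))
        (.store 9 (.reg 37) (.const 3))))

/-- Chooses the ends of a joining edge. -/
def pickPair : Prog :=
  .seq countLabels (.seq scoreFirst (.seq argmax (.seq (.set 51 (.reg 54))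
    (.seq scoreSecond (.seq argmax (.set 52 (.reg 54)))))))

/-- The number of vertices of `T` with the label of `v`. -/
noncomputable def labelCount (T : Set (Fin n)) (lab : ℕ → ℕ) (v : Fin n) : ℕ :=
  {w : Fin n | w ∈ T ∧ lab w = lab v}.ncard

theorem wp_countLabels {s : Store} (hn : s.reg 0 = n) (hT : Indicates T (s.arr 4)) :
    Wp countLabels s fun s' t =>
      (∀ v : Fin n, s'.arr 8 (s.arr 5 v) = labelCount T (s.arr 5) v) ∧ t ≤ 40 * n + 20 := by
  rw [countLabels, wp_seq]
  refine (wp_for_const 0 n 5 (fun j s' => ∀ v : Fin n, (v : ℕ) < j → s'.arr 8 (s.arr 5 v) = 0)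
    rfl (Nat.zero_le _) rfl (by simp) (fun j s' hF _ _ => by
      simpa [Expr.eval, hn] using hF.1 0 rfl) ?_).mono' ?_
  · intro j s' _ hj hF hr hI
    have e5 : s'.arr 5 = s.arr 5 := hF.2 5 rfl
    simp only [wp_store, Expr.eval, Expr.cost, hr, e5, Function.update_self]
    refine ⟨fun v hv => ?_, by omega⟩
    by_cases hvj : s.arr 5 v = s.arr 5 j
    · simp [hvj]
    · rw [Function.update_of_ne hvj]
      refine hI v ?_
      have : (v : ℕ) ≠ j := fun h => hvj (by rw [h])
      omega
  rintro s1 t1 hF1 ⟨⟨-, h1⟩, ht1⟩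
  have f4 : s1.arr 4 = s.arr 4 := hF1.2 4 rfl
  have f5 : s1.arr 5 = s.arr 5 := hF1.2 5 rfl
  refine (wp_for_const 0 n 11 (fun j s' => ∀ v : Fin n, s'.arr 8 (s.arr 5 v) =
      sumBelow {w : Fin n | w ∈ T ∧ s.arr 5 w = s.arr 5 v} (fun _ => 1) j)
    rfl (Nat.zero_le _) rfl (fun v => h1 v v.2) (fun j s' hF _ _ => by
      simpa [Expr.eval, hF1.1 0 rfl, hn] using hF.1 0 rfl) ?_).mono ?_
  · intro j s' _ hj hF hr hI
    have e5 : s'.arr 5 = s.arr 5 := (hF.2 5 rfl).trans f5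
    have e4 : s'.arr 4 = s.arr 4 := (hF.2 4 rfl).trans f4
    lift j to Fin n using hj
    simp only [wp_store, Expr.eval, Op.eval, Expr.cost, hr, e5, e4, Function.update_self]
    refine ⟨fun v => ?_, by omega⟩
    rw [sumBelow_succ, ← hI v]
    by_cases hvj : s.arr 5 v = s.arr 5 j
    · rw [hvj, Function.update_self]
      by_cases hjT : j ∈ T
      · simp [hjT, (hT j).1 hjT]
      · simp [hjT, (hT j).2 hjT]
    · rw [Function.update_of_ne hvj]
      simp [Ne.symm hvj]
  · rintro s' t ⟨⟨-, h2⟩, ht⟩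
    refine ⟨fun v => ?_, ?_⟩
    · rw [h2, sumBelow_one, labelCount]
    · simp only [Expr.cost] at ht ht1
      omega

theorem wp_argmax [NeZero n] {s : Store} (hn : s.reg 0 = n) :
    Wp argmax s fun s' t => (∃ a : Fin n, s'.reg 54 = a ∧ ∀ v : Fin n, s.arr 9 v ≤ s.arr 9 a) ∧
      t ≤ 20 * n + 10 := by
  rw [argmax, wp_seq, wp_set]
  refine (wp_for_const 0 n 10 (fun j s' => ∃ a : Fin n, s'.reg 54 = a ∧
      ∀ v : Fin n, (v : ℕ) < j → s.arr 9 v ≤ s.arr 9 a)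
    rfl (Nat.zero_le _) rfl ⟨0, by simp [Expr.eval]⟩ (fun j s' hF _ _ => by
      simpa [Expr.eval, hn] using hF.1 0 rfl) ?_).mono ?_
  · rintro j s' - hj hF hr ⟨a, ha, hI⟩
    have e9 : s'.arr 9 = s.arr 9 := hF.2 9 rfl
    lift j to Fin n using hj
    by_cases hlt : s.arr 9 a < s.arr 9 j
    · simp only [wp_cond, wp_set, wp_skip, Expr.eval, Op.eval, Expr.cost, hr, e9, ha, hlt,
        Function.update_of_ne, ne_eq, Nat.reduceEqDiff, not_false_eq_true, ↓reduceIte, one_ne_zero,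
        Function.update_self]
      refine ⟨⟨j, rfl, fun v hv => ?_⟩, by omega⟩
      by_cases hvj : v = j
      · rw [hvj]
      · have := Fin.val_ne_of_ne hvj
        have := hI v (by omega)
        omega
    · simp only [wp_cond, wp_set, wp_skip, Expr.eval, Op.eval, Expr.cost, hr, e9, ha, hlt,
        Function.update_of_ne, ne_eq, Nat.reduceEqDiff, not_false_eq_true, ↓reduceIte,
        Function.update_self]
      refine ⟨⟨a, rfl, fun v hv => ?_⟩, by omega⟩
      by_cases hvj : v = j
      · rw [hvj]
        omega
      · have := Fin.val_ne_of_ne hvj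
        exact hI v (by omega)
  · rintro s' t ⟨⟨-, a, ha, h1⟩, ht⟩
    refine ⟨⟨a, ha, fun v => h1 v v.2⟩, ?_⟩
    simp only [Expr.cost] at ht ⊢
    omega

theorem wp_scoreFirst {s : Store} (hn : s.reg 0 = n) (hT : Indicates T (s.arr 4)) :
    Wp scoreFirst s fun s' t => (∀ v : Fin n, (v ∉ T → s'.arr 9 v = 0) ∧
        (v ∈ T → s.arr 8 (s.arr 5 v) ≤ 1 → s'.arr 9 v = 1) ∧
        (v ∈ T → 1 < s.arr 8 (s.arr 5 v) → s'.arr 9 v = 2)) ∧ t ≤ 30 * n + 10 := by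
  refine (wp_for_const 0 n 16 (fun j s' => ∀ v : Fin n, (v : ℕ) < j → (v ∉ T → s'.arr 9 v = 0) ∧
      (v ∈ T → s.arr 8 (s.arr 5 v) ≤ 1 → s'.arr 9 v = 1) ∧
      (v ∈ T → 1 < s.arr 8 (s.arr 5 v) → s'.arr 9 v = 2))
    rfl (Nat.zero_le _) rfl (by simp) (fun j s' hF _ _ => by
      simpa [Expr.eval, hn] using hF.1 0 rfl) ?_).mono ?_
  · intro j s' _ hj hF hr hI
    have e5 : s'.arr 5 = s.arr 5 := hF.2 5 rfl
    have e4 : s'.arr 4 = s.arr 4 := hF.2 4 rfl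
    have e8 : s'.arr 8 = s.arr 8 := hF.2 8 rfl
    lift j to Fin n using hj
    simp only [wp_store, Expr.eval, Op.eval, Expr.cost, hr, e5, e4, e8, Function.update_self]
    refine ⟨fun v hv => ?_, by omega⟩
    by_cases hvj : v = j
    · subst hvj
      rw [Function.update_self]
      refine ⟨fun h => ?_, fun h h' => ?_, fun h h' => ?_⟩
      · rw [(hT v).2 h]
        split_ifs <;> omega
      · rw [(hT v).1 h]
        simp [not_lt.2 h']
      · rw [(hT v).1 h]
        simp [h']
    · have := Fin.val_ne_of_ne hvj
      rw [Function.update_of_ne this]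
      exact hI v (by omega)
  · rintro s' t ⟨⟨-, h1⟩, ht⟩
    refine ⟨fun v => h1 v v.2, ?_⟩
    simp only [Expr.cost] at ht
    omega

theorem wp_scoreSecond {s : Store} {a : Fin n} (hn : s.reg 0 = n) (hT : Indicates T (s.arr 4))
    (ha : s.reg 51 = a) :
    Wp scoreSecond s fun s' t => (∀ v : Fin n, (s.arr 5 v = s.arr 5 a → s'.arr 9 v = 0) ∧
        (s.arr 5 v ≠ s.arr 5 a → s.arr 8 (s.arr 5 v) = 0 → s'.arr 9 v = 3) ∧
        (s.arr 5 v ≠ s.arr 5 a → s.arr 8 (s.arr 5 v) ≠ 0 →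
          (v ∈ T → s'.arr 9 v = 2) ∧ (v ∉ T → s'.arr 9 v = 1))) ∧ t ≤ 40 * n + 10 := by
  refine (wp_for_const 0 n 20 (fun j s' => ∀ v : Fin n, (v : ℕ) < j →
      (s.arr 5 v = s.arr 5 a → s'.arr 9 v = 0) ∧
      (s.arr 5 v ≠ s.arr 5 a → s.arr 8 (s.arr 5 v) = 0 → s'.arr 9 v = 3) ∧
      (s.arr 5 v ≠ s.arr 5 a → s.arr 8 (s.arr 5 v) ≠ 0 →
        (v ∈ T → s'.arr 9 v = 2) ∧ (v ∉ T → s'.arr 9 v = 1)))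
    rfl (Nat.zero_le _) rfl (by simp) (fun j s' hF _ _ => by
      simpa [Expr.eval, hn] using hF.1 0 rfl) ?_).mono ?_
  · intro j s' _ hj hF hr hI
    have e5 : s'.arr 5 = s.arr 5 := hF.2 5 rfl
    have e4 : s'.arr 4 = s.arr 4 := hF.2 4 rfl
    have e8 : s'.arr 8 = s.arr 8 := hF.2 8 rfl
    have e51 : s'.reg 51 = a := (hF.1 51 rfl).trans ha
    lift j to Fin n using hj
    have hlast : ∀ y, ((s.arr 5 j = s.arr 5 a → y = 0) ∧
        (s.arr 5 j ≠ s.arr 5 a → s.arr 8 (s.arr 5 j) = 0 → y = 3) ∧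
        (s.arr 5 j ≠ s.arr 5 a → s.arr 8 (s.arr 5 j) ≠ 0 →
          (j ∈ T → y = 2) ∧ (j ∉ T → y = 1))) → ∀ v : Fin n, (v : ℕ) < j + 1 →
        (s.arr 5 v = s.arr 5 a → Function.update (s'.arr 9) j y v = 0) ∧
        (s.arr 5 v ≠ s.arr 5 a → s.arr 8 (s.arr 5 v) = 0 → Function.update (s'.arr 9) j y v = 3) ∧
        (s.arr 5 v ≠ s.arr 5 a → s.arr 8 (s.arr 5 v) ≠ 0 →
          (v ∈ T → Function.update (s'.arr 9) j y v = 2) ∧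
          (v ∉ T → Function.update (s'.arr 9) j y v = 1)) := by
      intro y hy v hv
      by_cases hvj : v = j
      · subst hvj
        rw [Function.update_self]
        exact hy
      · have := Fin.val_ne_of_ne hvj
        rw [Function.update_of_ne this]
        exact hI v (by omega)
    by_cases c1 : s.arr 5 j = s.arr 5 a
    · simp only [wp_cond, wp_store, Expr.eval, Op.eval, Expr.cost, hr, e5, e4, e8, e51, c1,
        Function.update_self, ↓reduceIte, one_ne_zero]
      exact ⟨hlast _ (by simp [c1]), by omega⟩
    · by_cases c2 : s.arr 8 (s.arr 5 j) = 0
      · simp only [wp_cond, wp_store, Expr.eval, Op.eval, Expr.cost, hr, e5, e4, e8, e51, c1, c2,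
          Function.update_self, ↓reduceIte, one_ne_zero]
        exact ⟨hlast _ (by simp [c1, c2]), by omega⟩
      · simp only [wp_cond, wp_store, Expr.eval, Op.eval, Expr.cost, hr, e5, e4, e8, e51, c1, c2,
          Function.update_self, ↓reduceIte, one_ne_zero]
        refine ⟨hlast _ ⟨fun h => absurd h c1, fun _ h => absurd h c2, fun _ _ =>
          ⟨fun h => ?_, fun h => ?_⟩⟩, by omega⟩
        · rw [(hT j).1 h]
        · rw [(hT j).2 h]
  · rintro s' t ⟨⟨-, h1⟩, ht⟩
    refine ⟨fun v => h1 v v.2, ?_⟩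
    simp only [Expr.cost] at ht
    omega

/-- The choice by scores is admissible. -/
theorem joinRule_of_scores (hl : Labels K lab c) (hK : ¬ K.Connected) [NeZero n] {x y : ℕ → ℕ}
    {a b : Fin n}
    (hx : ∀ v : Fin n, (v ∉ T → x v = 0) ∧ (v ∈ T → labelCount T lab v ≤ 1 → x v = 1) ∧
      (v ∈ T → 1 < labelCount T lab v → x v = 2))
    (ha : ∀ v : Fin n, x v ≤ x a)
    (hy : ∀ v : Fin n, (lab v = lab a → y v = 0) ∧
      (lab v ≠ lab a → labelCount T lab v = 0 → y v = 3) ∧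
      (lab v ≠ lab a → labelCount T lab v ≠ 0 → (v ∈ T → y v = 2) ∧ (v ∉ T → y v = 1)))
    (hb : ∀ v : Fin n, y v ≤ y b) : ¬ K.Reachable a b ∧ JoinRule K T a b := by
  have hpos : ∀ v : Fin n, lab v ≠ lab a → 1 ≤ y v := by
    intro v hv
    by_cases h0 : labelCount T lab v = 0
    · rw [(hy v).2.1 hv h0]
      omega
    · by_cases hvT : v ∈ T
      · rw [((hy v).2.2 hv h0).1 hvT]
        omega
      · rw [((hy v).2.2 hv h0).2 hvT]
  have hab : lab b ≠ lab a := by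
    intro h
    obtain ⟨v, hv⟩ : ∃ v, ¬ K.Reachable a v := by
      by_contra! h
      exact hK ((connected_iff_exists_forall_reachable K).2 ⟨a, h⟩)
    have h1 := hpos v fun h => hv ((hl.eq_iff a v).1 h.symm)
    have h2 := hb v
    rw [(hy b).1 h] at h2
    omega
  refine ⟨fun h => hab ((hl.eq_iff b a).2 h.symm), ?_⟩
  have hzero : ∀ v : Fin n, labelCount T lab v = 0 ↔ ∀ w ∈ T, lab w ≠ lab v := by
    intro v
    rw [labelCount, Set.ncard_eq_zero, Set.eq_empty_iff_forall_notMem]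
    simp only [Set.mem_ofPred_eq, not_and]
  by_cases hT : T = ∅
  · exact .empty hT
  obtain ⟨t, ht⟩ := Set.nonempty_iff_ne_empty.2 hT
  have htx : 1 ≤ x t := by
    rcases Nat.lt_or_ge 1 (labelCount T lab t) with h | h
    · rw [(hx t).2.2 ht h]
      omega
    · rw [(hx t).2.1 ht h]
  have haT : a ∈ T := by
    by_contra h
    have := ha t
    rw [(hx a).1 h] at this
    omega
  by_cases h0 : labelCount T lab b = 0
  · exact .free haT fun v hv hvT => (hzero b).1 h0 v hvT ((hl.eq_iff v b).2 hv.symm)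
  have hcov : ∀ v : Fin n, lab v ≠ lab a → labelCount T lab v ≠ 0 := by
    intro v hv hv0
    have h1 := hb v
    have h2 := (hy b).2.2 hab h0
    rw [(hy v).2.1 hv hv0] at h1
    by_cases hbT : b ∈ T
    · rw [h2.1 hbT] at h1
      omega
    · rw [h2.2 hbT] at h1
      omega
  have hbT : b ∈ T := by
    by_contra hbT
    have h1 := h0
    rw [hzero] at h1
    push Not at h1
    obtain ⟨w, hw, hwb⟩ := h1
    have h2 := hb w
    rw [((hy b).2.2 hab h0).2 hbT, ((hy w).2.2 (hwb ▸ hab) (hcov w (hwb ▸ hab))).1 hw] at h2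
    omega
  rcases Nat.lt_or_ge 1 (labelCount T lab a) with h1 | h1
  · obtain ⟨w, hw, hwa⟩ := Set.exists_ne_of_one_lt_ncard h1 a
    exact .big haT hbT ⟨w, hw.1, hwa, (hl.eq_iff a w).1 hw.2.symm⟩
  · refine .small haT hbT (fun u hu v hv huv => ?_) ?_
    · have h2 : labelCount T lab u ≤ 1 := by
        by_contra! h3
        have := ha u
        rw [(hx u).2.2 hu h3, (hx a).2.1 haT h1] at this
        omega
      rw [labelCount, Set.ncard_le_one] at h2
      exact h2 u ⟨hu, rfl⟩ v ⟨hv, ((hl.eq_iff u v).2 huv).symm⟩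
    · rw [numFree, Set.ncard_eq_zero, Set.eq_empty_iff_forall_notMem]
      intro d hd
      induction d using ConnectedComponent.ind with | _ v
      have h3 : ∀ w ∈ T, lab w ≠ lab v := fun w hw hwv =>
        hd w (ConnectedComponent.eq.2 ((hl.eq_iff w v).1 hwv)) hw
      exact hcov v (fun h => h3 a haT h.symm) ((hzero v).2 h3)

theorem wp_pickPair [NeZero n] {s : Store} (hn : s.reg 0 = n) (hl : Labels K (s.arr 5) c)
    (hK : ¬ K.Connected) (hT : Indicates T (s.arr 4)) :
    Wp pickPair s fun s' t => (∃ a b : Fin n, s'.reg 51 = a ∧ s'.reg 52 = b ∧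
      ¬ K.Reachable a b ∧ JoinRule K T a b) ∧ t ≤ 200 * n + 100 := by
  rw [pickPair, wp_seq]
  refine (wp_countLabels hn hT).mono' ?_
  rintro s1 t1 hF1 ⟨h1, ht1⟩
  have a0 := (hF1.1 0 rfl).trans hn
  have a4 : s1.arr 4 = s.arr 4 := hF1.2 4 rfl
  have a5 : s1.arr 5 = s.arr 5 := hF1.2 5 rfl
  rw [wp_seq]
  refine (wp_scoreFirst a0 (a4 ▸ hT)).mono' ?_
  rintro s2 t2 hF2 ⟨h2, ht2⟩
  have b0 := (hF2.1 0 rfl).trans a0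
  have b4 : s2.arr 4 = s.arr 4 := (hF2.2 4 rfl).trans a4
  have b5 : s2.arr 5 = s.arr 5 := (hF2.2 5 rfl).trans a5
  have b8 : s2.arr 8 = s1.arr 8 := hF2.2 8 rfl
  rw [wp_seq]
  refine (wp_argmax b0).mono' ?_
  rintro s3 t3 hF3 ⟨⟨a, ha, h3⟩, ht3⟩
  have c0 := (hF3.1 0 rfl).trans b0
  have c4 : s3.arr 4 = s.arr 4 := (hF3.2 4 rfl).trans b4
  have c5 : s3.arr 5 = s.arr 5 := (hF3.2 5 rfl).trans b5
  have c8 : s3.arr 8 = s1.arr 8 := (hF3.2 8 rfl).trans b8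
  rw [wp_seq, wp_set, wp_seq]
  refine (wp_scoreSecond (T := T) (a := a) (by simpa using c0) (by simpa [c4] using hT)
    (by simpa [Expr.eval] using ha)).mono' ?_
  rintro s4 t4 hF4 ⟨h4, ht4⟩
  have d0 : s4.reg 0 = n := by simpa [c0] using hF4.1 0 rfl
  have d51 : s4.reg 51 = a := by simpa [Expr.eval, ha] using hF4.1 51 rfl
  rw [wp_seq]
  refine (wp_argmax d0).mono' ?_
  rintro s5 t5 hF5 ⟨⟨b, hb, h5⟩, ht5⟩
  simp only [wp_set, Expr.eval, Expr.cost]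
  simp only [a5] at h1 h2
  simp only [c5, c8, h1] at h4
  simp only [h1] at h2
  refine ⟨⟨a, b, ?_, ?_, joinRule_of_scores hl hK (T := T) h2 h3 h4 h5⟩, by omega⟩
  · simpa [d51] using hF5.1 51 rfl
  · simpa using hb

end

theorem Nform_le_card {V : Type*} [Finite V] (G : SimpleGraph V) (T : Set V) :
    Nform (numFree G T) (numHit G T) T.ncard ≤ Nat.card V := by
  have h1 : numFree G T + numHit G T ≤ Nat.card V := by
    rw [numFree_add_numHit]
    exact Nat.card_le_card_of_surjective G.connectedComponentMk fun c => by
      induction c using ConnectedComponent.ind with | _ v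
      exact ⟨v, rfl⟩
  have h2 : numFree G T + T.ncard ≤ Nat.card V := by
    have h3 : {c : G.ConnectedComponent | ∀ v ∈ c.supp, v ∉ T} ⊆
        G.connectedComponentMk '' Tᶜ := by
      intro c hc
      induction c using ConnectedComponent.ind with | _ v
      exact ⟨v, hc v rfl, rfl⟩
    have h4 := (Set.ncard_le_ncard h3 (Set.toFinite _)).trans (Set.ncard_image_le (Set.toFinite _))
    have h5 := Set.ncard_add_ncard_compl T
    rw [numFree]
    omega
  rw [Nform]
  split_ifs <;> omega

theorem Nform_pos_of_not_connected {V : Type*} [Finite V] [Nonempty V] {G : SimpleGraph V}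
    {T : Set V} (h : ¬ G.Connected) : 1 ≤ Nform (numFree G T) (numHit G T) T.ncard := by
  rw [connected_iff_numFree_add_numHit (T := T)] at h
  have h1 : 0 < numFree G T + numHit G T := by
    rw [numFree_add_numHit]
    exact Nat.card_pos
  rw [Nform]
  split_ifs <;> omega

/-- One round of the joining phase: unless the graph is connected, a joining edge is added. -/
def joinStep : Prog :=
  .seq components (.cond (.op .eq (.reg 30) (.const 1)) .skip
    (.seq pickPair (.seq (.store 15 (.op .add (.reg 55) (.reg 55)) (.reg 51))
      (.seq (.store 15 (.op .add (.op .add (.reg 55) (.reg 55)) (.const 1)) (.reg 52))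
      (.seq (.set 55 (.op .add (.reg 55) (.const 1)))
      (.seq (.store 4 (.reg 51) (.op .sub (.const 1) (.cell 4 (.reg 51))))
      (.seq (.store 4 (.reg 52) (.op .sub (.const 1) (.cell 4 (.reg 52)))) toggle)))))))

/-- Joins the components: array 15 receives the joining pairs, register 55 their number, array 13
the joined graph, and array 4 the vertices that have the wrong parity in it. -/
def join : Prog :=
  .seq (.set 55 (.const 0)) (forLoop 47 (.const 0) (.reg 0) joinStep)

section
variable {n : ℕ} {G : SimpleGraph (Fin n)} {T : Set (Fin n)} {s : Store}

theorem Indicates.toggle {x : ℕ → ℕ} (h : Indicates T x) {a b : Fin n} (hab : a ≠ b) :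
    Indicates (T ∆ {a, b}) (Function.update (Function.update x a (1 - x a)) b (1 - x b)) := by
  have hab' : (a : ℕ) ≠ b := Fin.val_ne_of_ne hab
  intro v
  by_cases hva : v = a
  · subst hva
    rw [Function.update_of_ne hab', Function.update_self]
    have := h v
    by_cases hv : v ∈ T <;> simp_all [Set.mem_symmDiff]
  · by_cases hvb : v = b
    · subst hvb
      rw [Function.update_self]
      have := h v
      by_cases hv : v ∈ T <;> simp_all [Set.mem_symmDiff]
    · have h1 := Fin.val_ne_of_ne hva
      have h2 := Fin.val_ne_of_ne hvb
      rw [Function.update_of_ne h2, Function.update_of_ne h1]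
      have := h v
      simp_all [Set.mem_symmDiff]

/-- The memory holds a list of joining pairs and the joined graph. -/
def JoinState (G : SimpleGraph (Fin n)) (T : Set (Fin n)) (z : ℕ → Fin n) (l : ℕ)
    (G' : SimpleGraph (Fin n)) (T' : Set (Fin n)) (s : Store) : Prop :=
  JoinInv G T z l G' T' ∧ IsRel G'.Adj (s.arr 13) ∧ Indicates T' (s.arr 4) ∧ s.reg 55 = l ∧
    ∀ i < 2 * l, s.arr 15 i = z i

theorem wp_joinStep [NeZero n] (hs : Ctx n s) {z : ℕ → Fin n} {l : ℕ}
    {G' : SimpleGraph (Fin n)} {T' : Set (Fin n)} (h : JoinState G T z l G' T' s) :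
    Wp joinStep s fun s' t => ((G'.Connected ∧ JoinState G T z l G' T' s') ∨
      (¬ G'.Connected ∧ ∃ z' G'' T'', JoinState G T z' (l + 1) G'' T'' s')) ∧
      t ≤ 140 * n ^ 2 + 350 * n + 300 := by
  obtain ⟨h1, h2, h3, h4, h5⟩ := h
  rw [joinStep, wp_seq]
  refine (wp_components hs h2).mono' ?_
  rintro s1 t1 hF1 ⟨hl, ht1⟩
  have a4 : s1.arr 4 = s.arr 4 := hF1.2 4 rfl
  have a13 : s1.arr 13 = s.arr 13 := hF1.2 13 rfl
  have a15 : s1.arr 15 = s.arr 15 := hF1.2 15 rfl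
  have a55 : s1.reg 55 = l := (hF1.1 55 rfl).trans h4
  have hs1 := hs.of_frame hF1
  by_cases hc : s1.reg 30 = 1
  · simp only [wp_cond, wp_skip, Expr.eval, Op.eval, Expr.cost, hc, ↓reduceIte, one_ne_zero]
    refine ⟨Or.inl ⟨hl.eq_one_iff.1 hc, h1, ?_, ?_, a55, ?_⟩, by omega⟩
    · rwa [a13]
    · rwa [a4]
    · rwa [a15]
  · have hnc := mt hl.eq_one_iff.2 hc
    simp only [wp_cond, wp_seq, Expr.eval, Op.eval, Expr.cost, hc, ↓reduceIte]
    refine (wp_pickPair hs1.size hl hnc (T := T') (by rwa [a4])).mono' ?_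
    rintro s2 t2 hF2 ⟨⟨a, b, ha, hb, hab, hr⟩, ht2⟩
    have hs2 := hs1.of_frame hF2
    have b4 : s2.arr 4 = s.arr 4 := (hF2.2 4 rfl).trans a4
    have b13 : s2.arr 13 = s.arr 13 := (hF2.2 13 rfl).trans a13
    have b15 : s2.arr 15 = s.arr 15 := (hF2.2 15 rfl).trans a15
    have b55 : s2.reg 55 = l := (hF2.1 55 rfl).trans a55
    have hne : a ≠ b := fun h => hab (h ▸ Reachable.refl _)
    have hne' : (b : ℕ) ≠ a := Fin.val_ne_of_ne hne.symm
    simp only [wp_set, wp_store, Expr.eval, Op.eval, Expr.cost, Function.update_self,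
      Function.update_of_ne, ne_eq, Nat.reduceEqDiff, not_false_eq_true, ha, hb, b55, b4, b15, hne']
    refine (wp_toggle (K := G') (a := a) (b := b) (by exact ⟨by simpa using hs2.size,
      by simpa using hs2.zero, by simpa using hs2.row, by simpa using hs2.zero'⟩)
      (by simpa [b13] using h2) (by simpa using ha) (by simpa using hb)).mono' ?_
    rintro s3 t3 hF3 ⟨h6, ht3⟩
    have c4 := hF3.2 4 rfl
    have c15 := hF3.2 15 rfl
    have c55 := hF3.1 55 rfl
    simp only [Function.update_self, Function.update_of_ne, ne_eq, Nat.reduceEqDiff,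
      not_false_eq_true] at c4 c15 c55
    refine ⟨Or.inr ⟨hnc, fun i => if i < 2 * l then z i else if i = 2 * l then a else b,
      G' ∆ edge a b, T' ∆ {a, b}, ?_, h6, ?_, c55, ?_⟩, by omega⟩
    · have e1 : ∀ i < 2 * l, z i = if i < 2 * l then z i else if i = 2 * l then a else b :=
        fun i hi => (if_pos hi).symm
      have := (h1.congr e1).step
      simp only [lt_self_iff_false, if_false, if_true, show ¬ (2 * l + 1 < 2 * l) by omega,
        show ¬ (2 * l + 1 = 2 * l) by omega] at this
      exact this hab hr
    · rw [c4]
      exact h3.toggle hne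
    · intro i hi
      rw [c15]
      beta_reduce
      by_cases hi1 : i < 2 * l
      · rw [Function.update_of_ne (by omega), Function.update_of_ne (by omega), if_pos hi1,
          h5 i hi1]
      · by_cases hi2 : i = 2 * l
        · rw [Function.update_of_ne (by omega), if_neg hi1, if_pos hi2, hi2, ← two_mul,
            Function.update_self]
        · obtain rfl : i = l + l + 1 := by omega
          rw [Function.update_self, if_neg hi1, if_neg hi2]

/-- After `n` rounds the graph is connected: otherwise each round has added a joining edge, and the
bound, at most `n` in the beginning, would have dropped below `1`. -/
theorem wp_join [NeZero n] (hs : Ctx n s) (hG : IsRel G.Adj (s.arr 13))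
    (hT : Indicates T (s.arr 4)) (heven : Even T.ncard) :
    Wp join s fun s' t => (∃ z l G' T', JoinState G T z l G' T' s' ∧ G'.Connected) ∧
      t ≤ 900 * n ^ 3 := by
  have hn : 1 ≤ n := Nat.one_le_iff_ne_zero.2 (NeZero.ne n)
  rw [join, wp_seq, wp_set]
  refine (wp_for_const 0 n (140 * n ^ 2 + 350 * n + 300) (fun j s' => ∃ z l G' T',
      JoinState G T z l G' T' s' ∧ (G'.Connected ∨ l = j))
    rfl (Nat.zero_le _) rfl ⟨fun _ => 0, 0, G, T, ?_, Or.inr rfl⟩ (fun j s' hF _ _ => by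
      simpa [Expr.eval, hs.size] using hF.1 0 rfl) ?_).mono ?_
  · exact ⟨.init heven _, hG, hT, by simp [Expr.eval], by simp⟩
  · rintro j s' - hj hF hr ⟨z, l, G', T', h1, h2⟩
    have hs0 : Ctx n ⟨Function.update s.reg 55 ((Expr.const 0).eval s), s.arr⟩ :=
      ⟨by simpa using hs.size, hs.zero, hs.row, hs.zero'⟩
    refine (wp_joinStep (hs0.of_frame hF) h1).mono ?_
    rintro s'' t ⟨h3, ht⟩
    refine ⟨?_, ht⟩
    rcases h3 with ⟨h3, g1, g2, g3, g4, g5⟩ | ⟨h3, z', G'', T'', g1, g2, g3, g4, g5⟩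
    · exact ⟨z, l, G', T', ⟨g1, g2, g3, by simpa using g4, g5⟩, Or.inl h3⟩
    · exact ⟨z', l + 1, G'', T'', ⟨g1, g2, g3, by simpa using g4, g5⟩,
        Or.inr (by rw [h2.resolve_left h3])⟩
  · rintro s' t ⟨⟨-, z, l, G', T', h1, h2⟩, ht⟩
    refine ⟨⟨z, l, G', T', h1, h2.elim id fun hl => ?_⟩, ?_⟩
    · by_contra hnc
      have h3 := Nform_le_card G T
      have h4 := Nform_pos_of_not_connected (T := T') hnc
      have h5 := h1.1.count
      rw [Nat.card_fin] at h3
      omega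
    · simp only [Expr.cost, Nat.sub_zero] at ht ⊢
      have e1 : n * (140 * n ^ 2 + 350 * n + 300 + 1 + 7) =
          140 * n ^ 3 + 350 * n ^ 2 + 308 * n := by ring
      have e2 : n ^ 2 ≤ n ^ 3 := Nat.pow_le_pow_right hn (by omega)
      have e3 : n ≤ n ^ 3 := Nat.le_self_pow (by omega) n
      omega

end

/-! ### Pairing the vertices of the wrong parity in cubic time -/

section
variable {V : Type*} {K G : SimpleGraph V} {T T₁ T₂ : Set V} {z : ℕ → V} {l m N : ℕ}

/-- The pairs with index from `l` to `m` consist of distinct vertices of `T`, not adjacent in `K`,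
and `T₁` is the set of the remaining vertices of `T`. -/
structure Paired (K : SimpleGraph V) (T : Set V) (z : ℕ → V) (l m : ℕ) (T₁ : Set V) : Prop where
  le : l ≤ m
  nonadj : ∀ j, l ≤ j → j < m → ¬ K.Adj (z (2 * j)) (z (2 * j + 1))
  inj : ∀ i i', 2 * l ≤ i → i < 2 * m → 2 * l ≤ i' → i' < 2 * m → z i = z i' → i = i'
  mem : ∀ v, v ∈ T ↔ v ∈ T₁ ∨ ∃ i, 2 * l ≤ i ∧ i < 2 * m ∧ z i = v
  notMem : ∀ i, 2 * l ≤ i → i < 2 * m → z i ∉ T₁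

theorem Paired.init (K : SimpleGraph V) (T : Set V) (z : ℕ → V) (l : ℕ) : Paired K T z l l T where
  le := le_rfl
  nonadj := by omega
  inj := by omega
  mem v := ⟨Or.inl, fun h => h.elim id fun ⟨i, h⟩ => by omega⟩
  notMem := by omega

/-- The list `z` with the pair `u`, `v` at the positions `2 m` and `2 m + 1`. -/
def snocPair (z : ℕ → V) (m : ℕ) (u v : V) : ℕ → V :=
  fun i => if i < 2 * m then z i else if i = 2 * m then u else v

theorem snocPair_of_lt {m i : ℕ} (hi : i < 2 * m) (u v : V) : snocPair z m u v i = z i := if_pos hi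

@[simp] theorem snocPair_two_mul (z : ℕ → V) (m : ℕ) (u v : V) : snocPair z m u v (2 * m) = u := by
  simp [snocPair]

@[simp] theorem snocPair_two_mul_add_one (z : ℕ → V) (m : ℕ) (u v : V) :
    snocPair z m u v (2 * m + 1) = v := by
  simp [snocPair]

theorem Paired.snoc (h : Paired K T z l m T₁) {u v : V} (hu : u ∈ T₁) (hv : v ∈ T₁) (huv : u ≠ v)
    (hadj : ¬ K.Adj u v) : Paired K T (snocPair z m u v) l (m + 1) (T₁ \ {u, v}) := by
  have hle := h.le
  have hcase : ∀ i, i < 2 * (m + 1) → i < 2 * m ∨ i = 2 * m ∨ i = 2 * m + 1 := by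
    intros; omega
  have hold : ∀ i, 2 * l ≤ i → i < 2 * m → z i ≠ u ∧ z i ≠ v := fun i h1 h2 =>
    ⟨fun h3 => h.notMem i h1 h2 (h3 ▸ hu), fun h3 => h.notMem i h1 h2 (h3 ▸ hv)⟩
  refine ⟨by omega, fun j hj hj' => ?_, fun i i' hi hiN hi' hiN' heq => ?_, fun w => ?_,
    fun i hi hi' => ?_⟩
  · rcases Nat.lt_succ_iff_lt_or_eq.1 hj' with h1 | rfl
    · rw [snocPair_of_lt (by omega), snocPair_of_lt (by omega)]
      exact h.nonadj j hj h1
    · simpa using hadj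
  · rcases hcase i hiN with h1 | rfl | rfl <;> rcases hcase i' hiN' with h2 | rfl | rfl
    · rw [snocPair_of_lt h1, snocPair_of_lt h2] at heq
      exact h.inj i i' hi h1 hi' h2 heq
    · rw [snocPair_of_lt h1, snocPair_two_mul] at heq
      exact absurd heq (hold i hi h1).1
    · rw [snocPair_of_lt h1, snocPair_two_mul_add_one] at heq
      exact absurd heq (hold i hi h1).2
    · rw [snocPair_of_lt h2, snocPair_two_mul] at heq
      exact absurd heq.symm (hold i' hi' h2).1
    · rfl
    · rw [snocPair_two_mul, snocPair_two_mul_add_one] at heq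
      exact absurd heq huv
    · rw [snocPair_of_lt h2, snocPair_two_mul_add_one] at heq
      exact absurd heq.symm (hold i' hi' h2).2
    · rw [snocPair_two_mul, snocPair_two_mul_add_one] at heq
      exact absurd heq.symm huv
    · rfl
  · rw [h.mem]
    constructor
    · rintro (hw | ⟨i, h1, h2, rfl⟩)
      · by_cases hwu : w = u
        · exact Or.inr ⟨2 * m, by omega, by omega, by simp [hwu]⟩
        · by_cases hwv : w = v
          · exact Or.inr ⟨2 * m + 1, by omega, by omega, by simp [hwv]⟩
          · exact Or.inl ⟨hw, by simp [hwu, hwv]⟩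
      · exact Or.inr ⟨i, h1, by omega, snocPair_of_lt h2 u v⟩
    · rintro (hw | ⟨i, h1, h2, rfl⟩)
      · exact Or.inl hw.1
      · rcases hcase i h2 with h3 | rfl | rfl
        · rw [snocPair_of_lt h3]
          exact Or.inr ⟨i, h1, h3, rfl⟩
        · left
          simpa using hu
        · left
          simpa using hv
  · rcases hcase i hi' with h3 | rfl | rfl
    · rw [snocPair_of_lt h3]
      exact fun h4 => h.notMem i hi h3 h4.1
    · simp
    · simp

theorem Paired.ncard_eq [Finite V] (h : Paired K T z l m T₁) :
    T.ncard = T₁.ncard + 2 * (m - l) := by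
  have h1 : T = T₁ ∪ z '' (Finset.Ico (2 * l) (2 * m) : Set ℕ) := by
    ext v
    rw [h.mem]
    simp [and_assoc]
  have h2 : (z '' (Finset.Ico (2 * l) (2 * m) : Set ℕ)).ncard = 2 * (m - l) := by
    rw [Set.InjOn.ncard_image, Set.ncard_coe_finset, Nat.card_Ico]
    · omega
    · intro i hi j hj hij
      simp only [Finset.coe_Ico, Set.mem_Ico] at hi hj
      exact h.inj i j hi.1 hi.2 hj.1 hj.2 hij
  rw [h1, Set.ncard_union_eq, h2]
  rw [Set.disjoint_left]
  rintro v hv ⟨i, hi, rfl⟩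
  simp only [Finset.coe_Ico, Set.mem_Ico] at hi
  exact h.notMem i hi.1 hi.2 hv

theorem Paired.congr {z' : ℕ → V} (h : Paired K T z l m T₁) (hz : ∀ i < 2 * m, z' i = z i) :
    Paired K T z' l m T₁ where
  le := h.le
  nonadj j hj hj' := by
    rw [hz _ (by omega), hz _ (by omega)]
    exact h.nonadj j hj hj'
  inj i i' hi hi' hj hj' := by
    rw [hz _ hi', hz _ hj']
    exact h.inj i i' hi hi' hj hj'
  mem v := by
    rw [h.mem]
    refine or_congr_right (exists_congr fun i => and_congr_right fun _ => and_congr_right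
      fun hi => ?_)
    rw [hz i hi]
  notMem i hi hi' := by
    rw [hz i hi']
    exact h.notMem i hi hi'

/-- A maximal matching of non-adjacent vertices, followed by a pairing of the remaining vertices. -/
theorem Paired.pairInv [Finite V] (h : Paired G T z l m T₁) (h' : Paired ⊥ T₁ z m N T₂)
    (hclique : ∀ u ∈ T₁, ∀ v ∈ T₁, v ≠ u → G.Adj u v) (hsub : T₂.ncard ≤ 1) (hT : Even T.ncard) :
    PairInv G T z l m N := by
  have hle := h.le
  have hle' := h'.le
  have hT₂ : T₂ = ∅ := by
    have h1 := h.ncard_eq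
    have h2 := h'.ncard_eq
    rw [← Set.ncard_eq_zero]
    obtain ⟨k, hk⟩ := hT
    omega
  subst hT₂
  have hmem : ∀ i, 2 * m ≤ i → i < 2 * N → z i ∈ T₁ := fun i hi hi' =>
    (h'.mem _).2 (Or.inr ⟨i, hi, hi', rfl⟩)
  refine ⟨hle, hle', h.nonadj, fun i i' hi hiN hi' hiN' hne => ?_,
    fun i i' hi hiN hi' hiN' heq => ?_, fun v => ?_⟩
  · exact hclique _ (hmem i hi hiN) _ (hmem i' hi' hiN') fun h1 =>
      hne (h'.inj i i' hi hiN hi' hiN' h1.symm)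
  · rcases Nat.lt_or_ge i (2 * m) with h1 | h1 <;> rcases Nat.lt_or_ge i' (2 * m) with h2 | h2
    · exact h.inj i i' hi h1 hi' h2 heq
    · exact absurd (heq ▸ hmem i' h2 hiN') (h.notMem i hi h1)
    · exact absurd (heq ▸ hmem i h1 hiN) (h.notMem i' hi' h2)
    · exact h'.inj i i' h1 hiN h2 hiN' heq
  · rw [h.mem, h'.mem]
    constructor
    · rintro ((h1 | ⟨i, h1, h2, h3⟩) | ⟨i, h1, h2, h3⟩)
      · exact h1.elim
      · exact ⟨i, by omega, h2, h3⟩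
      · exact ⟨i, h1, by omega, h3⟩
    · rintro ⟨i, h1, h2, h3⟩
      rcases Nat.lt_or_ge i (2 * m) with h4 | h4
      · exact Or.inr ⟨i, h1, h4, h3⟩
      · exact Or.inl (Or.inr ⟨i, h4, h2, h3⟩)

end

/-- Register 57 receives a vertex marked in array 4 that differs from the vertex in register 48 and
is not adjacent to it according to the matrix in array `a`, or `n` if there is none. -/
def search (a : ℕ) : Prog :=
  .seq (.set 57 (.reg 0)) (forLoop 37 (.const 0) (.reg 0)
    (.cond (.cell 4 (.reg 37))
      (.cond (.op .add (.op .eq (.reg 37) (.reg 48))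
        (.cell a (.op .add (.cell 12 (.reg 48)) (.reg 37)))) .skip (.set 57 (.reg 37)))
      .skip))

/-- Pairs the vertices marked in array 4 greedily with vertices that are not adjacent according to
the matrix in array `a`. The pairs are appended to array 15, and register 56 counts them. -/
def pairUp (a : ℕ) : Prog :=
  forLoop 48 (.const 0) (.reg 0)
    (.cond (.cell 4 (.reg 48))
      (.seq (search a) (.cond (.op .lt (.reg 57) (.reg 0))
        (.seq (.store 15 (.op .add (.reg 56) (.reg 56)) (.reg 48))
        (.seq (.store 15 (.op .add (.op .add (.reg 56) (.reg 56)) (.const 1)) (.reg 57))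
        (.seq (.set 56 (.op .add (.reg 56) (.const 1)))
        (.seq (.store 4 (.reg 48) (.const 0)) (.store 4 (.reg 57) (.const 0)))))) .skip))
      .skip)

section
variable {n : ℕ} {K : SimpleGraph (Fin n)} {T T₁ : Set (Fin n)} {s : Store} {a : ℕ}

theorem wp_search (hs : Ctx n s) (hK : IsRel K.Adj (s.arr a)) (hT : Indicates T (s.arr 4))
    {u : Fin n} (hu : s.reg 48 = u) :
    Wp (search a) s fun s' t =>
      ((s'.reg 57 = n ∧ ∀ v ∈ T, v ≠ u → K.Adj u v) ∨
        ∃ v ∈ T, s'.reg 57 = v ∧ v ≠ u ∧ ¬ K.Adj u v) ∧ t ≤ 40 * n + 20 := by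
  rw [search, wp_seq, wp_set]
  refine (wp_for_const 0 n 20 (fun j s' =>
    (s'.reg 57 = n ∧ ∀ v ∈ T, (v : ℕ) < j → v ≠ u → K.Adj u v) ∨
        ∃ v ∈ T, s'.reg 57 = v ∧ v ≠ u ∧ ¬ K.Adj u v)
    rfl (Nat.zero_le _) rfl (Or.inl (by simp [Expr.eval, hs.size])) (fun j s' hF _ _ => by
      simpa [Expr.eval, hs.size] using hF.1 0 rfl) ?_).mono ?_
  · intro j s' _ hj hF hr hI
    have e4 : s'.arr 4 = s.arr 4 := hF.2 4 rfl
    have ea : s'.arr a = s.arr a := hF.2 a rfl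
    have e12 : s'.arr 12 = s.arr 12 := hF.2 12 rfl
    have e48 : s'.reg 48 = u := by simpa [hu] using hF.1 48 rfl
    have erow := hs.row u u.2.le
    lift j to Fin n using hj
    have hskip : (j ∈ T → j ≠ u → K.Adj u j) →
        ((s'.reg 57 = n ∧ ∀ v ∈ T, (v : ℕ) < j + 1 → v ≠ u → K.Adj u v) ∨
          ∃ v ∈ T, s'.reg 57 = v ∧ v ≠ u ∧ ¬ K.Adj u v) := by
      intro hj
      refine hI.imp (fun h => ⟨h.1, fun v hv hvj hvu => ?_⟩) id
      by_cases hvj' : v = j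
      · subst hvj'
        exact hj hv hvu
      · have := Fin.val_ne_of_ne hvj'
        exact h.2 v hv (by omega) hvu
    by_cases c1 : j ∈ T
    · by_cases c2 : j = u
      · subst c2
        simp only [wp_cond, wp_set, wp_skip, Expr.eval, Op.eval, Expr.cost, hr, e4, ea, e12, e48,
          (hT j).1 c1, Function.update_of_ne, ne_eq, Nat.reduceEqDiff, not_false_eq_true,
          ↓reduceIte, one_ne_zero, Nat.add_eq_zero_iff, false_and]
        exact ⟨hskip fun _ h => absurd rfl h, by omega⟩
      · have c2' : (j : ℕ) ≠ u := Fin.val_ne_of_ne c2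
        by_cases c3 : K.Adj u j
        · simp only [wp_cond, wp_set, wp_skip, Expr.eval, Op.eval, Expr.cost, hr, e4, ea, e12, e48,
            (hT j).1 c1, Function.update_of_ne, ne_eq, Nat.reduceEqDiff, not_false_eq_true,
            ↓reduceIte, one_ne_zero, c2', erow, (hK u j).1 c3, zero_add]
          exact ⟨hskip fun _ _ => c3, by omega⟩
        · simp only [wp_cond, wp_set, wp_skip, Expr.eval, Op.eval, Expr.cost, hr, e4, ea, e12, e48,
            (hT j).1 c1, Function.update_of_ne, ne_eq, Nat.reduceEqDiff, not_false_eq_true,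
            ↓reduceIte, one_ne_zero, c2', erow, (hK u j).2 c3, add_zero, Function.update_self]
          exact ⟨Or.inr ⟨j, c1, rfl, c2, c3⟩, by omega⟩
    · simp only [wp_cond, wp_set, wp_skip, Expr.eval, Op.eval, Expr.cost, hr, e4,
        (hT j).2 c1, Function.update_of_ne, ne_eq, Nat.reduceEqDiff, not_false_eq_true,
        ↓reduceIte, one_ne_zero]
      exact ⟨hskip fun h => absurd h c1, by omega⟩
  · rintro s' t ⟨⟨-, h1⟩, ht⟩
    refine ⟨h1.imp (fun h => ⟨h.1, fun v hv => h.2 v hv v.2⟩) id, ?_⟩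
    simp only [Expr.cost] at ht ⊢
    omega

/-- The memory holds a partial pairing of the vertices of `T`. -/
def PairState (K : SimpleGraph (Fin n)) (T : Set (Fin n)) (z : ℕ → Fin n) (l m : ℕ)
    (T₁ : Set (Fin n)) (s : Store) : Prop :=
  Paired K T z l m T₁ ∧ Indicates T₁ (s.arr 4) ∧ s.reg 56 = m ∧ ∀ i < 2 * m, s.arr 15 i = z i

/-- One pass suffices: a vertex without a partner at its turn is adjacent to all vertices of `T`
that are left then, and hence to those that are left at the end. -/
theorem wp_pairUp (ha4 : a ≠ 4) (ha15 : a ≠ 15) (hs : Ctx n s) (hK : IsRel K.Adj (s.arr a))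
    (hT : Indicates T (s.arr 4)) {z : ℕ → Fin n} {l : ℕ} (hl : s.reg 56 = l)
    (hz : ∀ i < 2 * l, s.arr 15 i = z i) :
    Wp (pairUp a) s fun s' t => (∃ z' m T₁, PairState K T z' l m T₁ s' ∧ (∀ i < 2 * l, z' i = z i) ∧
      ∀ u ∈ T₁, ∀ v ∈ T₁, v ≠ u → K.Adj u v) ∧ t ≤ 40 * n ^ 2 + 110 * n + 10 := by
  refine (wp_for_const 0 n (40 * n + 100) (fun j s' => ∃ z' m T₁, PairState K T z' l m T₁ s' ∧
      (∀ i < 2 * l, z' i = z i) ∧ ∀ u ∈ T₁, (u : ℕ) < j → ∀ v ∈ T₁, v ≠ u → K.Adj u v)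
    rfl (Nat.zero_le _) rfl ⟨z, l, T, ⟨.init _ _ _ _, hT, by simpa using hl, hz⟩,
      fun _ _ => rfl, by simp⟩ (fun j s' hF _ _ => by
      simpa [Expr.eval, hs.size] using hF.1 0 rfl) ?_).mono ?_
  · rintro j s' - hj hF hr ⟨z', m, T₁, ⟨h1, h2, h3, h4⟩, h5, h6⟩
    have ea : s'.arr a = s.arr a :=
      hF.2 a (by simp [forLoop, search, Prog.setsArr, ha4.symm, ha15.symm])
    have hs' := hs.of_frame hF
    lift j to Fin n using hj
    by_cases c1 : j ∈ T₁
    · simp only [wp_cond, wp_seq, Expr.eval, Op.eval, Expr.cost, hr, (hT j).1, (h2 j).1 c1,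
        ↓reduceIte, one_ne_zero]
      refine (wp_search (K := K) hs' (by rwa [ea]) h2 hr).mono' ?_
      rintro s'' t hF' ⟨h7, ht⟩
      have f0 : s''.reg 0 = n := (hs'.of_frame hF').size
      have f4 : s''.arr 4 = s'.arr 4 := hF'.2 4 rfl
      have f15 : s''.arr 15 = s'.arr 15 := hF'.2 15 rfl
      have f48 : s''.reg 48 = j := (hF'.1 48 rfl).trans hr
      have f56 : s''.reg 56 = m := (hF'.1 56 rfl).trans h3
      rcases h7 with ⟨h7, h8⟩ | ⟨v, hv, hv', hvj, hadj⟩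
      · simp only [wp_skip, h7, f0, lt_self_iff_false, ↓reduceIte]
        refine ⟨⟨z', m, T₁,
          ⟨h1, by simpa [f4] using h2, by simpa using f56, by simpa [f15] using h4⟩, h5,
          fun u hu huj => ?_⟩, by omega⟩
        by_cases huj' : u = j
        · subst huj'
          exact h8
        · have := Fin.val_ne_of_ne huj'
          exact h6 u hu (by omega)
      · have hvj' : (v : ℕ) ≠ j := Fin.val_ne_of_ne hvj
        simp only [wp_set, wp_store, Expr.eval, Op.eval, Expr.cost, hv', f0, v.2, ↓reduceIte,
          one_ne_zero, Function.update_self, Function.update_of_ne, ne_eq, Nat.reduceEqDiff,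
          not_false_eq_true, f48, f56, f4, f15]
        refine ⟨⟨snocPair z' m j v, m + 1, T₁ \ {j, v}, ⟨h1.snoc c1 hv hvj.symm hadj, ?_, rfl, ?_⟩,
          fun i hi => ?_, fun u hu huj w hw => ?_⟩, by omega⟩
        · intro w
          simp only [Function.update_self, Set.mem_sdiff, Set.mem_insert_iff, Set.mem_singleton_iff]
          by_cases hwv : w = v
          · simp [hwv]
          · rw [Function.update_of_ne (Fin.val_ne_of_ne hwv)]
            by_cases hwj : w = j
            · simp [hwj]
            · rw [Function.update_of_ne (Fin.val_ne_of_ne hwj)]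
              simpa [hwv, hwj] using h2 w
        · intro i hi
          change Function.update (Function.update (s'.arr 15) (m + m) (j : ℕ)) (m + m + 1) (v : ℕ) i
            = _
          by_cases hi1 : i < 2 * m
          · rw [Function.update_of_ne (by omega), Function.update_of_ne (by omega),
              snocPair_of_lt hi1, h4 i hi1]
          · by_cases hi2 : i = 2 * m
            · rw [Function.update_of_ne (by omega), hi2, snocPair_two_mul, ← two_mul,
                Function.update_self]
            · obtain rfl : i = 2 * m + 1 := by omega
              rw [snocPair_two_mul_add_one, ← two_mul, Function.update_self]
        · have := h1.le
          rw [snocPair_of_lt (by omega), h5 i hi]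
        · have huj' : u ≠ j := fun h => hu.2 (by simp [h])
          have := Fin.val_ne_of_ne huj'
          exact h6 u hu.1 (by omega) w hw.1
    · simp only [wp_cond, wp_skip, Expr.eval, Op.eval, Expr.cost, hr, (h2 j).2 c1,
        ↓reduceIte]
      refine ⟨⟨z', m, T₁, ⟨h1, h2, by simpa using h3, h4⟩, h5, fun u hu huj => ?_⟩, by omega⟩
      have huj' : u ≠ j := fun h => c1 (h ▸ hu)
      have := Fin.val_ne_of_ne huj'
      exact h6 u hu (by omega)
  · rintro s' t ⟨⟨-, z', m, T₁, h1, h2, h3⟩, ht⟩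
    refine ⟨⟨z', m, T₁, h1, h2, fun u hu => h3 u hu u.2⟩, ?_⟩
    simp only [Expr.cost, Nat.sub_zero] at ht ⊢
    have : n * (40 * n + 100 + 1 + 7) = 40 * n ^ 2 + 108 * n := by ring
    omega

/-- Pairs all vertices marked in array 4: first non-adjacent vertices, and then the remaining ones,
by means of the empty matrix in array 16. Register 53 receives the number of all pairs. -/
def pairAll : Prog :=
  .seq (.set 56 (.reg 55)) (.seq (pairUp 13) (.seq (pairUp 16) (.set 53 (.reg 56))))

theorem wp_pairAll (hs : Ctx n s) (hK : IsRel K.Adj (s.arr 13)) (hT : Indicates T (s.arr 4))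
    (heven : Even T.ncard) {z : ℕ → Fin n} {l : ℕ} (hl : s.reg 55 = l)
    (hz : ∀ i < 2 * l, s.arr 15 i = z i) :
    Wp pairAll s fun s' t => (∃ z' m N, PairInv K T z' l m N ∧ (∀ i < 2 * l, z i = z' i) ∧
      s'.reg 53 = N ∧ ∀ i < 2 * N, s'.arr 15 i = z' i) ∧ t ≤ 80 * n ^ 2 + 220 * n + 30 := by
  rw [pairAll, wp_seq, wp_set, wp_seq]
  refine (wp_pairUp (a := 13) (K := K) (T := T) (z := z) (l := l) (by omega) (by omega)
    (by exact ⟨by simpa using hs.size, hs.zero, hs.row, hs.zero'⟩) (by exact hK) (by exact hT)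
    (by simp [Expr.eval, hl]) (by exact hz)).mono' ?_
  rintro s1 t1 hF1 ⟨⟨z1, m, T₁, ⟨h1, h2, h3, h4⟩, h5, h6⟩, ht1⟩
  have hs1 : Ctx n s1 := Ctx.of_frame (P := pairUp 13) (s := ⟨Function.update s.reg 56
    ((Expr.reg 55).eval s), s.arr⟩) ⟨by simpa using hs.size, hs.zero, hs.row, hs.zero'⟩ hF1
  rw [wp_seq]
  refine (wp_pairUp (a := 16) (K := ⊥) (T := T₁) (z := z1) (l := m) (by omega) (by omega) hs1
    (fun u v => by simp [hs1.zero']) h2 h3 h4).mono ?_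
  rintro s2 t2 ⟨⟨z2, N, T₂, ⟨g1, g2, g3, g4⟩, g5, g6⟩, ht2⟩
  simp only [wp_set, Expr.eval, Expr.cost]
  refine ⟨⟨z2, m, N, (h1.congr g5).pairInv g1 h6 ?_ heven, fun i hi => ?_, by simpa using g3, g4⟩,
    by omega⟩
  · rw [Set.ncard_le_one]
    intro u hu v hv
    by_contra huv
    exact g6 u hu v hv (Ne.symm huv)
  · have := h1.le
    rw [g5 i (by omega), h5 i hi]

end

/-! ### Trying exchanges and bypasses -/

/-- Edits the graph by the pairs in array 15, and undoes this if the result is not connected.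
Register 58 tells whether it is. -/
def attempt : Prog :=
  .seq toggleAll (.seq components
    (.cond (.op .eq (.reg 30) (.const 1)) (.set 58 (.const 1)) toggleAll))

/-- Exchanges the entries of array 15 at the positions in the registers 59 and 63. -/
def swapCells : Prog :=
  .seq (.set 60 (.cell 15 (.reg 59))) (.seq (.store 15 (.reg 59) (.cell 15 (.reg 63)))
    (.store 15 (.reg 63) (.reg 60)))

/-- Tries all exchanges with the position in register 63. -/
def exchanges : Prog :=
  forLoop 59 (.const 0) (.op .add (.reg 53) (.reg 53))
    (.cond (.reg 58) .skip (.seq swapCells (.seq attempt swapCells)))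

/-- Tries to replace the last pair by the two pairs through another vertex. The last entry of the
list is saved in register 60, because the first bypass overwrites it. -/
def bypasses : Prog :=
  .seq (.set 60 (.cell 15 (.op .sub (.op .add (.reg 53) (.reg 53)) (.const 1))))
    (.seq (.set 53 (.op .add (.reg 53) (.const 1)))
    (forLoop 59 (.const 0) (.reg 0) (.cond (.reg 58) .skip
      (.seq (.store 15 (.op .sub (.op .add (.reg 53) (.reg 53)) (.const 3)) (.reg 59))
      (.seq (.store 15 (.op .sub (.op .add (.reg 53) (.reg 53)) (.const 2)) (.reg 59))
      (.seq (.store 15 (.op .sub (.op .add (.reg 53) (.reg 53)) (.const 1)) (.reg 60))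
        attempt))))))

/-- Tries the list in array 15, its exchanges, and its bypasses, until the result is connected. -/
def attempts : Prog :=
  .seq (.set 58 (.const 0)) (.seq attempt
    (.seq (.set 63 (.op .sub (.op .add (.reg 53) (.reg 53)) (.const 1))) (.seq exchanges
    (.seq (.cond (.op .lt (.reg 55) (.reg 53))
      (.seq (.set 63 (.op .add (.op .add (.reg 55) (.reg 55)) (.const 1))) exchanges) .skip)
    (.cond (.reg 58) .skip bypasses)))))

section
variable {n : ℕ} {G : SimpleGraph (Fin n)} {s : Store} {N : ℕ}

/-- After trying the lists in `W`: either register 58 is `1`, and array 13 holds a connected graph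
obtained by one of them, or register 58 is `0`, there is no such list, and array 13 holds `G`. -/
def Outcome (G : SimpleGraph (Fin n)) (N : ℕ) (W : (ℕ → Fin n) → Prop) (s : Store) : Prop :=
  (s.reg 58 = 1 ∧ ∃ w, W w ∧ (G ∆ gr (vec w N)).Connected ∧
    IsRel (G ∆ gr (vec w N)).Adj (s.arr 13)) ∨
  (s.reg 58 = 0 ∧ (∀ w, W w → ¬ (G ∆ gr (vec w N)).Connected) ∧ IsRel G.Adj (s.arr 13))

theorem Outcome.congr {W W' : (ℕ → Fin n) → Prop} {s' : Store} (h : Outcome G N W s)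
    (hW : ∀ w, W w ↔ W' w) (h58 : s'.reg 58 = s.reg 58) (h13 : s'.arr 13 = s.arr 13) :
    Outcome G N W' s' := by
  obtain rfl : W = W' := funext fun w => propext (hW w)
  rwa [Outcome, h58, h13]

theorem wp_attempt [NeZero n] (hs : Ctx n s) {z : ℕ → Fin n} (hN : s.reg 53 = N)
    (hz : ∀ i < 2 * N, s.arr 15 i = z i) {W : (ℕ → Fin n) → Prop} (h : Outcome G N W s)
    (h58 : s.reg 58 = 0) :
    Wp attempt s fun s' t => Outcome G N (fun w => W w ∨ w = z) s' ∧
      t ≤ 140 * n ^ 2 + 150 * n + 160 * N + 100 := by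
  obtain ⟨h1, -⟩ | ⟨-, hW, hG⟩ := h
  · omega
  rw [attempt, wp_seq]
  refine (wp_toggleAll hs hG hN hz).mono' ?_
  rintro s1 t1 hF1 ⟨h1, ht1⟩
  have hs1 := hs.of_frame hF1
  rw [wp_seq]
  refine (wp_components hs1 h1).mono' ?_
  rintro s2 t2 hF2 ⟨h2, ht2⟩
  have hs2 := hs1.of_frame hF2
  have e13 : s2.arr 13 = s1.arr 13 := hF2.2 13 rfl
  by_cases hc : s2.reg 30 = 1
  · simp only [wp_cond, wp_set, Expr.eval, Op.eval, Expr.cost, hc, ↓reduceIte, one_ne_zero]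
    exact ⟨Or.inl ⟨by simp, z, Or.inr rfl, h2.eq_one_iff.1 hc, by simpa [e13] using h1⟩, by omega⟩
  · simp only [wp_cond, Expr.eval, Op.eval, Expr.cost, hc, ↓reduceIte]
    have e15 : s2.arr 15 = s.arr 15 := (hF2.2 15 rfl).trans (hF1.2 15 rfl)
    have e53 : s2.reg 53 = s.reg 53 := (hF2.1 53 rfl).trans (hF1.1 53 rfl)
    have e58 : s2.reg 58 = s.reg 58 := (hF2.1 58 rfl).trans (hF1.1 58 rfl)
    refine (wp_toggleAll (z := z) hs2 (e13.symm ▸ h1) (e53.trans hN) (by rwa [e15])).mono' ?_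
    rintro s3 t3 hF3 ⟨h3, ht3⟩
    -- switching all pairs a second time restores `G`
    rw [symmDiff_assoc, symmDiff_self, symmDiff_bot] at h3
    refine ⟨Or.inr ⟨((hF3.1 58 rfl).trans e58).trans h58, ?_, h3⟩, by omega⟩
    rintro w (hw | rfl)
    · exact hW w hw
    · exact mt h2.eq_one_iff.2 hc

theorem wp_swapCells {i q : ℕ} (hi : s.reg 59 = i) (hq : s.reg 63 = q) :
    Wp swapCells s fun s' t => s'.arr 15 = s.arr 15 ∘ Equiv.swap i q ∧ t ≤ 20 := by
  simp only [swapCells, wp_seq, wp_set, wp_store, Expr.eval, Expr.cost, hi, hq,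
    Function.update_self, Function.update_of_ne, ne_eq, Nat.reduceEqDiff, not_false_eq_true]
  refine ⟨?_, by omega⟩
  rw [Equiv.swap_comm, Equiv.comp_swap_eq_update]

theorem wp_exchanges [NeZero n] (hs : Ctx n s) {z : ℕ → Fin n} (hN : s.reg 53 = N) (hNn : N ≤ n)
    (hz : ∀ i < 2 * N, s.arr 15 i = z i) {q : ℕ} (hq : s.reg 63 = q) (hqN : 0 < N → q < 2 * N)
    {W : (ℕ → Fin n) → Prop} (h : Outcome G N W s) :
    Wp exchanges s fun s' t =>
      (Outcome G N (fun w => W w ∨ ∃ i < 2 * N, w = z ∘ Equiv.swap i q) s' ∧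
        s'.arr 15 = s.arr 15) ∧ t ≤ 280 * n ^ 3 + 620 * n ^ 2 + 320 * n + 10 := by
  refine (wp_for_const 0 (2 * N) (140 * n ^ 2 + 310 * n + 150) (fun j s' =>
      Outcome G N (fun w => W w ∨ ∃ i < j, w = z ∘ Equiv.swap i q) s' ∧ s'.arr 15 = s.arr 15)
    rfl (Nat.zero_le _) rfl ⟨h.congr (fun w => by simp) (by simp) rfl, rfl⟩ (fun j s' hF _ _ => by
      have : s'.reg 53 = s.reg 53 := hF.1 53 rfl
      simp [Expr.eval, Op.eval, this, hN, two_mul]) ?_).mono ?_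
  · rintro j s' - hj hF hr ⟨h1, h2⟩
    have hs' := hs.of_frame hF
    have hq' : s'.reg 63 = q := (hF.1 63 rfl).trans hq
    have hN' : s'.reg 53 = N := (hF.1 53 rfl).trans hN
    rcases h1 with ⟨h58, w, h1, h3⟩ | h1
    · simp only [wp_cond, wp_skip, Expr.eval, Expr.cost, h58, one_ne_zero, ↓reduceIte]
      refine ⟨⟨Or.inl ⟨by simpa using h58, w, ?_, h3⟩, h2⟩, by omega⟩
      exact h1.imp_right fun ⟨i, hi, hi'⟩ => ⟨i, by omega, hi'⟩
    · simp only [wp_cond, Expr.eval, Expr.cost, h1.1, ↓reduceIte]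
      rw [wp_seq]
      refine (wp_swapCells hr hq').mono' ?_
      rintro s1 t1 hF1 ⟨g1, ht1⟩
      have a58 : s1.reg 58 = s'.reg 58 := hF1.1 58 rfl
      have a13 : s1.arr 13 = s'.arr 13 := hF1.2 13 rfl
      rw [wp_seq]
      refine (wp_attempt (G := G) (N := N) (z := z ∘ Equiv.swap j q) (hs'.of_frame hF1)
        ((hF1.1 53 rfl).trans hN') (fun i hi => ?_)
        ((show Outcome G N _ s' from Or.inr h1).congr (fun _ => Iff.rfl) a58 a13)
        (a58.trans h1.1)).mono' ?_
      · rw [g1, h2]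
        exact hz _ ((swap_lt_iff hj (hqN (by omega))).1 hi)
      · rintro s2 t2 hF2 ⟨g2, ht2⟩
        have a15 : s2.arr 15 = s1.arr 15 := hF2.2 15 rfl
        refine (wp_swapCells (i := j) (q := q) (((hF2.1 59 rfl).trans (hF1.1 59 rfl)).trans hr)
          (((hF2.1 63 rfl).trans (hF1.1 63 rfl)).trans hq')).mono' ?_
        rintro s3 t3 hF3 ⟨g3, ht3⟩
        refine ⟨⟨g2.congr (fun w => ?_) ?_ (hF3.2 13 rfl), ?_⟩, by omega⟩
        · simp only [Nat.lt_succ_iff_lt_or_eq, or_and_right, exists_or, exists_eq_left, or_assoc]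
        · simpa using hF3.1 58 rfl
        · rw [g3, a15, g1, h2]
          funext i
          simp
  · rintro s' t ⟨⟨-, h1⟩, ht⟩
    refine ⟨h1, ht.trans ?_⟩
    simp only [Expr.cost, Nat.sub_zero]
    have : 2 * N * (140 * n ^ 2 + 310 * n + 150 + (1 + 1 + 1) + 7) ≤
        2 * n * (140 * n ^ 2 + 310 * n + 150 + (1 + 1 + 1) + 7) := by gcongr
    have e : 2 * n * (140 * n ^ 2 + 310 * n + 150 + (1 + 1 + 1) + 7) =
        280 * n ^ 3 + 620 * n ^ 2 + 320 * n := by ring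
    omega

theorem wp_bypasses [NeZero n] (hs : Ctx n s) {z : ℕ → Fin n} (hN : s.reg 53 = N) (hN1 : 1 ≤ N)
    (hNn : N ≤ n) (hz : ∀ i < 2 * N, s.arr 15 i = z i) (h58 : s.reg 58 = 0)
    (hG : IsRel G.Adj (s.arr 13)) :
    Wp bypasses s fun s' t => Outcome G (N + 1) (fun w => ∃ x : Fin n, w = bypass z N x) s' ∧
      t ≤ 140 * n ^ 3 + 310 * n ^ 2 + 400 * n + 30 := by
  have e1 : s.arr 15 (N + N - 1) = z (2 * N - 1) := by rw [← two_mul, hz _ (by omega)]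
  simp only [bypasses, wp_seq, wp_set, Expr.eval, Op.eval, Expr.cost, hN, e1,
    Function.update_of_ne, ne_eq, Nat.reduceEqDiff, not_false_eq_true]
  refine (wp_for_const 0 n (140 * n ^ 2 + 310 * n + 350) (fun j s' =>
      Outcome G (N + 1) (fun w => ∃ x : Fin n, (x : ℕ) < j ∧ w = bypass z N x) s' ∧
        ∀ i < 2 * N - 1, s'.arr 15 i = z i)
    rfl (Nat.zero_le _) rfl ?_
    (fun j s' hF _ _ => by simpa [Expr.eval, hs.size] using hF.1 0 rfl) ?_).mono ?_
  · exact ⟨Or.inr ⟨by simpa using h58, by simp, hG⟩, fun i hi => hz i (by omega)⟩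
  · rintro j s' - hj hF hr ⟨h1, h2⟩
    have hs0 : Ctx n ⟨Function.update (Function.update s.reg 60 (z (2 * N - 1) : ℕ)) 53 (N + 1),
        s.arr⟩ := ⟨by simpa using hs.size, hs.zero, hs.row, hs.zero'⟩
    have hs' := hs0.of_frame hF
    have e53 : s'.reg 53 = N + 1 := by simpa using hF.1 53 rfl
    have e60 : s'.reg 60 = z (2 * N - 1) := by simpa using hF.1 60 rfl
    lift j to Fin n using hj
    rcases h1 with ⟨h58', w, ⟨x, hx, hx'⟩, h3⟩ | h1
    · simp only [wp_cond, wp_skip, Expr.eval, Expr.cost, h58', one_ne_zero, ↓reduceIte]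
      exact ⟨⟨Or.inl ⟨by simpa using h58', w, ⟨x, by omega, hx'⟩, h3⟩, h2⟩, by omega⟩
    · have p1 : N + 1 + (N + 1) - 3 = 2 * N - 1 := by omega
      have p2 : N + 1 + (N + 1) - 2 = 2 * N := by omega
      have p3 : N + 1 + (N + 1) - 1 = 2 * N + 1 := by omega
      simp only [wp_cond, wp_seq, wp_store, Expr.eval, Op.eval, Expr.cost, h1.1, hr, e53, e60,
        p1, p2, p3, Function.update_self, ↓reduceIte]
      refine (wp_attempt (G := G) (N := N + 1) (z := bypass z N j)
        (W := fun w => ∃ x : Fin n, (x : ℕ) < j ∧ w = bypass z N x) (by exact ⟨hs'.size,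
        by simpa using hs'.zero, by simpa using hs'.row, by simpa using hs'.zero'⟩) (by exact e53)
        ?_ ?_ (by exact h1.1)).mono' ?_
      · intro i hi
        change Function.update (Function.update (Function.update (s'.arr 15) (2 * N - 1) (j : ℕ))
          (2 * N) (j : ℕ)) (2 * N + 1) (z (2 * N - 1) : ℕ) i = _
        rw [bypass]
        by_cases c1 : i < 2 * N - 1
        · rw [Function.update_of_ne (by omega), Function.update_of_ne (by omega),
            Function.update_of_ne (by omega), if_pos c1, h2 i c1]
        · rw [if_neg c1]
          by_cases c2 : i < 2 * N + 1
          · rw [if_pos c2, Function.update_of_ne (by omega)]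
            by_cases c3 : i = 2 * N
            · rw [c3, Function.update_self]
            · rw [Function.update_of_ne c3, show i = 2 * N - 1 by omega, Function.update_self]
          · rw [if_neg c2, show i = 2 * N + 1 by omega, Function.update_self]
      · exact (show Outcome G (N + 1) _ s' from Or.inr h1).congr (fun _ => Iff.rfl) rfl (by simp)
      · rintro s2 t2 hF2 ⟨g2, ht2⟩
        refine ⟨⟨g2.congr (fun w => ?_) (by simp) rfl, fun i hi => ?_⟩, by omega⟩
        · constructor
          · rintro (⟨x, hx, hx'⟩ | hx)
            · exact ⟨x, by omega, hx'⟩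
            · exact ⟨j, by omega, hx⟩
          · rintro ⟨x, hx, hx'⟩
            by_cases hxj : x = j
            · exact Or.inr (hxj ▸ hx')
            · have := Fin.val_ne_of_ne hxj
              exact Or.inl ⟨x, by omega, hx'⟩
        · have := hF2.2 15 rfl
          change s2.arr 15 i = _
          rw [this]
          change Function.update (Function.update (Function.update (s'.arr 15) (2 * N - 1)
            (j : ℕ)) (2 * N) (j : ℕ)) (2 * N + 1) (z (2 * N - 1) : ℕ) i = _
          rw [Function.update_of_ne (by omega), Function.update_of_ne (by omega),
            Function.update_of_ne (by omega), h2 i hi]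
  · rintro s' t ⟨⟨-, h1, -⟩, ht⟩
    refine ⟨h1.congr (fun w => by simp) rfl rfl, ?_⟩
    simp only [Expr.cost, Nat.sub_zero] at ht
    have e : n * (140 * n ^ 2 + 310 * n + 350 + 1 + 7) =
        140 * n ^ 3 + 310 * n ^ 2 + 358 * n := by ring
    omega

theorem wp_attempts [NeZero n] (hs : Ctx n s) {z : ℕ → Fin n} {l : ℕ} (hN : s.reg 53 = N)
    (hNn : N ≤ n) (hl : s.reg 55 = l) (hz : ∀ i < 2 * N, s.arr 15 i = z i)
    (hG : IsRel G.Adj (s.arr 13))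
    (hN1 : (∀ w, IsExchange z w l N → ¬ (G ∆ gr (vec w N)).Connected) → 1 ≤ N) :
    Wp attempts s fun s' t => ((s'.reg 58 = 1 ∧ ∃ w, IsExchange z w l N ∧
        (G ∆ gr (vec w N)).Connected ∧ IsRel (G ∆ gr (vec w N)).Adj (s'.arr 13)) ∨
      ((∀ w, IsExchange z w l N → ¬ (G ∆ gr (vec w N)).Connected) ∧
        Outcome G (N + 1) (fun w => ∃ x : Fin n, w = bypass z N x) s')) ∧ t ≤ 4000 * n ^ 3 := by
  have hn : 1 ≤ n := Nat.one_le_iff_ne_zero.2 (NeZero.ne n)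
  have hn3 : n ≤ n ^ 3 := Nat.le_self_pow (by omega) n
  have hn2 : n ^ 2 ≤ n ^ 3 := Nat.pow_le_pow_right hn (by omega)
  simp only [attempts, wp_seq, wp_set, Expr.eval, Expr.cost]
  refine (wp_attempt (G := G) (N := N) (z := z) (W := fun _ => False)
    (by exact ⟨by simpa using hs.size, hs.zero, hs.row, hs.zero'⟩) (by simpa using hN) (by exact hz)
    (by exact Or.inr ⟨by simp, by simp, hG⟩) (by simp)).mono' ?_
  rintro s1 t1 hF1 ⟨h1, ht1⟩
  have hs1 : Ctx n s1 := Ctx.of_frame (P := attempt) (s := ⟨Function.update s.reg 58 0, s.arr⟩)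
    ⟨by simpa using hs.size, hs.zero, hs.row, hs.zero'⟩ hF1
  have a53 : s1.reg 53 = N := (hF1.1 53 rfl).trans (by simpa using hN)
  have a55 : s1.reg 55 = l := (hF1.1 55 rfl).trans (by simpa using hl)
  have a15 : s1.arr 15 = s.arr 15 := hF1.2 15 rfl
  simp only [a53, Op.eval]
  refine (wp_exchanges (G := G) (N := N) (z := z) (q := N + N - 1)
    (by exact ⟨by simpa using hs1.size, hs1.zero, hs1.row, hs1.zero'⟩) (by simpa using a53) hNn
    (by exact a15.symm ▸ hz) (by simp) (by omega)
    (by exact h1.congr (fun _ => Iff.rfl) (by simp) rfl)).mono' ?_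
  rintro s2 t2 hF2 ⟨⟨h2, b15⟩, ht2⟩
  have hs2 : Ctx n s2 := Ctx.of_frame (P := exchanges)
    (s := ⟨Function.update s1.reg 63 (N + N - 1), s1.arr⟩)
    ⟨by simpa using hs1.size, hs1.zero, hs1.row, hs1.zero'⟩ hF2
  have b53 : s2.reg 53 = N := (hF2.1 53 rfl).trans (by simpa using a53)
  have b55 : s2.reg 55 = l := (hF2.1 55 rfl).trans (by simpa using a55)
  replace b15 : s2.arr 15 = s.arr 15 := b15.trans a15
  have key : Wp (.cond (.op .lt (.reg 55) (.reg 53))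
      (.seq (.set 63 (.op .add (.op .add (.reg 55) (.reg 55)) (.const 1))) exchanges) .skip) s2
      fun s' t => (Outcome G N (fun w => IsExchange z w l N) s' ∧ s'.arr 15 = s2.arr 15) ∧
        t ≤ 280 * n ^ 3 + 620 * n ^ 2 + 320 * n + 30 := by
    by_cases hlN : l < N
    · simp only [wp_cond, wp_seq, wp_set, Expr.eval, Op.eval, Expr.cost, b53, b55, hlN, ↓reduceIte,
        one_ne_zero]
      refine (wp_exchanges (G := G) (N := N) (z := z) (q := l + l + 1)
        (by exact ⟨by simpa using hs2.size, hs2.zero, hs2.row, hs2.zero'⟩) (by simpa using b53) hNn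
        (by exact b15.symm ▸ hz) (by simp) (by omega)
        (by exact h2.congr (fun _ => Iff.rfl) (by simp) rfl)).mono ?_
      rintro s3 t3 ⟨⟨h3, h3'⟩, ht3⟩
      refine ⟨⟨h3.congr (fun w => ?_) rfl rfl, h3'⟩, by omega⟩
      simp only [IsExchange, hlN, true_and, false_or, or_assoc, two_mul]
    · simp only [wp_cond, wp_skip, Expr.eval, Op.eval, Expr.cost, b53, b55, hlN, ↓reduceIte]
      refine ⟨⟨h2.congr (fun w => ?_) rfl rfl, trivial⟩, by omega⟩
      simp only [IsExchange, hlN, false_and, or_false, false_or, two_mul]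
  refine key.mono' ?_
  rintro s3 t3 hF3 ⟨⟨h3, c15⟩, ht3⟩
  have hs3 := hs2.of_frame hF3
  have c53 : s3.reg 53 = N := (hF3.1 53 rfl).trans b53
  rcases h3 with h3 | h3
  · simp only [wp_cond, wp_skip, Expr.eval, Expr.cost, h3.1, one_ne_zero, ↓reduceIte]
    exact ⟨Or.inl ⟨trivial, h3.2⟩, by omega⟩
  · simp only [wp_cond, Expr.eval, Expr.cost, h3.1, ↓reduceIte]
    refine (wp_bypasses (z := z) hs3 c53 (hN1 h3.2.1) hNn (by rwa [c15, b15]) h3.1 h3.2.2).mono ?_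
    rintro s4 t4 ⟨h4, ht4⟩
    exact ⟨Or.inr ⟨h3.2.1, h4⟩, by omega⟩

end

/-! ### Listing the edits -/

section
variable {n : ℕ}

/-- The pairs `(a, b)` with `b < a` and `R a b` that precede `(u, j)` in the lexicographic order. -/
def below (R : Fin n → Fin n → Prop) (u j : ℕ) : Set (ℕ × ℕ) :=
  {p | ∃ a b : Fin n, p = ((a : ℕ), (b : ℕ)) ∧ b < a ∧ R a b ∧
    ((a : ℕ) < u ∨ (a : ℕ) = u ∧ (b : ℕ) < j)}

variable {R : Fin n → Fin n → Prop}

theorem below_zero : below R 0 0 = ∅ := by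
  ext p
  simp [below]

theorem below_self (u : ℕ) : below R u u = below R (u + 1) 0 := by
  ext p
  simp only [below, Set.mem_ofPred_eq]
  refine exists_congr fun a => exists_congr fun b => and_congr_right fun _ =>
    and_congr_right fun h => and_congr_right fun _ => ?_
  rw [Fin.lt_def] at h
  omega

theorem notMem_below (u v : Fin n) : ((u : ℕ), (v : ℕ)) ∉ below R u v := by
  rintro ⟨a, b, h, -, -, h1⟩
  rw [Prod.mk.injEq] at h
  omega

theorem below_succ_of_rel {u v : Fin n} (hvu : v < u) (h : R u v) :
    below R u (v + 1) = insert ((u : ℕ), (v : ℕ)) (below R u v) := by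
  ext p
  simp only [below, Set.mem_ofPred_eq, Set.mem_insert_iff]
  constructor
  · rintro ⟨a, b, rfl, h1, h2, h3⟩
    by_cases hab : (a : ℕ) = u ∧ (b : ℕ) = v
    · exact Or.inl (by rw [hab.1, hab.2])
    · exact Or.inr ⟨a, b, rfl, h1, h2, by omega⟩
  · rintro (rfl | ⟨a, b, rfl, h1, h2, h3⟩)
    · exact ⟨u, v, rfl, hvu, h, by omega⟩
    · exact ⟨a, b, rfl, h1, h2, by omega⟩

theorem below_succ_of_not_rel {u v : Fin n} (h : ¬ R u v) : below R u (v + 1) = below R u v := by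
  ext p
  simp only [below, Set.mem_ofPred_eq]
  refine exists_congr fun a => exists_congr fun b => and_congr_right fun _ =>
    and_congr_right fun _ => and_congr_right fun hR => ?_
  have : ¬ ((a : ℕ) = u ∧ (b : ℕ) = v) := by
    rintro ⟨h1, h2⟩
    rw [Fin.ext h1, Fin.ext h2] at hR
    exact h hR
  omega

/-- The pairs `(f i, g i)` with `i < l` list the set `E`, each element exactly once. -/
def Listed (f g : ℕ → ℕ) (l : ℕ) (E : Set (ℕ × ℕ)) : Prop :=
  Set.BijOn (fun i => (f i, g i)) (Set.Iio l) E

theorem Listed.empty (f g : ℕ → ℕ) : Listed f g 0 ∅ := by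
  simp [Listed]

theorem Listed.snoc {f g : ℕ → ℕ} {l x y : ℕ} {E : Set (ℕ × ℕ)} (h : Listed f g l E)
    (hxy : (x, y) ∉ E) :
    Listed (Function.update f l x) (Function.update g l y) (l + 1) (insert (x, y) E) := by
  have h1 : Set.Iio (l + 1) = insert l (Set.Iio l) := by
    ext i
    simp only [Set.mem_Iio, Set.mem_insert_iff]
    omega
  have h2 : Set.BijOn (fun i => (Function.update f l x i, Function.update g l y i))
      (Set.Iio l) E := by
    refine h.congr fun i hi => ?_
    rw [Set.mem_Iio] at hi
    simp [Function.update_of_ne hi.ne]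
  have h3 := h2.insert (a := l) (by simpa using hxy)
  simpa [Listed, h1] using h3

theorem Listed.listsEdges {K : SimpleGraph (Fin n)} {f g : ℕ → ℕ} {l : ℕ}
    (h : Listed f g l (below K.Adj n 0)) {F : Finset (Sym2 (Fin n))}
    (hF : (F : Set _) = K.edgeSet) : ListsEdges f g l F := by
  refine Set.BijOn.comp (g := fun p : ℕ × ℕ => s(p.1, p.2)) ⟨?_, ?_, ?_⟩ h
  · rintro _ ⟨a, b, rfl, -, hab, -⟩
    exact ⟨s(a, b), by rw [hF]; exact hab, rfl⟩
  · rintro _ ⟨a, b, rfl, hab, -, -⟩ _ ⟨c, d, rfl, hcd, -, -⟩ he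
    rw [Fin.lt_def] at hab hcd
    rcases Sym2.eq_iff.1 he with ⟨h1, h2⟩ | ⟨h1, h2⟩
    · exact Prod.ext h1 h2
    · simp only at h1 h2
      omega
  · rintro _ ⟨e, he, rfl⟩
    rw [hF] at he
    induction e with | _ a b
    rw [mem_edgeSet] at he
    rcases lt_or_gt_of_ne he.ne with hab | hab
    · exact ⟨((b : ℕ), (a : ℕ)), ⟨b, a, rfl, hab, he.symm, Or.inl b.2⟩, Sym2.eq_swap⟩
    · exact ⟨((a : ℕ), (b : ℕ)), ⟨a, b, rfl, hab, he, Or.inl a.2⟩, rfl⟩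

/-- Lists the pairs of vertices on which the matrices in the arrays 13 and 14 differ: those in the
former are listed in the arrays 0 and 1, those in the latter in the arrays 2 and 3. The registers
61 and 62 receive the lengths of the lists. -/
def listEdits : Prog :=
  .seq (.set 61 (.const 0)) (.seq (.set 62 (.const 0))
    (forLoop 59 (.const 0) (.reg 0) (forLoop 37 (.const 0) (.reg 59)
      (.cond (.op .eq (.cell 13 (.op .add (.cell 12 (.reg 59)) (.reg 37)))
          (.cell 14 (.op .add (.cell 12 (.reg 59)) (.reg 37)))) .skip
        (.cond (.cell 13 (.op .add (.cell 12 (.reg 59)) (.reg 37)))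
          (.seq (.store 0 (.reg 61) (.reg 59)) (.seq (.store 1 (.reg 61) (.reg 37))
            (.set 61 (.op .add (.reg 61) (.const 1)))))
          (.seq (.store 2 (.reg 62) (.reg 59)) (.seq (.store 3 (.reg 62) (.reg 37))
            (.set 62 (.op .add (.reg 62) (.const 1))))))))))

variable {G H : SimpleGraph (Fin n)} {s : Store}

theorem wp_listEdits (hs : Ctx n s) (hH : IsRel H.Adj (s.arr 13)) (hG : IsRel G.Adj (s.arr 14)) :
    Wp listEdits s fun s' t =>
      (Listed (s'.arr 0) (s'.arr 1) (s'.reg 61) (below (H \ G).Adj n 0) ∧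
        Listed (s'.arr 2) (s'.arr 3) (s'.reg 62) (below (G \ H).Adj n 0)) ∧
      t ≤ 70 * n ^ 2 + 20 * n + 20 := by
  simp only [listEdits, wp_seq, wp_set, Expr.eval, Expr.cost]
  refine (wp_for_const 0 n (70 * n + 10) (fun u s' =>
      Listed (s'.arr 0) (s'.arr 1) (s'.reg 61) (below (H \ G).Adj u 0) ∧
        Listed (s'.arr 2) (s'.arr 3) (s'.reg 62) (below (G \ H).Adj u 0))
    rfl (Nat.zero_le _) rfl ?_ (fun j s' hF _ _ => by simpa [Expr.eval, hs.size] using hF.1 0 rfl)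
    ?_).mono ?_
  · rw [below_zero, below_zero]
    exact ⟨by simpa using Listed.empty _ _, by simpa using Listed.empty _ _⟩
  · rintro u s1 - hu hF hr ⟨h1, h2⟩
    have hs0 : Ctx n ⟨Function.update (Function.update s.reg 61 0) 62 0, s.arr⟩ :=
      ⟨by simpa using hs.size, hs.zero, hs.row, hs.zero'⟩
    have hs1 := hs0.of_frame hF
    have a13 : s1.arr 13 = s.arr 13 := hF.2 13 rfl
    have a14 : s1.arr 14 = s.arr 14 := hF.2 14 rfl
    lift u to Fin n using hu
    refine (wp_for_const 0 u 60 (fun v s' =>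
        Listed (s'.arr 0) (s'.arr 1) (s'.reg 61) (below (H \ G).Adj u v) ∧
        Listed (s'.arr 2) (s'.arr 3) (s'.reg 62) (below (G \ H).Adj u v))
      rfl (Nat.zero_le _) rfl ⟨by simpa using h1, by simpa using h2⟩
      (fun j s' hF' _ _ => by simpa [Expr.eval, hr] using hF'.1 59 rfl) ?_).mono ?_
    · rintro v s2 - hv hF' hr' ⟨h3, h4⟩
      have b13 : s2.arr 13 = s.arr 13 := (hF'.2 13 rfl).trans a13
      have b14 : s2.arr 14 = s.arr 14 := (hF'.2 14 rfl).trans a14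
      have b59 : s2.reg 59 = u := (hF'.1 59 rfl).trans hr
      have b12 := (hs1.of_frame hF').row u u.2.le
      obtain ⟨v, rfl⟩ : ∃ w : Fin n, (w : ℕ) = v := ⟨⟨v, by omega⟩, rfl⟩
      have hvu : v < u := hv
      by_cases c1 : H.Adj u v <;> by_cases c2 : G.Adj u v
      · simp only [wp_cond, wp_skip, Expr.eval, Op.eval, Expr.cost, b59, hr', b12, b13, b14,
          (hH u v).1 c1, (hG u v).1 c2, ↓reduceIte, one_ne_zero]
        rw [below_succ_of_not_rel (by simp [c2]), below_succ_of_not_rel (by simp [c1])]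
        exact ⟨⟨by simpa using h3, by simpa using h4⟩, by omega⟩
      · simp only [wp_cond, wp_seq, wp_store, wp_set, Expr.eval, Op.eval, Expr.cost, b59, hr', b12,
          b13, b14, (hH u v).1 c1, (hG u v).2 c2, ↓reduceIte, one_ne_zero]
        rw [below_succ_of_rel hvu (by simp [c1, c2]), below_succ_of_not_rel (by simp [c1])]
        exact ⟨⟨by simpa using h3.snoc (notMem_below u v), by simpa using h4⟩, by omega⟩
      · simp only [wp_cond, wp_seq, wp_store, wp_set, Expr.eval, Op.eval, Expr.cost, b59, hr', b12,
          b13, b14, (hH u v).2 c1, (hG u v).1 c2, ↓reduceIte, zero_ne_one]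
        rw [below_succ_of_not_rel (by simp [c2]), below_succ_of_rel hvu (by simp [c1, c2])]
        exact ⟨⟨by simpa using h3, by simpa using h4.snoc (notMem_below u v)⟩, by omega⟩
      · simp only [wp_cond, wp_skip, Expr.eval, Op.eval, Expr.cost, b59, hr', b12, b13, b14,
          (hH u v).2 c1, (hG u v).2 c2, ↓reduceIte, one_ne_zero]
        rw [below_succ_of_not_rel (by simp [c1]), below_succ_of_not_rel (by simp [c2])]
        exact ⟨⟨by simpa using h3, by simpa using h4⟩, by omega⟩
    · rintro s' t ⟨⟨-, h3, h4⟩, ht⟩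
      rw [below_self] at h3 h4
      refine ⟨⟨by simpa using h3, by simpa using h4⟩, ?_⟩
      simp only [Expr.cost] at ht
      have := u.2
      omega
  · rintro s' t ⟨⟨-, h1⟩, ht⟩
    refine ⟨h1, ?_⟩
    simp only [Expr.cost, Nat.sub_zero] at ht
    have : n * (70 * n + 10 + 1 + 7) = 70 * n ^ 2 + 18 * n := by ring
    omega

end

/-! ### The solver -/

/-- A target graph with the least number of edits is obtained by an optimal solution. -/
theorem isOptimalSolution_of_forall_le {V : Type*} {G H : SimpleGraph V} {δ : V → Fin 2}
    {A D : Finset (Sym2 V)} (hA : (A : Set (Sym2 V)) = H.edgeSet \ G.edgeSet)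
    (hD : (D : Set (Sym2 V)) = G.edgeSet \ H.edgeSet) (hH : IsTarget δ H)
    (hmin : ∀ F, IsTarget δ (G ∆ F) → (G ∆ H).edgeSet.ncard ≤ F.edgeSet.ncard) :
    IsOptimalSolution G δ A D := by
  obtain ⟨h1, h2, h3⟩ := edit_eq_of_coe hA hD
  refine ⟨⟨h1, h2, h3.symm ▸ hH⟩, ?_⟩
  rintro A' D' ⟨h4, h5, h6⟩
  rw [card_add_card_eq h1 h2, card_add_card_eq h4 h5, h3]
  exact hmin _ (by rwa [symmDiff_symmDiff_cancel_left])

/-- Computes in array 13 a target graph that is reached by the least number of edits, provided that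
the number of vertices of the wrong parity is even. Register 58 tells whether there is one. -/
def findTarget : Prog :=
  .seq rows (.seq buildMatrix (.seq (copyMatrix 13 14) (.seq join (.seq pairAll
    (.seq (copyMatrix 14 13) attempts)))))

/-- Computes an optimal solution, or reports that there is none. -/
def solveProg : Prog :=
  .seq tables (.seq markWrong (.cond (.cell 3 (.reg 10)) (.set 0 (.const 0))
    (.seq findTarget (.cond (.reg 58)
      (.seq listEdits (.seq (.set 0 (.const 1)) (.seq (.set 1 (.reg 61)) (.set 2 (.reg 62)))))
      (.set 0 (.const 0))))))

/-- The factor in the bound on the running time of `solveProg`. -/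
def solveConst : ℕ := 6000

section
variable {n : ℕ} {G : SimpleGraph (Fin n)} {δ : Fin n → Fin 2} {k : ℕ} {s₀ s : Store}

/-- A target found by an exchange takes as many edits as the lower bound requires. One found by a
bypass takes one more, but then the lower bound is not attained. If neither is found, then the
instance is trivial. -/
theorem wp_findTarget [NeZero n] (h : IsInput G δ k s₀) (hs : Holds n s₀ s)
    (hz : ∀ a, 5 ≤ a → a ≠ 11 → s.arr a = s₀.arr a) (h4 : Indicates (wrong G δ) (s.arr 4))
    (heven : Even (wrong G δ).ncard) :
    Wp findTarget s fun s' t => (Ctx n s' ∧ IsRel G.Adj (s'.arr 14) ∧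
      ((s'.reg 58 = 1 ∧ ∃ H, IsRel H.Adj (s'.arr 13) ∧ IsTarget δ H ∧
        ∀ F, IsTarget δ (G ∆ F) → (G ∆ H).edgeSet.ncard ≤ F.edgeSet.ncard) ∨
      (s'.reg 58 = 0 ∧ ∀ F, ¬ IsTarget δ (G ∆ F)))) ∧ t ≤ 5500 * n ^ 3 := by
  have hn : 1 ≤ n := Nat.one_le_iff_ne_zero.2 (NeZero.ne n)
  have hn3 : n ≤ n ^ 3 := Nat.le_self_pow (by omega) n
  have hn2 : n ^ 2 ≤ n ^ 3 := Nat.pow_le_pow_right hn (by omega)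
  have hz' : ∀ a, 5 ≤ a → a ≠ 11 → ∀ i, s.arr a i = 0 := fun a ha ha' i => by
    rw [hz a ha ha', h.arr_zero a (by omega)]
  rw [findTarget, wp_seq]
  refine (wp_rows hs.size (hz' 12 (by omega) (by omega) 0)).mono' ?_
  rintro s1 t1 hF1 ⟨h1, ht1⟩
  have hs1 : Ctx n s1 := by
    refine ⟨(hF1.1 0 rfl).trans hs.size, fun i => ?_, h1, fun i => ?_⟩
    · rw [hF1.2 7 rfl, hz' 7 (by omega) (by omega)]
    · rw [hF1.2 16 rfl, hz' 16 (by omega) (by omega)]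
  rw [wp_seq]
  refine (wp_buildMatrix h hs1 ((hF1.2 1 rfl).trans hs.start) ((hF1.2 2 rfl).trans hs.list)
    fun i => ?_).mono' ?_
  · rw [hF1.2 13 rfl, hz' 13 (by omega) (by omega)]
  rintro s2 t2 hF2 ⟨h2, ht2⟩
  have hs2 := hs1.of_frame hF2
  rw [wp_seq]
  refine (wp_copyMatrix (by omega) (by omega) hs2 h2).mono' ?_
  rintro s3 t3 hF3 ⟨h3, ht3⟩
  have hs3 := hs2.of_frame hF3
  have c13 : s3.arr 13 = s2.arr 13 := hF3.2 13 rfl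
  have c4 : s3.arr 4 = s.arr 4 := ((hF3.2 4 rfl).trans (hF2.2 4 rfl)).trans (hF1.2 4 rfl)
  rw [wp_seq]
  refine (wp_join (T := wrong G δ) hs3 (c13.symm ▸ h2) (c4.symm ▸ h4) heven).mono' ?_
  rintro s5 t5 hF5 ⟨⟨z, l, G', T', ⟨hJ, g13, g4, gl, gz⟩, hG'⟩, ht5⟩
  have hs5 := hs3.of_frame hF5
  have d14 : s5.arr 14 = s3.arr 14 := hF5.2 14 rfl
  have heven' : Even T'.ncard := hJ.even
  rw [wp_seq]
  refine (wp_pairAll hs5 g13 g4 heven' gl gz).mono' ?_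
  rintro s6 t6 hF6 ⟨⟨z', m, N, hp, hzz, hN, hz15⟩, ht6⟩
  have hs6 := hs5.of_frame hF6
  have e14 : s6.arr 14 = s3.arr 14 := (hF6.2 14 rfl).trans d14
  replace hJ := hJ.congr hzz
  rw [wp_seq]
  refine (wp_copyMatrix (by omega) (by omega) hs6 (e14.symm ▸ h3)).mono' ?_
  rintro s7 t7 hF7 ⟨h7, ht7⟩
  have hs7 := hs6.of_frame hF7
  have f14 : s7.arr 14 = s3.arr 14 := (hF7.2 14 rfl).trans e14
  have f15 : s7.arr 15 = s6.arr 15 := hF7.2 15 rfl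
  have f53 : s7.reg 53 = N := (hF7.1 53 rfl).trans hN
  have f55 : s7.reg 55 = l := ((hF7.1 55 rfl).trans (hF6.1 55 rfl)).trans gl
  have hNform := hJ.eq_Nform hG' hp
  have hNn : N ≤ n := by
    rw [hNform]
    exact (Nform_le_card _ _).trans_eq (Nat.card_fin n)
  have hocc := hJ.occ_eq_one_iff hp
  refine (wp_attempts hs7 f53 hNn f55 (f15.symm ▸ hz15) h7 fun hno => ?_).mono' ?_
  · rcases exists_exchange_or hJ hp hG' with ⟨w, hw, hc⟩ | ⟨rfl, -⟩
    · exact absurd hc (hno w hw)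
    · omega
  rintro s8 t8 hF8 ⟨h8, ht8⟩
  refine ⟨⟨hs7.of_frame hF8, ?_, ?_⟩, by omega⟩
  · rw [hF8.2 14 rfl, f14]
    exact h3
  rcases h8 with ⟨h58, w, hw, hc, hR⟩ | ⟨hno, h8⟩
  · refine Or.inl ⟨h58, _, hR, isTarget_of_occ (fun v => ?_) hc, fun F hF => ?_⟩
    · rw [hw.occ_eq, hocc]
    · rw [isTarget_symmDiff_iff] at hF
      rw [symmDiff_symmDiff_cancel_left]
      refine (ncard_edgeSet_gr_vec_le w N).trans ?_
      rw [hNform]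
      exact Nform_le hF.2 hF.1
  · rcases exists_exchange_or hJ hp hG' with ⟨w, hw, hc⟩ | ⟨rfl, -⟩
    · exact absurd hc (hno w hw)
    rcases h8 with ⟨h58, _, ⟨x, rfl⟩, hc, hR⟩ | ⟨h58, hb, -⟩
    · refine Or.inl ⟨h58, _, hR, isTarget_of_occ (fun v => ?_) hc, fun F hF => ?_⟩
      · rw [occ_bypass, hocc]
      · rw [isTarget_symmDiff_iff] at hF
        rw [symmDiff_symmDiff_cancel_left]
        exact (ncard_edgeSet_gr_vec_le _ _).trans (lt_ncard_of_no_exchange hJ hp hG' hno hF.2 hF.1)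
    · refine Or.inr ⟨h58, opt_eq_top_iff.1 (opt_eq_top_iff_isTrivialNo.2 ?_)⟩
      refine isTrivialNo_of_no_exchange hJ hp hG' hno (not_le.1 fun hV => ?_)
      obtain ⟨x, hx⟩ := exists_bypass_connected hJ hp hG' hno hV
      exact hb _ ⟨x, rfl⟩ hx

theorem wp_solveProg [NeZero n] (h : IsInput G δ k s) :
    Wp solveProg s fun s' t => t ≤ solveConst * n ^ 3 ∧ ReturnsSolution G δ s' := by
  classical
  have hn : 1 ≤ n := Nat.one_le_iff_ne_zero.2 (NeZero.ne n)
  have hn3 : n ≤ n ^ 3 := Nat.le_self_pow (by omega) n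
  have hn2 : n ^ 2 ≤ n ^ 3 := Nat.pow_le_pow_right hn (by omega)
  have hno : (∀ F, ¬ IsTarget δ (G ∆ F)) → ∀ s' : Store, s'.reg 0 = 0 → ReturnsSolution G δ s' := by
    intro hF s' hs'
    refine ⟨fun _ => hs', fun ⟨A, D, hAD⟩ => ?_⟩
    obtain ⟨F, hF', -⟩ := exists_isSolution_iff.1 ⟨A, D, hAD, rfl⟩
    exact absurd hF' (hF F)
  rw [solveConst, solveProg, wp_seq]
  refine (wp_tables h.size (h.arr_zero 3 (by omega) 0) (h.arr_zero 11 (by omega) 0)).mono' ?_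
  rintro s1 t1 hF1 ⟨h1, ht1⟩
  have hs1 : Holds n s s1 := ⟨(hF1.1 0 rfl).trans h.size, hF1.2 1 rfl, hF1.2 2 rfl⟩
  rw [wp_seq]
  refine (wp_markWrong h hs1 (hF1.2 0 rfl) fun i hi => (h1 i hi).1).mono' ?_
  rintro s2 t2 hF2 ⟨⟨h2, h2'⟩, ht2⟩
  have hs2 : Holds n s s2 := ⟨(hF2.1 0 rfl).trans hs1.size, (hF2.2 1 rfl).trans hs1.start,
    (hF2.2 2 rfl).trans hs1.list⟩
  have hcard : (wrong G δ).ncard ≤ n := by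
    simpa using Set.ncard_le_ncard (Set.subset_univ (wrong G δ)) (Set.toFinite _)
  have e3 : s2.arr 3 (wrong G δ).ncard = (wrong G δ).ncard % 2 := by
    rw [hF2.2 3 rfl]
    exact (h1 _ hcard).1
  by_cases hodd : (wrong G δ).ncard % 2 = 0
  · simp only [wp_cond, Expr.eval, Expr.cost, h2', e3, hodd, ↓reduceIte]
    rw [wp_seq]
    refine (wp_findTarget h hs2 (fun a ha ha' => ?_) h2 (Nat.even_iff.2 hodd)).mono' ?_
    · refine (hF2.2 a ?_).trans (hF1.2 a ?_)
      · simp [markWrong, forLoop, Prog.setsArr]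
        omega
      · simp [tables, forLoop, Prog.setsArr]
        omega
    rintro s3 t3 hF3 ⟨⟨hs3, h14, ⟨h58, H, hH, hT, hmin⟩ | ⟨h58, hF⟩⟩, ht3⟩
    · simp only [wp_cond, wp_seq, Expr.eval, Expr.cost, h58, one_ne_zero, ↓reduceIte]
      refine (wp_listEdits hs3 hH h14).mono ?_
      rintro s4 t4 ⟨⟨h5, h6⟩, ht4⟩
      simp only [wp_set, Expr.eval, Expr.cost]
      refine ⟨by omega, ?_⟩
      have hA : ((H \ G).edgeSet.toFinset : Set (Sym2 (Fin n))) = H.edgeSet \ G.edgeSet := by simp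
      have hD : ((G \ H).edgeSet.toFinset : Set (Sym2 (Fin n))) = G.edgeSet \ H.edgeSet := by simp
      have hopt := isOptimalSolution_of_forall_le hA hD hT hmin
      refine ⟨fun hnex => absurd ⟨_, _, hopt.1⟩ hnex, fun _ => ⟨by simp, _, _, hopt, ?_, ?_⟩⟩
      · simpa using h5.listsEdges (F := (H \ G).edgeSet.toFinset) (by simp)
      · simpa using h6.listsEdges (F := (G \ H).edgeSet.toFinset) (by simp)
    · simp only [wp_cond, wp_set, Expr.eval, Expr.cost, h58, ↓reduceIte]
      exact ⟨by omega, hno hF _ (by simp)⟩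
  · simp only [wp_cond, wp_set, Expr.eval, Expr.cost, h2', e3, hodd, ↓reduceIte]
    refine ⟨by omega, hno (opt_eq_top_iff.1 (opt_eq_top_iff_isTrivialNo.2 (Or.inl ?_))) _ (by simp)⟩
    exact Nat.odd_iff.2 (by omega)

end

end ParityEditing

open ParityEditing in
theorem mainTheorem1 :
    -- the decision problem is solvable in time `O(n + m)`
    (∃ (P : Prog) (C : ℕ), ∀ (n : ℕ), 1 ≤ n →
      ∀ (G : SimpleGraph (Fin n)) (δ : Fin n → Fin 2) (k : ℕ) (s : Store), IsInput G δ k s →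
        HaltsWithin P s (C * (n + G.edgeSet.ncard)) (Answers (CDPE G δ k))) ∧
    -- the optimum is computable in time `O(n + m)`
    (∃ (P : Prog) (C : ℕ), ∀ (n : ℕ), 1 ≤ n →
      ∀ (G : SimpleGraph (Fin n)) (δ : Fin n → Fin 2) (s : Store), IsInput G δ 0 s →
        HaltsWithin P s (C * (n + G.edgeSet.ncard)) (ReturnsValue (opt G δ))) ∧
    -- an optimal solution, if one exists, can be found in time `O(n ^ 3)`
    (∃ (P : Prog) (C : ℕ), ∀ (n : ℕ), 1 ≤ n →
      ∀ (G : SimpleGraph (Fin n)) (δ : Fin n → Fin 2) (s : Store), IsInput G δ 0 s →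
        HaltsWithin P s (C * n ^ 3) (ReturnsSolution G δ)) ∧
    -- Eulerian Editing, the case `δ ≡ 0`, is solvable in time `O(n + m)`
    (∃ (P : Prog) (C : ℕ), ∀ (n : ℕ), 1 ≤ n →
      ∀ (G : SimpleGraph (Fin n)) (k : ℕ) (s : Store), IsInput G (fun _ => 0) k s →
        HaltsWithin P s (C * (n + G.edgeSet.ncard)) (Answers (EulerianEditing G k))) ∧
    -- the exact value of the optimum
    (∀ (V : Type*) [Finite V] [Nonempty V] (G : SimpleGraph V) (δ : V → Fin 2) (T : Set V)
      (p q : ℕ), T = wrong G δ → p = numFree G T → q = numHit G T →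
      (∀ k : ℕ, CDPE G δ k ↔ opt G δ ≤ k) ∧
      (opt G δ = ⊤ ↔ IsTrivialNo G T) ∧
      (¬ IsTrivialNo G T →
        (p = 1 ∧ q = 0 → opt G δ = 0) ∧
        (2 ≤ p ∧ q = 0 → opt G δ = (max 3 p : ℕ)) ∧
        (p = 0 ∧ q = 1 ∧ IsBridgeStar G T → opt G δ = (T.ncard / 2 + 1 : ℕ)) ∧
        (1 ≤ q ∧ ¬ (p = 0 ∧ q = 1 ∧ IsBridgeStar G T) →
          opt G δ = (max (p + q - 1) (p + T.ncard / 2) : ℕ)))) := by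
  refine ⟨⟨decideProg, 2000, fun n hn G δ k s h => ?_⟩, ⟨optProg, 2000, fun n hn G δ s h => ?_⟩,
    ⟨solveProg, solveConst, fun n hn G δ s h => ?_⟩, ⟨decideProg, 2000, fun n hn G k s h => ?_⟩,
    fun V _ _ G δ T p q hT hp hq => ?_⟩
  · have : NeZero n := ⟨by omega⟩
    exact (wp_decideProg h).haltsWithin
  · have : NeZero n := ⟨by omega⟩
    exact (wp_optProg h).haltsWithin
  · have : NeZero n := ⟨by omega⟩
    exact (wp_solveProg h).haltsWithin
  · have : NeZero n := ⟨by omega⟩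
    have h1 := wp_decideProg h
    simp only [← eulerianEditing_iff] at h1
    exact h1.haltsWithin
  · subst hT hp hq
    exact ⟨fun k => cdpe_iff, opt_eq_top_iff_isTrivialNo, opt_formula⟩
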